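/- **Setting.** Let $\mathbb T^d=\mathbb R^d/\mathbb Z^d$, and for a distribution $f\in\mathscr D'(\mathbb T^d)$ let $\hat f(m)=\langle f,e^{-2\pi i m\cdot x}\rangle$, $m\in\mathbb Z^d$. Fix a radial $\chi\in C_c^\infty(\mathbb R^d)$ supported in $B(0,1)$ and equal to $1$ on $B(0,9/10)$. For a dyadic integer $N\ge 1$ put $P_{\le N}f=\sum_m\chi(m/N)\hat f(m)e^{2\pi i m\cdot x}$, $P_1=P_{\le 1}$, and $P_N=P_{\le N}-P_{\le N/2}$ for $N\ge2$. The Besov space $B^s_{q,r}$ (with $r<\infty$) is the set of distributions with $\|f\|_{B^s_{q,r}}=\big(\sum_N N^{sr}\|P_Nf\|_{L^q}^r\big)^{1/r}<\infty$. For $s>0$, a vector-valued distribution $u$ has a well-defined paraproduct $u\otimes u$ in $\dot H^{-s}$ if $\sum_{N,M}\|P_Nu\otimes P_Mu\|_{\dot H^{-s}}<\infty$, where $\|g\|_{\dot H^{-s}}^2=\sum_{m\ne0}|m|^{-2s}|\hat g(m)|^2$; then $u\otimes u:=\sum_{N,M}P_Nu\otimes P_Mu$, normalized to have mean zero. Consider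 the fractional Navier–Stokes equations $$\partial_t u+\operatorname{Div}(u\otimes u)+(-\Delta)^\alpha u+\nabla \pi=0,\qquad \operatorname{Div}u=0,\qquad u(0)=u_0,\tag{NS}$$ on $\mathbb T^d$, where $(-\Delta)^\alpha$ has symbol $(2\pi|m|)^{2\alpha}$. For a divergence-free distribution $u_0$, a *mild solution* of (NS) on $[0,T)$ with initial data $u_0$ is a family $u(t)$, $0\le t<T$, of real vector-valued distributions such that, for some $s>0$ and almost every $t\in(0,T)$, $u(t)\otimes u(t)$ is well defined as a paraproduct in $\dot H^{-s}$, and $$u(t)=e^{-t(-\Delta)^\alpha}u_0-\int_0^te^{-(t-s)(-\Delta)^\alpha}\,\mathbb P\operatorname{Div}(u\otimes u)(s)\,ds\quad\text{in }\mathscr D'((0,T)\times\mathbb T^d),$$ where $\mathbb P$ is the Leray projection and both $u$ and the integral term are integrable against test functions. **Proposition.** Let $d\ge2$, $\alpha>1/2$, $\max\{\frac d{2\alpha-1},1\}<p<\infty$, $\max\{\frac d{2\alpha-1},1\}<q\le\infty$, $0<\theta<\frac12\big(2\alpha-1-\frac dq\big)$ and $1\le r<\infty$. Write $p'=\frac p{p-1}$.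 All initial data below are real vector fields. (i) Let $\max\{p,p'\}\le\rho\le\infty$. For every divergence-free $u_0\in L^p(\mathbb T^d)$ there exist a time $T>0$ and a ball $U$ around $u_0$ in the space of divergence-free $L^p$ vector fields such that for every $v_0\in U$ there is a unique mild solution $v$ of (NS) with initial data $v_0$ in the class $$X_T=\Big\{v\in C([0,T];L^p):\ t^{\frac d{2\alpha}(\frac1p-\frac1\rho)}v(t)\in L^\infty((0,T);L^\rho)\Big\}.$$ The solution map $v_0\mapsto v$ is continuous from $U$ to $C([0,T];L^p)$, and $v\in C^\infty((0,T)\times\mathbb T^d)$. (ii) Let $\theta+\frac d{2q}<\beta<\frac12(2\alpha-1)$. For every divergence-free $u_0\in B^{-\theta}_{q,r}(\mathbb T^d)$ there exist a time $T>0$ and a ball $U$ around $u_0$ in the space of divergence-free $B^{-\theta}_{q,r}$ vector fields such that for every $v_0\in U$ there is a unique mild solution $v$ of (NS) with initial data $v_0$ in the class $$Y_T=\Big\{v\in C([0,T];B^{-\theta}_{q,r}):\ t^{\frac\beta\alpha}v(t)\in L^\infty((0,T);B^{-\theta+2\beta}_{q,r})\Big\}.$$ The solution map $v_0\mapsto v$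 is continuous from $U$ to $C([0,T];B^{-\theta}_{q,r})$, and $v\in C^\infty((0,T)\times\mathbb T^d)$. -/

import Mathlib

open MeasureTheory Set Filter Topology
open scoped ENNReal ContDiff

noncomputable section

namespace FracNS

/-! ### The torus, smooth functions and distributions -/

/-- The torus `𝕋^d = ℝ^d / ℤ^d`. -/
abbrev Torus (d : ℕ) : Type := UnitAddTorus (Fin d)

/-- The normalized Haar (Lebesgue) measure on `𝕋^d`, of total mass one. -/
def torusMeasure (d : ℕ) : Measure (Torus d) :=
  Measure.pi fun _ => AddCircle.haarAddCircle

/-- The quotient map `ℝ^d → 𝕋^d`. -/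
def toTorus {d : ℕ} (x : Fin d → ℝ) : Torus d := fun i => (x i : UnitAddCircle)

/-- The space `C^∞(𝕋^d)` of complex valued functions on the torus whose lift to `ℝ^d` is smooth. -/
def SmoothFun (d : ℕ) : Submodule ℂ (Torus d → ℂ) where
  carrier := {φ | ContDiff ℝ ∞ fun x : Fin d → ℝ => φ (toTorus x)}
  add_mem' := by
    intro a b ha hb
    simp only [mem_ofPred_eq] at ha hb
    exact ha.add hb
  zero_mem' := by
    simp only [mem_ofPred_eq, Pi.zero_apply]
    exact contDiff_const
  smul_mem' := by
    intro c a ha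
    simp only [mem_ofPred_eq] at ha
    exact ha.const_smul c

theorem mFourier_smooth {d : ℕ} (m : Fin d → ℤ) :
    (fun x => UnitAddTorus.mFourier m x) ∈ SmoothFun d := by
  change ContDiff ℝ ∞ fun x : Fin d → ℝ => ∏ i, fourier (m i) ((x i : ℝ) : UnitAddCircle)
  refine contDiff_prod fun i _ => ?_
  simp only [fourier_coe_apply]
  have h : ContDiff ℝ ∞ fun x : Fin d → ℝ => ((x i : ℝ) : ℂ) :=
    Complex.ofRealCLM.contDiff.comp (contDiff_apply ℝ ℝ i)
  exact (((contDiff_const (c := 2 * (Real.pi : ℂ) * Complex.I * (m i : ℂ))).mul h).div_const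
    ((1 : ℝ) : ℂ)).cexp

/-- The exponential `x ↦ e^{2πi m·x}` as a smooth function. -/
def expFun {d : ℕ} (m : Fin d → ℤ) : SmoothFun d :=
  ⟨fun x => UnitAddTorus.mFourier m x, mFourier_smooth m⟩

/-- The partial derivative `∂_i φ` of a function on the torus. -/
def partialFun {d : ℕ} (i : Fin d) (φ : Torus d → ℂ) : Torus d → ℂ :=
  fun y => deriv (fun s : ℝ => φ (y + toTorus (Pi.single i s))) 0

theorem partialFun_smooth {d : ℕ} (i : Fin d) (φ : SmoothFun d) :
    partialFun i φ.1 ∈ SmoothFun d := by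
  have hφ : ContDiff ℝ ∞ fun x : Fin d → ℝ => φ.1 (toTorus x) := φ.2
  change ContDiff ℝ ∞ fun x : Fin d → ℝ => partialFun i φ.1 (toTorus x)
  have key : (fun x : Fin d → ℝ => partialFun i φ.1 (toTorus x)) =
      fun x => fderiv ℝ (fun x : Fin d → ℝ => φ.1 (toTorus x)) x (Pi.single i 1) := by
    funext x
    have hd : DifferentiableAt ℝ (fun x : Fin d → ℝ => φ.1 (toTorus x)) x :=
      (hφ.differentiable (by simp)) x
    have e : (fun s : ℝ => φ.1 (toTorus x + toTorus (Pi.single i s))) =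
        fun s : ℝ => (fun x : Fin d → ℝ => φ.1 (toTorus x)) (x + s • Pi.single i (1 : ℝ)) := by
      funext s
      have h1 : toTorus x + toTorus (Pi.single i s) = toTorus (x + s • Pi.single i (1 : ℝ)) := by
        funext j
        have h2 : (s • Pi.single i (1 : ℝ) : Fin d → ℝ) = Pi.single i s := by
          rw [← Pi.single_smul]; simp
        rw [h2]
        simp [toTorus]
      simp only [h1]
    change deriv (fun s : ℝ => φ.1 (toTorus x + toTorus (Pi.single i s))) 0 = _
    rw [e]
    exact hd.lineDeriv_eq_fderiv
  rw [key]
  exact (hφ.fderiv_right (m := ∞) (by simp)).clm_apply contDiff_const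

/-- The partial derivative `∂_i` on `C^∞(𝕋^d)`. -/
def partialSmooth {d : ℕ} (i : Fin d) (φ : SmoothFun d) : SmoothFun d :=
  ⟨partialFun i φ.1, partialFun_smooth i φ⟩

/-- The space `𝓓'(𝕋^d)` of distributions: the linear functionals `f` on `C^∞(𝕋^d)` which are
continuous, i.e. `|⟨f, φ⟩| ≤ C max_{j ≤ k} ‖D^j φ‖_∞` for some `C` and `k`. -/
def TorusDist (d : ℕ) : Submodule ℂ (SmoothFun d →ₗ[ℂ] ℂ) where
  carrier := {f | ∃ (k : ℕ) (C : ℝ), 0 ≤ C ∧ ∀ (φ : SmoothFun d) (B : ℝ),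
    (∀ j ≤ k, ∀ x, ‖iteratedFDeriv ℝ j (fun x : Fin d → ℝ => φ.1 (toTorus x)) x‖ ≤ B) →
      ‖f φ‖ ≤ C * B}
  add_mem' := by
    rintro f g ⟨k, C, hC, hf⟩ ⟨l, D, hD, hg⟩
    refine ⟨max k l, C + D, add_nonneg hC hD, fun φ B h => ?_⟩
    have h1 := hf φ B fun j hj => h j (hj.trans (le_max_left _ _))
    have h2 := hg φ B fun j hj => h j (hj.trans (le_max_right _ _))
    calc ‖f φ + g φ‖ ≤ ‖f φ‖ + ‖g φ‖ := norm_add_le _ _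
      _ ≤ (C + D) * B := by rw [add_mul]; exact add_le_add h1 h2
  zero_mem' := ⟨0, 0, le_rfl, fun φ B _ => by simp⟩
  smul_mem' := by
    rintro c f ⟨k, C, hC, hf⟩
    refine ⟨k, ‖c‖ * C, by positivity, fun φ B h => ?_⟩
    have h1 := hf φ B h
    calc ‖c • f φ‖ = ‖c‖ * ‖f φ‖ := norm_smul _ _
      _ ≤ ‖c‖ * (C * B) := by gcongr
      _ = ‖c‖ * C * B := by ring

/-- Vector fields on `𝕋^d` with distributional components. -/
abbrev VecDist (d : ℕ) : Type := Fin d → TorusDist d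

/-- The Fourier coefficient `f̂(m) = ⟨f, e^{-2πi m·x}⟩`. -/
def coeff {d : ℕ} (f : TorusDist d) (m : Fin d → ℤ) : ℂ := f.1 (expFun (-m))

/-- The pairing with the test function `φ` of the distribution given by the Fourier series
`∑_m c(m) e^{2πi m·x}`. -/
def seriesPairing {d : ℕ} (c : (Fin d → ℤ) → ℂ) (φ : Torus d → ℂ) : ℂ :=
  ∑' m, c m * ∫ x, UnitAddTorus.mFourier m x * φ x ∂(torusMeasure d)

/-- The distribution `f` is given by the integrable function `g`. -/
def Represents {d : ℕ} (g : Torus d → ℂ) (f : TorusDist d) : Prop :=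
  Integrable g (torusMeasure d) ∧
    ∀ φ : SmoothFun d, f.1 φ = ∫ x, g x * φ.1 x ∂(torusMeasure d)

/-- A real vector field: each component takes real values on real valued test functions. -/
def IsReal {d : ℕ} (u : VecDist d) : Prop :=
  ∀ i, ∀ φ : SmoothFun d, (∀ x, (φ.1 x).im = 0) → ((u i).1 φ).im = 0

/-- `Div u = 0` in the sense of distributions. -/
def DivFree {d : ℕ} (u : VecDist d) : Prop :=
  ∀ φ : SmoothFun d, ∑ i, (u i).1 (partialSmooth i φ) = 0

/-! ### Frequencies and Littlewood–Paley projections -/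

/-- The frequency `m ∈ ℤ^d` as a vector of Euclidean space. -/
def freq {d : ℕ} (m : Fin d → ℤ) : EuclideanSpace ℝ (Fin d) :=
  WithLp.toLp 2 fun i => (m i : ℝ)

/-- A radial smooth bump function supported in `B(0,1)` and equal to `1` on `B(0,9/10)`. -/
structure Cutoff (d : ℕ) where
  toFun : EuclideanSpace ℝ (Fin d) → ℝ
  smooth : ContDiff ℝ ∞ toFun
  radial : ∀ x y, ‖x‖ = ‖y‖ → toFun x = toFun y
  support_subset : Function.support toFun ⊆ Metric.ball 0 1
  eq_one : ∀ x ∈ Metric.ball (0 : EuclideanSpace ℝ (Fin d)) (9 / 10), toFun x = 1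

/-- The symbol of `P_N` for `N = 2^a`: `χ(m)` if `a = 0`, and `χ(m/N) - χ(2m/N)` otherwise. -/
def Cutoff.symbol {d : ℕ} (χ : Cutoff d) : ℕ → (Fin d → ℤ) → ℝ
  | 0, m => χ.toFun (freq m)
  | a + 1, m => χ.toFun ((2 ^ (a + 1) : ℝ)⁻¹ • freq m) - χ.toFun ((2 ^ a : ℝ)⁻¹ • freq m)

/-- The function `P_N f` for `N = 2^a` (the series has finitely many nonzero terms). -/
def lpBlock {d : ℕ} (χ : Cutoff d) (a : ℕ) (f : TorusDist d) : Torus d → ℂ :=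
  fun x => ∑' m, (χ.symbol a m : ℂ) * coeff f m * UnitAddTorus.mFourier m x

/-! ### Function spaces. Norms take the value `∞` outside the space. The norm of a vector field is
the sum of the norms of its components. -/

/-- The `L^p` norm of a distribution, `∞` if it is not given by an `L^p` function. -/
def lpNorm {d : ℕ} (p : ℝ≥0∞) (f : TorusDist d) : ℝ≥0∞ :=
  ⨅ (g : Torus d → ℂ) (_ : Represents g f), eLpNorm g p (torusMeasure d)

/-- The norm of the Besov space `B^s_{q,r}`, for finite `r`:
`(∑_N N^{sr} ‖P_N f‖_{L^q}^r)^{1/r}`. -/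
def besovNorm {d : ℕ} (χ : Cutoff d) (s : ℝ) (q : ℝ≥0∞) (r : ℝ) (f : TorusDist d) : ℝ≥0∞ :=
  (∑' a : ℕ, ENNReal.ofReal (((2 : ℝ) ^ a) ^ (s * r)) *
    (eLpNorm (lpBlock χ a f) q (torusMeasure d)) ^ r) ^ (1 / r)

/-- The `L^p(𝕋^d)` norm of vector fields. -/
def vecLpNorm {d : ℕ} (p : ℝ≥0∞) (u : VecDist d) : ℝ≥0∞ := ∑ i, lpNorm p (u i)

/-- The `B^s_{q,r}(𝕋^d)` norm of vector fields. -/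
def vecBesovNorm {d : ℕ} (χ : Cutoff d) (s : ℝ) (q : ℝ≥0∞) (r : ℝ) (u : VecDist d) : ℝ≥0∞ :=
  ∑ i, besovNorm χ s q r (u i)

/-- The norm of `Ḣ^{-s}` of an integrable function modulo constants,
`(∑_{m ≠ 0} |m|^{-2s} |ĝ(m)|²)^{1/2}`. -/
def hDotNegNorm {d : ℕ} (s : ℝ) (g : Torus d → ℂ) : ℝ≥0∞ :=
  (∑' m : {m : Fin d → ℤ // m ≠ 0}, ENNReal.ofReal
    (‖freq m.1‖ ^ (-2 * s) * ‖UnitAddTorus.mFourierCoeff g m.1‖ ^ 2)) ^ (1 / 2 : ℝ)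

/-! ### The nonlinearity -/

/-- `u ⊗ u` is well-defined as a paraproduct in `Ḣ^{-s}`:
`∑_{N,M} ‖P_N u ⊗ P_M u‖_{Ḣ^{-s}} < ∞`, stated for each component. -/
def TensorWellDefined {d : ℕ} (χ : Cutoff d) (s : ℝ) (u : VecDist d) : Prop :=
  ∀ i j, ∑' ab : ℕ × ℕ,
    hDotNegNorm s (fun x => lpBlock χ ab.1 (u i) x * lpBlock χ ab.2 (u j) x) < ⊤

open Classical in
/-- The Fourier coefficients of the component `(i,j)` of the paraproduct
`u ⊗ u = ∑_{N,M} P_N u ⊗ P_M u`, normalized to have mean zero. -/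
def tensorCoeff {d : ℕ} (χ : Cutoff d) (u : VecDist d) (i j : Fin d) (m : Fin d → ℤ) : ℂ :=
  if m = 0 then 0 else ∑' ab : ℕ × ℕ,
    UnitAddTorus.mFourierCoeff (fun x => lpBlock χ ab.1 (u i) x * lpBlock χ ab.2 (u j) x) m

/-- The Fourier coefficients of `Div A`, `(Div A)_i = ∑_j ∂_j A_{ij}`, for a matrix field with
Fourier coefficients `A i j m`. -/
def divCoeff {d : ℕ} (A : Fin d → Fin d → (Fin d → ℤ) → ℂ) (i : Fin d) (m : Fin d → ℤ) : ℂ :=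
  ∑ j, 2 * Real.pi * Complex.I * (m j : ℂ) * A i j m

open Classical in
/-- The Fourier coefficients of the Leray projection of a vector field with Fourier coefficients
`F k m`. The symbol is `δ_{ik} - m_i m_k / |m|²` for `m ≠ 0` and `δ_{ik}` for `m = 0`. -/
def lerayCoeff {d : ℕ} (F : Fin d → (Fin d → ℤ) → ℂ) (i : Fin d) (m : Fin d → ℤ) : ℂ :=
  ∑ k, ((if i = k then 1 else 0) - (m i : ℂ) * (m k : ℂ) / ((‖freq m‖ ^ 2 : ℝ) : ℂ)) * F k m

/-- The symbol `e^{-t (2π|m|)^{2α}}` of `e^{-t(-Δ)^α}`. -/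
def heatSymbol {d : ℕ} (α t : ℝ) (m : Fin d → ℤ) : ℝ :=
  Real.exp (-t * (2 * Real.pi * ‖freq m‖) ^ (2 * α))

/-- `⟨(e^{-t(-Δ)^α} u₀)_i, φ⟩`. -/
def heatPairing {d : ℕ} (α t : ℝ) (u₀ : VecDist d) (i : Fin d) (φ : Torus d → ℂ) : ℂ :=
  seriesPairing (fun m => (heatSymbol α t m : ℂ) * coeff (u₀ i) m) φ

/-- `⟨(e^{-τ(-Δ)^α} ℙ Div (w ⊗ w))_i, φ⟩`. -/
def duhamelPairing {d : ℕ} (χ : Cutoff d) (α τ : ℝ) (w : VecDist d) (i : Fin d)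
    (φ : Torus d → ℂ) : ℂ :=
  seriesPairing (fun m => (heatSymbol α τ m : ℂ) * lerayCoeff (divCoeff (tensorCoeff χ w)) i m) φ

/-! ### Mild solutions -/

/-- Test functions in `C_c^∞((0,T) × 𝕋^d)`. -/
structure SpaceTimeTest (d : ℕ) (T : ℝ) where
  toFun : ℝ → Torus d → ℂ
  smooth : ContDiff ℝ ∞ fun z : ℝ × (Fin d → ℝ) => toFun z.1 (toTorus z.2)
  compact_support : ∃ a b : ℝ, 0 < a ∧ b < T ∧ ∀ t, t ∉ Icc a b → ∀ x, toFun t x = 0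

/-- The slice `Φ(t, ·)` of a space-time test function. -/
def SpaceTimeTest.slice {d : ℕ} {T : ℝ} (Φ : SpaceTimeTest d T) (t : ℝ) : SmoothFun d :=
  ⟨Φ.toFun t, Φ.smooth.comp (contDiff_const.prodMk contDiff_id)⟩

/-- `u` is a mild solution on `[0,T)` of the fractional Navier–Stokes equations with initial data
`u₀`: it is real, `u ⊗ u` is well-defined as a paraproduct, and
`u(t) = e^{-t(-Δ)^α} u₀ - ∫_0^t e^{-(t-s)(-Δ)^α} ℙ Div (u ⊗ u)(s) ds` in `𝓓'((0,T) × 𝕋^d)`,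
where both `u` and the Duhamel term are required to be integrable against test functions. -/
structure IsMildSolution {d : ℕ} (χ : Cutoff d) (α T : ℝ) (u₀ : VecDist d)
    (u : ℝ → VecDist d) : Prop where
  real : ∀ t ∈ Ico 0 T, IsReal (u t)
  tensor : ∃ s > 0, ∀ᵐ t ∂(volume.restrict (Ioo 0 T)), TensorWellDefined χ s (u t)
  integrable : ∀ (Φ : SpaceTimeTest d T) (i : Fin d),
    IntegrableOn (fun t => (u t i).1 (Φ.slice t)) (Ioo 0 T)
  duhamel_integrable : ∀ (Φ : SpaceTimeTest d T) (i : Fin d),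
    IntegrableOn (fun z : ℝ × ℝ => duhamelPairing χ α (z.1 - z.2) (u z.2) i (Φ.slice z.1).1)
      {z : ℝ × ℝ | 0 < z.2 ∧ z.2 < z.1 ∧ z.1 < T}
  equation : ∀ (Φ : SpaceTimeTest d T) (i : Fin d),
    ∫ t in Ioo 0 T, (u t i).1 (Φ.slice t) =
      (∫ t in Ioo 0 T, heatPairing α t u₀ i (Φ.slice t).1) -
        ∫ t in Ioo 0 T, ∫ s in Ioo 0 t, duhamelPairing χ α (t - s) (u s) i (Φ.slice t).1

/-- `u ∈ C([0,T]; E)`, where `E` is the space of vector fields of finite norm `N`. -/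
def ContinuousIn {d : ℕ} (N : VecDist d → ℝ≥0∞) (T : ℝ) (u : ℝ → VecDist d) : Prop :=
  ∀ t ∈ Icc 0 T, N (u t) < ⊤ ∧ Tendsto (fun s => N (u s - u t)) (𝓝[Icc 0 T] t) (𝓝 0)

/-- `t^σ u(t) ∈ L^∞((0,T); E)`, where `E` is the space of vector fields of finite norm `N`. -/
def WeightedBounded {d : ℕ} (N : VecDist d → ℝ≥0∞) (σ T : ℝ) (u : ℝ → VecDist d) : Prop :=
  ∃ C : ℝ, ∀ᵐ t ∂(volume.restrict (Ioo 0 T)), ENNReal.ofReal (t ^ σ) * N (u t) ≤ ENNReal.ofReal C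

/-- `u ∈ C^∞((0,T) × 𝕋^d)`. -/
def SmoothOn {d : ℕ} (T : ℝ) (u : ℝ → VecDist d) : Prop :=
  ∃ U : Fin d → ℝ → Torus d → ℝ, ∀ i,
    ContDiffOn ℝ ∞ (fun z : ℝ × (Fin d → ℝ) => U i z.1 (toTorus z.2)) (Ioo 0 T ×ˢ univ) ∧
    ∀ t ∈ Ioo 0 T, Represents (fun x => (U i t x : ℂ)) (u t i)

/-- Admissible initial data: real divergence-free vector fields of finite norm `N`. -/
def InitialData {d : ℕ} (N : VecDist d → ℝ≥0∞) : Set (VecDist d) :=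
  {u₀ | IsReal u₀ ∧ DivFree u₀ ∧ N u₀ < ⊤}

/-- `u` is a mild solution with initial data `u₀` in the solution class
`{u ∈ C([0,T]; E) : t^σ u(t) ∈ L^∞((0,T); F)}`, where `E` and `F` are the spaces of vector fields
with finite norm `N` and `M`, respectively. -/
def IsSolutionInClass {d : ℕ} (χ : Cutoff d) (α : ℝ) (N M : VecDist d → ℝ≥0∞) (σ T : ℝ)
    (u₀ : VecDist d) (u : ℝ → VecDist d) : Prop :=
  IsMildSolution χ α T u₀ u ∧ ContinuousIn N T u ∧ WeightedBounded M σ T u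

/-- Local well-posedness in the space `E` of vector fields with finite norm `N`, with the solution
class `{u ∈ C([0,T]; E) : t^σ u(t) ∈ L^∞((0,T); F)}`. Around every initial datum `u₀` there are a
ball in the space of initial data and a time `T > 0` such that every initial datum `v₀` in the ball
has a solution `S v₀` in the class on `[0,T]`, which is unique (as a function on `[0,T]`) and smooth
on `(0,T) × 𝕋^d`, and `S` is continuous from the ball to `C([0,T]; E)`. -/
def LocallyWellPosed {d : ℕ} (χ : Cutoff d) (α : ℝ) (N M : VecDist d → ℝ≥0∞) (σ : ℝ) : Prop :=
  ∀ u₀ ∈ InitialData N, ∃ T > 0, ∃ δ > 0, ∃ S : VecDist d → ℝ → VecDist d,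
    (∀ v₀ ∈ InitialData N, N (v₀ - u₀) < ENNReal.ofReal δ →
      IsSolutionInClass χ α N M σ T v₀ (S v₀) ∧
      (∀ v, IsSolutionInClass χ α N M σ T v₀ v → ∀ t ∈ Icc 0 T, v t = S v₀ t) ∧
      SmoothOn T (S v₀)) ∧
    (∀ v₀ ∈ InitialData N, N (v₀ - u₀) < ENNReal.ofReal δ → ∀ ε > 0, ∃ η > 0,
      ∀ w₀ ∈ InitialData N, N (w₀ - u₀) < ENNReal.ofReal δ → N (w₀ - v₀) < ENNReal.ofReal η →
        ∀ t ∈ Icc 0 T, N (S w₀ t - S v₀ t) ≤ ENNReal.ofReal ε)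

end FracNS

end

noncomputable section

namespace FracNS

variable {d : ℕ}

/-! ### Fourier coefficients of integrable functions on the torus -/

instance : IsProbabilityMeasure (torusMeasure d) :=
  inferInstanceAs (IsProbabilityMeasure (Measure.pi fun _ : Fin d => AddCircle.haarAddCircle (T := 1)))

instance : (torusMeasure d).IsAddHaarMeasure :=
  inferInstanceAs (Measure.IsAddHaarMeasure
    (Measure.pi fun _ : Fin d => AddCircle.haarAddCircle (T := 1)))

theorem mFourierCoeff_eq (g : Torus d → ℂ) (m : Fin d → ℤ) :
    UnitAddTorus.mFourierCoeff g m = ∫ x, UnitAddTorus.mFourier (-m) x * g x ∂(torusMeasure d) := rfl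

theorem norm_mFourier_apply (m : Fin d → ℤ) (x : Torus d) : ‖UnitAddTorus.mFourier m x‖ = 1 := by
  simp only [UnitAddTorus.mFourier, fourier_apply, ContinuousMap.coe_mk, norm_prod,
    Circle.norm_coe, Finset.prod_const_one]

theorem integrable_mFourier_mul {g : Torus d → ℂ} (hg : Integrable g (torusMeasure d))
    (m : Fin d → ℤ) : Integrable (fun x => UnitAddTorus.mFourier m x * g x) (torusMeasure d) :=
  hg.bdd_mul (c := 1) (UnitAddTorus.mFourier m).continuous.aestronglyMeasurable
    (.of_forall fun x => (norm_mFourier_apply m x).le)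

theorem mFourier_add_apply (m : Fin d → ℤ) (x y : Torus d) :
    UnitAddTorus.mFourier m (x + y) = UnitAddTorus.mFourier m x * UnitAddTorus.mFourier m y := by
  simp [UnitAddTorus.mFourier, ← Finset.prod_mul_distrib, fourier_apply, AddCircle.toCircle_add]

theorem integral_mFourier (m : Fin d → ℤ) :
    ∫ x, UnitAddTorus.mFourier m x ∂(torusMeasure d) = if m = 0 then 1 else 0 := by
  have h := (orthonormal_iff_ite.1 (UnitAddTorus.orthonormal_mFourier (d := Fin d))) 0 m
  rw [UnitAddTorus.mFourierLp, UnitAddTorus.mFourierLp, ContinuousMap.inner_toLp] at h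
  have e : ∫ x, UnitAddTorus.mFourier m x ∂(torusMeasure d) = if 0 = m then 1 else 0 := by
    rw [← h]
    refine integral_congr_ae (.of_forall fun x => ?_)
    simp [UnitAddTorus.mFourier_zero]
  rw [e]
  simp only [eq_comm]

theorem ae_eq_zero_of_mFourierCoeff_eq_zero {g : Torus d → ℂ}
    (hg : Integrable g (torusMeasure d)) (h : ∀ m, UnitAddTorus.mFourierCoeff g m = 0) :
    g =ᵐ[torusMeasure d] 0 := by
  have hcont : ∀ F : C(Torus d, ℂ), ∫ x, F x * g x ∂(torusMeasure d) = 0 := by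
    let L : C(Torus d, ℂ) →ₗ[ℂ] ℂ :=
      { toFun := fun F => ∫ x, F x * g x ∂(torusMeasure d)
        map_add' := fun F G => by
          rw [← integral_add]
          · simp [add_mul]
          · exact hg.bdd_mul (c := ‖F‖) F.continuous.aestronglyMeasurable
              (.of_forall F.norm_coe_le_norm)
          · exact hg.bdd_mul (c := ‖G‖) G.continuous.aestronglyMeasurable
              (.of_forall G.norm_coe_le_norm)
        map_smul' := fun c F => by
          simp [mul_assoc, integral_const_mul] }
    have hL : ∀ F, ‖L F‖ ≤ (∫ x, ‖g x‖ ∂(torusMeasure d)) * ‖F‖ := fun F => by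
      refine (norm_integral_le_integral_norm _).trans ?_
      rw [← integral_mul_const]
      refine integral_mono_of_nonneg (.of_forall fun _ => norm_nonneg _) (hg.norm.mul_const _)
        (.of_forall fun x => ?_)
      simp only [norm_mul]
      rw [mul_comm]
      gcongr
      exact F.norm_coe_le_norm x
    have hLc := (L.mkContinuous _ hL).continuous
    have hker : (Submodule.span ℂ (range (UnitAddTorus.mFourier (d := Fin d)))).topologicalClosure ≤
        LinearMap.ker (L.mkContinuous _ hL : C(Torus d, ℂ) →ₗ[ℂ] ℂ) := by
      refine Submodule.topologicalClosure_minimal _ ?_ ?_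
      · rw [Submodule.span_le]
        rintro _ ⟨m, rfl⟩
        have := h (-m)
        rw [mFourierCoeff_eq, neg_neg] at this
        exact this
      · exact isClosed_singleton.preimage hLc
    rw [UnitAddTorus.span_mFourier_closure_eq_top] at hker
    intro F
    exact hker (Submodule.mem_top (x := F))
  refine ae_eq_zero_of_forall_setIntegral_isClosed_eq_zero hg fun s hs => ?_
  have hpos : ∀ n : ℕ, (0 : ℝ) < 1 / ((n : ℝ) + 1) := fun n => by positivity
  have key := thickenedIndicator_tendsto_indicator_closure hpos tendsto_one_div_add_atTop_nhds_zero_nat s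
  rw [hs.closure_eq, tendsto_pi_nhds] at key
  rw [← integral_indicator hs.measurableSet]
  have hlim : Tendsto (fun n : ℕ => ∫ x, ((thickenedIndicator (hpos n) s x : ℝ) : ℂ) * g x
      ∂(torusMeasure d)) atTop (𝓝 (∫ x, s.indicator g x ∂(torusMeasure d))) := by
    refine tendsto_integral_of_dominated_convergence (fun x => ‖g x‖) ?_ hg.norm ?_ ?_
    · intro n
      refine AEStronglyMeasurable.mul ?_ hg.1
      exact (Complex.continuous_ofReal.comp
        (NNReal.continuous_coe.comp (thickenedIndicator (hpos n) s).continuous)).aestronglyMeasurable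
    · intro n
      refine .of_forall fun x => ?_
      rw [norm_mul]
      refine mul_le_of_le_one_left (norm_nonneg _) ?_
      have h1 := thickenedIndicator_le_one (hpos n) s x
      rw [Complex.norm_real, Real.norm_of_nonneg (NNReal.coe_nonneg _)]
      exact_mod_cast h1
    · refine .of_forall fun x => ?_
      have h2 : Tendsto (fun n : ℕ => ((thickenedIndicator (hpos n) s x : ℝ) : ℂ)) atTop
          (𝓝 (((s.indicator (fun _ => (1 : NNReal)) x : NNReal) : ℝ) : ℂ)) :=
        (Complex.continuous_ofReal.comp NNReal.continuous_coe).continuousAt.tendsto.comp (key x)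
      have h3 := h2.mul_const (g x)
      convert! h3 using 2
      by_cases hx : x ∈ s <;> simp [hx]
  refine tendsto_nhds_unique hlim ?_
  have h0 : ∀ n : ℕ, ∫ x, ((thickenedIndicator (hpos n) s x : ℝ) : ℂ) * g x ∂(torusMeasure d) = 0 :=
    fun n => hcont ⟨fun x => ((thickenedIndicator (hpos n) s x : ℝ) : ℂ), Complex.continuous_ofReal.comp
        (NNReal.continuous_coe.comp (thickenedIndicator (hpos n) s).continuous)⟩
  simp only [h0]
  exact tendsto_const_nhds

/-- Families of Fourier coefficients. -/
abbrev Seq (d : ℕ) : Type := (Fin d → ℤ) → ℂ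

/-- `c` is the family of Fourier coefficients of the integrable function `g`. -/
def IsFourier (g : Torus d → ℂ) (c : Seq d) : Prop :=
  Integrable g (torusMeasure d) ∧ ∀ m, UnitAddTorus.mFourierCoeff g m = c m

theorem IsFourier.ae_eq {g g' : Torus d → ℂ} {c : Seq d} (h : IsFourier g c) (h' : IsFourier g' c) :
    g =ᵐ[torusMeasure d] g' := by
  have : g - g' =ᵐ[torusMeasure d] 0 := by
    refine ae_eq_zero_of_mFourierCoeff_eq_zero (h.1.sub h'.1) fun m => ?_
    have e : UnitAddTorus.mFourierCoeff (g - g') m =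
        UnitAddTorus.mFourierCoeff g m - UnitAddTorus.mFourierCoeff g' m := by
      simp only [mFourierCoeff_eq, Pi.sub_apply, mul_sub]
      exact integral_sub (integrable_mFourier_mul h.1 _) (integrable_mFourier_mul h'.1 _)
    rw [e, h.2, h'.2, sub_self]
  filter_upwards [this] with x hx
  exact sub_eq_zero.1 hx

theorem IsFourier.add {g g' : Torus d → ℂ} {c c' : Seq d} (h : IsFourier g c) (h' : IsFourier g' c') :
    IsFourier (g + g') (c + c') := by
  refine ⟨h.1.add h'.1, fun m => ?_⟩
  rw [Pi.add_apply, ← h.2, ← h'.2]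
  simp only [mFourierCoeff_eq, Pi.add_apply, mul_add]
  exact integral_add (integrable_mFourier_mul h.1 _) (integrable_mFourier_mul h'.1 _)

theorem IsFourier.smul {g : Torus d → ℂ} {c : Seq d} (h : IsFourier g c) (a : ℂ) :
    IsFourier (a • g) (a • c) := by
  refine ⟨h.1.smul a, fun m => ?_⟩
  rw [Pi.smul_apply, ← h.2]
  simp only [mFourierCoeff_eq, Pi.smul_apply, smul_eq_mul, mul_left_comm _ a, integral_const_mul]

theorem IsFourier.sub {g g' : Torus d → ℂ} {c c' : Seq d} (h : IsFourier g c) (h' : IsFourier g' c') :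
    IsFourier (g - g') (c - c') := by
  have := h.add (h'.smul (-1))
  simpa [sub_eq_add_neg] using this

theorem isFourier_zero : IsFourier (0 : Torus d → ℂ) 0 :=
  ⟨integrable_zero _ _ _, fun m => by simp [mFourierCoeff_eq]⟩

theorem isFourier_mFourier (k : Fin d → ℤ) :
    IsFourier (fun x => UnitAddTorus.mFourier k x) (Pi.single k 1) := by
  refine ⟨(UnitAddTorus.mFourier k).continuous.integrable_of_hasCompactSupport
    (HasCompactSupport.of_compactSpace _), fun m => ?_⟩
  have : ∀ x, UnitAddTorus.mFourier (-m) x * UnitAddTorus.mFourier k x =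
      UnitAddTorus.mFourier (-m + k) x := fun x => UnitAddTorus.mFourier_add.symm
  rw [mFourierCoeff_eq]
  simp only [this, integral_mFourier]
  rw [Pi.single_apply]
  congr 1
  rw [neg_add_eq_zero]

theorem isFourier_of_summable {c : Seq d} (hc : Summable fun m => ‖c m‖) :
    IsFourier (fun x => ∑' m, c m * UnitAddTorus.mFourier m x) c ∧
      Continuous fun x => ∑' m, c m * UnitAddTorus.mFourier m x := by
  have hcont : Continuous fun x => ∑' m, c m * UnitAddTorus.mFourier m x := by
    refine continuous_tsum (u := fun m => ‖c m‖) (fun m => ?_) hc fun m x => ?_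
    · exact continuous_const.mul (UnitAddTorus.mFourier m).continuous
    · rw [norm_mul, norm_mFourier_apply, mul_one]
  refine ⟨⟨hcont.integrable_of_hasCompactSupport (HasCompactSupport.of_compactSpace _),
    fun k => ?_⟩, hcont⟩
  rw [mFourierCoeff_eq]
  simp only [← tsum_mul_left]
  rw [← integral_tsum_of_summable_integral_norm]
  · have : ∀ m, ∫ x, UnitAddTorus.mFourier (-k) x * (c m * UnitAddTorus.mFourier m x)
        ∂(torusMeasure d) = if m = k then c m else 0 := by
      intro m
      have e : ∀ x, UnitAddTorus.mFourier (-k) x * (c m * UnitAddTorus.mFourier m x) =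
          c m * UnitAddTorus.mFourier (-k + m) x := fun x => by
        rw [UnitAddTorus.mFourier_add]; ring
      simp only [e, integral_const_mul, integral_mFourier, neg_add_eq_zero, eq_comm (a := k)]
      simp
    simp only [this]
    rw [tsum_ite_eq]
  · intro m
    exact integrable_mFourier_mul (((UnitAddTorus.mFourier m).continuous.integrable_of_hasCompactSupport
      (HasCompactSupport.of_compactSpace _)).const_mul _) _
  · simpa [norm_mFourier_apply] using hc

/-! ### The `L^q` norm of a family of Fourier coefficients -/

/-- The `L^q` norm of the function with Fourier coefficients `c`, `∞` if there is none. -/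
def seqLp (q : ℝ≥0∞) (c : Seq d) : ℝ≥0∞ :=
  ⨅ (g : Torus d → ℂ) (_ : IsFourier g c), eLpNorm g q (torusMeasure d)

theorem IsFourier.seqLp_eq {g : Torus d → ℂ} {c : Seq d} (h : IsFourier g c) (q : ℝ≥0∞) :
    seqLp q c = eLpNorm g q (torusMeasure d) := by
  refine le_antisymm (iInf₂_le g h) (le_iInf₂ fun g' h' => ?_)
  exact (eLpNorm_congr_ae (h.ae_eq h')).le

theorem exists_isFourier {q : ℝ≥0∞} {c : Seq d} (h : seqLp q c ≠ ⊤) : ∃ g, IsFourier g c := by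
  by_contra! hc
  exact h (by simp [seqLp, hc])

theorem IsFourier.memLp {g : Torus d → ℂ} {c : Seq d} (h : IsFourier g c) {q : ℝ≥0∞}
    (hq : seqLp q c ≠ ⊤) : MemLp g q (torusMeasure d) :=
  ⟨h.1.1, by rw [← h.seqLp_eq]; exact hq.lt_top⟩

theorem seqLp_zero (q : ℝ≥0∞) : seqLp q (0 : Seq d) = 0 := by
  rw [isFourier_zero.seqLp_eq]; simp

theorem seqLp_add {q : ℝ≥0∞} (hq : 1 ≤ q) (c c' : Seq d) :
    seqLp q (c + c') ≤ seqLp q c + seqLp q c' := by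
  by_cases h : seqLp q c = ⊤
  · simp [h]
  by_cases h' : seqLp q c' = ⊤
  · simp [h']
  obtain ⟨g, hg⟩ := exists_isFourier h
  obtain ⟨g', hg'⟩ := exists_isFourier h'
  rw [hg.seqLp_eq, hg'.seqLp_eq, (hg.add hg').seqLp_eq]
  exact eLpNorm_add_le hg.1.1 hg'.1.1 hq

theorem seqLp_smul (q : ℝ≥0∞) (a : ℂ) (c : Seq d) : seqLp q (a • c) ≤ ‖a‖ₑ * seqLp q c := by
  rcases eq_or_ne a 0 with rfl | ha
  · simp [seqLp_zero]
  by_cases h : seqLp q c = ⊤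
  · rw [h, ENNReal.mul_top (by simpa using ha)]; exact le_top
  obtain ⟨g, hg⟩ := exists_isFourier h
  rw [hg.seqLp_eq, (hg.smul a).seqLp_eq, eLpNorm_const_smul]

theorem seqLp_neg (q : ℝ≥0∞) (c : Seq d) : seqLp q (-c) = seqLp q c := by
  have h : ∀ c : Seq d, seqLp q (-c) ≤ seqLp q c := fun c => by
    have := seqLp_smul q (-1) c
    simpa using this
  refine le_antisymm (h c) ?_
  simpa using h (-c)

theorem seqLp_mono {p q : ℝ≥0∞} (hpq : p ≤ q) (c : Seq d) : seqLp p c ≤ seqLp q c := by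
  by_cases h : seqLp q c = ⊤
  · simp [h]
  obtain ⟨g, hg⟩ := exists_isFourier h
  rw [hg.seqLp_eq, hg.seqLp_eq]
  exact eLpNorm_le_eLpNorm_of_exponent_le hpq hg.1.1

theorem enorm_le_seqLp {q : ℝ≥0∞} (hq : 1 ≤ q) (c : Seq d) (m : Fin d → ℤ) :
    ‖c m‖ₑ ≤ seqLp q c := by
  refine le_trans ?_ (seqLp_mono hq c)
  by_cases h : seqLp 1 c = ⊤
  · simp [h]
  obtain ⟨g, hg⟩ := exists_isFourier h
  rw [hg.seqLp_eq, ← hg.2, mFourierCoeff_eq, eLpNorm_one_eq_lintegral_enorm]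
  refine (enorm_integral_le_lintegral_enorm _).trans (lintegral_mono fun x => ?_)
  rw [enorm_mul]
  have : ‖UnitAddTorus.mFourier (-m) x‖ₑ = 1 := by
    rw [← ofReal_norm, norm_mFourier_apply, ENNReal.ofReal_one]
  rw [this, one_mul]

theorem seqLp_le_tsum (q : ℝ≥0∞) (c : Seq d) : seqLp q c ≤ ∑' m, ‖c m‖ₑ := by
  by_cases h : ∑' m, ‖c m‖ₑ = ⊤
  · simp [h]
  have hs : Summable fun m => ‖c m‖ := by
    have := ENNReal.summable_toReal h
    simpa using this
  refine (seqLp_mono le_top c).trans ?_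
  rw [(isFourier_of_summable hs).1.seqLp_eq]
  refine eLpNormEssSup_le_of_ae_enorm_bound (.of_forall fun x => ?_)
  refine (enorm_tsum_le_tsum_enorm).trans (ENNReal.tsum_le_tsum fun m => ?_)
  rw [enorm_mul, ← ofReal_norm (UnitAddTorus.mFourier m x), norm_mFourier_apply]
  simp

/-- Minkowski's inequality for integrals of nonnegative functions. -/
theorem lintegral_minkowski {S X : Type*} [MeasurableSpace S] [MeasurableSpace X] {ν : Measure S}
    {μ : Measure X} [SFinite ν] [SFinite μ] {q : ℝ} (hq : 1 ≤ q) {h : S → X → ℝ≥0∞}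
    (hm : AEMeasurable (Function.uncurry h) (ν.prod μ)) {w : S → ℝ≥0∞} (hw : Measurable w)
    (hle : ∀ᵐ s ∂ν, (∫⁻ x, h s x ^ q ∂μ) ^ (1 / q) ≤ w s) :
    (∫⁻ x, (∫⁻ s, h s x ∂ν) ^ q ∂μ) ^ (1 / q) ≤ ∫⁻ s, w s ∂ν := by
  have hq0 : 0 < q := by linarith
  by_cases hW : ∫⁻ s, w s ∂ν = ⊤
  · simp [hW]
  have hwfin : ∀ᵐ s ∂ν, w s < ⊤ := ae_lt_top hw hW
  have hle' : ∀ᵐ s ∂ν, ∫⁻ x, h s x ^ q ∂μ ≤ w s ^ q := by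
    filter_upwards [hle] with s hs
    rw [one_div] at hs
    exact (ENNReal.rpow_inv_le_iff hq0).1 hs
  rw [one_div, ENNReal.rpow_inv_le_iff hq0]
  rcases eq_or_lt_of_le hq with rfl | hq1
  · simp only [ENNReal.rpow_one] at hle' ⊢
    rw [lintegral_lintegral_swap]
    · exact lintegral_mono_ae hle'
    · exact hm.prod_swap
  have hmq : AEMeasurable (fun z : S × X => h z.1 z.2 ^ q) (ν.prod μ) := hm.pow_const q
  have hsec : ∀ᵐ s ∂ν, AEMeasurable (h s) μ := by
    filter_upwards [hm.aestronglyMeasurable.prodMk_left] with s hs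
    exact hs.aemeasurable
  have hzero : ∀ᵐ z ∂(ν.prod μ), w z.1 < ⊤ ∧ (w z.1 = 0 → h z.1 z.2 = 0) := by
    obtain ⟨h', hh', hhe⟩ : ∃ h' : S × X → ℝ≥0∞, Measurable h' ∧
        Function.uncurry h =ᵐ[ν.prod μ] h' := ⟨hm.mk, hm.measurable_mk, hm.ae_eq_mk⟩
    have hset : MeasurableSet {z : S × X | w z.1 < ⊤ ∧ (w z.1 = 0 → h' z = 0)} := by
      have h1 : MeasurableSet {z : S × X | w z.1 < ⊤} :=
        measurableSet_lt (hw.comp measurable_fst) measurable_const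
      have h2 : MeasurableSet {z : S × X | w z.1 = 0} :=
        (hw.comp measurable_fst) (measurableSet_singleton 0)
      have h3 : MeasurableSet {z : S × X | h' z = 0} := hh' (measurableSet_singleton 0)
      have : {z : S × X | w z.1 < ⊤ ∧ (w z.1 = 0 → h' z = 0)} =
          {z : S × X | w z.1 < ⊤} ∩ ({z : S × X | w z.1 = 0}ᶜ ∪ {z : S × X | h' z = 0}) := by
        ext z; simp [imp_iff_not_or]
      rw [this]
      exact h1.inter (h2.compl.union h3)
    have hae : ∀ᵐ z ∂(ν.prod μ), w z.1 < ⊤ ∧ (w z.1 = 0 → h' z = 0) := by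
      rw [Measure.ae_prod_iff_ae_ae hset]
      have hse := Measure.ae_ae_of_ae_prod hhe
      filter_upwards [hle', hwfin, hse, hsec] with s hs hsf hse hsm
      by_cases h0 : w s = 0
      · rw [h0, ENNReal.zero_rpow_of_pos hq0, nonpos_iff_eq_zero, lintegral_eq_zero_iff'
          (hsm.pow_const q)] at hs
        filter_upwards [hs, hse] with x hx hxe
        refine ⟨hsf, fun _ => ?_⟩
        rw [← hxe]
        simpa [hq0, hq0.not_gt] using hx
      · exact .of_forall fun x => ⟨hsf, fun h => absurd h h0⟩
    filter_upwards [hae, hhe] with z hz hze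
    refine ⟨hz.1, fun h0 => ?_⟩
    have := hz.2 h0
    rw [← hze] at this
    exact this
  have hzero' : ∀ᵐ x ∂μ, ∀ᵐ s ∂ν, w s < ⊤ ∧ (w s = 0 → h s x = 0) := by
    have := (Measure.measurePreserving_swap (μ := μ) (ν := ν)).quasiMeasurePreserving.ae hzero
    exact Measure.ae_ae_of_ae_prod this
  have hsec' : ∀ᵐ x ∂μ, AEMeasurable (fun s => h s x) ν := by
    filter_upwards [hm.prod_swap.aestronglyMeasurable.prodMk_left] with s hs
    exact hs.aemeasurable
  set W := ∫⁻ s, w s ∂ν with hWdef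
  obtain hconj : q.HolderConjugate (q / (q - 1)) := Real.HolderConjugate.conjExponent hq1
  set q' := q / (q - 1)
  have hq'0 : 0 < q' := hconj.symm.pos
  have hqq' : q / q' = q - 1 := hconj.div_conj_eq_sub_one
  have hpt : ∀ᵐ x ∂μ, (∫⁻ s, h s x ∂ν) ^ q ≤
      (∫⁻ s, h s x ^ q * w s ^ (-(q - 1)) ∂ν) * W ^ (q - 1) := by
    filter_upwards [hzero', hsec'] with x hx hxm
    have e1 : ∫⁻ s, h s x ∂ν = ∫⁻ s, (h s x * w s ^ (-(1 / q'))) * w s ^ (1 / q') ∂ν := by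
      refine lintegral_congr_ae ?_
      filter_upwards [hx] with s hs
      by_cases h0 : w s = 0
      · simp [hs.2 h0]
      · rw [mul_assoc, ← ENNReal.rpow_add _ _ h0 hs.1.ne]; simp
    have e2 := ENNReal.lintegral_mul_le_Lp_mul_Lq ν hconj
      (f := fun s => h s x * w s ^ (-(1 / q'))) (g := fun s => w s ^ (1 / q'))
      (hxm.mul (hw.pow_const _).aemeasurable) (hw.pow_const _).aemeasurable
    have e3 : ∀ s, (w s ^ (1 / q')) ^ q' = w s := fun s => by
      rw [← ENNReal.rpow_mul, one_div, inv_mul_cancel₀ hq'0.ne', ENNReal.rpow_one]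
    have e4 : ∀ s, (h s x * w s ^ (-(1 / q'))) ^ q = h s x ^ q * w s ^ (-(q - 1)) := fun s => by
      rw [ENNReal.mul_rpow_of_nonneg _ _ hq0.le, ← ENNReal.rpow_mul, ← hqq']
      congr 2; ring
    simp only [Pi.mul_apply, e3, e4] at e2
    rw [e1]
    calc _ ≤ ((∫⁻ s, h s x ^ q * w s ^ (-(q - 1)) ∂ν) ^ (1 / q) * W ^ (1 / q')) ^ q :=
          ENNReal.rpow_le_rpow e2 hq0.le
      _ = _ := by
          rw [ENNReal.mul_rpow_of_nonneg _ _ hq0.le, ← ENNReal.rpow_mul, ← ENNReal.rpow_mul,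
            one_div_mul_cancel hq0.ne', ENNReal.rpow_one, ← hqq']
          congr 2; ring
  have hmw : AEMeasurable (fun z : S × X => h z.1 z.2 ^ q * w z.1 ^ (-(q - 1))) (ν.prod μ) :=
    hmq.mul ((hw.comp measurable_fst).pow_const _).aemeasurable
  calc ∫⁻ x, (∫⁻ s, h s x ∂ν) ^ q ∂μ
      ≤ ∫⁻ x, (∫⁻ s, h s x ^ q * w s ^ (-(q - 1)) ∂ν) * W ^ (q - 1) ∂μ := lintegral_mono_ae hpt
    _ = (∫⁻ s, ∫⁻ x, h s x ^ q * w s ^ (-(q - 1)) ∂μ ∂ν) * W ^ (q - 1) := by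
        rw [lintegral_mul_const' _ _ (ENNReal.rpow_ne_top_of_nonneg (by linarith) hW)]
        congr 1
        rw [lintegral_lintegral_swap]
        exact hmw.prod_swap
    _ ≤ (∫⁻ s, w s ∂ν) * W ^ (q - 1) := by
        gcongr ?_ * _
        refine lintegral_mono_ae ?_
        filter_upwards [hle', hwfin, hsec] with s hs hsf hsm
        by_cases h0 : w s = 0
        · rw [h0, ENNReal.zero_rpow_of_pos hq0, nonpos_iff_eq_zero, lintegral_eq_zero_iff'
            (hsm.pow_const q)] at hs
          rw [h0, nonpos_iff_eq_zero, lintegral_eq_zero_iff' ((hsm.pow_const q).mul_const _)]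
          filter_upwards [hs] with x hx
          simp only [Pi.zero_apply] at hx
          simp [hx]
        · have : w s ^ (-(q - 1)) ≠ ⊤ := by
            simp [ENNReal.rpow_eq_top_iff, h0, hsf.ne]
          rw [lintegral_mul_const' _ _ this]
          calc _ ≤ w s ^ q * w s ^ (-(q - 1)) := by gcongr
            _ = w s := by
              rw [← ENNReal.rpow_add _ _ h0 hsf.ne]; simp
    _ = W ^ q := by
        by_cases h0 : W = 0
        · rw [← hWdef, h0, zero_mul, ENNReal.zero_rpow_of_pos hq0]
        · rw [← hWdef]
          nth_rewrite 1 [← ENNReal.rpow_one W]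
          rw [← ENNReal.rpow_add _ _ h0 hW]; simp

/-- Minkowski's inequality for Bochner integrals, with `1 ≤ q ≤ ∞`. -/
theorem eLpNorm_integral_le {S X : Type*} [MeasurableSpace S] [MeasurableSpace X] {ν : Measure S}
    {μ : Measure X} [SFinite ν] [SFinite μ] {q : ℝ≥0∞} (hq : 1 ≤ q) {h : S → X → ℂ}
    (hm : AEStronglyMeasurable (Function.uncurry h) (ν.prod μ)) {w : S → ℝ≥0∞} (hw : Measurable w)
    (hle : ∀ᵐ s ∂ν, eLpNorm (h s) q μ ≤ w s) :
    eLpNorm (fun x => ∫ s, h s x ∂ν) q μ ≤ ∫⁻ s, w s ∂ν := by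
  have hme : AEMeasurable (Function.uncurry fun s x => ‖h s x‖ₑ) (ν.prod μ) := hm.enorm
  rcases eq_or_ne q ⊤ with rfl | hqt
  · obtain ⟨h', hh', hhe⟩ : ∃ h' : S × X → ℝ≥0∞, Measurable h' ∧
        (Function.uncurry fun s x => ‖h s x‖ₑ) =ᵐ[ν.prod μ] h' :=
      ⟨hme.mk, hme.measurable_mk, hme.ae_eq_mk⟩
    have hae : ∀ᵐ z ∂(ν.prod μ), h' z ≤ w z.1 := by
      refine (Measure.ae_prod_iff_ae_ae (measurableSet_le hh' (hw.comp measurable_fst))).2 ?_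
      filter_upwards [hle, Measure.ae_ae_of_ae_prod hhe] with s hs hse
      filter_upwards [ae_le_eLpNormEssSup (f := h s) (μ := μ), hse] with x hx hxe
      rw [← hxe]
      exact hx.trans hs
    have hae' : ∀ᵐ z ∂(ν.prod μ), ‖h z.1 z.2‖ₑ ≤ w z.1 := by
      filter_upwards [hae, hhe] with z hz hze
      rw [← hze] at hz
      exact hz
    have := Measure.ae_ae_of_ae_prod
      ((Measure.measurePreserving_swap (μ := μ) (ν := ν)).quasiMeasurePreserving.ae hae')
    refine eLpNormEssSup_le_of_ae_enorm_bound ?_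
    filter_upwards [this] with x hx
    exact (enorm_integral_le_lintegral_enorm _).trans (lintegral_mono_ae hx)
  · have hq0 : q ≠ 0 := (zero_lt_one.trans_le hq).ne'
    have hq1 : 1 ≤ q.toReal := by
      rw [← ENNReal.toReal_one]; exact ENNReal.toReal_mono hqt hq
    rw [eLpNorm_eq_lintegral_rpow_enorm_toReal hq0 hqt]
    refine le_trans ?_ (lintegral_minkowski hq1 hme hw ?_)
    · gcongr
      exact enorm_integral_le_lintegral_enorm _
    · filter_upwards [hle] with s hs
      rwa [eLpNorm_eq_lintegral_rpow_enorm_toReal hq0 hqt] at hs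

end FracNS

end



noncomputable section

namespace FracNS

variable {d : ℕ}

theorem seqLp_tsum {q : ℝ≥0∞} (hq : 1 ≤ q) {c : ℕ → Seq d} {c' : Seq d}
    (hc : ∀ m, HasSum (fun a => c a m) (c' m)) : seqLp q c' ≤ ∑' a, seqLp q (c a) := by
  by_cases h : ∑' a, seqLp q (c a) = ⊤
  · simp [h]
  have hfin : ∀ a, seqLp q (c a) ≠ ⊤ := fun a => ENNReal.ne_top_of_tsum_ne_top h a
  choose g hg using fun a => exists_isFourier (hfin a)
  have hg1 : ∑' a, ∫⁻ x, ‖g a x‖ₑ ∂(torusMeasure d) ≠ ⊤ := by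
    refine ne_top_of_le_ne_top h (ENNReal.tsum_le_tsum fun a => ?_)
    rw [← eLpNorm_one_eq_lintegral_enorm, ← (hg a).seqLp_eq]
    exact seqLp_mono hq _
  have hae : ∀ᵐ x ∂(torusMeasure d), Summable fun a => g a x := by
    rw [← lintegral_tsum fun a => (hg a).1.1.enorm] at hg1
    filter_upwards [ae_lt_top' (AEMeasurable.tsum fun a => (hg a).1.1.enorm) hg1] with x hx
    refine Summable.of_norm ?_
    have := ENNReal.summable_toReal hx.ne
    simpa using this
  have hlim : ∀ᵐ x ∂(torusMeasure d), Tendsto (fun n => (∑ a ∈ Finset.range n, g a) x) atTop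
      (𝓝 (∑' a, g a x)) := by
    filter_upwards [hae] with x hx
    simpa using hx.hasSum.tendsto_sum_nat
  have hmeas : ∀ n, AEStronglyMeasurable (∑ a ∈ Finset.range n, g a) (torusMeasure d) := fun n =>
    Finset.aestronglyMeasurable_sum _ fun a _ => (hg a).1.1
  have hle : ∀ p, 1 ≤ p → eLpNorm (fun x => ∑' a, g a x) p (torusMeasure d) ≤
      ∑' a, eLpNorm (g a) p (torusMeasure d) := fun p hp => by
    refine (Lp.eLpNorm_lim_le_liminf_eLpNorm hmeas _ hlim).trans ?_
    refine (Filter.liminf_le_liminf (.of_forall fun n => eLpNorm_sum_le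
      (fun a _ => (hg a).1.1) hp)).trans ?_
    rw [ENNReal.tendsto_nat_tsum _ |>.liminf_eq]
  have hsm : AEStronglyMeasurable (fun x => ∑' a, g a x) (torusMeasure d) :=
    aestronglyMeasurable_of_tendsto_ae atTop hmeas hlim
  have hF : IsFourier (fun x => ∑' a, g a x) c' := by
    refine ⟨⟨hsm, ?_⟩, fun m => ?_⟩
    · have := hle 1 le_rfl
      rw [eLpNorm_one_eq_lintegral_enorm] at this
      simp only [eLpNorm_one_eq_lintegral_enorm] at this
      exact this.trans_lt hg1.lt_top
    · rw [mFourierCoeff_eq]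
      simp only [← tsum_mul_left]
      have hs : Summable fun a => ∫ x, ‖UnitAddTorus.mFourier (-m) x * g a x‖ ∂(torusMeasure d) := by
        simp only [norm_mul, norm_mFourier_apply, one_mul]
        have := ENNReal.summable_toReal hg1
        refine this.congr fun a => ?_
        rw [integral_norm_eq_lintegral_enorm (hg a).1.1]
      have := hasSum_integral_of_summable_integral_norm
        (fun a => integrable_mFourier_mul (hg a).1 (-m)) hs
      refine this.unique ?_
      refine (hc m).congr_fun fun a => ?_
      exact ((hg a).2 m)
  rw [hF.seqLp_eq]
  refine (hle q hq).trans_eq ?_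
  congr 1
  ext a
  rw [(hg a).seqLp_eq]

theorem seqLp_integral_of_isFourier {S : Type*} [MeasurableSpace S] {ν : Measure S} [SFinite ν]
    {q : ℝ≥0∞} (hq : 1 ≤ q) {f : S → Seq d} {h : S → Torus d → ℂ}
    (hF : ∀ᵐ s ∂ν, IsFourier (h s) (f s))
    (hm : AEStronglyMeasurable (Function.uncurry h) (ν.prod (torusMeasure d))) {w : S → ℝ≥0∞}
    (hw : Measurable w) (hle : ∀ᵐ s ∂ν, seqLp q (f s) ≤ w s) :
    seqLp q (fun m => ∫ s, f s m ∂ν) ≤ ∫⁻ s, w s ∂ν := by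
  by_cases hW : ∫⁻ s, w s ∂ν = ⊤
  · simp [hW]
  have hbd : ∀ᵐ s ∂ν, eLpNorm (h s) q (torusMeasure d) ≤ w s := by
    filter_upwards [hF, hle] with s hs hl
    rwa [← hs.seqLp_eq]
  have hint : Integrable (Function.uncurry h) (ν.prod (torusMeasure d)) := by
    refine ⟨hm, ?_⟩
    rw [HasFiniteIntegral, lintegral_prod _ hm.enorm]
    refine lt_of_le_of_lt (lintegral_mono_ae ?_) (lt_top_iff_ne_top.2 hW)
    filter_upwards [hF, hle] with s hs hl
    change ∫⁻ x, ‖h s x‖ₑ ∂_ ≤ w s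
    rw [← eLpNorm_one_eq_lintegral_enorm, ← hs.seqLp_eq]
    exact (seqLp_mono hq _).trans hl
  have hFI : IsFourier (fun x => ∫ s, h s x ∂ν) (fun m => ∫ s, f s m ∂ν) := by
    refine ⟨hint.integral_prod_right, fun m => ?_⟩
    rw [mFourierCoeff_eq]
    simp only [← integral_const_mul]
    rw [integral_integral_swap (f := fun x s => UnitAddTorus.mFourier (-m) x * h s x)]
    · refine integral_congr_ae ?_
      filter_upwards [hF] with s hs
      rw [← hs.2, mFourierCoeff_eq]
    · have : Integrable (fun z : Torus d × S => h z.2 z.1) ((torusMeasure d).prod ν) := hint.swap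
      exact this.bdd_mul (c := 1)
        ((UnitAddTorus.mFourier (-m)).continuous.measurable.comp
          measurable_fst).aestronglyMeasurable
        (.of_forall fun x => (norm_mFourier_apply (-m) _).le)
  rw [hFI.seqLp_eq]
  exact eLpNorm_integral_le hq hm hw hbd

theorem seqLp_integral {S : Type*} [MeasurableSpace S] {ν : Measure S} [SFinite ν] {q : ℝ≥0∞}
    (hq : 1 ≤ q) {f : S → Seq d} (hf : ∀ m, AEStronglyMeasurable (fun s => f s m) ν)
    (hs : ∀ᵐ s ∂ν, Summable fun m => ‖f s m‖) {w : S → ℝ≥0∞} (hw : Measurable w)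
    (hle : ∀ᵐ s ∂ν, seqLp q (f s) ≤ w s) :
    seqLp q (fun m => ∫ s, f s m ∂ν) ≤ ∫⁻ s, w s ∂ν := by
  refine seqLp_integral_of_isFourier hq (h := fun s x => ∑' m, f s m * UnitAddTorus.mFourier m x)
    ?_ ?_ hw hle
  · filter_upwards [hs] with s hs
    exact (isFourier_of_summable hs).1
  · refine aestronglyMeasurable_of_tendsto_ae (u := (atTop : Filter (Finset (Fin d → ℤ))))
      (f := fun A z => ∑ m ∈ A, f z.1 m * UnitAddTorus.mFourier m z.2) (fun A => ?_) ?_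
    · refine Finset.aestronglyMeasurable_fun_sum _ fun m _ => ?_
      exact ((hf m).comp_quasiMeasurePreserving Measure.quasiMeasurePreserving_fst).mul
        ((UnitAddTorus.mFourier m).continuous.measurable.comp measurable_snd).aestronglyMeasurable
    · filter_upwards [Measure.quasiMeasurePreserving_fst.ae hs] with z hz
      refine Summable.hasSum (Summable.of_norm ?_)
      simpa [norm_mFourier_apply] using hz

theorem tendsto_of_tendsto_seqLp {q : ℝ≥0∞} (hq : 1 ≤ q) {u : ℕ → Seq d} {l : Seq d}
    (h : Tendsto (fun n => seqLp q (u n - l)) atTop (𝓝 0)) (m : Fin d → ℤ) :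
    Tendsto (fun n => u n m) atTop (𝓝 (l m)) := by
  rw [tendsto_iff_edist_tendsto_0]
  refine tendsto_of_tendsto_of_tendsto_of_le_of_le tendsto_const_nhds h (fun _ => zero_le) fun n => ?_
  rw [edist_eq_enorm_sub]
  exact enorm_le_seqLp hq (u n - l) m

theorem seqLp_complete {q : ℝ≥0∞} (hq : 1 ≤ q) {u : ℕ → Seq d} {l : Seq d} {B : ℕ → ℝ≥0∞}
    (hB : ∑' n, B n ≠ ⊤) (hu : ∀ n k, n ≤ k → seqLp q (u n - u k) ≤ B n)
    (hl : ∀ m, Tendsto (fun n => u n m) atTop (𝓝 (l m))) (n : ℕ) : seqLp q (u n - l) ≤ B n := by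
  have hBn : ∀ n, B n ≠ ⊤ := fun n => ENNReal.ne_top_of_tsum_ne_top hB n
  have hfin : ∀ n, seqLp q (u 0 - u n) ≠ ⊤ := fun n =>
    ne_top_of_le_ne_top (hBn 0) (hu 0 n (Nat.zero_le n))
  choose f hf using fun n => exists_isFourier (hfin n)
  have hsub : ∀ n k, IsFourier (f n - f k) (u k - u n) := fun n k => by
    have := (hf n).sub (hf k)
    convert! this using 1
    abel
  have hu' : ∀ N n, N ≤ n → eLpNorm (f n - f N) q (torusMeasure d) ≤ B N := fun N n h => by
    rw [← (hsub n N).seqLp_eq]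
    exact hu N n h
  obtain ⟨g, hg, hgl⟩ := Lp.cauchy_complete_eLpNorm (μ := torusMeasure d) hq
    (fun n => (hf n).memLp (hfin n)) (B := fun n => 2 * B n + 2⁻¹ ^ (n + 1)) (by
      rw [ENNReal.tsum_add, ENNReal.tsum_mul_left]
      refine ENNReal.add_ne_top.2 ⟨ENNReal.mul_ne_top (by simp) hB, ?_⟩
      simp_rw [pow_succ]
      rw [ENNReal.tsum_mul_right, ENNReal.tsum_geometric]
      simp [ENNReal.mul_eq_top]) (fun N n m hn hm => by
      have e : f n - f m = (f n - f N) - (f m - f N) := by abel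
      rw [e]
      refine (eLpNorm_sub_le (hsub n N).1.1 (hsub m N).1.1 hq).trans_lt ?_
      refine (add_le_add (hu' N n hn) (hu' N m hm)).trans_lt ?_
      rw [← two_mul]
      refine ENNReal.lt_add_right (ENNReal.mul_ne_top (by simp) (hBn N)) ?_
      simp)
  have hgi : Integrable g (torusMeasure d) := hg.integrable hq
  have hgF : IsFourier g (fun m => UnitAddTorus.mFourierCoeff g m) := ⟨hgi, fun _ => rfl⟩
  have hgc : ∀ m, UnitAddTorus.mFourierCoeff g m = u 0 m - l m := fun m => by
    have h1 : Tendsto (fun n => seqLp q ((u 0 - u n) - fun m => UnitAddTorus.mFourierCoeff g m))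
        atTop (𝓝 0) := by
      refine hgl.congr fun n => ?_
      rw [((hf n).sub hgF).seqLp_eq]
    refine tendsto_nhds_unique (tendsto_of_tendsto_seqLp hq h1 m) ?_
    exact (tendsto_const_nhds).sub (hl m)
  have hgF' : IsFourier g (u 0 - l) := ⟨hgi, hgc⟩
  have h2 : ∀ k, seqLp q (u k - l) = eLpNorm (f k - g) q (torusMeasure d) := fun k => by
    rw [← ((hf k).sub hgF').seqLp_eq, ← seqLp_neg]
    congr 1
    abel
  have h3 : ∀ k, n ≤ k → seqLp q (u n - l) ≤ B n + eLpNorm (f k - g) q (torusMeasure d) := fun k hk => by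
    have e : u n - l = (u n - u k) + (u k - l) := by abel
    rw [e, ← h2]
    exact (seqLp_add hq _ _).trans (add_le_add_left (hu n k hk) _)
  have h4 : Tendsto (fun k => B n + eLpNorm (f k - g) q (torusMeasure d)) atTop (𝓝 (B n + 0)) :=
    tendsto_const_nhds.add hgl
  rw [add_zero] at h4
  exact ge_of_tendsto h4 (eventually_atTop.2 ⟨n, h3⟩)

theorem eLpNorm_interpolation {X : Type*} [MeasurableSpace X] {μ : Measure X} {f : X → ℂ}
    (hf : AEStronglyMeasurable f μ) {p r κ : ℝ≥0∞} {l : ℝ} (h0 : 0 ≤ l) (h1 : l ≤ 1)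
    (hκ : κ⁻¹ = p⁻¹ * ENNReal.ofReal (1 - l) + r⁻¹ * ENNReal.ofReal l) :
    eLpNorm f κ μ ≤ eLpNorm f p μ ^ (1 - l) * eLpNorm f r μ ^ l := by
  rcases h0.eq_or_lt with rfl | h0
  · simp only [sub_zero, ENNReal.ofReal_one, mul_one, ENNReal.ofReal_zero, mul_zero, add_zero,
      inv_inj] at hκ
    simp [hκ]
  rcases h1.eq_or_lt with rfl | h1
  · simp only [sub_self, ENNReal.ofReal_one, mul_one, ENNReal.ofReal_zero, mul_zero, zero_add,
      inv_inj] at hκ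
    simp [hκ]
  have h1' : 0 < 1 - l := by linarith
  have ha0 : ENNReal.ofReal (1 - l) ≠ 0 := by simpa using h1
  have hb0 : ENNReal.ofReal l ≠ 0 := by simpa using h0
  have : ENNReal.HolderTriple (p / ENNReal.ofReal (1 - l)) (r / ENNReal.ofReal l) κ := by
    constructor
    rw [hκ, ENNReal.inv_div (Or.inl ENNReal.ofReal_ne_top) (Or.inl ha0),
      ENNReal.inv_div (Or.inl ENNReal.ofReal_ne_top) (Or.inl hb0), ENNReal.div_eq_inv_mul,
      ENNReal.div_eq_inv_mul]
  have hm1 : AEStronglyMeasurable (fun x => ‖f x‖ ^ (1 - l)) μ :=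
    (Real.continuous_rpow_const h1'.le).comp_aestronglyMeasurable hf.norm
  have hm2 : AEStronglyMeasurable (fun x => ‖f x‖ ^ l) μ :=
    (Real.continuous_rpow_const h0.le).comp_aestronglyMeasurable hf.norm
  have key := eLpNorm_smul_le_mul_eLpNorm (p := p / ENNReal.ofReal (1 - l))
    (q := r / ENNReal.ofReal l) (r := κ) hm2 hm1
  rw [eLpNorm_norm_rpow _ h1', eLpNorm_norm_rpow _ h0,
    ENNReal.div_mul_cancel ha0 ENNReal.ofReal_ne_top,
    ENNReal.div_mul_cancel hb0 ENNReal.ofReal_ne_top] at key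
  refine le_trans (le_of_eq ?_) key
  rw [← eLpNorm_norm f]
  congr 1
  ext x
  simp only [Pi.smul_apply', smul_eq_mul]
  rw [← Real.rpow_add_of_nonneg (norm_nonneg _) h1'.le h0.le]
  simp

theorem seqLp_interpolation {c : Seq d} {p r κ : ℝ≥0∞} (hp : seqLp p c ≠ ⊤) {l : ℝ} (h0 : 0 ≤ l)
    (h1 : l ≤ 1) (hκ : κ⁻¹ = p⁻¹ * ENNReal.ofReal (1 - l) + r⁻¹ * ENNReal.ofReal l) :
    seqLp κ c ≤ seqLp p c ^ (1 - l) * seqLp r c ^ l := by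
  obtain ⟨g, hg⟩ := exists_isFourier hp
  simp only [hg.seqLp_eq]
  exact eLpNorm_interpolation hg.1.1 h0 h1 hκ

/-! ### Products -/

/-- The Fourier coefficients of a product. -/
def conv (a b : Seq d) : Seq d := fun m => ∑' k, a k * b (m - k)

theorem mFourierCoeff_congr_ae {f g : Torus d → ℂ} (h : f =ᵐ[torusMeasure d] g) (m : Fin d → ℤ) :
    UnitAddTorus.mFourierCoeff f m = UnitAddTorus.mFourierCoeff g m := by
  rw [mFourierCoeff_eq, mFourierCoeff_eq]
  refine integral_congr_ae ?_
  filter_upwards [h] with x hx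
  rw [hx]

theorem hasSum_mFourierCoeff_mul {f g : Torus d → ℂ} (hf : MemLp f 2 (torusMeasure d))
    (hg : MemLp g 2 (torusMeasure d)) :
    HasSum (fun m => starRingEnd ℂ (UnitAddTorus.mFourierCoeff f m) *
      UnitAddTorus.mFourierCoeff g m) (∫ x, starRingEnd ℂ (f x) * g x ∂(torusMeasure d)) := by
  have key : HasSum (fun m => starRingEnd ℂ (UnitAddTorus.mFourierCoeff (hf.toLp f : Torus d → ℂ) m) *
      UnitAddTorus.mFourierCoeff (hg.toLp g : Torus d → ℂ) m)
      (∫ x, starRingEnd ℂ ((hf.toLp f : Torus d → ℂ) x) * (hg.toLp g : Torus d → ℂ) x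
        ∂(torusMeasure d)) := UnitAddTorus.hasSum_prod_mFourierCoeff (hf.toLp f) (hg.toLp g)
  simp only [mFourierCoeff_congr_ae hf.coeFn_toLp, mFourierCoeff_congr_ae hg.coeFn_toLp] at key
  convert! key using 1
  refine integral_congr_ae ?_
  filter_upwards [hf.coeFn_toLp, hg.coeFn_toLp] with x hx hx'
  rw [hx, hx']

theorem summable_sq_of_seqLp {c : Seq d} (h : seqLp 2 c ≠ ⊤) : Summable fun m => ‖c m‖ ^ 2 := by
  obtain ⟨g, hg⟩ := exists_isFourier h
  have := (hasSum_mFourierCoeff_mul (hg.memLp h) (hg.memLp h)).summable.norm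
  refine this.congr fun m => ?_
  rw [hg.2 m, norm_mul, RCLike.norm_conj, sq]

theorem summable_conv {a b : Seq d} (ha : Summable fun m => ‖a m‖ ^ 2)
    (hb : Summable fun m => ‖b m‖ ^ 2) (m : Fin d → ℤ) : Summable fun k => ‖a k * b (m - k)‖ := by
  have hb' : Summable fun k => ‖b (m - k)‖ ^ 2 := (Equiv.subLeft m).summable_iff.2 hb
  refine Summable.of_nonneg_of_le (fun _ => norm_nonneg _) (fun k => ?_) (ha.add hb')
  rw [norm_mul]
  nlinarith [sq_nonneg (‖a k‖ - ‖b (m - k)‖), sq_nonneg (‖a k‖), sq_nonneg (‖b (m - k)‖)]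

theorem isFourier_mul {f g : Torus d → ℂ} {a b : Seq d} (hf : IsFourier f a) (hg : IsFourier g b)
    (hf2 : MemLp f 2 (torusMeasure d)) (hg2 : MemLp g 2 (torusMeasure d)) :
    IsFourier (fun x => f x * g x) (conv a b) := by
  refine ⟨hf2.integrable_mul hg2, fun m => ?_⟩
  set G : Torus d → ℂ := fun x => starRingEnd ℂ (UnitAddTorus.mFourier (-m) x * g x) with hG
  have hGm : MemLp G 2 (torusMeasure d) := by
    refine MemLp.of_le hg2 ?_ (.of_forall fun x => ?_)
    · exact Complex.continuous_conj.comp_aestronglyMeasurable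
        ((UnitAddTorus.mFourier (-m)).continuous.aestronglyMeasurable.mul hg2.1)
    · simp [hG, norm_mFourier_apply]
  have key := hasSum_mFourierCoeff_mul hGm hf2
  have e2 : ∀ k, starRingEnd ℂ (UnitAddTorus.mFourierCoeff G k) = b (m - k) := fun k => by
    rw [← hg.2, mFourierCoeff_eq, mFourierCoeff_eq, ← integral_conj]
    refine integral_congr_ae (.of_forall fun x => ?_)
    simp only [hG, map_mul, Complex.conj_conj, ← UnitAddTorus.mFourier_neg, neg_neg]
    rw [← mul_assoc, ← UnitAddTorus.mFourier_add]
    congr 3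
    abel
  simp only [hf.2, e2] at key
  have e3 : ∫ x, (starRingEnd ℂ) (G x) * f x ∂(torusMeasure d) =
      UnitAddTorus.mFourierCoeff (fun x => f x * g x) m := by
    rw [mFourierCoeff_eq]
    refine integral_congr_ae (.of_forall fun x => ?_)
    simp only [hG, Complex.conj_conj]
    ring
  rw [← e3, conv, ← key.tsum_eq]
  exact tsum_congr fun k => mul_comm _ _

theorem seqLp_conv_le {a b : Seq d} {p q r : ℝ≥0∞} [ENNReal.HolderTriple p q r]
    (ha : seqLp 2 a ≠ ⊤) (hb : seqLp 2 b ≠ ⊤) :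
    seqLp r (conv a b) ≤ seqLp p a * seqLp q b := by
  obtain ⟨f, hf⟩ := exists_isFourier ha
  obtain ⟨g, hg⟩ := exists_isFourier hb
  rw [(isFourier_mul hf hg (hf.memLp ha) (hg.memLp hb)).seqLp_eq, hf.seqLp_eq, hg.seqLp_eq]
  have key := eLpNorm_smul_le_mul_eLpNorm (p := p) (q := q) (r := r) (φ := f) hg.1.1 hf.1.1
  have e : (fun x => f x * g x) = f • g := by
    ext x
    rw [Pi.smul_apply', smul_eq_mul]
  rw [e]
  exact key

end FracNS

end



noncomputable section

namespace FracNS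

variable {d : ℕ}

/-! ### Fourier multipliers -/

/-- The Fourier multiplier `c` maps `L^p` to `L^q` with norm at most `C`. -/
def MulLE (p q : ℝ≥0∞) (c : Seq d) (C : ℝ) : Prop :=
  ∀ f, seqLp p f ≠ ⊤ → seqLp q (fun m => c m * f m) ≤ ENNReal.ofReal C * seqLp p f

/-- The Fourier multiplier `c` is bounded by `C` on all the spaces `L^q`, `1 ≤ q ≤ ∞`. -/
def MulBound (c : Seq d) (C : ℝ) : Prop := ∀ q, 1 ≤ q → MulLE q q c C

theorem mFourier_toTorus (m : Fin d → ℤ) (x : Fin d → ℝ) :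
    UnitAddTorus.mFourier m (toTorus x) =
      Complex.exp (2 * Real.pi * Complex.I * ((∑ i, (m i : ℝ) * x i : ℝ) : ℂ)) := by
  change ∏ i, fourier (m i) ((x i : ℝ) : UnitAddCircle) = _
  simp only [fourier_coe_apply]
  rw [← Complex.exp_sum]
  congr 1
  push_cast
  rw [Finset.mul_sum]
  refine Finset.sum_congr rfl fun i _ => ?_
  ring

theorem measurable_toTorus : Measurable (toTorus (d := d)) := by
  refine measurable_pi_lambda _ fun i => ?_
  exact (AddCircle.continuous_mk' (1 : ℝ)).measurable.comp (measurable_pi_apply i)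

theorem IsFourier.translate {g : Torus d → ℂ} {c : Seq d} (h : IsFourier g c) (y : Torus d) :
    IsFourier (fun x => g (x + y)) (fun m => UnitAddTorus.mFourier m y * c m) := by
  refine ⟨h.1.comp_add_right y, fun m => ?_⟩
  change _ = UnitAddTorus.mFourier m y * c m
  rw [mFourierCoeff_eq, ← h.2, mFourierCoeff_eq, ← integral_const_mul,
    ← integral_add_right_eq_self
      (fun x => UnitAddTorus.mFourier m y * (UnitAddTorus.mFourier (-m) x * g x)) y]
  refine integral_congr_ae (.of_forall fun x => ?_)
  simp only
  rw [mFourier_add_apply]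
  have : UnitAddTorus.mFourier m y * UnitAddTorus.mFourier (-m) y = 1 := by
    rw [← UnitAddTorus.mFourier_add]; simp [UnitAddTorus.mFourier_zero]
  linear_combination (-(UnitAddTorus.mFourier (-m) x * g (x + y))) * this

theorem seqLp_translate (q : ℝ≥0∞) {c : Seq d} (y : Torus d) (h : seqLp q c ≠ ⊤) :
    seqLp q (fun m => UnitAddTorus.mFourier m y * c m) = seqLp q c := by
  obtain ⟨g, hg⟩ := exists_isFourier h
  rw [hg.seqLp_eq, (hg.translate y).seqLp_eq]
  exact eLpNorm_comp_measurePreserving hg.1.1 (measurePreserving_add_right _ y)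

open scoped SchwartzMap FourierTransform RealInnerProductSpace in
theorem mulBound_of_schwartz {V : Type*} [NormedAddCommGroup V] [InnerProductSpace ℝ V]
    [MeasurableSpace V] [BorelSpace V] [FiniteDimensional ℝ V] (Φ : 𝓢(V, ℂ)) :
    ∃ C : ℝ, 0 ≤ C ∧ ∀ (b : V) (e : Fin d → V),
      MulBound (fun m => Φ (b + ∑ i, (m i : ℝ) • e i)) C := by
  refine ⟨∫ w, ‖𝓕 Φ w‖, by positivity, fun b e q hq f hf => ?_⟩
  obtain ⟨g₀, hg₀⟩ := exists_isFourier hf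
  obtain ⟨g, hgm, hg⟩ : ∃ g, StronglyMeasurable g ∧ IsFourier g f := by
    refine ⟨hg₀.1.1.mk, hg₀.1.1.stronglyMeasurable_mk, hg₀.1.congr hg₀.1.1.ae_eq_mk, fun m => ?_⟩
    rw [← hg₀.2]
    exact (mFourierCoeff_congr_ae hg₀.1.1.ae_eq_mk m).symm
  set π : V → Torus d := fun w => toTorus fun i => ⟪w, e i⟫ with hπ
  have hπm : Measurable π := measurable_toTorus.comp
    (measurable_pi_lambda _ fun i => (continuous_id.inner continuous_const).measurable)
  set k : V → ℂ := fun w => Complex.exp (2 * Real.pi * Complex.I * (⟪w, b⟫ : ℝ)) * 𝓕 Φ w with hk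
  have hkn : ∀ w, ‖k w‖ = ‖𝓕 Φ w‖ := fun w => by
    have : (2 * Real.pi * Complex.I * (⟪w, b⟫ : ℝ) : ℂ) = ((2 * Real.pi * ⟪w, b⟫ : ℝ) : ℂ) *
      Complex.I := by push_cast; ring
    rw [hk, norm_mul, this, Complex.norm_exp_ofReal_mul_I, one_mul]
  have hkc : Continuous k := by
    refine Continuous.mul (Complex.continuous_exp.comp (continuous_const.mul
      (Complex.continuous_ofReal.comp (continuous_id.inner continuous_const)))) (𝓕 Φ).continuous
  have key := seqLp_integral_of_isFourier (ν := (volume : Measure V)) hq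
    (f := fun w m => k w * (UnitAddTorus.mFourier m (π w) * f m))
    (h := fun w => k w • fun x => g (x + π w))
    (.of_forall fun w => (hg.translate (π w)).smul (k w)) (by
      refine AEStronglyMeasurable.mul (f := fun z : V × Torus d => k z.1)
        (g := fun z => g (z.2 + π z.1)) ?_ ?_
      · exact (hkc.measurable.comp measurable_fst).aestronglyMeasurable
      · exact (hgm.measurable.comp
          (measurable_snd.add (hπm.comp measurable_fst))).aestronglyMeasurable)
    (w := fun w => ‖k w‖ₑ * seqLp q f) (hkc.measurable.enorm.mul_const _) (.of_forall fun w => by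
      refine (seqLp_smul q (k w) _).trans ?_
      rw [seqLp_translate q _ hf])
  rw [lintegral_mul_const _ hkc.measurable.enorm] at key
  have hint : Integrable (fun w => ‖𝓕 Φ w‖) := (𝓕 Φ).integrable.norm
  have e1 : ∫⁻ w, ‖k w‖ₑ = ENNReal.ofReal (∫ w, ‖𝓕 Φ w‖) := by
    rw [ofReal_integral_eq_lintegral_ofReal hint (.of_forall fun _ => norm_nonneg _)]
    refine lintegral_congr fun w => ?_
    rw [← hkn, ofReal_norm]
  rw [e1] at key
  convert! key using 2
  ext m
  have e2 : Φ (b + ∑ i, (m i : ℝ) • e i) = ∫ w, k w * UnitAddTorus.mFourier m (π w) := by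
    have hinv : 𝓕⁻ (𝓕 Φ) = Φ := FourierTransform.fourierInv_fourier_eq Φ
    conv_lhs => rw [← hinv]
    rw [SchwartzMap.fourierInv_coe, Real.fourierInv_eq]
    refine integral_congr_ae (.of_forall fun w => ?_)
    simp only [hk, hπ, mFourier_toTorus]
    rw [Circle.smul_def, Real.fourierChar_apply, smul_eq_mul,
      mul_right_comm _ (𝓕 Φ w), ← Complex.exp_add]
    congr 2
    rw [inner_add_right, inner_sum]
    simp only [inner_smul_right]
    push_cast
    ring
  change Φ (b + ∑ i, (m i : ℝ) • e i) * f m = _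
  rw [e2, ← integral_mul_const]
  simp only [mul_assoc]

theorem mulBound_family {Ψ : ℝ × EuclideanSpace ℝ (Fin d) → ℂ} (hΨ : ContDiff ℝ ∞ Ψ)
    (hc : HasCompactSupport Ψ) :
    ∃ C : ℝ, 0 ≤ C ∧ ∀ z N : ℝ, MulBound (fun m => Ψ (z, N⁻¹ • freq m)) C := by
  let L := WithLp.prodContinuousLinearEquiv 2 ℝ ℝ (EuclideanSpace ℝ (Fin d))
  have h1 : ContDiff ℝ ∞ (Ψ ∘ L) := hΨ.comp L.contDiff
  have h2 : HasCompactSupport (Ψ ∘ L) := hc.comp_homeomorph L.toHomeomorph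
  obtain ⟨C, hC, h⟩ := mulBound_of_schwartz (d := d) (h2.toSchwartzMap h1)
  refine ⟨C, hC, fun z N => ?_⟩
  convert! h (L.symm (z, 0)) (fun i => L.symm (0, N⁻¹ • EuclideanSpace.single i 1)) using 2 with m
  change _ = Ψ (L _)
  congr 1
  simp only [map_add, map_sum, map_smul, ContinuousLinearEquiv.apply_symm_apply]
  ext i
  · simp [Prod.fst_sum]
  · simp only [Prod.snd_add, Prod.snd_sum, Prod.smul_snd, zero_add, PiLp.smul_apply, freq,
      WithLp.ofLp_sum, Finset.sum_apply, smul_eq_mul]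
    simp [mul_comm]

end FracNS

end



noncomputable section

namespace FracNS

variable {d : ℕ}

theorem MulLE.mono {p q : ℝ≥0∞} {c : Seq d} {C C' : ℝ} (h : MulLE p q c C) (hC : C ≤ C') :
    MulLE p q c C' := fun f hf => (h f hf).trans (by gcongr)

theorem MulBound.mono {c : Seq d} {C C' : ℝ} (h : MulBound c C) (hC : C ≤ C') :
    MulBound c C' := fun q hq => (h q hq).mono hC

theorem MulLE.const_mul {p q : ℝ≥0∞} {c : Seq d} {C : ℝ} (h : MulLE p q c C) (a : ℂ) :
    MulLE p q (fun m => a * c m) (‖a‖ * C) := fun f hf => by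
  have e : (fun m => a * c m * f m) = a • fun m => c m * f m := by
    ext m; simp [mul_assoc]
  rw [e, ENNReal.ofReal_mul (norm_nonneg a), ofReal_norm, mul_assoc]
  exact (seqLp_smul _ _ _).trans (by gcongr; exact h f hf)

theorem MulBound.const_mul {c : Seq d} {C : ℝ} (h : MulBound c C) (a : ℂ) :
    MulBound (fun m => a * c m) (‖a‖ * C) := fun q hq => (h q hq).const_mul a

theorem MulLE.comp {p q r : ℝ≥0∞} {c c' : Seq d} {C C' : ℝ} (h' : MulLE q r c' C')
    (h : MulLE p q c C) (hC' : 0 ≤ C') : MulLE p r (fun m => c' m * c m) (C' * C) := fun f hf => by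
  have h1 : seqLp q (fun m => c m * f m) ≠ ⊤ :=
    ne_top_of_le_ne_top (ENNReal.mul_ne_top ENNReal.ofReal_ne_top hf) (h f hf)
  have h2 := h' _ h1
  simp only [mul_assoc] at h2 ⊢
  refine h2.trans ?_
  rw [ENNReal.ofReal_mul hC', mul_assoc]
  gcongr
  exact h f hf

theorem MulBound.comp {c c' : Seq d} {C C' : ℝ} (h' : MulBound c' C') (h : MulBound c C)
    (hC' : 0 ≤ C') : MulBound (fun m => c' m * c m) (C' * C) :=
  fun q hq => (h' q hq).comp (h q hq) hC'

theorem MulLE.add {p q : ℝ≥0∞} (hq : 1 ≤ q) {c c' : Seq d} {C C' : ℝ} (h : MulLE p q c C)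
    (h' : MulLE p q c' C') (hC : 0 ≤ C) (hC' : 0 ≤ C') :
    MulLE p q (fun m => c m + c' m) (C + C') := fun f hf => by
  have e : (fun m => (c m + c' m) * f m) = (fun m => c m * f m) + fun m => c' m * f m := by
    ext m; simp [add_mul]
  rw [e, ENNReal.ofReal_add hC hC', add_mul]
  exact (seqLp_add hq _ _).trans (add_le_add (h f hf) (h' f hf))

theorem MulBound.add {c c' : Seq d} {C C' : ℝ} (h : MulBound c C) (h' : MulBound c' C')
    (hC : 0 ≤ C) (hC' : 0 ≤ C') : MulBound (fun m => c m + c' m) (C + C') :=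
  fun q hq => (h q hq).add hq (h' q hq) hC hC'

theorem MulLE.tsum {p q : ℝ≥0∞} (hq : 1 ≤ q) {c : ℕ → Seq d} {c' : Seq d} {C : ℕ → ℝ}
    (h : ∀ a, MulLE p q (c a) (C a)) (hC : ∀ a, 0 ≤ C a) (hs : Summable C)
    (hc : ∀ m, HasSum (fun a => c a m) (c' m)) : MulLE p q c' (∑' a, C a) := fun f hf => by
  refine (seqLp_tsum hq (c := fun a m => c a m * f m) fun m => (hc m).mul_right (f m)).trans ?_
  rw [ENNReal.ofReal_tsum_of_nonneg hC hs, ← ENNReal.tsum_mul_right]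
  exact ENNReal.tsum_le_tsum fun a => h a f hf

theorem MulBound.tsum {c : ℕ → Seq d} {c' : Seq d} {C : ℕ → ℝ}
    (h : ∀ a, MulBound (c a) (C a)) (hC : ∀ a, 0 ≤ C a) (hs : Summable C)
    (hc : ∀ m, HasSum (fun a => c a m) (c' m)) : MulBound c' (∑' a, C a) := fun q hq =>
  MulLE.tsum hq (fun a => h a q hq) hC hs hc

theorem mulBound_translate (y : Torus d) : MulBound (fun m => UnitAddTorus.mFourier m y) 1 :=
  fun q _ f hf => by rw [seqLp_translate q y hf]; simp

theorem mulBound_one : MulBound (fun _ : Fin d → ℤ => (1 : ℂ)) 1 := fun q _ f _ => by simp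

theorem mulBound_zero : MulBound (0 : Seq d) 0 := fun q _ f _ => by
  have : (fun m => (0 : Seq d) m * f m) = 0 := by ext; simp
  rw [this, seqLp_zero]; simp

theorem seqLp_single {q : ℝ≥0∞} (hq : 1 ≤ q) (k : Fin d → ℤ) (a : ℂ) :
    seqLp q (Pi.single k a) = ‖a‖ₑ := by
  refine le_antisymm ?_ ?_
  · refine (seqLp_le_tsum q _).trans_eq ?_
    rw [tsum_eq_single k]
    · simp
    · intro m hm; simp [hm]
  · simpa using enorm_le_seqLp hq (Pi.single k a) k

theorem MulBound.norm_le {c : Seq d} {C : ℝ} (h : MulBound c C) (hC : 0 ≤ C) (m : Fin d → ℤ) :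
    ‖c m‖ ≤ C := by
  have h1 := h 1 le_rfl (Pi.single m 1) (by rw [seqLp_single le_rfl]; simp)
  have e : (fun k => c k * (Pi.single m 1 : Seq d) k) = Pi.single m (c m) := by
    ext k
    by_cases hk : k = m
    · subst hk; simp
    · simp [hk]
  rw [e, seqLp_single le_rfl, seqLp_single le_rfl, enorm_one, mul_one, ← ofReal_norm] at h1
  exact (ENNReal.ofReal_le_ofReal_iff hC).1 h1

/-! ### Multipliers localized to annuli -/

/-- A smooth bump function on a compact set not containing the origin. -/
structure IsAnnularBump (ψ : EuclideanSpace ℝ (Fin d) → ℝ) : Prop where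
  smooth : ContDiff ℝ ∞ ψ
  compact : HasCompactSupport ψ
  zero : ∃ r > 0, ∀ x, ‖x‖ < r → ψ x = 0

theorem IsAnnularBump.mulBound {ψ : EuclideanSpace ℝ (Fin d) → ℝ} (hψ : IsAnnularBump ψ)
    {B : ℝ × EuclideanSpace ℝ (Fin d) → ℂ} (hB : ∀ z ξ, ξ ≠ 0 → ContDiffAt ℝ ∞ B (z, ξ)) :
    ∃ C : ℝ, 0 ≤ C ∧ ∀ z N : ℝ, |z| ≤ 1 →
      MulBound (fun m => ψ (N⁻¹ • freq m) * B (z, N⁻¹ • freq m)) C := by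
  let η : ContDiffBump (0 : ℝ) := ⟨1, 2, one_pos, one_lt_two⟩
  obtain ⟨C, hC, h⟩ := mulBound_family (d := d)
    (Ψ := fun p => ((η p.1 * ψ p.2 : ℝ) : ℂ) * B p) (by
      rw [contDiff_iff_contDiffAt]
      rintro ⟨z, ξ⟩
      by_cases hξ : ξ = 0
      · obtain ⟨r, hr, h0⟩ := hψ.zero
        have : (fun p : ℝ × EuclideanSpace ℝ (Fin d) => ((η p.1 * ψ p.2 : ℝ) : ℂ) * B p)
            =ᶠ[𝓝 (z, ξ)] fun _ => 0 := by
          have hmem : {p : ℝ × EuclideanSpace ℝ (Fin d) | ‖p.2‖ < r} ∈ 𝓝 (z, ξ) := by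
            refine (isOpen_lt (continuous_snd.norm) continuous_const).mem_nhds ?_
            simpa [hξ] using hr
          filter_upwards [hmem] with p hp
          rw [h0 _ hp]; simp
        exact contDiffAt_const.congr_of_eventuallyEq this
      · refine ContDiffAt.mul ?_ (hB z ξ hξ)
        have h1 : ContDiff ℝ ∞ fun p : ℝ × EuclideanSpace ℝ (Fin d) => η p.1 * ψ p.2 :=
          (η.contDiff.comp contDiff_fst).mul (hψ.smooth.comp contDiff_snd)
        exact (Complex.ofRealCLM.contDiff.comp h1).contDiffAt) (by
      refine HasCompactSupport.intro (η.hasCompactSupport.isCompact.prod hψ.compact.isCompact) ?_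
      rintro ⟨z, ξ⟩ h
      rw [mem_prod, not_and_or] at h
      rcases h with h | h
      · simp [image_eq_zero_of_notMem_tsupport h]
      · simp [image_eq_zero_of_notMem_tsupport h])
  refine ⟨C, hC, fun z N hz => ?_⟩
  convert! h z N using 2 with m
  have : η z = 1 := η.one_of_mem_closedBall (by simpa [η] using hz)
  simp [this]

theorem mulBound_cutoff {χ : EuclideanSpace ℝ (Fin d) → ℝ} (h : ContDiff ℝ ∞ χ)
    (hc : HasCompactSupport χ) :
    ∃ C : ℝ, 0 ≤ C ∧ ∀ N : ℝ, MulBound (fun m => (χ (N⁻¹ • freq m) : ℂ)) C := by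
  let η : ContDiffBump (0 : ℝ) := ⟨1, 2, one_pos, one_lt_two⟩
  obtain ⟨C, hC, h⟩ := mulBound_family (d := d)
    (Ψ := fun p => ((η p.1 * χ p.2 : ℝ) : ℂ)) (by
      have h1 : ContDiff ℝ ∞ fun p : ℝ × EuclideanSpace ℝ (Fin d) => η p.1 * χ p.2 :=
          (η.contDiff.comp contDiff_fst).mul (h.comp contDiff_snd)
      exact Complex.ofRealCLM.contDiff.comp h1) (by
      refine HasCompactSupport.intro (η.hasCompactSupport.isCompact.prod hc.isCompact) ?_
      rintro ⟨z, ξ⟩ h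
      rw [mem_prod, not_and_or] at h
      rcases h with h | h
      · simp [image_eq_zero_of_notMem_tsupport h]
      · simp [image_eq_zero_of_notMem_tsupport h])
  refine ⟨C, hC, fun N => ?_⟩
  convert! h 0 N using 2 with m
  have : η 0 = 1 := η.one_of_mem_closedBall (by simp [η])
  simp [this]

/-- The symbol of `(-Δ)^α`. -/
def lapSymbol (α : ℝ) (ξ : EuclideanSpace ℝ (Fin d)) : ℝ := (2 * Real.pi * ‖ξ‖) ^ (2 * α)

theorem lapSymbol_pos (α : ℝ) {ξ : EuclideanSpace ℝ (Fin d)} (h : ξ ≠ 0) : 0 < lapSymbol α ξ := by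
  have := norm_pos_iff.2 h
  have := Real.pi_pos
  unfold lapSymbol
  positivity

theorem lapSymbol_nonneg (α : ℝ) (ξ : EuclideanSpace ℝ (Fin d)) : 0 ≤ lapSymbol α ξ := by
  have := Real.pi_pos
  unfold lapSymbol
  positivity

theorem contDiffAt_lapSymbol (α : ℝ) {ξ : EuclideanSpace ℝ (Fin d)} (h : ξ ≠ 0) :
    ContDiffAt ℝ ∞ (lapSymbol α) ξ := by
  refine ContDiffAt.rpow_const_of_ne (contDiffAt_const.mul (contDiffAt_norm ℝ h)) ?_
  have := norm_pos_iff.2 h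
  have := Real.pi_pos
  positivity

theorem lapSymbol_smul (α : ℝ) {N : ℝ} (hN : 0 ≤ N) (ξ : EuclideanSpace ℝ (Fin d)) :
    lapSymbol α (N • ξ) = N ^ (2 * α) * lapSymbol α ξ := by
  have := Real.pi_pos
  unfold lapSymbol
  rw [norm_smul, Real.norm_of_nonneg hN, mul_left_comm, Real.mul_rpow hN (by positivity)]

theorem contDiff_dslope_exp : ContDiff ℝ ∞ (dslope Complex.exp 0) := by
  have h : Differentiable ℂ (dslope Complex.exp 0) := by
    rw [← differentiableOn_univ]
    exact (Complex.differentiableOn_dslope univ_mem).2 Complex.differentiable_exp.differentiableOn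
  exact (h.contDiff (n := ∞)).restrict_scalars ℝ

theorem mul_dslope_exp (w : ℂ) : w * dslope Complex.exp 0 w = Complex.exp w - 1 := by
  simpa using sub_smul_dslope Complex.exp 0 w

variable {ψ : EuclideanSpace ℝ (Fin d) → ℝ} {A : EuclideanSpace ℝ (Fin d) → ℂ} (α : ℝ)

theorem IsAnnularBump.mulBound_heat (hψ : IsAnnularBump ψ)
    (hA : ∀ ξ, ξ ≠ 0 → ContDiffAt ℝ ∞ A ξ) (K : ℕ) :
    ∃ C : ℝ, 0 ≤ C ∧ ∀ τ N : ℝ, 0 ≤ τ → MulBound (fun m => ψ (N⁻¹ • freq m) *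
      (A (N⁻¹ • freq m) * Real.exp (-τ * lapSymbol α (N⁻¹ • freq m)))) (C * (1 + τ ^ K)⁻¹) := by
  have hlap : ∀ z ξ, ξ ≠ 0 → ContDiffAt ℝ ∞
      (fun p : ℝ × EuclideanSpace ℝ (Fin d) => lapSymbol α p.2) (z, ξ) := fun z ξ h =>
    ContDiffAt.comp (z, ξ) (f := Prod.snd) (g := lapSymbol α)
      (contDiffAt_lapSymbol α h) contDiffAt_snd
  have hA' : ∀ z ξ, ξ ≠ 0 → ContDiffAt ℝ ∞
      (fun p : ℝ × EuclideanSpace ℝ (Fin d) => A p.2) (z, ξ) := fun z ξ h =>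
    ContDiffAt.comp (z, ξ) (f := Prod.snd) (g := A) (hA ξ h) contDiffAt_snd
  obtain ⟨C₁, hC₁, h₁⟩ := hψ.mulBound
    (B := fun p => A p.2 * (Real.exp (-p.1 * lapSymbol α p.2) : ℂ)) fun z ξ h =>
    (hA' z ξ h).mul (Complex.ofRealCLM.contDiff.contDiffAt.comp _
      ((contDiffAt_fst.neg.mul (hlap z ξ h)).exp))
  obtain ⟨C₂, hC₂, h₂⟩ := hψ.mulBound
    (B := fun p => A p.2 * (((lapSymbol α p.2)⁻¹ ^ K *
      ((Polynomial.X ^ K : Polynomial ℝ).eval (p.1 * (lapSymbol α p.2)⁻¹)⁻¹ *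
        expNegInvGlue (p.1 * (lapSymbol α p.2)⁻¹)) : ℝ) : ℂ)) fun z ξ h => by
    have hinv : ContDiffAt ℝ ∞ (fun p : ℝ × EuclideanSpace ℝ (Fin d) => (lapSymbol α p.2)⁻¹) (z, ξ) :=
      (hlap z ξ h).inv (lapSymbol_pos α h).ne'
    refine (hA' z ξ h).mul (Complex.ofRealCLM.contDiff.contDiffAt.comp _ ((hinv.pow K).mul ?_))
    exact ((expNegInvGlue.contDiff_polynomial_eval_inv_mul (n := ⊤)
      (Polynomial.X ^ K)).contDiffAt).comp (z, ξ) (contDiffAt_fst.mul hinv)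
  refine ⟨2 * (C₁ + C₂), by positivity, fun τ N hτ => ?_⟩
  rcases le_or_gt τ 1 with h1 | h1
  · refine (h₁ τ N (by rwa [abs_of_nonneg hτ])).mono ?_
    have h2 : (2 : ℝ)⁻¹ ≤ (1 + τ ^ K)⁻¹ := by
      gcongr
      linarith [pow_le_one₀ hτ h1 (n := K)]
    nlinarith
  · have h2 := (h₂ τ⁻¹ N (by
      rw [abs_of_nonneg (by positivity)]; exact (inv_le_one₀ (by linarith)).2 h1.le)).const_mul
      (((τ ^ K)⁻¹ : ℝ) : ℂ)
    have h3 : (2 * τ ^ K)⁻¹ ≤ (1 + τ ^ K)⁻¹ := by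
      gcongr
      linarith [one_le_pow₀ h1.le (n := K)]
    rw [mul_inv] at h3
    rw [Complex.norm_real, Real.norm_of_nonneg (by positivity), mul_comm] at h2
    refine MulBound.mono ?_ (C := C₂ * (τ ^ K)⁻¹) (by
      nlinarith [inv_nonneg.2 (by positivity : 0 ≤ τ ^ K)])
    convert! h2 using 2 with m
    by_cases hm : N⁻¹ • freq m = 0
    · obtain ⟨r, hr, h0⟩ := hψ.zero
      rw [hm, h0 0 (by simpa using hr)]; simp
    · have hl := lapSymbol_pos α hm
      set ρ := lapSymbol α (N⁻¹ • freq m)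
      have hτ0 : 0 < τ := by linarith
      have e : Real.exp (-τ * ρ) = (τ ^ K)⁻¹ * (ρ⁻¹ ^ K *
          ((Polynomial.X ^ K : Polynomial ℝ).eval (τ⁻¹ * ρ⁻¹)⁻¹ * expNegInvGlue (τ⁻¹ * ρ⁻¹))) := by
        rw [Polynomial.eval_pow, Polynomial.eval_X, expNegInvGlue,
          if_neg (by have : 0 < τ⁻¹ * ρ⁻¹ := by positivity
                     linarith)]
        rw [← mul_inv, inv_inv, mul_pow, inv_pow, neg_mul]
        field_simp
      rw [e]
      push_cast
      ring

end FracNS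

end



noncomputable section

namespace FracNS

variable {d : ℕ} (α : ℝ)

theorem IsAnnularBump.mulBound_bump {ψ : EuclideanSpace ℝ (Fin d) → ℝ} (hψ : IsAnnularBump ψ) :
    ∃ C : ℝ, 0 ≤ C ∧ ∀ N : ℝ, MulBound (fun m => (ψ (N⁻¹ • freq m) : ℂ)) C :=
  mulBound_cutoff hψ.smooth hψ.compact

theorem IsAnnularBump.mulBound_heat_sub_one {ψ : EuclideanSpace ℝ (Fin d) → ℝ}
    (hψ : IsAnnularBump ψ) :
    ∃ C : ℝ, 0 ≤ C ∧ ∀ τ N : ℝ, 0 ≤ τ → τ ≤ 1 → MulBound (fun m => ψ (N⁻¹ • freq m) *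
      ((Real.exp (-τ * lapSymbol α (N⁻¹ • freq m)) : ℂ) - 1)) (C * τ) := by
  have hlap : ∀ z ξ, ξ ≠ 0 → ContDiffAt ℝ ∞
      (fun p : ℝ × EuclideanSpace ℝ (Fin d) => lapSymbol α p.2) (z, ξ) := fun z ξ h =>
    ContDiffAt.comp (z, ξ) (f := Prod.snd) (g := lapSymbol α)
      (contDiffAt_lapSymbol α h) contDiffAt_snd
  obtain ⟨C, hC, h⟩ := hψ.mulBound (B := fun p => ((-lapSymbol α p.2 : ℝ) : ℂ) *
      dslope Complex.exp 0 ((-p.1 * lapSymbol α p.2 : ℝ) : ℂ)) fun z ξ h =>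
    (Complex.ofRealCLM.contDiff.contDiffAt.comp _ (hlap z ξ h).neg).mul
      (contDiff_dslope_exp.contDiffAt.comp _ (Complex.ofRealCLM.contDiff.contDiffAt.comp _
      (contDiffAt_fst.neg.mul (hlap z ξ h))))
  refine ⟨C, hC, fun τ N h0 h1 => ?_⟩
  have := (h τ N (by rwa [abs_of_nonneg h0])).const_mul (τ : ℂ)
  rw [Complex.norm_real, Real.norm_of_nonneg h0, mul_comm] at this
  convert! this using 2 with m
  rw [Complex.ofReal_exp, ← mul_dslope_exp]
  push_cast
  ring

theorem IsAnnularBump.mulBound_exp_sub_one {ψ : EuclideanSpace ℝ (Fin d) → ℝ}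
    (hψ : IsAnnularBump ψ) (j : Fin d) :
    ∃ C : ℝ, 0 ≤ C ∧ ∀ z N : ℝ, |z| ≤ 1 → MulBound (fun m => ψ (N⁻¹ • freq m) *
      (Complex.exp (2 * Real.pi * Complex.I * ((z * (N⁻¹ * m j) : ℝ) : ℂ)) - 1)) (C * |z|) := by
  have hp : ContDiff ℝ ∞ fun p : ℝ × EuclideanSpace ℝ (Fin d) =>
      ((p.2 j : ℝ) : ℂ) :=
    Complex.ofRealCLM.contDiff.comp
      ((EuclideanSpace.proj j : EuclideanSpace ℝ (Fin d) →L[ℝ] ℝ).contDiff.comp contDiff_snd)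
  have hz : ContDiff ℝ ∞ fun p : ℝ × EuclideanSpace ℝ (Fin d) => ((p.1 : ℝ) : ℂ) :=
    Complex.ofRealCLM.contDiff.comp contDiff_fst
  obtain ⟨C, hC, h⟩ := hψ.mulBound (B := fun p => (2 * Real.pi * Complex.I * (p.2 j : ℝ)) *
      dslope Complex.exp 0 (2 * Real.pi * Complex.I * ((p.1 : ℝ) * (p.2 j : ℝ)))) fun z ξ h =>
    ContDiff.contDiffAt ((contDiff_const.mul hp).mul
      (contDiff_dslope_exp.comp (contDiff_const.mul (hz.mul hp))))
  refine ⟨C, hC, fun z N h1 => ?_⟩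
  have := (h z N h1).const_mul (z : ℂ)
  rw [Complex.norm_real, Real.norm_eq_abs, mul_comm |z| C] at this
  convert! this using 2 with m
  have e : (2 * Real.pi * Complex.I * ((z * (N⁻¹ * m j) : ℝ) : ℂ)) =
      2 * Real.pi * Complex.I * ((z : ℂ) * (((N⁻¹ • freq m) j : ℝ) : ℂ)) := by
    simp [freq]
  rw [e, ← mul_dslope_exp]
  ring

/-! ### Bernstein's inequality -/

theorem abs_le_norm_freq (m : Fin d → ℤ) (i : Fin d) : |(m i : ℝ)| ≤ ‖freq m‖ := by
  have := PiLp.norm_apply_le (freq m) i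
  simpa [freq] using this

theorem MulBound.mulLE_one_top {c : Seq d} {C R : ℝ} (h : MulBound c C) (hC : 0 ≤ C) (hR : 1 ≤ R)
    (hc : ∀ m, c m ≠ 0 → ‖freq m‖ ≤ R) : MulLE 1 ⊤ c (C * (3 * R) ^ d) := fun f hf => by
  let s : Finset (Fin d → ℤ) := Fintype.piFinset fun _ => Finset.Icc (-⌊R⌋) ⌊R⌋
  have hfl : 0 ≤ ⌊R⌋ := Int.floor_nonneg.2 (by linarith)
  have hcard : (s.card : ℝ) ≤ (3 * R) ^ d := by
    simp only [s, Fintype.card_piFinset, Finset.prod_const, Finset.card_univ, Fintype.card_fin,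
      Int.card_Icc]
    push_cast
    gcongr
    have : ((⌊R⌋ + 1 - -⌊R⌋).toNat : ℝ) = 2 * ⌊R⌋ + 1 := by
      have h : ((⌊R⌋ + 1 - -⌊R⌋).toNat : ℤ) = 2 * ⌊R⌋ + 1 := by omega
      exact_mod_cast h
    rw [this]
    have := Int.floor_le R
    linarith
  have hs : ∀ m ∉ s, c m = 0 := fun m hm => by
    by_contra h0
    refine hm ?_
    simp only [s, Fintype.mem_piFinset, Finset.mem_Icc]
    intro i
    have h1 := (abs_le_norm_freq m i).trans (hc m h0)
    rw [abs_le] at h1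
    refine ⟨?_, Int.le_floor.2 h1.2⟩
    rw [neg_le]
    exact Int.le_floor.2 (by push_cast; linarith)
  refine (seqLp_le_tsum _ _).trans ?_
  rw [tsum_eq_sum (s := s) fun m hm => by simp [hs m hm]]
  calc ∑ m ∈ s, ‖c m * f m‖ₑ ≤ ∑ m ∈ s, ENNReal.ofReal C * seqLp 1 f := by
        refine Finset.sum_le_sum fun m _ => ?_
        rw [enorm_mul, ← ofReal_norm (c m)]
        gcongr
        · exact h.norm_le hC m
        · exact enorm_le_seqLp le_rfl f m
    _ = (s.card : ℝ≥0∞) * (ENNReal.ofReal C * seqLp 1 f) := by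
        rw [Finset.sum_const, nsmul_eq_mul]
    _ ≤ ENNReal.ofReal ((3 * R) ^ d) * (ENNReal.ofReal C * seqLp 1 f) := by
        gcongr
        rw [← ENNReal.ofReal_natCast]
        exact ENNReal.ofReal_le_ofReal hcard
    _ = _ := by
        rw [ENNReal.ofReal_mul hC]; ring

theorem MulLE.top_of_one {p : ℝ≥0∞} (hp : 1 ≤ p) (hpt : p ≠ ⊤) {c : Seq d} {C D : ℝ} (hC : 0 ≤ C)
    (hD : 1 ≤ D) (h : MulLE ⊤ ⊤ c C) (h1 : MulLE 1 ⊤ c (C * D)) :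
    MulLE p ⊤ c (2 * C * D ^ (p⁻¹).toReal) := fun f hf => by
  obtain ⟨g, hg⟩ := exists_isFourier hf
  have hp0 : p ≠ 0 := (zero_lt_one.trans_le hp).ne'
  have hpr : 1 ≤ p.toReal := by
    rw [← ENNReal.toReal_one]; exact ENNReal.toReal_mono hpt hp
  set P := p.toReal with hP
  have hP0 : 0 < P := by linarith
  have hpinv : (p⁻¹).toReal = P⁻¹ := ENNReal.toReal_inv p
  rw [hpinv]
  set M := seqLp p f with hM
  by_cases hM0 : M = 0
  · have : f = 0 := by
      ext m
      have := enorm_le_seqLp hp f m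
      rw [← hM, hM0] at this
      simpa using this
    have e : (fun m => c m * f m) = 0 := by ext m; simp [this]
    rw [e, seqLp_zero]
    exact zero_le
  set lam : ℝ≥0∞ := ENNReal.ofReal (D ^ P⁻¹) * M with hlam
  have hDp : 0 < D ^ P⁻¹ := by positivity
  have hlam0 : lam ≠ 0 := mul_ne_zero (by simpa using hDp) hM0
  have hlamt : lam ≠ ⊤ := ENNReal.mul_ne_top ENNReal.ofReal_ne_top hf
  obtain ⟨g', hg'm, hge⟩ := hg.1.1
  have hg' : IsFourier g' f := ⟨hg.1.congr hge, fun m => by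
    rw [← hg.2]; exact (mFourierCoeff_congr_ae hge m).symm⟩
  set E : Set (Torus d) := {x | ‖g' x‖ₑ ≤ lam} with hE
  have hEm : MeasurableSet E := measurableSet_le hg'm.measurable.enorm measurable_const
  have hF1 : IsFourier (E.indicator g') (UnitAddTorus.mFourierCoeff (E.indicator g')) :=
    ⟨hg'.1.indicator hEm, fun _ => rfl⟩
  have hF2 : IsFourier (Eᶜ.indicator g') (UnitAddTorus.mFourierCoeff (Eᶜ.indicator g')) :=
    ⟨hg'.1.indicator hEm.compl, fun _ => rfl⟩
  set f1 : Seq d := UnitAddTorus.mFourierCoeff (E.indicator g')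
  set f2 : Seq d := UnitAddTorus.mFourierCoeff (Eᶜ.indicator g')
  have hsum : f = f1 + f2 := by
    ext m
    have := (hF1.add hF2).2 m
    rw [Set.indicator_self_add_compl, hg'.2] at this
    exact this
  have hf1 : seqLp ⊤ f1 ≤ lam := by
    rw [hF1.seqLp_eq]
    refine eLpNormEssSup_le_of_ae_enorm_bound (.of_forall fun x => ?_)
    by_cases hx : x ∈ E
    · rw [indicator_of_mem hx]; exact hx
    · rw [indicator_of_notMem hx]; simp
  have hf2 : seqLp 1 f2 ≤ ENNReal.ofReal (D ^ (P⁻¹ - 1)) * M := by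
    rw [hF2.seqLp_eq, eLpNorm_one_eq_lintegral_enorm]
    have hMp : ∫⁻ x, ‖g' x‖ₑ ^ P ∂(torusMeasure d) = M ^ P := by
      rw [hM, hg'.seqLp_eq, eLpNorm_eq_lintegral_rpow_enorm_toReal hp0 hpt, ← ENNReal.rpow_mul,
        one_div_mul_cancel hP0.ne', ENNReal.rpow_one]
    calc ∫⁻ x, ‖Eᶜ.indicator g' x‖ₑ ∂(torusMeasure d)
        ≤ ∫⁻ x, ‖g' x‖ₑ ^ P * lam ^ (1 - P) ∂(torusMeasure d) := by
          refine lintegral_mono fun x => ?_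
          by_cases hx : x ∈ E
          · rw [indicator_of_notMem (by simpa using hx)]; simp
          · rw [indicator_of_mem (by simpa using hx)]
            have hx' : lam < ‖g' x‖ₑ := by simpa [hE] using hx
            have hx0 : ‖g' x‖ₑ ≠ 0 := (hlam0.bot_lt.trans hx').ne'
            calc ‖g' x‖ₑ = ‖g' x‖ₑ ^ P * ‖g' x‖ₑ ^ (1 - P) := by
                  rw [← ENNReal.rpow_add _ _ hx0 enorm_ne_top]; simp
              _ ≤ _ := by
                  refine mul_le_mul' le_rfl ?_
                  have := ENNReal.rpow_le_rpow hx'.le (by linarith : 0 ≤ P - 1)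
                  rw [← neg_sub P 1, ENNReal.rpow_neg, ENNReal.rpow_neg]
                  exact ENNReal.inv_le_inv.2 this
      _ = M ^ P * lam ^ (1 - P) := by
          rw [lintegral_mul_const' _ _ (by simp [ENNReal.rpow_eq_top_iff, hlam0, hlamt]), hMp]
      _ = _ := by
          rw [hlam, ENNReal.mul_rpow_of_ne_top ENNReal.ofReal_ne_top hf,
            ENNReal.ofReal_rpow_of_pos hDp, ← Real.rpow_mul (by linarith), mul_left_comm,
            ← ENNReal.rpow_add _ _ hM0 hf]
          congr 2
          · congr 1
            field_simp
          · simp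
  have e : (fun m => c m * f m) = (fun m => c m * f1 m) + fun m => c m * f2 m := by
    ext m; rw [hsum]; simp [mul_add]
  rw [e]
  calc _ ≤ ENNReal.ofReal C * lam + ENNReal.ofReal (C * D) * (ENNReal.ofReal (D ^ (P⁻¹ - 1)) * M) := by
        refine (seqLp_add (by simp) _ _).trans (add_le_add ?_ ?_)
        · exact (h f1 (ne_top_of_le_ne_top hlamt hf1)).trans (by gcongr)
        · exact (h1 f2 (ne_top_of_le_ne_top (ENNReal.mul_ne_top ENNReal.ofReal_ne_top hf) hf2)).trans
            (by gcongr)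
    _ = _ := by
        rw [hlam, ← mul_assoc, ← mul_assoc, ← ENNReal.ofReal_mul hC, ← ENNReal.ofReal_mul (by positivity),
          ← add_mul, ← ENNReal.ofReal_add (by positivity) (by positivity)]
        congr 2
        have : D * D ^ (P⁻¹ - 1) = D ^ P⁻¹ := by
          rw [Real.rpow_sub (by linarith), Real.rpow_one]; field_simp
        rw [mul_assoc C D, this]; ring

theorem MulBound.bernstein {c : Seq d} {C R : ℝ} (h : MulBound c C) (hC : 0 ≤ C) (hR : 1 ≤ R)
    (hc : ∀ m, c m ≠ 0 → ‖freq m‖ ≤ R) {p q : ℝ≥0∞} (hp : 1 ≤ p) (hpq : p ≤ q) :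
    MulLE p q c (2 * C * (3 * R) ^ (d * ((p⁻¹).toReal - (q⁻¹).toReal))) := by
  rcases eq_or_ne p q with rfl | hne
  · simp only [sub_self, mul_zero, Real.rpow_zero, mul_one]
    exact (h p hp).mono (by linarith)
  have hpt : p ≠ ⊤ := fun h => hne (le_antisymm hpq (h ▸ le_top))
  have hp0 : p ≠ 0 := (zero_lt_one.trans_le hp).ne'
  have hq0 : q ≠ 0 := (zero_lt_one.trans_le (hp.trans hpq)).ne'
  have hD : 1 ≤ (3 * R) ^ d := one_le_pow₀ (by linarith)
  have htop := MulLE.top_of_one hp hpt hC hD (h ⊤ (by simp)) (h.mulLE_one_top hC hR hc)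
  intro f hf
  have hcf := h p hp f hf
  have hcf' := htop f hf
  have hfin : seqLp p (fun m => c m * f m) ≠ ⊤ :=
    ne_top_of_le_ne_top (ENNReal.mul_ne_top ENNReal.ofReal_ne_top hf) hcf
  have hpi0 : p⁻¹ ≠ 0 := ENNReal.inv_ne_zero.2 hpt
  have hpit : p⁻¹ ≠ ⊤ := ENNReal.inv_ne_top.2 hp0
  have hqit : q⁻¹ ≠ ⊤ := ENNReal.inv_ne_top.2 hq0
  have hpr : 0 < (p⁻¹).toReal := ENNReal.toReal_pos hpi0 hpit
  have hle : (q⁻¹).toReal ≤ (p⁻¹).toReal := ENNReal.toReal_mono hpit (ENNReal.inv_le_inv.2 hpq)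
  set l : ℝ := 1 - (q⁻¹).toReal / (p⁻¹).toReal with hl
  have hl0 : 0 ≤ l := by
    rw [hl, sub_nonneg]; exact (div_le_one hpr).2 hle
  have hl1 : l ≤ 1 := by
    rw [hl]; linarith [div_nonneg (ENNReal.toReal_nonneg (a := q⁻¹)) hpr.le]
  have key := seqLp_interpolation (κ := q) (r := ⊤) hfin hl0 hl1 (by
    rw [ENNReal.inv_top, zero_mul, add_zero, hl, sub_sub_cancel]
    have e : p⁻¹ * ENNReal.ofReal ((q⁻¹).toReal / (p⁻¹).toReal) =
        ENNReal.ofReal ((p⁻¹).toReal * ((q⁻¹).toReal / (p⁻¹).toReal)) := by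
      rw [ENNReal.ofReal_mul hpr.le, ENNReal.ofReal_toReal hpit]
    rw [e, mul_div_cancel₀ _ hpr.ne', ENNReal.ofReal_toReal hqit])
  refine key.trans ?_
  set D : ℝ := (3 * R) ^ d with hDdef
  have h1l : 0 ≤ 1 - l := by linarith
  calc _ ≤ (ENNReal.ofReal (2 * C) * seqLp p f) ^ (1 - l) *
        (ENNReal.ofReal (2 * C * D ^ (p⁻¹).toReal) * seqLp p f) ^ l := by
        gcongr
        exact hcf.trans (by gcongr; linarith)
    _ = _ := by
      rw [ENNReal.ofReal_mul (by positivity : 0 ≤ 2 * C) (q := D ^ (p⁻¹).toReal),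
        mul_assoc, mul_left_comm _ (ENNReal.ofReal (D ^ (p⁻¹).toReal)),
        ENNReal.mul_rpow_of_nonneg (ENNReal.ofReal (D ^ (p⁻¹).toReal)) _ hl0, mul_left_comm,
        ← ENNReal.rpow_add_of_nonneg _ _ h1l hl0, sub_add_cancel, ENNReal.rpow_one,
        ENNReal.ofReal_rpow_of_nonneg (by positivity) hl0, ← Real.rpow_mul (by positivity),
        ← mul_assoc, ← ENNReal.ofReal_mul (by positivity), mul_comm (D ^ _)]
      congr 3
      rw [hDdef, ← Real.rpow_natCast, ← Real.rpow_mul (by positivity)]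
      congr 1
      rw [hl]
      field_simp

/-! ### Dyadic sums -/

theorem sum_min_inv_le {r : ℝ} (hr : 1 < r) {y : ℝ} (hy : 0 < y) :
    Summable (fun a : ℕ => min (y * r ^ a) (y * r ^ a)⁻¹) ∧
      ∑' a : ℕ, min (y * r ^ a) (y * r ^ a)⁻¹ ≤ 2 * (1 + r) / (r - 1) := by
  have hr1 : 0 < r - 1 := by linarith
  let h : ℕ → ℝ := fun a => y * r ^ a / (1 + y * r ^ a)
  have hx : ∀ a : ℕ, 0 < y * r ^ a := fun a => by positivity
  have hstep : ∀ a, min (y * r ^ a) (y * r ^ a)⁻¹ ≤ 2 * (1 + r) / (r - 1) * (h (a + 1) - h a) := by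
    intro a
    set x := y * r ^ a with hxd
    have hx0 : 0 < x := hx a
    have e1 : h (a + 1) - h a = (r - 1) * x / ((1 + r * x) * (1 + x)) := by
      have e2 : h (a + 1) = r * x / (1 + r * x) := by
        simp only [h, hxd, pow_succ]; ring_nf
      have e3 : h a = x / (1 + x) := rfl
      rw [e2, e3]
      field_simp
      ring
    have e4 : 2 * (1 + r) / (r - 1) * (h (a + 1) - h a) =
        2 * (1 + r) * x / ((1 + r * x) * (1 + x)) := by
      rw [e1]; field_simp
    rw [e4, le_div_iff₀ (by positivity)]
    rcases le_total x 1 with h1 | h1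
    · refine (mul_le_mul_of_nonneg_right (min_le_left _ _) (by positivity)).trans ?_
      have : (1 + r * x) * (1 + x) ≤ (1 + r) * 2 := by gcongr <;> nlinarith
      nlinarith
    · refine (mul_le_mul_of_nonneg_right (min_le_right _ _) (by positivity)).trans ?_
      have : (1 + r * x) * (1 + x) ≤ ((1 + r) * x) * (2 * x) := by gcongr <;> nlinarith
      calc x⁻¹ * ((1 + r * x) * (1 + x)) ≤ x⁻¹ * (((1 + r) * x) * (2 * x)) := by gcongr
        _ = _ := by field_simp
  have hpart : ∀ n, ∑ a ∈ Finset.range n, min (y * r ^ a) (y * r ^ a)⁻¹ ≤ 2 * (1 + r) / (r - 1) := by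
    intro n
    refine (Finset.sum_le_sum fun a _ => hstep a).trans ?_
    rw [← Finset.mul_sum, Finset.sum_range_sub]
    refine mul_le_of_le_one_right (by positivity) ?_
    have h1 : h n ≤ 1 := (div_le_one (by have := hx n; positivity)).2 (by have := hx n; linarith)
    have h0 : 0 ≤ h 0 := by have := hx 0; positivity
    linarith
  have hnn : ∀ a, 0 ≤ min (y * r ^ a) (y * r ^ a)⁻¹ := fun a => by
    have := hx a
    positivity
  have hs := summable_of_sum_range_le hnn hpart
  exact ⟨hs, hs.tsum_le_of_sum_range_le hpart⟩

theorem exists_dyadic_sum_le {x z : ℝ} (hx : 0 < x) (hxz : x < z) :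
    ∃ C : ℝ, 0 ≤ C ∧ ∀ s : ℝ, 0 < s →
      Summable (fun a : ℕ => ((2 : ℝ) ^ a) ^ x * (1 + (s * 2 ^ a) ^ z)⁻¹) ∧
      ∑' a : ℕ, ((2 : ℝ) ^ a) ^ x * (1 + (s * 2 ^ a) ^ z)⁻¹ ≤ C * s ^ (-x) := by
  set δ := min x (z - x) with hδ
  have hδ0 : 0 < δ := lt_min hx (by linarith)
  have hr : 1 < (2 : ℝ) ^ δ := Real.one_lt_rpow one_lt_two hδ0
  refine ⟨2 * (1 + 2 ^ δ) / (2 ^ δ - 1), div_nonneg (by positivity) (by linarith), fun s hs => ?_⟩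
  obtain ⟨h1, h2⟩ := sum_min_inv_le hr (Real.rpow_pos_of_pos hs δ)
  have hle : ∀ a : ℕ, ((2 : ℝ) ^ a) ^ x * (1 + (s * 2 ^ a) ^ z)⁻¹ ≤
      s ^ (-x) * min (s ^ δ * ((2 : ℝ) ^ δ) ^ a) (s ^ δ * ((2 : ℝ) ^ δ) ^ a)⁻¹ := fun a => by
    have hY : 0 < s * 2 ^ a := by positivity
    have e : s ^ δ * ((2 : ℝ) ^ δ) ^ a = (s * 2 ^ a) ^ δ := by
      rw [Real.mul_rpow hs.le (by positivity), ← Real.rpow_natCast, ← Real.rpow_natCast,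
        ← Real.rpow_mul (by norm_num), ← Real.rpow_mul (by norm_num), mul_comm δ]
    have e2 : ((2 : ℝ) ^ a) ^ x = s ^ (-x) * (s * 2 ^ a) ^ x := by
      rw [Real.mul_rpow hs.le (by positivity), ← mul_assoc, ← Real.rpow_add hs]; simp
    rw [e, e2, mul_assoc]
    set Y := s * 2 ^ a
    gcongr
    rw [← Real.rpow_neg hY.le]
    have hYz : 0 < Y ^ z := by positivity
    rcases le_total Y 1 with h | h
    · have h3 : Y ^ x * (1 + Y ^ z)⁻¹ ≤ Y ^ δ := by
        calc _ ≤ Y ^ x * 1 := by gcongr; exact inv_le_one_of_one_le₀ (by linarith)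
          _ ≤ Y ^ δ := by
            rw [mul_one]; exact Real.rpow_le_rpow_of_exponent_ge hY h (min_le_left _ _)
      refine le_min h3 (h3.trans ?_)
      exact Real.rpow_le_rpow_of_exponent_ge hY h (by linarith)
    · have h3 : Y ^ x * (1 + Y ^ z)⁻¹ ≤ Y ^ (-δ) := by
        calc _ ≤ Y ^ x * (Y ^ z)⁻¹ := by gcongr; linarith
          _ = Y ^ (x - z) := by rw [← Real.rpow_neg hY.le, ← Real.rpow_add hY, sub_eq_add_neg]
          _ ≤ Y ^ (-δ) := Real.rpow_le_rpow_of_exponent_le h (by linarith [min_le_right x (z - x)])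
      refine le_min (h3.trans ?_) h3
      exact Real.rpow_le_rpow_of_exponent_le h (by linarith)
  have hs' := Summable.of_nonneg_of_le (fun a => by positivity) hle (h1.mul_left _)
  refine ⟨hs', (hs'.tsum_le_tsum hle (h1.mul_left _)).trans ?_⟩
  rw [tsum_mul_left, mul_comm]
  gcongr

end FracNS

end



noncomputable section

namespace FracNS

variable {d : ℕ} (α : ℝ)

/-! ### Dyadic blocks -/

theorem one_le_norm_freq {m : Fin d → ℤ} (hm : m ≠ 0) : 1 ≤ ‖freq m‖ := by
  obtain ⟨i, hi⟩ := Function.ne_iff.1 hm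
  refine le_trans ?_ (abs_le_norm_freq m i)
  exact_mod_cast Int.one_le_abs hi

theorem freq_zero : freq (0 : Fin d → ℤ) = 0 := by
  ext i; simp [freq]

theorem freq_ne_zero {m : Fin d → ℤ} (hm : m ≠ 0) : freq m ≠ 0 := by
  have := one_le_norm_freq hm
  intro h
  rw [h, norm_zero] at this
  linarith

theorem heatSymbol_eq (t : ℝ) (m : Fin d → ℤ) :
    heatSymbol α t m = Real.exp (-t * lapSymbol α (freq m)) := rfl

/-- The symbol of the block of frequencies `|m| ~ 2^a` given by an annular bump function. -/
def blockSymbol (ψ : EuclideanSpace ℝ (Fin d) → ℝ) : ℕ → (Fin d → ℤ) → ℝ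
  | 0, m => if m = 0 then 1 else 0
  | a + 1, m => ψ ((2 ^ (a + 1) : ℝ)⁻¹ • freq m)

/-- The profile of the Littlewood–Paley projections. -/
def Cutoff.annulus (χ : Cutoff d) (ξ : EuclideanSpace ℝ (Fin d)) : ℝ :=
  χ.toFun ξ - χ.toFun ((2 : ℝ) • ξ)

/-- A bump function equal to one on the support of the profile of the projections. -/
def Cutoff.fatAnnulus (χ : Cutoff d) (ξ : EuclideanSpace ℝ (Fin d)) : ℝ :=
  χ.toFun ((1 / 2 : ℝ) • ξ) - χ.toFun ((4 : ℝ) • ξ)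

namespace Cutoff

variable (χ : Cutoff d)

theorem eq_zero {ξ : EuclideanSpace ℝ (Fin d)} (h : 1 ≤ ‖ξ‖) : χ.toFun ξ = 0 := by
  by_contra h0
  have := χ.support_subset h0
  simp only [Metric.mem_ball, dist_zero_right] at this
  linarith

theorem eq_one' {ξ : EuclideanSpace ℝ (Fin d)} (h : ‖ξ‖ < 9 / 10) : χ.toFun ξ = 1 :=
  χ.eq_one ξ (by simpa using h)

theorem hasCompactSupport : HasCompactSupport χ.toFun :=
  HasCompactSupport.intro (isCompact_closedBall 0 1) fun x hx => χ.eq_zero (by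
    simp only [Metric.mem_closedBall, dist_zero_right, not_le] at hx
    exact hx.le)

theorem isAnnularBump_annulus : IsAnnularBump χ.annulus where
  smooth := χ.smooth.sub (χ.smooth.comp (contDiff_id.const_smul (2 : ℝ)))
  compact := HasCompactSupport.intro (isCompact_closedBall 0 1) fun x hx => by
    simp only [Metric.mem_closedBall, dist_zero_right, not_le] at hx
    rw [annulus, χ.eq_zero hx.le, χ.eq_zero (by rw [norm_smul]; norm_num; linarith), sub_zero]
  zero := ⟨9 / 20, by norm_num, fun x hx => by
    rw [annulus, χ.eq_one' (by linarith), χ.eq_one' (by rw [norm_smul]; norm_num; linarith),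
      sub_self]⟩

theorem isAnnularBump_fatAnnulus : IsAnnularBump χ.fatAnnulus where
  smooth := (χ.smooth.comp (contDiff_id.const_smul (1 / 2 : ℝ))).sub
    (χ.smooth.comp (contDiff_id.const_smul (4 : ℝ)))
  compact := HasCompactSupport.intro (isCompact_closedBall 0 2) fun x hx => by
    simp only [Metric.mem_closedBall, dist_zero_right, not_le] at hx
    rw [fatAnnulus, χ.eq_zero (by rw [norm_smul]; norm_num; linarith),
      χ.eq_zero (by rw [norm_smul]; norm_num; linarith), sub_zero]
  zero := ⟨9 / 40, by norm_num, fun x hx => by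
    rw [fatAnnulus, χ.eq_one' (by rw [norm_smul]; norm_num; linarith),
      χ.eq_one' (by rw [norm_smul]; norm_num; linarith), sub_self]⟩

theorem symbol_eq (a : ℕ) (m : Fin d → ℤ) : χ.symbol a m = blockSymbol χ.annulus a m := by
  cases a with
  | zero =>
    simp only [symbol, blockSymbol]
    split_ifs with h
    · rw [h, freq_zero, χ.eq_one' (by simp)]
    · exact χ.eq_zero (one_le_norm_freq h)
  | succ a =>
    simp only [symbol, blockSymbol, annulus, smul_smul, pow_succ]
    congr 3
    field_simp

theorem fat_mul_symbol (a : ℕ) (m : Fin d → ℤ) :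
    blockSymbol χ.fatAnnulus a m * χ.symbol a m = χ.symbol a m := by
  rw [symbol_eq]
  cases a with
  | zero => simp [blockSymbol]
  | succ a =>
    simp only [blockSymbol]
    set ξ := (2 ^ (a + 1) : ℝ)⁻¹ • freq m
    by_cases h0 : χ.annulus ξ = 0
    · simp [h0]
    have h1 : ‖ξ‖ < 1 := by
      by_contra! h
      exact h0 (by
        rw [annulus, χ.eq_zero h, χ.eq_zero (by rw [norm_smul]; norm_num; linarith), sub_zero])
    have h2 : 9 / 20 ≤ ‖ξ‖ := by
      by_contra! h
      exact h0 (by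
        rw [annulus, χ.eq_one' (by linarith), χ.eq_one' (by rw [norm_smul]; norm_num; linarith),
          sub_self])
    rw [fatAnnulus, χ.eq_one' (by rw [norm_smul]; norm_num; linarith),
      χ.eq_zero (by rw [norm_smul]; norm_num; linarith), sub_zero, one_mul]

theorem norm_freq_le_of_fat_ne_zero {a : ℕ} {m : Fin d → ℤ} (h : blockSymbol χ.fatAnnulus a m ≠ 0) :
    ‖freq m‖ ≤ 2 * 2 ^ a := by
  cases a with
  | zero =>
    simp only [blockSymbol, ne_eq, ite_eq_right_iff, one_ne_zero, imp_false, not_not] at h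
    simp [h, freq_zero]
  | succ a =>
    by_contra! h1
    refine h ?_
    simp only [blockSymbol, fatAnnulus]
    have h2 : 2 < ‖(2 ^ (a + 1) : ℝ)⁻¹ • freq m‖ := by
      rw [norm_smul, Real.norm_of_nonneg (by positivity), lt_inv_mul_iff₀ (by positivity)]
      linarith
    rw [χ.eq_zero (by rw [norm_smul]; norm_num; linarith),
      χ.eq_zero (by rw [norm_smul]; norm_num; linarith), sub_zero]

theorem norm_freq_le_of_symbol_ne_zero {a : ℕ} {m : Fin d → ℤ} (h : χ.symbol a m ≠ 0) :
    ‖freq m‖ ≤ 2 * 2 ^ a :=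
  χ.norm_freq_le_of_fat_ne_zero fun h0 => h (by rw [← fat_mul_symbol, h0, zero_mul])

theorem sum_symbol (n : ℕ) (m : Fin d → ℤ) :
    ∑ a ∈ Finset.range (n + 1), χ.symbol a m = χ.toFun ((2 ^ n : ℝ)⁻¹ • freq m) := by
  induction n with
  | zero => simp [symbol]
  | succ n ih => rw [Finset.sum_range_succ, ih]; simp [symbol]

theorem exists_symbol_eq_zero (m : Fin d → ℤ) : ∃ n : ℕ, (∀ a, n < a → χ.symbol a m = 0) ∧
    ‖freq m‖ < 9 / 10 * 2 ^ n := by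
  obtain ⟨n, hn⟩ := pow_unbounded_of_one_lt (10 / 9 * ‖freq m‖) (one_lt_two (α := ℝ))
  refine ⟨n, fun a ha => ?_, by linarith⟩
  obtain ⟨b, rfl⟩ : ∃ b, a = b + 1 := ⟨a - 1, by omega⟩
  have h : ∀ k, n ≤ k → χ.toFun ((2 ^ k : ℝ)⁻¹ • freq m) = 1 := fun k hk => χ.eq_one' (by
    rw [norm_smul, Real.norm_of_nonneg (by positivity), inv_mul_lt_iff₀ (by positivity)]
    have : (2 : ℝ) ^ n ≤ 2 ^ k := pow_le_pow_right₀ one_le_two hk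
    linarith)
  simp only [symbol]
  rw [h _ (by omega), h _ (by omega), sub_self]

theorem hasSum_symbol (m : Fin d → ℤ) : HasSum (fun a => (χ.symbol a m : ℂ)) 1 := by
  obtain ⟨n, hn, hn'⟩ := χ.exists_symbol_eq_zero m
  have : HasSum (fun a => (χ.symbol a m : ℂ)) (∑ a ∈ Finset.range (n + 1), (χ.symbol a m : ℂ)) :=
    hasSum_sum_of_ne_finset_zero fun a ha => by
      rw [hn a (by simpa using ha)]; simp
  convert! this
  rw [← Complex.ofReal_sum, sum_symbol, χ.eq_one' (by
    rw [norm_smul, Real.norm_of_nonneg (by positivity), inv_mul_lt_iff₀ (by positivity)]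
    linarith)]
  simp

end Cutoff

theorem mulBound_zero_mode : MulBound (fun m : Fin d → ℤ => if m = 0 then (1 : ℂ) else 0) 1 :=
  fun q hq f _ => by
  have e : (fun m => (if m = 0 then (1 : ℂ) else 0) * f m) = Pi.single 0 (f 0) := by
    ext m
    by_cases h : m = 0
    · subst h; simp
    · simp [h]
  rw [e, seqLp_single hq]
  simpa using enorm_le_seqLp hq f 0

theorem heat_scaling {N : ℝ} (hN : 0 < N) (t : ℝ) (m : Fin d → ℤ) :
    heatSymbol α t m = Real.exp (-(t * N ^ (2 * α)) * lapSymbol α (N⁻¹ • freq m)) := by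
  rw [heatSymbol_eq]
  congr 1
  rw [neg_mul, neg_mul, mul_assoc, ← lapSymbol_smul α hN.le, smul_inv_smul₀ hN.ne']

theorem IsAnnularBump.mulBound_block {α : ℝ} (hα : 0 < α) {ψ : EuclideanSpace ℝ (Fin d) → ℝ} (hψ : IsAnnularBump ψ)
    {A : EuclideanSpace ℝ (Fin d) → ℂ} (hA : ∀ ξ, ξ ≠ 0 → ContDiffAt ℝ ∞ A ξ) {k : ℝ}
    (hk : ∀ N : ℝ, 0 < N → ∀ ξ, A (N • ξ) = ((N ^ k : ℝ) : ℂ) * A ξ) (K : ℕ) :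
    ∃ C : ℝ, 0 ≤ C ∧ ∀ (a : ℕ) (t : ℝ), 0 ≤ t → t ≤ 1 →
      MulBound (fun m => blockSymbol ψ a m * (A (freq m) * heatSymbol α t m))
        (C * (((2 : ℝ) ^ a) ^ k * (1 + (t * (2 ^ a) ^ (2 * α)) ^ K)⁻¹)) := by
  obtain ⟨C, hC, h⟩ := hψ.mulBound_heat α hA K
  refine ⟨C + 2 * ‖A 0‖, by positivity, fun a t ht0 ht1 => ?_⟩
  cases a with
  | zero =>
    have h1 : (2 : ℝ)⁻¹ ≤ (1 + t ^ K)⁻¹ := by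
      gcongr
      linarith [pow_le_one₀ ht0 ht1 (n := K)]
    refine MulBound.mono (C := ‖A 0‖ * 1) ?_ ?_
    · have h0 := (mulBound_zero_mode (d := d)).const_mul (A 0)
      convert! h0 using 2 with m
      by_cases hm : m = 0
      · subst hm
        simp [blockSymbol, freq_zero, heatSymbol_eq, lapSymbol, hα.ne']
      · simp [blockSymbol, hm]
    · simp only [pow_zero, Real.one_rpow, mul_one, one_mul]
      nlinarith [norm_nonneg (A 0)]
  | succ a =>
    have hN : (0 : ℝ) < 2 ^ (a + 1) := by positivity
    have h1 := (h (t * (2 ^ (a + 1)) ^ (2 * α)) (2 ^ (a + 1)) (by positivity)).const_mul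
      (((2 ^ (a + 1)) ^ k : ℝ) : ℂ)
    rw [Complex.norm_real, Real.norm_of_nonneg (by positivity), mul_left_comm] at h1
    refine MulBound.mono (C := C * (((2 : ℝ) ^ (a + 1)) ^ k *
      (1 + (t * (2 ^ (a + 1)) ^ (2 * α)) ^ K)⁻¹)) ?_ (by
        refine mul_le_mul_of_nonneg_right (by linarith [norm_nonneg (A 0)]) (by positivity))
    convert! h1 using 2 with m
    rw [heat_scaling α hN t m]
    have e : A (freq m) = (((2 ^ (a + 1)) ^ k : ℝ) : ℂ) * A ((2 ^ (a + 1) : ℝ)⁻¹ • freq m) := by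
      rw [← hk _ hN, smul_inv_smul₀ hN.ne']
    rw [e]
    simp only [blockSymbol]
    ring

theorem mulLE_of_blocks (χ : Cutoff d) {α : ℝ} (hα : 0 < α) {x : ℝ} (hx : 0 < x) {K : ℕ}
    (hK : x < 2 * α * K) : ∃ C : ℝ, 0 ≤ C ∧ ∀ (p q : ℝ≥0∞) (_ : 1 ≤ q) (c : Seq d) (B : ℝ)
      (_ : 0 ≤ B) (t : ℝ) (_ : 0 < t),
      (∀ a : ℕ, MulLE p q (fun m => χ.symbol a m * c m)
        (B * (((2 : ℝ) ^ a) ^ x * (1 + (t * (2 ^ a) ^ (2 * α)) ^ K)⁻¹))) →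
      MulLE p q c (B * (C * t ^ (-(x / (2 * α))))) := by
  obtain ⟨C, hC, h⟩ := exists_dyadic_sum_le hx hK
  refine ⟨C, hC, fun p q hq c B hB t ht hb => ?_⟩
  obtain ⟨hs, hle⟩ := h (t ^ (1 / (2 * α))) (by positivity)
  have e : ∀ a : ℕ, (t * ((2 : ℝ) ^ a) ^ (2 * α)) ^ K = (t ^ (1 / (2 * α)) * 2 ^ a) ^ (2 * α * K) :=
    fun a => by
    rw [Real.mul_rpow (by positivity) (by positivity), ← Real.rpow_mul ht.le, mul_pow,
      Real.rpow_mul (by positivity) (2 * α), Real.rpow_natCast]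
    congr 1
    rw [← Real.rpow_natCast]
    congr 1
    field_simp
  simp only [e] at hb
  refine (MulLE.tsum hq hb (fun a => by positivity) (hs.mul_left B) fun m => ?_).mono ?_
  · simpa using (χ.hasSum_symbol m).mul_right (c m)
  · rw [tsum_mul_left]
    gcongr
    refine hle.trans_eq ?_
    rw [← Real.rpow_mul ht.le]
    congr 2
    ring

theorem exists_nat_mul_gt {α : ℝ} (hα : 0 < α) (x : ℝ) : ∃ K : ℕ, x < 2 * α * K := by
  obtain ⟨K, hK⟩ := exists_nat_gt (x / (2 * α))
  exact ⟨K, by rwa [div_lt_iff₀' (by positivity)] at hK⟩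

theorem mulLE_heat (χ : Cutoff d) {α : ℝ} (hα : 0 < α) {A : EuclideanSpace ℝ (Fin d) → ℂ}
    (hA : ∀ ξ, ξ ≠ 0 → ContDiffAt ℝ ∞ A ξ) {k : ℝ}
    (hk : ∀ N : ℝ, 0 < N → ∀ ξ, A (N • ξ) = ((N ^ k : ℝ) : ℂ) * A ξ) {p q : ℝ≥0∞} (hp : 1 ≤ p)
    (hpq : p ≤ q) (hx : 0 < k + d * ((p⁻¹).toReal - (q⁻¹).toReal)) :
    ∃ C : ℝ, 0 ≤ C ∧ ∀ t : ℝ, 0 < t → t ≤ 1 →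
      MulLE p q (fun m => A (freq m) * heatSymbol α t m)
        (C * t ^ (-((k + d * ((p⁻¹).toReal - (q⁻¹).toReal)) / (2 * α)))) := by
  set y : ℝ := d * ((p⁻¹).toReal - (q⁻¹).toReal) with hy
  obtain ⟨K, hK⟩ := exists_nat_mul_gt hα (k + y)
  obtain ⟨C, hC, h⟩ := mulLE_of_blocks χ hα hx hK
  obtain ⟨C', hC', h'⟩ := χ.isAnnularBump_annulus.mulBound_block hα hA hk K
  refine ⟨2 * C' * 6 ^ y * C, by positivity, fun t ht0 ht1 => ?_⟩
  rw [mul_assoc (2 * C' * 6 ^ y)]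
  refine h p q (hp.trans hpq) _ _ (by positivity) t ht0 fun a => ?_
  have h1 := (h' a t ht0.le ht1).bernstein (by positivity)
    (R := 2 * 2 ^ a) (by linarith [one_le_pow₀ (one_le_two (α := ℝ)) (n := a)]) (fun m hm => by
      refine χ.norm_freq_le_of_symbol_ne_zero ?_
      intro h0
      rw [← χ.symbol_eq, h0] at hm
      simp at hm) hp hpq
  simp only [← χ.symbol_eq] at h1
  refine h1.mono (le_of_eq ?_)
  rw [← hy, ← mul_assoc 3, Real.mul_rpow (by norm_num) (by positivity), Real.rpow_add (by positivity)]
  norm_num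
  ring

theorem heatSymbol_pos (t : ℝ) (m : Fin d → ℤ) : 0 < heatSymbol α t m := Real.exp_pos _

theorem mulBound_heatSymbol (χ : Cutoff d) {α : ℝ} (hα : 0 < α) : ∃ C : ℝ, 0 ≤ C ∧
    ∀ t : ℝ, 0 ≤ t → t ≤ 1 → MulBound (fun m : Fin d → ℤ => (heatSymbol α t m : ℂ)) C := by
  obtain ⟨C₁, hC₁, h₁⟩ := χ.isAnnularBump_annulus.mulBound_heat_sub_one α
  obtain ⟨C₂, hC₂, h₂⟩ := χ.isAnnularBump_annulus.mulBound_block hα (A := fun _ => 1) (k := 0)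
    (fun _ _ => contDiffAt_const) (by simp) 1
  obtain ⟨C₃, hC₃, h₃⟩ := mulBound_cutoff χ.smooth χ.hasCompactSupport
  have hr : 1 < (2 : ℝ) ^ (2 * α) := Real.one_lt_rpow one_lt_two (by positivity)
  set D := 2 * (1 + (2 : ℝ) ^ (2 * α)) / (2 ^ (2 * α) - 1) with hD
  have hD0 : 0 ≤ D := div_nonneg (by positivity) (by linarith)
  refine ⟨C₃ + (C₁ + C₂) * D + 1, by positivity, fun t ht0 ht1 => ?_⟩
  rcases ht0.eq_or_lt with rfl | ht0
  · refine MulBound.mono (C := 1) ?_ (by linarith [mul_nonneg (add_nonneg hC₁ hC₂) hD0])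
    simpa [heatSymbol] using mulBound_one (d := d)
  obtain ⟨hs, hle⟩ := sum_min_inv_le hr ht0
  have hpow : ∀ a : ℕ, ((2 : ℝ) ^ a) ^ (2 * α) = (2 ^ (2 * α)) ^ a := fun a => by
    rw [← Real.rpow_natCast, ← Real.rpow_natCast, ← Real.rpow_mul (by norm_num),
      ← Real.rpow_mul (by norm_num), mul_comm]
  have hex : ∃ a : ℕ, 1 < t * (2 ^ (2 * α)) ^ a := by
    obtain ⟨n, hn⟩ := pow_unbounded_of_one_lt t⁻¹ hr
    exact ⟨n, by rwa [inv_lt_iff_one_lt_mul₀' ht0] at hn⟩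
  obtain ⟨b, hb⟩ : ∃ b, Nat.find hex = b + 1 := by
    refine Nat.exists_eq_succ_of_ne_zero fun h0 => ?_
    have := Nat.find_spec hex
    rw [h0, pow_zero, mul_one] at this
    linarith
  have hblock : ∀ a, MulBound (fun m => (χ.symbol a m : ℂ) * ((heatSymbol α t m : ℂ) -
      if a ∈ Finset.range (b + 1) then 1 else 0))
      ((C₁ + C₂) * min (t * (2 ^ (2 * α)) ^ a) (t * (2 ^ (2 * α)) ^ a)⁻¹) := fun a => by
    have hτ : 0 < t * (2 ^ (2 * α)) ^ a := by positivity
    by_cases ha : a < b + 1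
    · have h1 : t * (2 ^ (2 * α)) ^ a ≤ 1 := not_lt.1 (Nat.find_min hex (hb ▸ ha))
      rw [min_eq_left (h1.trans ((one_le_inv₀ hτ).2 h1))]
      simp only [Finset.mem_range, ha, if_true]
      cases a with
      | zero =>
        refine MulBound.mono (C := 0) ?_ (by positivity)
        convert! mulBound_zero using 2 with m
        rw [χ.symbol_eq]
        by_cases hm : m = 0
        · simp [hm, freq_zero, heatSymbol_eq, lapSymbol, hα.ne']
        · simp [blockSymbol, hm]
      | succ a =>
        have hN : (0 : ℝ) < 2 ^ (a + 1) := by positivity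
        have h2 := h₁ (t * (2 ^ (a + 1)) ^ (2 * α)) (2 ^ (a + 1)) (by positivity) (by rwa [hpow])
        rw [hpow] at h2
        refine MulBound.mono ?_ (C := C₁ * (t * (2 ^ (2 * α)) ^ (a + 1))) (by gcongr; linarith)
        convert! h2 using 3 with m
        · rw [χ.symbol_eq]; rfl
        · rw [heat_scaling α hN t m, hpow]
    · have h1 : 1 ≤ t * (2 ^ (2 * α)) ^ a := by
        refine (Nat.find_spec hex).le.trans ?_
        gcongr
        · exact hr.le
        · omega
      rw [min_eq_right ((inv_le_one₀ hτ).2 h1 |>.trans h1)]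
      simp only [Finset.mem_range, ha, if_false, sub_zero]
      have h2 := h₂ a t ht0.le ht1
      simp only [one_mul, Real.rpow_zero, pow_one, hpow] at h2
      refine MulBound.mono ?_ (C := C₂ * (1 + t * (2 ^ (2 * α)) ^ a)⁻¹) ?_
      · simpa only [χ.symbol_eq] using h2
      · gcongr
        · linarith
        · linarith
  have hsum := MulBound.tsum hblock (fun a => by positivity) (hs.mul_left _)
    (c' := fun m => (heatSymbol α t m : ℂ) - χ.toFun ((2 ^ b : ℝ)⁻¹ • freq m)) fun m => by
      have h1 := (χ.hasSum_symbol m).mul_right (heatSymbol α t m : ℂ)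
      have h2 : HasSum (fun a => (χ.symbol a m : ℂ) * if a ∈ Finset.range (b + 1) then 1 else 0)
          (∑ a ∈ Finset.range (b + 1),
            (χ.symbol a m : ℂ) * if a ∈ Finset.range (b + 1) then 1 else 0) :=
        hasSum_sum_of_ne_finset_zero fun a ha => by rw [if_neg ha, mul_zero]
      rw [Finset.sum_congr rfl fun a ha => by rw [if_pos ha, mul_one], ← Complex.ofReal_sum,
        χ.sum_symbol] at h2
      rw [one_mul] at h1
      convert! h1.sub h2 using 2 with a
      ring
  have hfin := (h₃ (2 ^ b)).add hsum hC₃ (tsum_nonneg fun a => by positivity)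
  refine MulBound.mono ?_ (C := C₃ + ∑' a : ℕ, (C₁ + C₂) *
    min (t * ((2 : ℝ) ^ (2 * α)) ^ a) (t * (2 ^ (2 * α)) ^ a)⁻¹) ?_
  · convert! hfin using 2 with m
    ring
  · rw [tsum_mul_left]
    have : (C₁ + C₂) * ∑' a : ℕ, min (t * ((2 : ℝ) ^ (2 * α)) ^ a) (t * (2 ^ (2 * α)) ^ a)⁻¹ ≤
      (C₁ + C₂) * D := by gcongr
    linarith

/-- The symbol of the translation by `h` in the direction of the `j`-th coordinate. -/
def shiftSymbol (j : Fin d) (h : ℝ) (m : Fin d → ℤ) : ℂ :=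
  Complex.exp (2 * Real.pi * Complex.I * ((h * m j : ℝ) : ℂ))

theorem shiftSymbol_eq (j : Fin d) (h : ℝ) (m : Fin d → ℤ) :
    shiftSymbol j h m = UnitAddTorus.mFourier m (toTorus (Pi.single j h)) := by
  rw [mFourier_toTorus, shiftSymbol]
  congr 3
  rw [Finset.sum_eq_single j]
  · simp [mul_comm]
  · intro i _ hi; simp [hi]
  · simp

theorem mulBound_shiftSymbol (j : Fin d) (h : ℝ) : MulBound (shiftSymbol j h) 1 := by
  have := mulBound_translate (toTorus (Pi.single j h))
  simpa only [← shiftSymbol_eq] using this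

theorem mulBound_block_shift_sub_one (χ : Cutoff d) {ς : ℝ} (h0 : 0 ≤ ς) (h1 : ς ≤ 1) (j : Fin d) :
    ∃ C : ℝ, 0 ≤ C ∧ ∀ (a : ℕ) (h : ℝ), MulBound (fun m => blockSymbol χ.fatAnnulus a m *
      (shiftSymbol j h m - 1)) (C * (|h| * 2 ^ a) ^ ς) := by
  obtain ⟨C₁, hC₁, h₁⟩ := χ.isAnnularBump_fatAnnulus.mulBound_exp_sub_one j
  obtain ⟨C₂, hC₂, h₂⟩ := χ.isAnnularBump_fatAnnulus.mulBound_bump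
  refine ⟨C₁ + 2 * C₂, by positivity, fun a h => ?_⟩
  cases a with
  | zero =>
    refine MulBound.mono (C := 0) ?_ (by positivity)
    convert! mulBound_zero using 2 with m
    by_cases hm : m = 0
    · simp [hm, shiftSymbol]
    · simp [blockSymbol, hm]
  | succ a =>
    set N : ℝ := 2 ^ (a + 1) with hNd
    have hN : 0 < N := by positivity
    have hz : |h * N| = |h| * N := by rw [abs_mul, abs_of_pos hN]
    rcases le_or_gt (|h| * N) 1 with hle | hgt
    · have := h₁ (h * N) N (by rwa [hz])
      rw [hz] at this
      refine MulBound.mono (C := C₁ * (|h| * N)) ?_ ?_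
      · convert! this using 2 with m
        rw [shiftSymbol]
        congr 5
        field_simp
      · gcongr
        · linarith
        · rcases (by positivity : 0 ≤ |h| * N).eq_or_lt with h' | h'
          · rw [← h']; positivity
          · nth_rewrite 1 [← Real.rpow_one (|h| * N)]
            exact Real.rpow_le_rpow_of_exponent_ge h' hle h1
    · have hb := h₂ N
      have hb2 := (hb.comp (mulBound_shiftSymbol j h) hC₂).add (hb.const_mul (-1))
        (by positivity) (by positivity)
      refine MulBound.mono (C := C₂ * 1 + ‖(-1 : ℂ)‖ * C₂) ?_ ?_
      · convert! hb2 using 2 with m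
        simp only [blockSymbol]
        ring
      · have : 1 ≤ (|h| * N) ^ ς := Real.one_le_rpow hgt.le h0
        simp only [norm_neg, norm_one]
        nlinarith

theorem mulBound_shift_sub_one_heat (χ : Cutoff d) {α : ℝ} (hα : 0 < α) {ς : ℝ} (h0 : 0 < ς)
    (h1 : ς ≤ 1) (j : Fin d) : ∃ C : ℝ, 0 ≤ C ∧ ∀ t h : ℝ, 0 < t → t ≤ 1 →
      MulBound (fun m => (shiftSymbol j h m - 1) * heatSymbol α t m)
        (C * |h| ^ ς * t ^ (-(ς / (2 * α)))) := by
  obtain ⟨C₁, hC₁, h₁⟩ := mulBound_block_shift_sub_one χ h0.le h1 j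
  obtain ⟨K, hK⟩ := exists_nat_mul_gt hα ς
  obtain ⟨C₂, hC₂, h₂⟩ := χ.isAnnularBump_annulus.mulBound_block hα (A := fun _ => 1) (k := 0)
    (fun _ _ => contDiffAt_const) (by simp) K
  obtain ⟨C₃, hC₃, h₃⟩ := mulLE_of_blocks χ hα h0 hK
  refine ⟨C₁ * C₂ * C₃, by positivity, fun t h ht0 ht1 q hq => ?_⟩
  have := h₃ q q hq (fun m => (shiftSymbol j h m - 1) * heatSymbol α t m) (C₁ * C₂ * |h| ^ ς)
    (by positivity) t ht0 fun a => by
      have h4 := ((h₁ a h).comp (h₂ a t ht0.le ht1) (by positivity)) q hq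
      simp only [← χ.symbol_eq, one_mul, Real.rpow_zero] at h4
      refine MulLE.mono (C := C₁ * (|h| * 2 ^ a) ^ ς *
        (C₂ * (1 + (t * (2 ^ a) ^ (2 * α)) ^ K)⁻¹)) ?_ (le_of_eq ?_)
      · convert! h4 using 2 with m
        have := χ.fat_mul_symbol a m
        have h5 : (blockSymbol χ.fatAnnulus a m : ℂ) * χ.symbol a m = χ.symbol a m := by
          exact_mod_cast this
        linear_combination (-(shiftSymbol j h m - 1) * heatSymbol α t m) * h5
      · rw [Real.mul_rpow (abs_nonneg h) (by positivity)]
        ring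
  refine this.mono (le_of_eq ?_)
  ring

/-- The symbol of the `(i,k)` component of the Leray projection composed with `∂_j`. -/
def lerayDeriv (i k j : Fin d) (ξ : EuclideanSpace ℝ (Fin d)) : ℂ :=
  2 * Real.pi * Complex.I * (ξ j : ℂ) * ((if i = k then 1 else 0) -
    (ξ i : ℂ) * (ξ k : ℂ) / ((‖ξ‖ ^ 2 : ℝ) : ℂ))

theorem contDiffAt_lerayDeriv (i k j : Fin d) {ξ : EuclideanSpace ℝ (Fin d)} (h : ξ ≠ 0) :
    ContDiffAt ℝ ∞ (lerayDeriv i k j) ξ := by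
  have hp : ∀ l : Fin d, ContDiffAt ℝ ∞ (fun ξ : EuclideanSpace ℝ (Fin d) => (ξ l : ℂ)) ξ := fun l =>
    (Complex.ofRealCLM.contDiff.comp
      (EuclideanSpace.proj l : EuclideanSpace ℝ (Fin d) →L[ℝ] ℝ).contDiff).contDiffAt
  have hn : ContDiffAt ℝ ∞ (fun ξ : EuclideanSpace ℝ (Fin d) => ((‖ξ‖ ^ 2 : ℝ) : ℂ)) ξ :=
    (Complex.ofRealCLM.contDiff.comp (contDiff_norm_sq ℝ)).contDiffAt
  have e : lerayDeriv i k j = fun ξ : EuclideanSpace ℝ (Fin d) => 2 * Real.pi * Complex.I * (ξ j : ℂ) *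
      ((if i = k then 1 else 0) - (ξ i : ℂ) * (ξ k : ℂ) * ((‖ξ‖ ^ 2 : ℝ) : ℂ)⁻¹) := by
    funext ξ
    rw [lerayDeriv, div_eq_mul_inv]
  rw [e]
  refine (contDiffAt_const.mul (hp j)).mul (contDiffAt_const.sub (((hp i).mul (hp k)).mul (hn.inv ?_)))
  simpa using h

theorem lerayDeriv_smul (i k j : Fin d) (N : ℝ) (hN : 0 < N) (ξ : EuclideanSpace ℝ (Fin d)) :
    lerayDeriv i k j (N • ξ) = ((N ^ (1 : ℝ) : ℝ) : ℂ) * lerayDeriv i k j ξ := by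
  have hN' : (N : ℂ) ≠ 0 := by exact_mod_cast hN.ne'
  simp only [lerayDeriv, PiLp.smul_apply, smul_eq_mul, norm_smul, Real.norm_of_nonneg hN.le,
    Real.rpow_one]
  push_cast
  have : (N : ℂ) * ξ i * (N * ξ k) / (N * ‖ξ‖) ^ 2 = (ξ i : ℂ) * ξ k / ‖ξ‖ ^ 2 := by
    rw [mul_pow, show (N : ℂ) * ξ i * (N * ξ k) = N ^ 2 * (ξ i * ξ k) by ring,
      mul_div_mul_left _ _ (pow_ne_zero 2 hN')]
  rw [this]
  ring

end FracNS

end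

noncomputable section
namespace FracNS
variable {d : ℕ}

/-! ### Polynomial weights -/

/-- The weight `1 + |m|`. -/
def wt (m : Fin d → ℤ) : ℝ := 1 + ‖freq m‖

theorem one_le_wt (m : Fin d → ℤ) : 1 ≤ wt m := by
  have := norm_nonneg (freq m)
  unfold wt; linarith

theorem wt_pos (m : Fin d → ℤ) : 0 < wt m := zero_lt_one.trans_le (one_le_wt m)

theorem summable_pi_int {f : ℤ → ℝ} (hf : Summable f) (h0 : ∀ n, 0 ≤ f n) :
    ∀ d : ℕ, Summable fun m : Fin d → ℤ => ∏ i, f (m i)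
  | 0 => (hasSum_fintype _).summable
  | d + 1 => by
    rw [← (Fin.consEquiv fun _ : Fin (d + 1) => ℤ).summable_iff]
    have := hf.mul_of_nonneg (summable_pi_int hf h0 d) h0 fun m => Finset.prod_nonneg fun i _ => h0 _
    refine this.congr fun p => ?_
    simp [Fin.consEquiv, Fin.prod_univ_succ]

theorem summable_wt (d : ℕ) : Summable fun m : Fin d → ℤ => (wt m ^ (2 * d))⁻¹ := by
  have h1 : Summable fun n : ℤ => ((1 + |(n : ℝ)|) ^ 2)⁻¹ := by
    have h2 : Summable fun n : ℤ => ((1 : ℝ) / (n : ℝ) ^ 2) := Real.summable_one_div_int_pow.2 one_lt_two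
    have h3 : Summable fun n : ℤ => (Pi.single 0 1 : ℤ → ℝ) n :=
      summable_of_ne_finset_zero (s := {0}) fun n hn => by
        simp only [Finset.mem_singleton] at hn; simp [hn]
    refine Summable.of_nonneg_of_le (fun n => by positivity) (fun n => ?_) (h2.add h3)
    rcases eq_or_ne n 0 with rfl | hn
    · simp
    · simp only [Pi.single_apply, hn, if_false, add_zero, one_div]
      have : (n : ℝ) ≠ 0 := by exact_mod_cast hn
      have h4 : 0 < |(n : ℝ)| := abs_pos.2 this
      rw [← sq_abs (n : ℝ)]
      gcongr
      linarith
  refine Summable.of_nonneg_of_le (fun m => by have := wt_pos m; positivity) (fun m => ?_)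
    (summable_pi_int h1 (fun n => by positivity) d)
  rw [Finset.prod_inv_distrib]
  have h5 : ∏ i : Fin d, (1 + |(m i : ℝ)|) ^ 2 ≤ wt m ^ (2 * d) := by
    calc _ ≤ ∏ i : Fin d, wt m ^ 2 := by
          refine Finset.prod_le_prod (fun i _ => by positivity) fun i _ => ?_
          have := abs_le_norm_freq m i
          unfold wt
          gcongr
      _ = _ := by rw [Finset.prod_const, Finset.card_univ, Fintype.card_fin, pow_mul]
  have h6 : 0 < ∏ i : Fin d, (1 + |(m i : ℝ)|) ^ 2 :=
    Finset.prod_pos fun i _ => by positivity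
  gcongr

/-- The heat symbol decays faster than any power of the weight. -/
theorem heatSymbol_le {α : ℝ} (hα : 0 < α) (L : ℕ) {ε : ℝ} (hε : 0 < ε) :
    ∃ C : ℝ, 0 ≤ C ∧ ∀ t, ε ≤ t → ∀ m : Fin d → ℤ, heatSymbol α t m ≤ C * (wt m ^ L)⁻¹ := by
  obtain ⟨K, hK⟩ := exists_nat_mul_gt hα L
  refine ⟨2 ^ L * (K.factorial / ε ^ K) + 1, by positivity, fun t ht m => ?_⟩
  have hw := wt_pos m
  rcases eq_or_ne m 0 with rfl | hm
  · have h1 : heatSymbol α t (0 : Fin d → ℤ) ≤ 1 := by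
      rw [heatSymbol_eq]
      refine Real.exp_le_one_iff.2 ?_
      have := lapSymbol_nonneg α (freq (0 : Fin d → ℤ))
      nlinarith
    have h2 : wt (0 : Fin d → ℤ) = 1 := by simp [wt, freq_zero]
    rw [h2, one_pow, inv_one, mul_one]
    have : 0 ≤ 2 ^ L * (K.factorial / ε ^ K) := by positivity
    linarith
  · have hf := one_le_norm_freq hm
    set l := lapSymbol α (freq m) with hl
    have hl1 : wt m ^ L ≤ 2 ^ L * l ^ K := by
      have h3 : ‖freq m‖ ^ (L : ℝ) ≤ l ^ K := by
        have h4 : (1 : ℝ) ≤ 2 * Real.pi := by have := Real.pi_gt_three; linarith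
        calc ‖freq m‖ ^ (L : ℝ) ≤ ‖freq m‖ ^ (2 * α * K) :=
              Real.rpow_le_rpow_of_exponent_le hf hK.le
          _ ≤ (2 * Real.pi * ‖freq m‖) ^ (2 * α * K) := by
              refine Real.rpow_le_rpow (by positivity) ?_ (by positivity)
              nlinarith
          _ = l ^ K := by
              rw [hl, lapSymbol, Real.rpow_mul (by positivity), Real.rpow_natCast]
      rw [Real.rpow_natCast] at h3
      calc wt m ^ L ≤ (2 * ‖freq m‖) ^ L := by unfold wt; gcongr; linarith
        _ = 2 ^ L * ‖freq m‖ ^ L := mul_pow _ _ _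
        _ ≤ _ := by gcongr
    have hl0 : 0 < l := lapSymbol_pos α (freq_ne_zero hm)
    have h5 : (ε * l) ^ K / K.factorial ≤ Real.exp (t * l) :=
      (Real.pow_div_factorial_le_exp _ (by positivity) K).trans (Real.exp_le_exp.2 (by gcongr))
    rw [heatSymbol_eq, neg_mul, Real.exp_neg, ← hl]
    have h6 : (Real.exp (t * l))⁻¹ ≤ K.factorial / (ε * l) ^ K := by
      rw [inv_le_comm₀ (Real.exp_pos _) (by positivity), inv_div]
      exact h5
    have h7 : K.factorial / (ε * l) ^ K ≤ 2 ^ L * (K.factorial / ε ^ K) * (wt m ^ L)⁻¹ := by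
      rw [mul_pow]
      have : (l ^ K)⁻¹ ≤ 2 ^ L * (wt m ^ L)⁻¹ := by
        rw [inv_le_iff_one_le_mul₀ (by positivity)]
        have h8 : 1 ≤ (2 ^ L * l ^ K) * (wt m ^ L)⁻¹ := by
          rw [← div_eq_mul_inv, le_div_iff₀ (by positivity), one_mul]; exact hl1
        linarith
      calc K.factorial / (ε ^ K * l ^ K) = K.factorial / ε ^ K * (l ^ K)⁻¹ := by
            field_simp
        _ ≤ K.factorial / ε ^ K * (2 ^ L * (wt m ^ L)⁻¹) := by gcongr
        _ = _ := by ring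
    have h9 : 0 ≤ (wt m ^ L)⁻¹ := by positivity
    nlinarith

theorem heatSymbol_le_one (α : ℝ) {t : ℝ} (ht : 0 ≤ t) (m : Fin d → ℤ) : heatSymbol α t m ≤ 1 := by
  rw [heatSymbol_eq]
  refine Real.exp_le_one_iff.2 ?_
  have := lapSymbol_nonneg α (freq m)
  nlinarith

theorem heatSymbol_add (α s t : ℝ) (m : Fin d → ℤ) :
    heatSymbol α (s + t) m = heatSymbol α s m * heatSymbol α t m := by
  simp only [heatSymbol_eq, ← Real.exp_add]
  congr 1; ring

theorem heatSymbol_zero (α : ℝ) (m : Fin d → ℤ) : heatSymbol α 0 m = 1 := by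
  simp [heatSymbol_eq]

theorem continuous_heatSymbol (α : ℝ) (m : Fin d → ℤ) : Continuous fun t => heatSymbol α t m := by
  simp only [heatSymbol_eq]
  fun_prop

theorem summable_wt_mul (L : ℕ) : Summable fun m : Fin d → ℤ => wt m ^ L * (wt m ^ (L + 2 * d))⁻¹ := by
  refine (summable_wt d).congr fun m => ?_
  have := wt_pos m
  rw [pow_add]; field_simp

/-! ### Norms on sequences of Fourier coefficients -/

/-- Families of Fourier coefficients of vector fields. -/
abbrev Vec (d : ℕ) : Type := Fin d → Seq d

/-- The properties of translation invariant Banach norms that the well-posedness theory uses. -/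
structure SeqNorm (b : Seq d → ℝ≥0∞) : Prop where
  add : ∀ u v, b (u + v) ≤ b u + b v
  smul : ∀ (a : ℂ) u, b (a • u) ≤ ‖a‖ₑ * b u
  coeff : ∃ (C : ℝ) (K : ℕ), 0 ≤ C ∧ ∀ u m, ‖u m‖ₑ ≤ ENNReal.ofReal (C * wt m ^ K) * b u
  complete : ∀ (u : ℕ → Seq d) (l : Seq d) (B : ℕ → ℝ≥0∞), ∑' n, B n ≠ ⊤ →
    (∀ n k, n ≤ k → b (u n - u k) ≤ B n) → (∀ m, Tendsto (fun n => u n m) atTop (𝓝 (l m))) →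
    ∀ n, b (u n - l) ≤ B n
  integral : ∀ (I : Set ℝ) (f : ℝ → Seq d) (w : ℝ → ℝ≥0∞),
    (∀ m, AEStronglyMeasurable (fun s => f s m) (volume.restrict I)) →
    (∀ᵐ s ∂(volume.restrict I), Summable fun m => ‖f s m‖) → Measurable w →
    (∀ᵐ s ∂(volume.restrict I), b (f s) ≤ w s) →
    b (fun m => ∫ s in I, f s m) ≤ ∫⁻ s in I, w s
  mul : ∀ (c : Seq d) (C : ℝ), 0 ≤ C → MulBound c C → ∀ u, b u ≠ ⊤ →
    b (fun m => c m * u m) ≤ ENNReal.ofReal C * b u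

/-- The sum of the norms of the components. -/
def vecNorm (b : Seq d → ℝ≥0∞) (u : Vec d) : ℝ≥0∞ := ∑ i, b (u i)

theorem le_vecNorm (b : Seq d → ℝ≥0∞) (u : Vec d) (i : Fin d) : b (u i) ≤ vecNorm b u :=
  Finset.single_le_sum (f := fun i => b (u i)) (fun _ _ => zero_le) (Finset.mem_univ i)

theorem vecNorm_le (b : Seq d → ℝ≥0∞) (u : Vec d) {B : ℝ≥0∞} (h : ∀ i, b (u i) ≤ B) :
    vecNorm b u ≤ d * B := by
  refine (Finset.sum_le_card_nsmul _ _ B fun i _ => h i).trans_eq ?_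
  simp

/-- The properties of norms of vector fields that the well-posedness theory uses. -/
structure VecNorm (b : Vec d → ℝ≥0∞) : Prop where
  add : ∀ u v, b (u + v) ≤ b u + b v
  smul : ∀ (a : ℂ) u, b (a • u) ≤ ‖a‖ₑ * b u
  coeff : ∃ (C : ℝ) (K : ℕ), 0 ≤ C ∧ ∀ u i m, ‖u i m‖ₑ ≤ ENNReal.ofReal (C * wt m ^ K) * b u
  complete : ∃ C : ℝ, 0 ≤ C ∧ ∀ (u : ℕ → Vec d) (l : Vec d) (B : ℕ → ℝ≥0∞), ∑' n, B n ≠ ⊤ →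
    (∀ n k, n ≤ k → b (u n - u k) ≤ B n) →
    (∀ i m, Tendsto (fun n => u n i m) atTop (𝓝 (l i m))) →
    ∀ n, b (u n - l) ≤ ENNReal.ofReal C * B n
  integral : ∃ C : ℝ, 0 ≤ C ∧ ∀ (I : Set ℝ) (f : ℝ → Vec d) (w : ℝ → ℝ≥0∞),
    (∀ i m, AEStronglyMeasurable (fun s => f s i m) (volume.restrict I)) →
    (∀ᵐ s ∂(volume.restrict I), ∀ i, Summable fun m => ‖f s i m‖) → Measurable w →
    (∀ᵐ s ∂(volume.restrict I), b (f s) ≤ w s) →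
    b (fun i m => ∫ s in I, f s i m) ≤ ENNReal.ofReal C * ∫⁻ s in I, w s
  mul : ∀ (c : Seq d) (C : ℝ), 0 ≤ C → MulBound c C → ∀ u, b u ≠ ⊤ →
    b (fun i m => c m * u i m) ≤ ENNReal.ofReal C * b u

theorem SeqNorm.vecNorm {b : Seq d → ℝ≥0∞} (h : SeqNorm b) : VecNorm (vecNorm b) where
  add u v := by
    unfold FracNS.vecNorm
    rw [← Finset.sum_add_distrib]
    exact Finset.sum_le_sum fun i _ => h.add _ _
  smul a u := by
    unfold FracNS.vecNorm
    rw [Finset.mul_sum]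
    exact Finset.sum_le_sum fun i _ => h.smul _ _
  coeff := by
    obtain ⟨C, K, hC, hb⟩ := h.coeff
    exact ⟨C, K, hC, fun u i m => (hb (u i) m).trans (by gcongr; exact le_vecNorm b u i)⟩
  complete := ⟨d, by positivity, fun u l B hB hu hl n => by
    rw [ENNReal.ofReal_natCast]
    exact vecNorm_le b _ fun i => h.complete (fun n => u n i) (l i) B hB
      (fun n k hnk => (le_vecNorm b _ i).trans (hu n k hnk)) (hl i) n⟩
  integral := ⟨d, by positivity, fun I f w hf hs hw hle => by
    rw [ENNReal.ofReal_natCast]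
    refine vecNorm_le b _ fun i => h.integral I (fun s => f s i) w (hf i) ?_ hw ?_
    · filter_upwards [hs] with s hs using hs i
    · filter_upwards [hle] with s hs using (le_vecNorm b _ i).trans hs⟩
  mul c C hC hc u hu := by
    unfold FracNS.vecNorm
    rw [Finset.mul_sum]
    exact Finset.sum_le_sum fun i _ => h.mul c C hC hc _
      (ne_top_of_le_ne_top hu (le_vecNorm b u i))

namespace VecNorm

variable {b : Vec d → ℝ≥0∞} (h : VecNorm b)
include h

theorem zero : b 0 = 0 := by
  have := h.smul 0 0
  simpa using this

theorem neg (u : Vec d) : b (-u) = b u := by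
  have h1 : ∀ u, b (-u) ≤ b u := fun u => by
    have := h.smul (-1) u
    simpa using this
  refine le_antisymm (h1 u) ?_
  simpa using h1 (-u)

theorem sub (u v : Vec d) : b (u - v) ≤ b u + b v := by
  rw [sub_eq_add_neg, ← h.neg v]
  exact h.add _ _

theorem sub_comm (u v : Vec d) : b (u - v) = b (v - u) := by
  rw [← h.neg, neg_sub]

theorem sum {ι : Type*} (s : Finset ι) (u : ι → Vec d) : b (∑ i ∈ s, u i) ≤ ∑ i ∈ s, b (u i) := by
  classical
  induction s using Finset.induction_on with
  | empty => simp [h.zero]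
  | insert a s ha ih =>
    rw [Finset.sum_insert ha, Finset.sum_insert ha]
    exact (h.add _ _).trans (by gcongr)

theorem coeff_real : ∃ (C : ℝ) (K : ℕ), 0 ≤ C ∧ ∀ u (A : ℝ), 0 ≤ A → b u ≤ ENNReal.ofReal A →
    ∀ i m, ‖u i m‖ ≤ C * wt m ^ K * A := by
  obtain ⟨C, K, hC, hb⟩ := h.coeff
  refine ⟨C, K, hC, fun u A hA hu i m => ?_⟩
  have := wt_pos m
  have h1 : ‖u i m‖ₑ ≤ ENNReal.ofReal (C * wt m ^ K * A) := by
    rw [ENNReal.ofReal_mul (by positivity)]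
    exact (hb u i m).trans (by gcongr)
  rwa [← ofReal_norm, ENNReal.ofReal_le_ofReal_iff (by positivity)] at h1

theorem eq_zero {u : Vec d} (hu : b u = 0) : u = 0 := by
  obtain ⟨C, K, hC, hb⟩ := h.coeff
  ext i m
  have := hb u i m
  rw [hu, mul_zero] at this
  simpa using this

end VecNorm

end FracNS
end

noncomputable section
namespace FracNS
variable {d : ℕ}

/-! ### The heat semigroup, the nonlinearity, and pairs of norms -/

/-- The fractional heat semigroup on Fourier coefficients. -/
def heat (α t : ℝ) (u : Vec d) : Vec d := fun i m => heatSymbol α t m * u i m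

/-- The Fourier coefficients of `ℙ Div (u ⊗ v)`. -/
def nonlin (u v : Vec d) : Vec d := fun i m =>
  ∑ k, ∑ j, lerayDeriv i k j (freq m) * conv (u k) (v j) m

/-- Bounds at time `s` for both norms of the solution class. -/
def Bdd (N M : Vec d → ℝ≥0∞) (σ s : ℝ) (u : Vec d) (A : ℝ) : Prop :=
  N u ≤ ENNReal.ofReal A ∧ ENNReal.ofReal (s ^ σ) * M u ≤ ENNReal.ofReal A

/-- Smoothing bounds for a forcing term at time `s`. -/
def Force (N M : Vec d → ℝ≥0∞) (α a₁ γ₁ a₂ γ₂ s : ℝ) (F : Vec d) (D : ℝ) : Prop :=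
  ∀ τ, 0 < τ → τ ≤ 1 →
    N (heat α τ F) ≤ ENNReal.ofReal (D * (τ ^ (-a₁) * s ^ (-γ₁))) ∧
    M (heat α τ F) ≤ ENNReal.ofReal (D * (τ ^ (-a₂) * s ^ (-γ₂)))

/-- The exponents of a pair of norms. -/
structure Exponents (α σ a₁ γ₁ a₂ γ₂ : ℝ) : Prop where
  α_pos : 0 < α
  σ_nonneg : 0 ≤ σ
  a₁_nonneg : 0 ≤ a₁
  γ₁_nonneg : 0 ≤ γ₁
  lt_one : a₁ + γ₁ < 1
  a₂_nonneg : 0 ≤ a₂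
  a₂_lt : a₂ < 1
  γ₂_nonneg : 0 ≤ γ₂
  γ₂_lt : γ₂ < 1
  lt_add : a₂ + γ₂ < 1 + σ

/-- A pair of norms on sequences for which the equation is locally well-posed. -/
structure SeqPair (α σ a₁ γ₁ a₂ γ₂ : ℝ) (N M : Seq d → ℝ≥0∞) : Prop
    extends Exponents α σ a₁ γ₁ a₂ γ₂ where
  normN : SeqNorm N
  normM : SeqNorm M
  heat_tendsto : ∀ u, N u ≠ ⊤ →
    Tendsto (fun t => N (fun m => ((heatSymbol α t m : ℂ) - 1) * u m)) (𝓝[>] 0) (𝓝 0)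
  heat_M : ∃ C : ℝ, 0 ≤ C ∧ ∀ t, 0 < t → t ≤ 1 → ∀ u, N u ≠ ⊤ →
    ENNReal.ofReal (t ^ σ) * M (fun m => heatSymbol α t m * u m) ≤ ENNReal.ofReal C * N u
  sq : ∀ u, M u ≠ ⊤ → Summable fun m => ‖u m‖ ^ 2
  bilinear : ∃ C : ℝ, 0 ≤ C ∧ ∀ s τ, 0 < s → s ≤ 1 → 0 < τ → τ ≤ 1 → ∀ (f g : Seq d) (A B : ℝ),
    0 ≤ A → 0 ≤ B → N f ≤ ENNReal.ofReal A → ENNReal.ofReal (s ^ σ) * M f ≤ ENNReal.ofReal A →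
    N g ≤ ENNReal.ofReal B → ENNReal.ofReal (s ^ σ) * M g ≤ ENNReal.ofReal B → ∀ i k j : Fin d,
    N (fun m => lerayDeriv i k j (freq m) * heatSymbol α τ m * conv f g m) ≤
      ENNReal.ofReal (C * A * B * (τ ^ (-a₁) * s ^ (-γ₁))) ∧
    M (fun m => lerayDeriv i k j (freq m) * heatSymbol α τ m * conv f g m) ≤
      ENNReal.ofReal (C * A * B * (τ ^ (-a₂) * s ^ (-γ₂)))

/-- A pair of norms of vector fields for which the equation is locally well-posed. -/
structure VecPair (α σ a₁ γ₁ a₂ γ₂ : ℝ) (N M : Vec d → ℝ≥0∞) : Prop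
    extends Exponents α σ a₁ γ₁ a₂ γ₂ where
  normN : VecNorm N
  normM : VecNorm M
  cutoff : Nonempty (Cutoff d)
  heat_tendsto : ∀ u, N u ≠ ⊤ → Tendsto (fun t => N (heat α t u - u)) (𝓝[>] 0) (𝓝 0)
  heat_M : ∃ C : ℝ, 0 ≤ C ∧ ∀ t, 0 < t → t ≤ 1 → ∀ u, N u ≠ ⊤ →
    ENNReal.ofReal (t ^ σ) * M (heat α t u) ≤ ENNReal.ofReal C * N u
  sq : ∀ u, M u ≠ ⊤ → ∀ i, Summable fun m => ‖u i m‖ ^ 2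
  bilinear : ∃ C : ℝ, 0 ≤ C ∧ ∀ s, 0 < s → s ≤ 1 → ∀ (u v : Vec d) (A B : ℝ), 0 ≤ A → 0 ≤ B →
    Bdd N M σ s u A → Bdd N M σ s v B → Force N M α a₁ γ₁ a₂ γ₂ s (nonlin u v) (C * A * B)

theorem SeqPair.vecPair {α σ a₁ γ₁ a₂ γ₂ : ℝ} {N M : Seq d → ℝ≥0∞}
    (h : SeqPair α σ a₁ γ₁ a₂ γ₂ N M) (χ : Cutoff d) :
    VecPair α σ a₁ γ₁ a₂ γ₂ (vecNorm N) (vecNorm M) where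
  toExponents := h.toExponents
  normN := h.normN.vecNorm
  normM := h.normM.vecNorm
  cutoff := ⟨χ⟩
  heat_tendsto u hu := by
    have h1 : ∀ i, Tendsto (fun t => N ((heat α t u - u) i)) (𝓝[>] 0) (𝓝 0) := fun i => by
      have := h.heat_tendsto (u i) (ne_top_of_le_ne_top hu (le_vecNorm N u i))
      simp only [sub_mul, one_mul] at this
      exact this
    have := tendsto_finsetSum Finset.univ fun i _ => h1 i
    simpa [vecNorm] using this
  heat_M := by
    obtain ⟨C, hC, hb⟩ := h.heat_M
    refine ⟨C, hC, fun t h0 h1 u hu => ?_⟩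
    unfold vecNorm
    rw [Finset.mul_sum, Finset.mul_sum]
    exact Finset.sum_le_sum fun i _ => hb t h0 h1 (u i) (ne_top_of_le_ne_top hu (le_vecNorm N u i))
  sq u hu i := h.sq (u i) (ne_top_of_le_ne_top hu (le_vecNorm M u i))
  bilinear := by
    obtain ⟨C, hC, hb⟩ := h.bilinear
    have key : ∀ b : Seq d → ℝ≥0∞, SeqNorm b → ∀ (u v : Vec d) (τ X : ℝ), 0 ≤ X →
        (∀ i k j, b (fun m => lerayDeriv i k j (freq m) * heatSymbol α τ m * conv (u k) (v j) m) ≤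
          ENNReal.ofReal X) →
        vecNorm b (heat α τ (nonlin u v)) ≤ ENNReal.ofReal (d * (d * d) * X) := by
      intro b hbn u v τ X hX hle
      have hz : b 0 = 0 := by simpa using hbn.smul 0 0
      have hsum : ∀ (s : Finset (Fin d)) (w : Fin d → Seq d) (Y : ℝ≥0∞), (∀ k, b (w k) ≤ Y) →
          b (∑ k ∈ s, w k) ≤ s.card * Y := by
        intro s w Y hw
        induction s using Finset.induction_on with
        | empty => simp [hz]
        | insert a s ha ih =>
          rw [Finset.sum_insert ha, Finset.card_insert_of_notMem ha]
          refine (hbn.add _ _).trans ((add_le_add (hw a) ih).trans_eq ?_)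
          push_cast; ring
      refine (vecNorm_le b _ (B := d * (d * ENNReal.ofReal X)) fun i => ?_).trans_eq ?_
      · have e : heat α τ (nonlin u v) i = ∑ k, ∑ j, fun m =>
            lerayDeriv i k j (freq m) * heatSymbol α τ m * conv (u k) (v j) m := by
          ext m
          simp only [heat, nonlin, Finset.mul_sum, Finset.sum_apply]
          refine Finset.sum_congr rfl fun k _ => Finset.sum_congr rfl fun j _ => by ring
        rw [e]
        refine (hsum _ _ (d * ENNReal.ofReal X) fun k => ?_).trans_eq (by simp)
        exact (hsum _ _ (ENNReal.ofReal X) fun j => hle i k j).trans_eq (by simp)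
      · rw [ENNReal.ofReal_mul (by positivity), ENNReal.ofReal_mul (by positivity),
          ENNReal.ofReal_mul (by positivity), ENNReal.ofReal_natCast]
        ring
    refine ⟨d * (d * d) * C, by positivity, fun s h0 h1 u v A B hA hB hu hv τ t0 t1 => ?_⟩
    have hb' := fun k j => hb s τ h0 h1 t0 t1 (u k) (v j) A B hA hB
      ((le_vecNorm N u k).trans hu.1) (le_trans (by gcongr; exact le_vecNorm M u k) hu.2)
      ((le_vecNorm N v j).trans hv.1) (le_trans (by gcongr; exact le_vecNorm M v j) hv.2)
    constructor
    · refine (key N h.normN u v τ _ (by positivity) fun i k j => (hb' k j i k j).1).trans_eq ?_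
      congr 1; ring
    · refine (key M h.normM u v τ _ (by positivity) fun i k j => (hb' k j i k j).2).trans_eq ?_
      congr 1; ring

/-! ### Algebra of the nonlinearity -/

theorem conv_add_left {a a' b : Seq d} (ha : Summable fun m => ‖a m‖ ^ 2)
    (ha' : Summable fun m => ‖a' m‖ ^ 2) (hb : Summable fun m => ‖b m‖ ^ 2) :
    conv (a + a') b = conv a b + conv a' b := by
  ext m
  simp only [conv, Pi.add_apply, add_mul]
  exact (summable_conv ha hb m).of_norm.tsum_add (summable_conv ha' hb m).of_norm

theorem conv_add_right {a b b' : Seq d} (ha : Summable fun m => ‖a m‖ ^ 2)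
    (hb : Summable fun m => ‖b m‖ ^ 2) (hb' : Summable fun m => ‖b' m‖ ^ 2) :
    conv a (b + b') = conv a b + conv a b' := by
  ext m
  simp only [conv, Pi.add_apply, mul_add]
  exact (summable_conv ha hb m).of_norm.tsum_add (summable_conv ha hb' m).of_norm

theorem conv_neg_left (a b : Seq d) : conv (-a) b = -conv a b := by
  ext m; simp [conv, tsum_neg]

theorem conv_neg_right (a b : Seq d) : conv a (-b) = -conv a b := by
  ext m; simp [conv, tsum_neg]

/-- The components are square summable. -/
def IsSq (u : Vec d) : Prop := ∀ i, Summable fun m => ‖u i m‖ ^ 2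

theorem IsSq.neg {u : Vec d} (h : IsSq u) : IsSq (-u) := fun i => by simpa using h i

theorem IsSq.add {u v : Vec d} (h : IsSq u) (h' : IsSq v) : IsSq (u + v) := fun i => by
  refine Summable.of_nonneg_of_le (fun _ => by positivity) (fun m => ?_)
    (((h i).add (h' i)).mul_left 2)
  have h1 : ‖(u + v) i m‖ ≤ ‖u i m‖ + ‖v i m‖ := norm_add_le _ _
  nlinarith [norm_nonneg ((u + v) i m), sq_nonneg (‖u i m‖ - ‖v i m‖)]

theorem nonlin_add_left {u u' v : Vec d} (hu : IsSq u) (hu' : IsSq u') (hv : IsSq v) :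
    nonlin (u + u') v = nonlin u v + nonlin u' v := by
  ext i m
  simp only [nonlin, Pi.add_apply, ← Finset.sum_add_distrib]
  refine Finset.sum_congr rfl fun k _ => Finset.sum_congr rfl fun j _ => ?_
  rw [conv_add_left (hu k) (hu' k) (hv j), Pi.add_apply, mul_add]

theorem nonlin_add_right {u v v' : Vec d} (hu : IsSq u) (hv : IsSq v) (hv' : IsSq v') :
    nonlin u (v + v') = nonlin u v + nonlin u v' := by
  ext i m
  simp only [nonlin, Pi.add_apply, ← Finset.sum_add_distrib]
  refine Finset.sum_congr rfl fun k _ => Finset.sum_congr rfl fun j _ => ?_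
  rw [conv_add_right (hu k) (hv j) (hv' j), Pi.add_apply, mul_add]

theorem nonlin_neg_left (u v : Vec d) : nonlin (-u) v = -nonlin u v := by
  ext i m
  simp [nonlin, conv_neg_left]

theorem nonlin_neg_right (u v : Vec d) : nonlin u (-v) = -nonlin u v := by
  ext i m
  simp [nonlin, conv_neg_right]

theorem nonlin_sub_nonlin {u v : Vec d} (hu : IsSq u) (hv : IsSq v) :
    nonlin u u - nonlin v v = nonlin (u - v) u + nonlin v (u - v) := by
  rw [sub_eq_add_neg u v, nonlin_add_left hu hv.neg hu, nonlin_add_right hv hu hv.neg,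
    nonlin_neg_left, nonlin_neg_right]
  abel

theorem heat_add (α t : ℝ) (u v : Vec d) : heat α t (u + v) = heat α t u + heat α t v := by
  ext i m; simp [heat, mul_add]

theorem heat_sub (α t : ℝ) (u v : Vec d) : heat α t (u - v) = heat α t u - heat α t v := by
  ext i m; simp [heat, mul_sub]

theorem heat_heat (α s t : ℝ) (u : Vec d) : heat α s (heat α t u) = heat α (s + t) u := by
  ext i m; simp [heat, heatSymbol_add, mul_assoc]

theorem heat_zero (α : ℝ) (u : Vec d) : heat α 0 u = u := by
  ext i m; simp [heat, heatSymbol_zero]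

section Bdd

variable {N M : Vec d → ℝ≥0∞} {σ s A B : ℝ} {u v : Vec d}

theorem Bdd.mono (h : Bdd N M σ s u A) (hAB : A ≤ B) : Bdd N M σ s u B :=
  ⟨h.1.trans (by gcongr), h.2.trans (by gcongr)⟩

theorem Bdd.add (hN : VecNorm N) (hM : VecNorm M) (hA : 0 ≤ A) (hB : 0 ≤ B)
    (h : Bdd N M σ s u A) (h' : Bdd N M σ s v B) : Bdd N M σ s (u + v) (A + B) := by
  unfold Bdd
  rw [ENNReal.ofReal_add hA hB]
  refine ⟨(hN.add _ _).trans (add_le_add h.1 h'.1), ?_⟩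
  refine le_trans ?_ (add_le_add h.2 h'.2)
  rw [← mul_add]
  gcongr
  exact hM.add _ _

theorem Bdd.neg (hN : VecNorm N) (hM : VecNorm M) (h : Bdd N M σ s u A) : Bdd N M σ s (-u) A := by
  unfold Bdd
  rw [hN.neg, hM.neg]
  exact h

theorem Bdd.sub (hN : VecNorm N) (hM : VecNorm M) (hA : 0 ≤ A) (hB : 0 ≤ B)
    (h : Bdd N M σ s u A) (h' : Bdd N M σ s v B) : Bdd N M σ s (u - v) (A + B) := by
  rw [sub_eq_add_neg]
  exact h.add hN hM hA hB (h'.neg hN hM)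

theorem Bdd.ne_top (h : Bdd N M σ s u A) : N u ≠ ⊤ := ne_top_of_le_ne_top ENNReal.ofReal_ne_top h.1

theorem Bdd.M_le (h : Bdd N M σ s u A) (hs : 0 < s) :
    M u ≤ ENNReal.ofReal (A * s ^ (-σ)) := by
  have h0 : 0 < s ^ σ := Real.rpow_pos_of_pos hs σ
  rw [Real.rpow_neg hs.le, ← div_eq_mul_inv, ENNReal.ofReal_div_of_pos h0,
    ENNReal.le_div_iff_mul_le (by simp [h0]) (by simp), mul_comm]
  exact h.2

theorem Bdd.mul (hN : VecNorm N) (hM : VecNorm M) (h : Bdd N M σ s u A) (hs : 0 < s) {c : Seq d}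
    {C : ℝ} (hC : 0 ≤ C) (hc : MulBound c C) : Bdd N M σ s (fun i m => c m * u i m) (C * A) := by
  unfold Bdd
  rw [ENNReal.ofReal_mul hC]
  refine ⟨(hN.mul c C hC hc u h.ne_top).trans (by gcongr; exact h.1), ?_⟩
  calc _ ≤ ENNReal.ofReal (s ^ σ) * (ENNReal.ofReal C * M u) := by
        gcongr
        exact hM.mul c C hC hc u (ne_top_of_le_ne_top ENNReal.ofReal_ne_top (h.M_le hs))
    _ = ENNReal.ofReal C * (ENNReal.ofReal (s ^ σ) * M u) := by ring
    _ ≤ _ := by gcongr; exact h.2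

end Bdd

theorem Force.mono {N M : Vec d → ℝ≥0∞} {α a₁ γ₁ a₂ γ₂ s : ℝ} {F : Vec d} {D D' : ℝ}
    (h : Force N M α a₁ γ₁ a₂ γ₂ s F D) (hs : 0 ≤ s) (hD : D ≤ D') :
    Force N M α a₁ γ₁ a₂ γ₂ s F D' := fun τ h0 h1 =>
  ⟨(h τ h0 h1).1.trans (by gcongr), (h τ h0 h1).2.trans (by gcongr)⟩

theorem Force.add {N M : Vec d → ℝ≥0∞} (hN : VecNorm N) (hM : VecNorm M) {α a₁ γ₁ a₂ γ₂ s : ℝ}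
    {F G : Vec d} {D E : ℝ} (hs : 0 ≤ s) (hD : 0 ≤ D) (hE : 0 ≤ E)
    (h : Force N M α a₁ γ₁ a₂ γ₂ s F D) (h' : Force N M α a₁ γ₁ a₂ γ₂ s G E) :
    Force N M α a₁ γ₁ a₂ γ₂ s (F + G) (D + E) := fun τ h0 h1 => by
  rw [heat_add, add_mul, add_mul, ENNReal.ofReal_add (by positivity) (by positivity),
    ENNReal.ofReal_add (by positivity) (by positivity)]
  exact ⟨(hN.add _ _).trans (add_le_add (h τ h0 h1).1 (h' τ h0 h1).1),
    (hM.add _ _).trans (add_le_add (h τ h0 h1).2 (h' τ h0 h1).2)⟩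

end FracNS
end

noncomputable section
namespace FracNS
variable {d : ℕ}

/-! ### Singular kernels -/

theorem lintegral_rpow_neg {γ : ℝ} (hγ : γ < 1) {t : ℝ} (ht : 0 < t) :
    ∫⁻ s in Ioo 0 t, ENNReal.ofReal (s ^ (-γ)) = ENNReal.ofReal (t ^ (1 - γ) / (1 - γ)) := by
  have hi : IntervalIntegrable (fun s : ℝ => s ^ (-γ)) volume 0 t :=
    intervalIntegral.intervalIntegrable_rpow' (by linarith)
  rw [intervalIntegrable_iff_integrableOn_Ioo_of_le ht.le] at hi
  rw [← ofReal_integral_eq_lintegral_ofReal hi]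
  · congr 1
    rw [← integral_Ioc_eq_integral_Ioo, ← intervalIntegral.integral_of_le ht.le,
      integral_rpow (Or.inl (by linarith)), Real.zero_rpow (by linarith)]
    ring_nf
  · filter_upwards [ae_restrict_mem measurableSet_Ioo] with s hs
    exact Real.rpow_nonneg hs.1.le _

theorem lintegral_sub_rpow_neg {a : ℝ} (ha : a < 1) {r t : ℝ} (ht : r < t) :
    ∫⁻ s in Ioo r t, ENNReal.ofReal ((t - s) ^ (-a)) =
      ENNReal.ofReal ((t - r) ^ (1 - a) / (1 - a)) := by
  rw [← lintegral_rpow_neg ha (sub_pos.2 ht), ← lintegral_indicator measurableSet_Ioo,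
    ← lintegral_indicator measurableSet_Ioo, ← lintegral_sub_left_eq_self _ t]
  congr 1 with s
  by_cases hs : s ∈ Ioo 0 (t - r)
  · rw [indicator_of_mem hs, indicator_of_mem (show t - s ∈ Ioo r t from ⟨by linarith [hs.2], by linarith [hs.1]⟩)]
    simp
  · rw [indicator_of_notMem hs, indicator_of_notMem]
    intro h; exact hs ⟨by linarith [h.2], by linarith [h.1]⟩

theorem kernel_le {a γ : ℝ} (ha : 0 ≤ a) (ha' : a < 1) (hγ : 0 ≤ γ) (hγ' : γ < 1) {t : ℝ} (ht : 0 < t) :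
    ∫⁻ s in Ioo 0 t, ENNReal.ofReal ((t - s) ^ (-a) * s ^ (-γ)) ≤
      ENNReal.ofReal ((4 / (1 - γ) + 4 / (1 - a)) * t ^ (1 - γ - a)) := by
  have hbd : ∀ {x y : ℝ}, 0 ≤ x → x < 1 → 0 ≤ y → t / 2 ≤ y → y ^ (-x) ≤ 4 * t ^ (-x) := by
    intro x y hx hx' hy hty
    calc y ^ (-x) ≤ (t / 2) ^ (-x) := Real.rpow_le_rpow_of_nonpos (by positivity) hty (by linarith)
      _ = 2 ^ x * t ^ (-x) := by
        rw [Real.div_rpow ht.le zero_le_two, Real.rpow_neg zero_le_two]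
        field_simp
      _ ≤ _ := by
        gcongr
        calc (2 : ℝ) ^ x ≤ 2 ^ (1 : ℝ) := Real.rpow_le_rpow_of_exponent_le one_le_two hx'.le
          _ ≤ 4 := by norm_num
  calc _ ≤ ∫⁻ s in Ioo 0 t, (ENNReal.ofReal (4 * t ^ (-a)) * ENNReal.ofReal (s ^ (-γ)) +
        ENNReal.ofReal (4 * t ^ (-γ)) * ENNReal.ofReal ((t - s) ^ (-a))) := by
        refine setLIntegral_mono' measurableSet_Ioo fun s hs => ?_
        have h1 : 0 ≤ s ^ (-γ) := Real.rpow_nonneg hs.1.le _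
        have h2 : 0 ≤ (t - s) ^ (-a) := Real.rpow_nonneg (by linarith [hs.2]) _
        rw [← ENNReal.ofReal_mul (by positivity), ← ENNReal.ofReal_mul (by positivity),
          ← ENNReal.ofReal_add (by positivity) (by positivity)]
        refine ENNReal.ofReal_le_ofReal ?_
        have h3 : 0 ≤ t ^ (-a) := by positivity
        have h4 : 0 ≤ t ^ (-γ) := by positivity
        rcases le_total s (t / 2) with h | h
        · have := hbd ha ha' (by linarith [hs.2]) (by linarith : t / 2 ≤ t - s)
          have : (t - s) ^ (-a) * s ^ (-γ) ≤ 4 * t ^ (-a) * s ^ (-γ) := by gcongr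
          have : 0 ≤ 4 * t ^ (-γ) * (t - s) ^ (-a) := by positivity
          linarith
        · have := hbd hγ hγ' hs.1.le h
          have : (t - s) ^ (-a) * s ^ (-γ) ≤ (t - s) ^ (-a) * (4 * t ^ (-γ)) := by gcongr
          have : 0 ≤ 4 * t ^ (-a) * s ^ (-γ) := by positivity
          linarith
    _ = ENNReal.ofReal (4 * t ^ (-a)) * ENNReal.ofReal (t ^ (1 - γ) / (1 - γ)) +
        ENNReal.ofReal (4 * t ^ (-γ)) * ENNReal.ofReal (t ^ (1 - a) / (1 - a)) := by
        rw [lintegral_add_left (by fun_prop), lintegral_const_mul _ (by fun_prop),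
          lintegral_const_mul _ (by fun_prop), lintegral_rpow_neg hγ' ht,
          lintegral_sub_rpow_neg ha' ht, sub_zero]
    _ ≤ _ := by
        have : 0 < 1 - γ := by linarith
        have : 0 < 1 - a := by linarith
        rw [← ENNReal.ofReal_mul (by positivity), ← ENNReal.ofReal_mul (by positivity),
          ← ENNReal.ofReal_add (by positivity) (by positivity)]
        refine ENNReal.ofReal_le_ofReal (le_of_eq ?_)
        have e1 : t ^ (1 - γ - a) = t ^ (-a) * t ^ (1 - γ) := by
          rw [← Real.rpow_add ht]; ring_nf
        have e2 : t ^ (-a) * t ^ (1 - γ) = t ^ (-γ) * t ^ (1 - a) := by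
          rw [← Real.rpow_add ht, ← Real.rpow_add ht]; ring_nf
        rw [e1]
        linear_combination (-4 / (1 - a)) * e2

theorem exists_kernel_exp_le {a γ σ : ℝ} (ha : 0 ≤ a) (ha' : a < 1) (hγ : 0 ≤ γ) (hγ' : γ < 1)
    (h : a + γ < 1 + σ) {ε : ℝ} (hε : 0 < ε) : ∃ l₀ : ℝ, 0 ≤ l₀ ∧ ∀ l ≥ l₀, ∀ t, 0 < t → t ≤ 1 →
      ∫⁻ s in Ioo 0 t, ENNReal.ofReal (Real.exp (l * s) * ((t - s) ^ (-a) * s ^ (-γ))) ≤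
        ENNReal.ofReal (ε * t ^ (-σ) * Real.exp (l * t)) := by
  obtain ⟨δ, hδ0, hδ⟩ : ∃ δ : ℝ, 0 < δ ∧ δ < min (1 - a) (1 + σ - a - γ) :=
    exists_between (lt_min (by linarith) (by linarith))
  have hδ1 := hδ.trans_le (min_le_left _ _)
  have hδ2 := hδ.trans_le (min_le_right _ _)
  set K := 4 / (1 - γ) + 4 / (1 - (a + δ)) with hK
  have hK0 : 0 ≤ K := by
    have : 0 < 1 - γ := by linarith
    have : 0 < 1 - (a + δ) := by linarith
    positivity
  have hlim : Tendsto (fun l : ℝ => l ^ (-δ) * K) atTop (𝓝 (0 * K)) :=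
    (tendsto_rpow_neg_atTop hδ0).mul_const K
  rw [zero_mul] at hlim
  obtain ⟨l₀, hl₀⟩ := eventually_atTop.1 (hlim.eventually (gt_mem_nhds hε))
  refine ⟨max l₀ 1, by positivity, fun l hl t ht ht1 => ?_⟩
  have hl0 : 0 < l := zero_lt_one.trans_le ((le_max_right _ _).trans hl)
  have hlK := hl₀ l ((le_max_left _ _).trans hl)
  calc _ ≤ ∫⁻ s in Ioo 0 t, ENNReal.ofReal (l ^ (-δ) * Real.exp (l * t)) *
        ENNReal.ofReal ((t - s) ^ (-(a + δ)) * s ^ (-γ)) := by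
        refine setLIntegral_mono' measurableSet_Ioo fun s hs => ?_
        have hts : 0 < t - s := by linarith [hs.2]
        have h1 : 0 ≤ s ^ (-γ) := Real.rpow_nonneg hs.1.le _
        rw [← ENNReal.ofReal_mul (by positivity)]
        refine ENNReal.ofReal_le_ofReal ?_
        have hx : Real.exp (-(l * (t - s))) ≤ (l * (t - s)) ^ (-δ) := by
          set x := l * (t - s)
          have hx0 : 0 < x := by positivity
          rw [Real.exp_neg, Real.rpow_neg hx0.le]
          refine inv_anti₀ (by positivity) ?_
          rcases le_total x 1 with h | h
          · exact (Real.rpow_le_one hx0.le h hδ0.le).trans (Real.one_le_exp hx0.le)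
          · calc x ^ δ ≤ x ^ (1 : ℝ) := Real.rpow_le_rpow_of_exponent_le h (by linarith)
              _ = x := Real.rpow_one x
              _ ≤ _ := by have := Real.add_one_le_exp x; linarith
        rw [Real.mul_rpow hl0.le hts.le] at hx
        have e : Real.exp (l * s) = Real.exp (l * t) * Real.exp (-(l * (t - s))) := by
          rw [← Real.exp_add]; ring_nf
        have e2 : (t - s) ^ (-(a + δ)) = (t - s) ^ (-a) * (t - s) ^ (-δ) := by
          rw [← Real.rpow_add hts]; ring_nf
        rw [e, e2]
        calc _ ≤ Real.exp (l * t) * (l ^ (-δ) * (t - s) ^ (-δ)) * ((t - s) ^ (-a) * s ^ (-γ)) := by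
              gcongr
          _ = _ := by ring
    _ = ENNReal.ofReal (l ^ (-δ) * Real.exp (l * t)) *
        ∫⁻ s in Ioo 0 t, ENNReal.ofReal ((t - s) ^ (-(a + δ)) * s ^ (-γ)) :=
        lintegral_const_mul' _ _ ENNReal.ofReal_ne_top
    _ ≤ ENNReal.ofReal (l ^ (-δ) * Real.exp (l * t)) * ENNReal.ofReal (K * t ^ (1 - γ - (a + δ))) := by
        gcongr
        exact kernel_le (by linarith) (by linarith) hγ hγ' ht
    _ ≤ _ := by
        rw [← ENNReal.ofReal_mul (by positivity)]
        refine ENNReal.ofReal_le_ofReal ?_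
        have h3 : t ^ (1 - γ - (a + δ)) ≤ t ^ (-σ) :=
          Real.rpow_le_rpow_of_exponent_ge ht ht1 (by linarith)
        calc _ = (l ^ (-δ) * K) * Real.exp (l * t) * t ^ (1 - γ - (a + δ)) := by ring
          _ ≤ ε * Real.exp (l * t) * t ^ (-σ) := by gcongr
          _ = _ := by ring

/-! ### Forcing terms and the Duhamel integral -/

/-- The Duhamel integral `∫_0^t e^{-(t-s)Λ} F(s) ds`. -/
def duh (α : ℝ) (F : ℝ → Vec d) (t : ℝ) : Vec d := fun i m =>
  ∫ s in Ioo 0 t, heatSymbol α (t - s) m * F s i m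

variable {α σ a₁ γ₁ a₂ γ₂ : ℝ} {N M : Vec d → ℝ≥0∞}

theorem VecPair.force_coeff (h : VecPair α σ a₁ γ₁ a₂ γ₂ N M) : ∃ (C : ℝ) (K : ℕ), 0 ≤ C ∧
    ∀ s F D, 0 < s → 0 ≤ D → Force N M α a₁ γ₁ a₂ γ₂ s F D → ∀ τ, 0 < τ → τ ≤ 1 → ∀ i m,
      ‖heat α τ F i m‖ ≤ C * wt m ^ K * (D * (τ ^ (-a₁) * s ^ (-γ₁))) := by
  obtain ⟨C, K, hC, hb⟩ := h.normN.coeff_real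
  exact ⟨C, K, hC, fun s F D hs hD hF τ h0 h1 i m =>
    hb (heat α τ F) _ (by positivity) (hF τ h0 h1).1 i m⟩

theorem VecPair.force_summable (h : VecPair α σ a₁ γ₁ a₂ γ₂ N M) {s D τ : ℝ} {F : Vec d}
    (hs : 0 < s) (hD : 0 ≤ D) (hF : Force N M α a₁ γ₁ a₂ γ₂ s F D) (h0 : 0 < τ) (h1 : τ ≤ 1)
    (i : Fin d) : Summable fun m => ‖heat α τ F i m‖ := by
  obtain ⟨C, K, hC, hb⟩ := h.force_coeff
  obtain ⟨C', hC', hb'⟩ := heatSymbol_le (d := d) h.α_pos (K + 2 * d) (half_pos h0)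
  set X := D * ((τ / 2) ^ (-a₁) * s ^ (-γ₁)) with hX
  have hX0 : 0 ≤ X := by positivity
  refine Summable.of_nonneg_of_le (fun _ => norm_nonneg _) (fun m => ?_)
    ((summable_wt_mul (d := d) K).mul_left (C * X * C'))
  have h2 := hb s F D hs hD hF (τ / 2) (by linarith) (by linarith) i m
  have e : heat α τ F i m = heatSymbol α (τ / 2) m * heat α (τ / 2) F i m := by
    have := congrFun (congrFun (heat_heat α (τ / 2) (τ / 2) F) i) m
    rw [add_halves] at this
    rw [← this]; rfl
  rw [e, norm_mul, Complex.norm_real, Real.norm_of_nonneg (heatSymbol_pos α _ m).le]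
  have hw := wt_pos m
  calc _ ≤ (C' * (wt m ^ (K + 2 * d))⁻¹) * (C * wt m ^ K * X) :=
        mul_le_mul (hb' _ le_rfl m) h2 (norm_nonneg _) (by positivity)
    _ = _ := by ring

theorem integrableOn_kernel {a γ : ℝ} (ha : 0 ≤ a) (ha' : a < 1) (hγ : 0 ≤ γ) (hγ' : γ < 1) {t : ℝ}
    (ht : 0 < t) : IntegrableOn (fun s => (t - s) ^ (-a) * s ^ (-γ)) (Ioo 0 t) := by
  refine ⟨Measurable.aestronglyMeasurable (by fun_prop), ?_⟩
  rw [hasFiniteIntegral_iff_ofReal]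
  · exact (kernel_le ha ha' hγ hγ' ht).trans_lt ENNReal.ofReal_lt_top
  · filter_upwards [ae_restrict_mem measurableSet_Ioo] with s hs
    have : 0 < t - s := by linarith [hs.2]
    have := hs.1
    positivity

theorem Exponents.γ₁_lt (h : Exponents α σ a₁ γ₁ a₂ γ₂) : γ₁ < 1 := by
  linarith [h.lt_one, h.a₁_nonneg]

theorem Exponents.a₁_lt (h : Exponents α σ a₁ γ₁ a₂ γ₂) : a₁ < 1 := by
  linarith [h.lt_one, h.γ₁_nonneg]

theorem VecPair.integrableOn_duh (h : VecPair α σ a₁ γ₁ a₂ γ₂ N M) {F : ℝ → Vec d} {D t : ℝ}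
    (hD : 0 ≤ D) (ht : 0 < t) (ht1 : t ≤ 1)
    (hm : ∀ i m, AEStronglyMeasurable (fun s => F s i m) (volume.restrict (Ioo 0 t)))
    (hF : ∀ᵐ s ∂(volume.restrict (Ioo 0 t)), Force N M α a₁ γ₁ a₂ γ₂ s (F s) D) (i : Fin d)
    (m : Fin d → ℤ) : IntegrableOn (fun s => heatSymbol α (t - s) m * F s i m) (Ioo 0 t) := by
  obtain ⟨C, K, hC, hb⟩ := h.force_coeff
  refine Integrable.mono' ((integrableOn_kernel h.a₁_nonneg h.a₁_lt h.γ₁_nonneg h.γ₁_lt ht).const_mul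
    (C * wt m ^ K * D)) ?_ ?_
  · refine AEStronglyMeasurable.mul ?_ (hm i m)
    have := (continuous_heatSymbol α m).comp (continuous_const.sub continuous_id : Continuous fun s => t - s)
    exact (Complex.continuous_ofReal.comp this).aestronglyMeasurable
  · filter_upwards [hF, ae_restrict_mem measurableSet_Ioo] with s hs hst
    refine (hb s (F s) D hst.1 hD hs (t - s) (by linarith [hst.2]) (by linarith [hst.1]) i m).trans_eq ?_
    ring

/-- The Duhamel integral gains a small factor in exponentially weighted norms. -/
theorem VecPair.duh_bdd (h : VecPair α σ a₁ γ₁ a₂ γ₂ N M) {ε : ℝ} (hε : 0 < ε) :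
    ∃ l : ℝ, 0 ≤ l ∧ ∀ (F : ℝ → Vec d) (D T : ℝ), 0 ≤ D → T ≤ 1 →
      (∀ i m, AEStronglyMeasurable (fun s => F s i m) (volume.restrict (Ioo 0 T))) →
      (∀ᵐ s ∂(volume.restrict (Ioo 0 T)), Force N M α a₁ γ₁ a₂ γ₂ s (F s) (D * Real.exp (l * s))) →
      ∀ t, 0 < t → t ≤ T → Bdd N M σ t (duh α F t) (ε * D * Real.exp (l * t)) := by
  obtain ⟨CN, hCN, hN⟩ := h.normN.integral
  obtain ⟨CM, hCM, hM⟩ := h.normM.integral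
  set ε' := ε / (CN + CM + 1) with hε'
  have hε0 : 0 < ε' := by positivity
  obtain ⟨l₁, hl₁, hk₁⟩ := exists_kernel_exp_le (σ := 0) h.a₁_nonneg h.a₁_lt h.γ₁_nonneg h.γ₁_lt
    (by linarith [h.lt_one]) hε0
  obtain ⟨l₂, hl₂, hk₂⟩ := exists_kernel_exp_le h.a₂_nonneg h.a₂_lt h.γ₂_nonneg h.γ₂_lt h.lt_add hε0
  refine ⟨max l₁ l₂, by positivity, fun F D T hD hT hm hF t ht htT => ?_⟩
  set l := max l₁ l₂ with hl
  have hsub : Ioo 0 t ⊆ Ioo 0 T := Ioo_subset_Ioo_right htT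
  have hF' : ∀ᵐ s ∂(volume.restrict (Ioo 0 t)),
      Force N M α a₁ γ₁ a₂ γ₂ s (F s) (D * Real.exp (l * s)) :=
    ae_mono (Measure.restrict_mono hsub le_rfl) hF
  have hm' : ∀ i m, AEStronglyMeasurable (fun s => heat α (t - s) (F s) i m)
      (volume.restrict (Ioo 0 t)) := fun i m => by
    refine AEStronglyMeasurable.mul ?_ ((hm i m).mono_measure (Measure.restrict_mono hsub le_rfl))
    have := (continuous_heatSymbol α m).comp (continuous_const.sub continuous_id : Continuous fun s => t - s)
    exact (Complex.continuous_ofReal.comp this).aestronglyMeasurable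
  have hs' : ∀ᵐ s ∂(volume.restrict (Ioo 0 t)), ∀ i, Summable fun m => ‖heat α (t - s) (F s) i m‖ := by
    filter_upwards [hF', ae_restrict_mem measurableSet_Ioo] with s hs hst i
    exact h.force_summable hst.1 (by positivity) hs (by linarith [hst.2]) (by linarith [hst.1]) i
  have key : ∀ (b : Vec d → ℝ≥0∞) (C ς a γ : ℝ), 0 ≤ C → C ≤ CN + CM + 1 →
      (∀ (I : Set ℝ) (f : ℝ → Vec d) (w : ℝ → ℝ≥0∞),
        (∀ i m, AEStronglyMeasurable (fun s => f s i m) (volume.restrict I)) →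
        (∀ᵐ s ∂(volume.restrict I), ∀ i, Summable fun m => ‖f s i m‖) → Measurable w →
        (∀ᵐ s ∂(volume.restrict I), b (f s) ≤ w s) →
        b (fun i m => ∫ s in I, f s i m) ≤ ENNReal.ofReal C * ∫⁻ s in I, w s) →
      (∫⁻ s in Ioo 0 t, ENNReal.ofReal (Real.exp (l * s) * ((t - s) ^ (-a) * s ^ (-γ))) ≤
        ENNReal.ofReal (ε' * t ^ (-ς) * Real.exp (l * t))) →
      (∀ᵐ s ∂(volume.restrict (Ioo 0 t)), b (heat α (t - s) (F s)) ≤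
        ENNReal.ofReal (D * Real.exp (l * s) * ((t - s) ^ (-a) * s ^ (-γ)))) →
      ENNReal.ofReal (t ^ ς) * b (duh α F t) ≤ ENNReal.ofReal (ε * D * Real.exp (l * t)) := by
    intro b C ς a γ hC hC' hint hker hle
    have h1 := hint (Ioo 0 t) (fun s => heat α (t - s) (F s))
      (fun s => ENNReal.ofReal (D * Real.exp (l * s) * ((t - s) ^ (-a) * s ^ (-γ)))) hm' hs'
      (by fun_prop) hle
    have e : (fun i m => ∫ s in Ioo 0 t, heat α (t - s) (F s) i m) = duh α F t := rfl
    rw [e] at h1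
    have e2 : ∫⁻ s in Ioo 0 t, ENNReal.ofReal (D * Real.exp (l * s) * ((t - s) ^ (-a) * s ^ (-γ))) =
        ENNReal.ofReal D *
        ∫⁻ s in Ioo 0 t, ENNReal.ofReal (Real.exp (l * s) * ((t - s) ^ (-a) * s ^ (-γ))) := by
      rw [← lintegral_const_mul' _ _ ENNReal.ofReal_ne_top]
      refine lintegral_congr fun s => ?_
      rw [mul_assoc, ENNReal.ofReal_mul hD]
    rw [e2] at h1
    calc _ ≤ ENNReal.ofReal (t ^ ς) * (ENNReal.ofReal C * (ENNReal.ofReal D *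
          ENNReal.ofReal (ε' * t ^ (-ς) * Real.exp (l * t)))) := by
          gcongr
          exact h1.trans (by gcongr)
      _ = ENNReal.ofReal (C * D * ε' * Real.exp (l * t)) := by
          rw [← ENNReal.ofReal_mul hD, ← ENNReal.ofReal_mul hC, ← ENNReal.ofReal_mul (by positivity)]
          congr 1
          rw [Real.rpow_neg ht.le]
          have : t ^ ς ≠ 0 := by positivity
          field_simp
      _ ≤ _ := by
          refine ENNReal.ofReal_le_ofReal ?_
          have : C * ε' ≤ ε := by
            rw [hε', mul_div_assoc', div_le_iff₀ (by positivity)]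
            nlinarith
          calc _ = (C * ε') * D * Real.exp (l * t) := by ring
            _ ≤ _ := by gcongr
  constructor
  · have := key N CN 0 a₁ γ₁ hCN (by linarith) hN (hk₁ l (le_max_left _ _) t ht (htT.trans hT)) (by
      filter_upwards [hF', ae_restrict_mem measurableSet_Ioo] with s hs hst
      exact (hs (t - s) (by linarith [hst.2]) (by linarith [hst.1])).1)
    simpa using this
  · exact key M CM σ a₂ γ₂ hCM (by linarith) hM (hk₂ l (le_max_right _ _) t ht (htT.trans hT)) (by
      filter_upwards [hF', ae_restrict_mem measurableSet_Ioo] with s hs hst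
      exact (hs (t - s) (by linarith [hst.2]) (by linarith [hst.1])).2)

end FracNS
end

noncomputable section
namespace FracNS
variable {d : ℕ}

/-! ### Measurability -/

/-- The Fourier coefficients are measurable in time. -/
def CoeffMeas (T : ℝ) (u : ℝ → Vec d) : Prop :=
  ∀ i m, AEStronglyMeasurable (fun s => u s i m) (volume.restrict (Ioo 0 T))

theorem CoeffMeas.mono {T T' : ℝ} {u : ℝ → Vec d} (h : CoeffMeas T u) (hT : T' ≤ T) : CoeffMeas T' u :=
  fun i m => (h i m).mono_measure (Measure.restrict_mono (Ioo_subset_Ioo_right hT) le_rfl)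

theorem CoeffMeas.sub {T : ℝ} {u v : ℝ → Vec d} (h : CoeffMeas T u) (h' : CoeffMeas T v) :
    CoeffMeas T fun s => u s - v s := fun i m => (h i m).sub (h' i m)

theorem coeffMeas_heat (α T : ℝ) (u : Vec d) : CoeffMeas T fun t => heat α t u := fun _ m =>
  ((Complex.continuous_ofReal.comp (continuous_heatSymbol α m)).mul continuous_const).aestronglyMeasurable

theorem CoeffMeas.of_tendsto {T : ℝ} {u : ℕ → ℝ → Vec d} {v : ℝ → Vec d}
    (h : ∀ n, CoeffMeas T (u n))
    (hl : ∀ t ∈ Ioo 0 T, ∀ i m, Tendsto (fun n => u n t i m) atTop (𝓝 (v t i m))) : CoeffMeas T v :=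
  fun i m => aestronglyMeasurable_of_tendsto_ae atTop (fun n => h n i m) (by
    filter_upwards [ae_restrict_mem measurableSet_Ioo] with t ht using hl t ht i m)

theorem aestronglyMeasurable_conv {S : Type*} [MeasurableSpace S] {ν : Measure S} {a b : S → Seq d}
    (ha : ∀ m, AEStronglyMeasurable (fun s => a s m) ν)
    (hb : ∀ m, AEStronglyMeasurable (fun s => b s m) ν)
    (ha2 : ∀ᵐ s ∂ν, Summable fun m => ‖a s m‖ ^ 2)
    (hb2 : ∀ᵐ s ∂ν, Summable fun m => ‖b s m‖ ^ 2) (m : Fin d → ℤ) :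
    AEStronglyMeasurable (fun s => conv (a s) (b s) m) ν := by
  refine aestronglyMeasurable_of_tendsto_ae (u := (atTop : Filter (Finset (Fin d → ℤ))))
    (f := fun F s => ∑ k ∈ F, a s k * b s (m - k)) (fun F => ?_) ?_
  · exact Finset.aestronglyMeasurable_fun_sum _ fun k _ => (ha k).mul (hb (m - k))
  · filter_upwards [ha2, hb2] with s h1 h2
    exact (summable_conv h1 h2 m).of_norm.hasSum

theorem CoeffMeas.nonlin {T : ℝ} {u : ℝ → Vec d} (h : CoeffMeas T u)
    (hs : ∀ᵐ s ∂(volume.restrict (Ioo 0 T)), IsSq (u s)) :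
    CoeffMeas T fun s => nonlin (u s) (u s) := fun i m => by
  refine Finset.aestronglyMeasurable_fun_sum _ fun k _ => Finset.aestronglyMeasurable_fun_sum _
    fun j _ => ?_
  refine AEStronglyMeasurable.const_mul (aestronglyMeasurable_conv (h k) (h j) ?_ ?_ m) _
  · filter_upwards [hs] with s hs using hs k
  · filter_upwards [hs] with s hs using hs j

theorem CoeffMeas.duh {α T : ℝ} {F : ℝ → Vec d} (h : CoeffMeas T F) : CoeffMeas T (duh α F) :=
  fun i m => by
  have hj : AEStronglyMeasurable (fun z : ℝ × ℝ => ({z : ℝ × ℝ | z.2 < z.1}.indicator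
      (fun z => (heatSymbol α (z.1 - z.2) m : ℂ) * F z.2 i m) z))
      ((volume.restrict (Ioo 0 T)).prod (volume.restrict (Ioo 0 T))) := by
    refine AEStronglyMeasurable.indicator ?_ (measurableSet_lt measurable_snd measurable_fst)
    refine AEStronglyMeasurable.mul ?_ (h i m).comp_snd
    exact (Complex.continuous_ofReal.comp ((continuous_heatSymbol α m).comp
      (continuous_fst.sub continuous_snd))).aestronglyMeasurable
  refine hj.integral_prod_right'.congr ?_
  filter_upwards [ae_restrict_mem measurableSet_Ioo] with s hs
  have e : Ioo 0 s = Ioo 0 T ∩ {r | r < s} := by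
    ext r; simp only [mem_Ioo, mem_inter_iff, mem_ofPred_eq]
    exact ⟨fun h => ⟨⟨h.1, h.2.trans hs.2⟩, h.2⟩, fun h => ⟨h.1.1, h.2⟩⟩
  simp only [FracNS.duh]
  rw [e, ← setIntegral_indicator (show MeasurableSet {r : ℝ | r < s} from measurableSet_Iio)]
  rfl

variable {α σ a₁ γ₁ a₂ γ₂ : ℝ} {N M : Vec d → ℝ≥0∞}

theorem duh_sub {t : ℝ} {F G : ℝ → Vec d}
    (hF : ∀ i m, IntegrableOn (fun s => heatSymbol α (t - s) m * F s i m) (Ioo 0 t))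
    (hG : ∀ i m, IntegrableOn (fun s => heatSymbol α (t - s) m * G s i m) (Ioo 0 t)) :
    duh α (fun s => F s - G s) t = duh α F t - duh α G t := by
  ext i m
  simp only [duh, Pi.sub_apply, mul_sub]
  exact integral_sub (hF i m) (hG i m)

theorem Bdd.isSq (h : VecPair α σ a₁ γ₁ a₂ γ₂ N M) {s A : ℝ} {u : Vec d} (hu : Bdd N M σ s u A)
    (hs : 0 < s) : IsSq u :=
  h.sq u (ne_top_of_le_ne_top ENNReal.ofReal_ne_top (hu.M_le hs))

theorem VecPair.mulBound_heat (h : VecPair α σ a₁ γ₁ a₂ γ₂ N M) : ∃ C : ℝ, 0 ≤ C ∧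
    ∀ t : ℝ, 0 ≤ t → t ≤ 1 → MulBound (fun m : Fin d → ℤ => (heatSymbol α t m : ℂ)) C := by
  obtain ⟨χ⟩ := h.cutoff
  exact mulBound_heatSymbol χ h.α_pos

theorem VecPair.heat_bdd (h : VecPair α σ a₁ γ₁ a₂ γ₂ N M) : ∃ C : ℝ, 0 ≤ C ∧ ∀ (u : Vec d) (R : ℝ),
    N u ≤ ENNReal.ofReal R → ∀ t, 0 < t → t ≤ 1 → Bdd N M σ t (heat α t u) (C * R) := by
  obtain ⟨C₁, hC₁, h₁⟩ := h.mulBound_heat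
  obtain ⟨C₂, hC₂, h₂⟩ := h.heat_M
  refine ⟨C₁ + C₂, by positivity, fun u R hu t h0 h1 => ?_⟩
  have hu' : N u ≠ ⊤ := ne_top_of_le_ne_top ENNReal.ofReal_ne_top hu
  unfold Bdd
  rw [ENNReal.ofReal_mul (by positivity)]
  constructor
  · refine (h.normN.mul _ C₁ hC₁ (h₁ t h0.le h1) u hu').trans ?_
    gcongr
    linarith
  · refine (h₂ t h0 h1 u hu').trans ?_
    gcongr
    linarith

/-- `t ↦ u(t)` solves the integral equation at time `t`. -/
def SolvesAt (α : ℝ) (u₀ : Vec d) (u : ℝ → Vec d) (t : ℝ) : Prop :=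
  u t = heat α t u₀ - duh α (fun s => nonlin (u s) (u s)) t

theorem VecPair.integrableOn_nonlin (h : VecPair α σ a₁ γ₁ a₂ γ₂ N M) {T A : ℝ} (hT : T ≤ 1)
    (hA : 0 ≤ A) {u : ℝ → Vec d} (hm : CoeffMeas T u)
    (hu : ∀ᵐ s ∂(volume.restrict (Ioo 0 T)), Bdd N M σ s (u s) A) {t : ℝ} (ht : 0 < t) (htT : t ≤ T)
    (i : Fin d) (m : Fin d → ℤ) :
    IntegrableOn (fun s => heatSymbol α (t - s) m * nonlin (u s) (u s) i m) (Ioo 0 t) := by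
  obtain ⟨C, hC, hb⟩ := h.bilinear
  have hsub : volume.restrict (Ioo 0 t) ≤ volume.restrict (Ioo 0 T) :=
    Measure.restrict_mono (Ioo_subset_Ioo_right htT) le_rfl
  refine h.integrableOn_duh (D := C * A * A) (F := fun s => nonlin (u s) (u s)) (by positivity) ht
    (htT.trans hT) ?_ ?_ i m
  · refine CoeffMeas.nonlin (hm.mono htT) ?_
    filter_upwards [ae_mono hsub hu, ae_restrict_mem measurableSet_Ioo] with s hs hst
    exact hs.isSq h hst.1
  · filter_upwards [ae_mono hsub hu, ae_restrict_mem measurableSet_Ioo] with s hs hst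
    exact hb s hst.1 (by linarith [hst.2]) _ _ _ _ hA hA hs hs

theorem VecPair.contraction (h : VecPair α σ a₁ γ₁ a₂ γ₂ N M) {A : ℝ} (hA : 0 ≤ A) {ε : ℝ}
    (hε : 0 < ε) : ∃ l : ℝ, 0 ≤ l ∧ ∀ (T K : ℝ) (u v : ℝ → Vec d), T ≤ 1 → 0 ≤ K →
      CoeffMeas T u → CoeffMeas T v →
      (∀ᵐ s ∂(volume.restrict (Ioo 0 T)), Bdd N M σ s (u s) A) →
      (∀ᵐ s ∂(volume.restrict (Ioo 0 T)), Bdd N M σ s (v s) A) →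
      (∀ᵐ s ∂(volume.restrict (Ioo 0 T)), Bdd N M σ s (u s - v s) (K * Real.exp (l * s))) →
      ∀ t, 0 < t → t ≤ T → Bdd N M σ t (duh α (fun s => nonlin (u s) (u s)) t -
        duh α (fun s => nonlin (v s) (v s)) t) (ε * K * Real.exp (l * t)) := by
  obtain ⟨C, hC, hb⟩ := h.bilinear
  obtain ⟨l, hl, hd⟩ := h.duh_bdd (ε := ε / (2 * C * A + 1)) (by positivity)
  refine ⟨l, hl, fun T K u v hT hK hmu hmv hu hv huv t ht htT => ?_⟩
  rw [← duh_sub (fun i m => h.integrableOn_nonlin hT hA hmu hu ht htT i m)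
    (fun i m => h.integrableOn_nonlin hT hA hmv hv ht htT i m)]
  have hsq : ∀ w : ℝ → Vec d, (∀ᵐ s ∂(volume.restrict (Ioo 0 T)), Bdd N M σ s (w s) A) →
      ∀ᵐ s ∂(volume.restrict (Ioo 0 T)), IsSq (w s) := fun w hw => by
    filter_upwards [hw, ae_restrict_mem measurableSet_Ioo] with s hs hst using hs.isSq h hst.1
  refine (hd _ (2 * C * A * K) T (by positivity) hT
    ((hmu.nonlin (hsq u hu)).sub (hmv.nonlin (hsq v hv))) ?_ t ht htT).mono ?_
  · filter_upwards [hu, hv, huv, hsq u hu, hsq v hv, ae_restrict_mem measurableSet_Ioo]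
      with s h1 h2 h3 h4 h5 hst
    have hs1 : s ≤ 1 := by linarith [hst.2]
    rw [nonlin_sub_nonlin h4 h5]
    have hKe : 0 ≤ K * Real.exp (l * s) := by positivity
    refine ((hb s hst.1 hs1 _ _ _ _ hKe hA h3 h1).add h.normN h.normM hst.1.le (by positivity)
      (by positivity) (hb s hst.1 hs1 _ _ _ _ hA hKe h2 h3)).mono hst.1.le (le_of_eq (by ring))
  · have : ε / (2 * C * A + 1) * (2 * C * A) ≤ ε := by
      rw [div_mul_eq_mul_div, div_le_iff₀ (by positivity)]
      nlinarith
    calc _ = ε / (2 * C * A + 1) * (2 * C * A) * K * Real.exp (l * t) := by ring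
      _ ≤ _ := by gcongr

theorem nonlin_zero : nonlin (0 : Vec d) 0 = 0 := by
  ext i m; simp [nonlin, conv]

theorem duh_zero (t : ℝ) : duh α (fun _ => (0 : Vec d)) t = 0 := by
  ext i m; simp [duh]

theorem VecNorm.bdd_zero (hN : VecNorm N) (hM : VecNorm M) (s A : ℝ) : Bdd N M σ s 0 A := by
  simp [Bdd, hN.zero, hM.zero]

/-- Solutions depend Lipschitz continuously on the data. -/
theorem VecPair.stability (h : VecPair α σ a₁ γ₁ a₂ γ₂ N M) {A : ℝ} (hA : 0 ≤ A) :
    ∃ L : ℝ, 0 ≤ L ∧ ∀ (T R : ℝ) (u₀ v₀ : Vec d) (u v : ℝ → Vec d), T ≤ 1 → 0 ≤ R →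
      CoeffMeas T u → CoeffMeas T v →
      (∀ᵐ s ∂(volume.restrict (Ioo 0 T)), Bdd N M σ s (u s) A) →
      (∀ᵐ s ∂(volume.restrict (Ioo 0 T)), Bdd N M σ s (v s) A) →
      (∀ᵐ s ∂(volume.restrict (Ioo 0 T)), SolvesAt α u₀ u s) →
      (∀ᵐ s ∂(volume.restrict (Ioo 0 T)), SolvesAt α v₀ v s) →
      N (u₀ - v₀) ≤ ENNReal.ofReal R → ∀ t, 0 < t → t ≤ T → SolvesAt α u₀ u t → SolvesAt α v₀ v t →
      N (u t - v t) ≤ ENNReal.ofReal (L * R) := by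
  obtain ⟨C₀, hC₀, hheat⟩ := h.heat_bdd
  obtain ⟨l, hl, hcon⟩ := h.contraction hA (ε := 1 / 2) (by norm_num)
  refine ⟨2 * C₀ * Real.exp l, by positivity,
    fun T R u₀ v₀ u v hT hR hmu hmv hu hv hsu hsv h0 t ht htT htu htv => ?_⟩
  have step : ∀ n : ℕ, ∀ᵐ s ∂(volume.restrict (Ioo 0 T)),
      Bdd N M σ s (u s - v s) ((2 * C₀ * R + 2 * A * (1 / 2) ^ n) * Real.exp (l * s)) := by
    have hstep : ∀ n : ℕ, (∀ᵐ s ∂(volume.restrict (Ioo 0 T)),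
        Bdd N M σ s (u s - v s) ((2 * C₀ * R + 2 * A * (1 / 2) ^ n) * Real.exp (l * s))) →
        ∀ t, 0 < t → t ≤ T → SolvesAt α u₀ u t → SolvesAt α v₀ v t →
        Bdd N M σ t (u t - v t) ((2 * C₀ * R + 2 * A * (1 / 2) ^ (n + 1)) * Real.exp (l * t)) := by
      intro n hn t ht htT htu htv
      have h1 := hheat _ R h0 t ht (htT.trans hT)
      have h2 := hcon T _ u v hT (by positivity) hmu hmv hu hv hn t ht htT
      have h3 := h1.sub h.normN h.normM (by positivity) (by positivity) h2
      rw [htu, htv]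
      have e : heat α t u₀ - duh α (fun s => nonlin (u s) (u s)) t -
          (heat α t v₀ - duh α (fun s => nonlin (v s) (v s)) t) = heat α t (u₀ - v₀) -
          (duh α (fun s => nonlin (u s) (u s)) t - duh α (fun s => nonlin (v s) (v s)) t) := by
        rw [heat_sub]; abel
      rw [e]
      refine h3.mono ?_
      have : 1 ≤ Real.exp (l * t) := Real.one_le_exp (by positivity)
      have : C₀ * R ≤ C₀ * R * Real.exp (l * t) := le_mul_of_one_le_right (by positivity) this
      rw [pow_succ]
      nlinarith
    intro n
    induction n with
    | zero =>
      filter_upwards [hu, hv, ae_restrict_mem measurableSet_Ioo] with s h1 h2 hst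
      refine (h1.sub h.normN h.normM hA hA h2).mono ?_
      have : 1 ≤ Real.exp (l * s) := Real.one_le_exp (mul_nonneg hl hst.1.le)
      have : A + A ≤ (2 * C₀ * R + 2 * A * (1 / 2) ^ 0) * 1 := by
        simp only [pow_zero, mul_one]
        have : 0 ≤ C₀ * R := by positivity
        nlinarith
      refine this.trans ?_
      gcongr
    | succ n ih =>
      filter_upwards [hsu, hsv, ae_restrict_mem measurableSet_Ioo] with s h1 h2 hst
      exact hstep n ih s hst.1 hst.2.le h1 h2
  have hpt : ∀ n : ℕ, N (u t - v t) ≤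
      ENNReal.ofReal (C₀ * R + 1 / 2 * (2 * C₀ * R + 2 * A * (1 / 2) ^ n) * Real.exp (l * t)) := by
    intro n
    have h1 := hheat _ R h0 t ht (htT.trans hT)
    have h2 := hcon T _ u v hT (by positivity) hmu hmv hu hv (step n) t ht htT
    have h3 := h1.sub h.normN h.normM (by positivity) (by positivity) h2
    rw [htu, htv]
    have e : heat α t u₀ - duh α (fun s => nonlin (u s) (u s)) t -
        (heat α t v₀ - duh α (fun s => nonlin (v s) (v s)) t) = heat α t (u₀ - v₀) -
        (duh α (fun s => nonlin (u s) (u s)) t - duh α (fun s => nonlin (v s) (v s)) t) := by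
      rw [heat_sub]; abel
    rw [e]
    exact h3.1
  have hlim : Tendsto (fun n : ℕ => ENNReal.ofReal
      (C₀ * R + 1 / 2 * (2 * C₀ * R + 2 * A * (1 / 2) ^ n) * Real.exp (l * t))) atTop
      (𝓝 (ENNReal.ofReal (C₀ * R + 1 / 2 * (2 * C₀ * R + 2 * A * 0) * Real.exp (l * t)))) := by
    refine ENNReal.tendsto_ofReal ?_
    refine Tendsto.const_add _ (Tendsto.mul_const _ (Tendsto.const_mul _ (Tendsto.const_add _ ?_)))
    exact (tendsto_pow_atTop_nhds_zero_of_lt_one (by norm_num) (by norm_num)).const_mul _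
  refine (ge_of_tendsto' hlim hpt).trans (ENNReal.ofReal_le_ofReal ?_)
  have h1 : 1 ≤ Real.exp l := Real.one_le_exp hl
  have h2 : Real.exp (l * t) ≤ Real.exp l := Real.exp_le_exp.2 (by nlinarith)
  have h3 : 0 ≤ C₀ * R := by positivity
  nlinarith

/-- Conjugation symmetry of the Fourier coefficients of real vector fields. -/
def ConjSymm (u : Vec d) : Prop := ∀ i m, u i (-m) = starRingEnd ℂ (u i m)

theorem freq_neg (m : Fin d → ℤ) : freq (-m) = -freq m := by
  ext i; simp [freq]

theorem heatSymbol_neg (t : ℝ) (m : Fin d → ℤ) : heatSymbol α t (-m) = heatSymbol α t m := by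
  simp [heatSymbol, freq_neg]

theorem ConjSymm.heat {u : Vec d} (h : ConjSymm u) (t : ℝ) : ConjSymm (heat α t u) := fun i m => by
  simp [FracNS.heat, heatSymbol_neg, h i m]

theorem ConjSymm.sub {u v : Vec d} (h : ConjSymm u) (h' : ConjSymm v) : ConjSymm (u - v) :=
  fun i m => by simp [h i m, h' i m]

theorem lerayDeriv_neg (i k j : Fin d) (ξ : EuclideanSpace ℝ (Fin d)) :
    lerayDeriv i k j (-ξ) = starRingEnd ℂ (lerayDeriv i k j ξ) := by
  simp only [lerayDeriv, PiLp.neg_apply, norm_neg, map_mul, map_sub, map_div₀, Complex.conj_ofReal,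
    Complex.conj_I, Complex.ofReal_neg, map_ofNat]
  have : starRingEnd ℂ (if i = k then 1 else 0) = if i = k then 1 else 0 := by split_ifs <;> simp
  rw [this]
  ring

theorem ConjSymm.nonlin {u v : Vec d} (h : ConjSymm u) (h' : ConjSymm v) : ConjSymm (nonlin u v) :=
  fun i m => by
  simp only [FracNS.nonlin, map_sum, map_mul, freq_neg, lerayDeriv_neg]
  refine Finset.sum_congr rfl fun k _ => Finset.sum_congr rfl fun j _ => ?_
  congr 1
  simp only [conv]
  rw [Complex.conj_tsum, ← (Equiv.neg (Fin d → ℤ)).tsum_eq]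
  refine tsum_congr fun l => ?_
  simp only [Equiv.neg_apply, map_mul]
  rw [h k l, ← h' j (m - l)]
  congr 2
  abel

theorem ConjSymm.duh {F : ℝ → Vec d} {t : ℝ} (h : ∀ s, 0 < s → s < t → ConjSymm (F s)) :
    ConjSymm (duh α F t) := fun i m => by
  simp only [FracNS.duh]
  rw [← integral_conj]
  refine setIntegral_congr_fun measurableSet_Ioo fun s hs => ?_
  simp [heatSymbol_neg, h s hs.1 hs.2 i m]

end FracNS
end

noncomputable section
namespace FracNS
variable {d : ℕ} {α σ a₁ γ₁ a₂ γ₂ : ℝ} {N M : Vec d → ℝ≥0∞}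

/-! ### Existence -/

/-- The Picard iterates of the integral equation. -/
def picard (α : ℝ) (u₀ : Vec d) : ℕ → ℝ → Vec d
  | 0, t => heat α t u₀
  | n + 1, t => heat α t u₀ - duh α (fun s => nonlin (picard α u₀ n s) (picard α u₀ n s)) t

theorem picard_conjSymm {u₀ : Vec d} (h : ConjSymm u₀) (n : ℕ) : ∀ t, ConjSymm (picard α u₀ n t) := by
  induction n with
  | zero => exact fun t => h.heat t
  | succ n ih => exact fun t => (h.heat t).sub (ConjSymm.duh fun s _ _ => (ih s).nonlin (ih s))

theorem VecPair.exists_picard (h : VecPair α σ a₁ γ₁ a₂ γ₂ N M) {R : ℝ} (hR : 0 ≤ R) (κ : ℝ) :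
    ∃ T A : ℝ, 0 < T ∧ T ≤ 1 ∧ 0 ≤ A ∧
      (∀ u₀, N u₀ ≤ ENNReal.ofReal R → ∀ n, CoeffMeas T (picard α u₀ n) ∧ ∀ t, 0 < t → t ≤ T →
        Bdd N M σ t (picard α u₀ n t) A ∧
        Bdd N M σ t (picard α u₀ (n + 1) t - picard α u₀ n t) (A / 2 ^ n)) ∧
      ∀ (K : ℝ) (u v : ℝ → Vec d), 0 ≤ K → CoeffMeas T u → CoeffMeas T v →
        (∀ t, 0 < t → t ≤ T → Bdd N M σ t (u t) (κ * A)) →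
        (∀ t, 0 < t → t ≤ T → Bdd N M σ t (v t) (κ * A)) →
        (∀ t, 0 < t → t ≤ T → Bdd N M σ t (u t - v t) K) → ∀ t, 0 < t → t ≤ T →
        Bdd N M σ t (duh α (fun s => nonlin (u s) (u s)) t -
          duh α (fun s => nonlin (v s) (v s)) t) (K / 2) := by
  obtain ⟨C₀, hC₀, hheat⟩ := h.heat_bdd
  set A := 2 * (C₀ * R) with hA
  have hA0 : 0 ≤ A := by positivity
  obtain ⟨l, hl, hcon⟩ := h.contraction (A := max 1 κ * A) (by positivity) (ε := 1 / 8) (by norm_num)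
  set T := min 1 (l + 1)⁻¹ with hT
  have hT0 : 0 < T := by positivity
  have hT1 : T ≤ 1 := min_le_left _ _
  have hexp : ∀ t, t ≤ T → Real.exp (l * t) ≤ 4 := fun t ht => by
    have h1 : l * t ≤ 1 := by
      calc l * t ≤ l * (l + 1)⁻¹ := by gcongr; exact ht.trans (min_le_right _ _)
        _ ≤ 1 := by rw [← div_eq_mul_inv, div_le_one (by positivity)]; linarith
    calc _ ≤ Real.exp 1 := Real.exp_le_exp.2 h1
      _ ≤ 4 := by have := Real.exp_one_lt_d9; linarith
  have hcon' : ∀ (K : ℝ) (u v : ℝ → Vec d), 0 ≤ K → CoeffMeas T u → CoeffMeas T v →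
        (∀ t, 0 < t → t ≤ T → Bdd N M σ t (u t) (max 1 κ * A)) →
        (∀ t, 0 < t → t ≤ T → Bdd N M σ t (v t) (max 1 κ * A)) →
        (∀ t, 0 < t → t ≤ T → Bdd N M σ t (u t - v t) K) → ∀ t, 0 < t → t ≤ T →
        Bdd N M σ t (duh α (fun s => nonlin (u s) (u s)) t -
          duh α (fun s => nonlin (v s) (v s)) t) (K / 2) := by
    intro K u v hK hmu hmv hu hv huv t ht htT
    refine (hcon T K u v hT1 hK hmu hmv ?_ ?_ ?_ t ht htT).mono ?_
    · filter_upwards [ae_restrict_mem measurableSet_Ioo] with s hs using hu s hs.1 hs.2.le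
    · filter_upwards [ae_restrict_mem measurableSet_Ioo] with s hs using hv s hs.1 hs.2.le
    · filter_upwards [ae_restrict_mem measurableSet_Ioo] with s hs
      refine (huv s hs.1 hs.2.le).mono ?_
      exact le_mul_of_one_le_right hK (Real.one_le_exp (mul_nonneg hl hs.1.le))
    · have := hexp t htT
      nlinarith
  have h1A : A ≤ max 1 κ * A := le_mul_of_one_le_left hA0 (le_max_left _ _)
  refine ⟨T, A, hT0, hT1, hA0, fun u₀ hu₀ => ?_, fun K u v hK hmu hmv hu hv =>
    hcon' K u v hK hmu hmv (fun t ht htT => (hu t ht htT).mono (by gcongr; exact le_max_right _ _))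
      (fun t ht htT => (hv t ht htT).mono (by gcongr; exact le_max_right _ _))⟩
  have hbase : ∀ n, CoeffMeas T (picard α u₀ n) ∧
      ∀ t, 0 < t → t ≤ T → Bdd N M σ t (picard α u₀ n t) A := by
    intro n
    induction n with
    | zero =>
      refine ⟨coeffMeas_heat α T u₀, fun t ht htT => (hheat u₀ R hu₀ t ht (htT.trans hT1)).mono ?_⟩
      have : 0 ≤ C₀ * R := by positivity
      linarith
    | succ n ih =>
      have hsq : ∀ᵐ s ∂(volume.restrict (Ioo 0 T)), IsSq (picard α u₀ n s) := by
        filter_upwards [ae_restrict_mem measurableSet_Ioo] with s hs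
        exact (ih.2 s hs.1 hs.2.le).isSq h hs.1
      refine ⟨(coeffMeas_heat α T u₀).sub (ih.1.nonlin hsq).duh, fun t ht htT => ?_⟩
      have h1 := hcon' A (picard α u₀ n) (fun _ => 0) hA0 ih.1 (fun _ _ => aestronglyMeasurable_const)
        (fun t ht htT => (ih.2 t ht htT).mono h1A)
        (fun t _ _ => h.normN.bdd_zero h.normM t _) (fun t ht htT => by simpa using ih.2 t ht htT) t ht htT
      simp only [nonlin_zero, duh_zero, sub_zero] at h1
      exact ((hheat u₀ R hu₀ t ht (htT.trans hT1)).sub h.normN h.normM (by positivity) (by positivity)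
        h1).mono (by linarith)
  have hdiff : ∀ n, ∀ t, 0 < t → t ≤ T →
      Bdd N M σ t (picard α u₀ (n + 1) t - picard α u₀ n t) (A / 2 ^ n) := by
    intro n
    induction n with
    | zero =>
      intro t ht htT
      have h1 := hcon' A (picard α u₀ 0) (fun _ => 0) hA0 (hbase 0).1
        (fun _ _ => aestronglyMeasurable_const)
        (fun t ht htT => ((hbase 0).2 t ht htT).mono h1A)
        (fun t _ _ => h.normN.bdd_zero h.normM t _)
        (fun t ht htT => by simpa using (hbase 0).2 t ht htT) t ht htT
      simp only [nonlin_zero, duh_zero, sub_zero] at h1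
      have e : picard α u₀ (0 + 1) t - picard α u₀ 0 t =
          -duh α (fun s => nonlin (picard α u₀ 0 s) (picard α u₀ 0 s)) t := by
        simp [picard]
      rw [e]
      exact (h1.neg h.normN h.normM).mono (by simp; linarith)
    | succ n ih =>
      intro t ht htT
      have h1 := hcon' (A / 2 ^ n) (picard α u₀ (n + 1)) (picard α u₀ n) (by positivity)
        (hbase _).1 (hbase _).1 (fun t ht htT => ((hbase _).2 t ht htT).mono h1A)
        (fun t ht htT => ((hbase _).2 t ht htT).mono h1A) ih t ht htT
      have e : picard α u₀ (n + 1 + 1) t - picard α u₀ (n + 1) t =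
          -(duh α (fun s => nonlin (picard α u₀ (n + 1) s) (picard α u₀ (n + 1) s)) t -
          duh α (fun s => nonlin (picard α u₀ n s) (picard α u₀ n s)) t) := by
        simp [picard]
      rw [e]
      exact (h1.neg h.normN h.normM).mono (by rw [pow_succ, div_div])
  exact fun n => ⟨(hbase n).1, fun t ht htT => ⟨(hbase n).2 t ht htT, hdiff n t ht htT⟩⟩

theorem VecNorm.le_geometric (hN : VecNorm N) {u : ℕ → Vec d} {A : ℝ≥0∞}
    (hu : ∀ n, N (u (n + 1) - u n) ≤ A * 2⁻¹ ^ n) (n k : ℕ) (hnk : n ≤ k) :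
    N (u n - u k) ≤ 2 * A * 2⁻¹ ^ n := by
  have h1 : u k - u n = ∑ j ∈ Finset.Ico n k, (u (j + 1) - u j) := (Finset.sum_Ico_sub u hnk).symm
  rw [hN.sub_comm, h1]
  calc _ ≤ ∑ j ∈ Finset.Ico n k, A * 2⁻¹ ^ j :=
        (hN.sum _ _).trans (Finset.sum_le_sum fun j _ => hu j)
    _ = ∑ j ∈ Finset.range (k - n), A * 2⁻¹ ^ n * 2⁻¹ ^ j := by
        rw [Finset.sum_Ico_eq_sum_range]
        refine Finset.sum_congr rfl fun j _ => ?_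
        rw [pow_add, mul_assoc]
    _ ≤ ∑' j : ℕ, A * 2⁻¹ ^ n * 2⁻¹ ^ j := ENNReal.sum_le_tsum _
    _ = _ := by
        rw [ENNReal.tsum_mul_left, ENNReal.tsum_geometric, ENNReal.one_sub_inv_two, inv_inv]
        ring

theorem VecNorm.exists_limit (hN : VecNorm N) : ∃ C : ℝ, 1 ≤ C ∧ ∀ (u : ℕ → Vec d) (A : ℝ), 0 ≤ A →
    (∀ n, N (u (n + 1) - u n) ≤ ENNReal.ofReal (A / 2 ^ n)) →
    (∀ i m, ∃ l, Tendsto (fun n => u n i m) atTop (𝓝 l)) ∧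
    ∀ v, (∀ i m, Tendsto (fun n => u n i m) atTop (𝓝 (v i m))) →
      ∀ n, N (u n - v) ≤ ENNReal.ofReal (C * A / 2 ^ n) := by
  obtain ⟨C₁, K, hC₁, hc⟩ := hN.coeff_real
  obtain ⟨C₂, hC₂, hcomp⟩ := hN.complete
  have e : ∀ (X : ℝ) (n : ℕ), 0 ≤ X → ENNReal.ofReal (X / 2 ^ n) = ENNReal.ofReal X * 2⁻¹ ^ n := by
    intro X n hX
    rw [div_eq_mul_inv, ENNReal.ofReal_mul hX, ← inv_pow, ENNReal.ofReal_pow (by positivity),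
      ENNReal.ofReal_inv_of_pos two_pos]
    simp
  refine ⟨max 1 (C₂ * 2), le_max_left _ _, fun u A hA hu => ⟨fun i m => ?_, fun v hv n => ?_⟩⟩
  · refine cauchySeq_tendsto_of_complete (cauchySeq_of_le_geometric (1 / 2) (C₁ * wt m ^ K * A)
      (by norm_num) fun n => ?_)
    rw [dist_comm, dist_eq_norm]
    refine (hc _ _ (by positivity) (hu n) i m).trans_eq ?_
    rw [one_div, inv_pow]; ring
  · simp only [e A _ hA] at hu
    have h1 := hcomp u v (fun n => 2 * ENNReal.ofReal A * 2⁻¹ ^ n) ?_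
      (fun n k hnk => hN.le_geometric hu n k hnk) hv n
    · refine h1.trans ?_
      rw [e _ n (by positivity), ENNReal.ofReal_mul (by positivity)]
      have h2 : ENNReal.ofReal C₂ * 2 ≤ ENNReal.ofReal (max 1 (C₂ * 2)) := by
        rw [← ENNReal.ofReal_ofNat 2, ← ENNReal.ofReal_mul hC₂]
        exact ENNReal.ofReal_le_ofReal (le_max_right _ _)
      calc _ = ENNReal.ofReal C₂ * 2 * ENNReal.ofReal A * 2⁻¹ ^ n := by ring
        _ ≤ _ := by gcongr
    · rw [ENNReal.tsum_mul_left, ENNReal.tsum_geometric, ENNReal.one_sub_inv_two]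
      exact ENNReal.mul_ne_top (ENNReal.mul_ne_top (by simp) ENNReal.ofReal_ne_top) (by simp)

/-- Local existence for the integral equation. -/
theorem VecPair.exists_solution (h : VecPair α σ a₁ γ₁ a₂ γ₂ N M) {R : ℝ} (hR : 0 ≤ R) :
    ∃ T A : ℝ, 0 < T ∧ T ≤ 1 ∧ 0 ≤ A ∧ ∀ u₀, N u₀ ≤ ENNReal.ofReal R → ∃ u : ℝ → Vec d,
      CoeffMeas T u ∧ (∀ t, 0 < t → t ≤ T → Bdd N M σ t (u t) A) ∧
      (∀ t, 0 ≤ t → t ≤ T → SolvesAt α u₀ u t) ∧ (ConjSymm u₀ → ∀ t, ConjSymm (u t)) := by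
  obtain ⟨CN, hCN, hlN⟩ := h.normN.exists_limit
  obtain ⟨CM, hCM, hlM⟩ := h.normM.exists_limit
  set C := max CN CM with hC
  have hC1 : 1 ≤ C := hCN.trans (le_max_left _ _)
  obtain ⟨T, A, hT0, hT1, hA, hpic, hcon⟩ := h.exists_picard hR (1 + C)
  refine ⟨T, (1 + C) * A, hT0, hT1, by positivity, fun u₀ hu₀ => ?_⟩
  have hp := hpic u₀ hu₀
  have hN' : ∀ t, 0 < t → t ≤ T → ∀ n, N (picard α u₀ (n + 1) t - picard α u₀ n t) ≤
      ENNReal.ofReal (A / 2 ^ n) := fun t ht htT n => ((hp n).2 t ht htT).2.1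
  have hM' : ∀ t, 0 < t → t ≤ T → ∀ n, M (picard α u₀ (n + 1) t - picard α u₀ n t) ≤
      ENNReal.ofReal (A * t ^ (-σ) / 2 ^ n) := fun t ht htT n => by
    have := ((hp n).2 t ht htT).2.M_le ht
    rwa [div_mul_eq_mul_div] at this
  have hlim : ∀ t, ∃ v : Vec d, (0 < t → t ≤ T →
      ∀ i m, Tendsto (fun n => picard α u₀ n t i m) atTop (𝓝 (v i m))) ∧ (¬(0 < t ∧ t ≤ T) → v = u₀) := by
    intro t
    by_cases ht : 0 < t ∧ t ≤ T
    · choose v hv using fun i m => (hlN (fun n => picard α u₀ n t) A hA (hN' t ht.1 ht.2)).1 i m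
      exact ⟨v, fun _ _ => hv, fun h => absurd ht h⟩
    · exact ⟨u₀, fun h0 h1 => absurd ⟨h0, h1⟩ ht, fun _ => rfl⟩
  choose u hu hu' using hlim
  have hd : ∀ t, 0 < t → t ≤ T → ∀ n, Bdd N M σ t (picard α u₀ n t - u t) (C * A / 2 ^ n) := by
    intro t ht htT n
    have h1 := (hlN (fun n => picard α u₀ n t) A hA (hN' t ht htT)).2 (u t) (hu t ht htT) n
    have h2 := (hlM (fun n => picard α u₀ n t) (A * t ^ (-σ)) (by positivity) (hM' t ht htT)).2 (u t)
      (hu t ht htT) n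
    refine ⟨h1.trans (by gcongr; exact le_max_left _ _), ?_⟩
    calc _ ≤ ENNReal.ofReal (t ^ σ) * ENNReal.ofReal (CM * (A * t ^ (-σ)) / 2 ^ n) := by gcongr
      _ = ENNReal.ofReal (CM * A / 2 ^ n) := by
          rw [← ENNReal.ofReal_mul (by positivity), Real.rpow_neg ht.le]
          congr 1
          have : t ^ σ ≠ 0 := by positivity
          field_simp
      _ ≤ _ := by gcongr; exact le_max_right _ _
  have hb : ∀ t, 0 < t → t ≤ T → Bdd N M σ t (u t) ((1 + C) * A) := by
    intro t ht htT
    have h1 := ((hp 0).2 t ht htT).1.sub h.normN h.normM hA (by positivity) (hd t ht htT 0)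
    rw [sub_sub_cancel] at h1
    exact h1.mono (by simp; linarith)
  have hm : CoeffMeas T u := CoeffMeas.of_tendsto (fun n => (hp n).1) fun t ht => hu t ht.1 ht.2.le
  have hbp : ∀ n t, 0 < t → t ≤ T → Bdd N M σ t (picard α u₀ n t) ((1 + C) * A) := fun n t ht htT =>
    ((hp n).2 t ht htT).1.mono (by nlinarith)
  refine ⟨u, hm, hb, fun t ht htT => ?_, fun hc t => ?_⟩
  · rcases ht.eq_or_lt with rfl | ht
    · rw [SolvesAt, heat_zero, hu' 0 (by simp)]
      ext i m; simp [duh]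
    · obtain ⟨C', K, hC', hco⟩ := h.normN.coeff_real
      ext i m
      refine tendsto_nhds_unique ((tendsto_add_atTop_iff_nat 1).2 (hu t ht htT i m)) ?_
      have h1 : Tendsto (fun n => duh α (fun s => nonlin (picard α u₀ n s) (picard α u₀ n s)) t i m)
          atTop (𝓝 (duh α (fun s => nonlin (u s) (u s)) t i m)) := by
        rw [tendsto_iff_norm_sub_tendsto_zero]
        have h2 : ∀ n : ℕ, ‖duh α (fun s => nonlin (picard α u₀ n s) (picard α u₀ n s)) t i m -
            duh α (fun s => nonlin (u s) (u s)) t i m‖ ≤ C' * wt m ^ K * (C * A / 2 ^ n / 2) :=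
          fun n => hco _ _ (by positivity)
            (hcon _ _ _ (by positivity) (hp n).1 hm (hbp n) hb (fun t ht htT => hd t ht htT n) t ht htT).1 i m
        refine squeeze_zero (fun _ => norm_nonneg _) h2 ?_
        have h3 : Tendsto (fun n : ℕ => C' * wt m ^ K * (C * A / 2) * (1 / 2) ^ n) atTop
            (𝓝 (C' * wt m ^ K * (C * A / 2) * 0)) :=
          (tendsto_pow_atTop_nhds_zero_of_lt_one (by norm_num) (by norm_num)).const_mul _
        rw [mul_zero] at h3
        refine h3.congr fun n => ?_
        rw [one_div, inv_pow]; ring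
      exact tendsto_const_nhds.sub h1
  · by_cases ht : 0 < t ∧ t ≤ T
    · intro i m
      refine tendsto_nhds_unique (hu t ht.1 ht.2 i (-m)) ?_
      have := (Complex.continuous_conj.tendsto _).comp (hu t ht.1 ht.2 i m)
      refine this.congr fun n => ?_
      exact (picard_conjSymm hc n t i m).symm
    · rw [hu' t ht]; exact hc

end FracNS
end

noncomputable section
namespace FracNS
variable {d : ℕ} {α σ a₁ γ₁ a₂ γ₂ : ℝ} {N M : Vec d → ℝ≥0∞}

/-! ### Continuity in time -/

theorem duh_eq_add {F : ℝ → Vec d} {r t : ℝ} (h0 : 0 ≤ r) (hrt : r ≤ t)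
    (hi : ∀ i m, IntegrableOn (fun s => heatSymbol α (t - s) m * F s i m) (Ioo 0 t)) :
    duh α F t = heat α (t - r) (duh α F r) + fun i m => ∫ s in Ioo r t, heat α (t - s) (F s) i m := by
  ext i m
  simp only [duh, heat, Pi.add_apply, ← integral_const_mul]
  have e1 : ∫ s in Ioo 0 r, (heatSymbol α (t - r) m : ℂ) * (heatSymbol α (r - s) m * F s i m) =
      ∫ s in Ioo 0 r, heatSymbol α (t - s) m * F s i m := by
    refine integral_congr_ae (.of_forall fun s => ?_)
    have : t - s = (t - r) + (r - s) := by ring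
    simp only [this, heatSymbol_add]
    push_cast; ring
  rw [e1, ← integral_Ioc_eq_integral_Ioo, ← integral_Ioc_eq_integral_Ioo,
    ← integral_Ioc_eq_integral_Ioo, ← setIntegral_union (Ioc_disjoint_Ioc_of_le le_rfl)
    measurableSet_Ioc, Ioc_union_Ioc_eq_Ioc h0 hrt]
  · exact (integrableOn_Ioc_iff_integrableOn_Ioo (μ := volume)).2
      ((hi i m).mono_set (Ioo_subset_Ioo_right hrt))
  · exact (integrableOn_Ioc_iff_integrableOn_Ioo (μ := volume)).2
      ((hi i m).mono_set (Ioo_subset_Ioo_left h0))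

/-- The remainder of the Duhamel integral over a time interval. -/
theorem VecPair.tail_bound (h : VecPair α σ a₁ γ₁ a₂ γ₂ N M) : ∃ C : ℝ, 0 ≤ C ∧
    ∀ (F : ℝ → Vec d) (D T : ℝ), 0 ≤ D → T ≤ 1 → CoeffMeas T F →
      (∀ s, 0 < s → s ≤ T → Force N M α a₁ γ₁ a₂ γ₂ s (F s) D) →
      (∀ t, 0 < t → t ≤ T → N (duh α F t) ≤ ENNReal.ofReal (C * D * t ^ (1 - γ₁ - a₁))) ∧
      ∀ r t, 0 < r → r < t → t ≤ T → N (fun i m => ∫ s in Ioo r t, heat α (t - s) (F s) i m) ≤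
        ENNReal.ofReal (C * D * r ^ (-γ₁) * (t - r) ^ (1 - a₁)) := by
  obtain ⟨CN, hCN, hN⟩ := h.normN.integral
  have ha := h.a₁_lt
  have hγ := h.γ₁_lt
  have ha' : 0 < 1 - a₁ := by linarith
  have hγ' : 0 < 1 - γ₁ := by linarith
  refine ⟨CN * (4 / (1 - γ₁) + 4 / (1 - a₁)) + CN / (1 - a₁), by positivity,
    fun F D T hD hT hm hF => ?_⟩
  have key : ∀ r t, 0 ≤ r → 0 < t → t ≤ T →
      N (fun i m => ∫ s in Ioo r t, heat α (t - s) (F s) i m) ≤ ENNReal.ofReal CN *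
        ∫⁻ s in Ioo r t, ENNReal.ofReal (D * ((t - s) ^ (-a₁) * s ^ (-γ₁))) := by
    intro r t hr ht htT
    have hsub : Ioo r t ⊆ Ioo 0 T := Ioo_subset_Ioo hr htT
    refine hN (Ioo r t) (fun s => heat α (t - s) (F s))
      (fun s => ENNReal.ofReal (D * ((t - s) ^ (-a₁) * s ^ (-γ₁)))) (fun i m => ?_) ?_ (by fun_prop) ?_
    · refine AEStronglyMeasurable.mul ?_ ((hm i m).mono_measure (Measure.restrict_mono hsub le_rfl))
      have := (continuous_heatSymbol α m).comp
        (continuous_const.sub continuous_id : Continuous fun s => t - s)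
      exact (Complex.continuous_ofReal.comp this).aestronglyMeasurable
    · filter_upwards [ae_restrict_mem measurableSet_Ioo] with s hs i
      have h1 := hsub hs
      exact h.force_summable h1.1 hD (hF s h1.1 h1.2.le) (by linarith [hs.2])
        (by linarith [hs.1]) i
    · filter_upwards [ae_restrict_mem measurableSet_Ioo] with s hs
      have h1 := hsub hs
      exact (hF s h1.1 h1.2.le (t - s) (by linarith [hs.2]) (by linarith [hs.1])).1
  constructor
  · intro t ht htT
    refine (key 0 t le_rfl ht htT).trans ?_
    simp only [ENNReal.ofReal_mul hD]
    rw [lintegral_const_mul' _ _ ENNReal.ofReal_ne_top]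
    calc _ ≤ ENNReal.ofReal CN * (ENNReal.ofReal D *
          ENNReal.ofReal ((4 / (1 - γ₁) + 4 / (1 - a₁)) * t ^ (1 - γ₁ - a₁))) := by
          gcongr
          exact kernel_le h.a₁_nonneg ha h.γ₁_nonneg hγ ht
      _ ≤ _ := by
          rw [← ENNReal.ofReal_mul hD, ← ENNReal.ofReal_mul hCN]
          refine ENNReal.ofReal_le_ofReal ?_
          have h1 : 0 ≤ CN / (1 - a₁) * D * t ^ (1 - γ₁ - a₁) := by positivity
          linarith
  · intro r t hr hrt htT
    refine (key r t hr.le (hr.trans hrt) htT).trans ?_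
    calc _ ≤ ENNReal.ofReal CN * ∫⁻ s in Ioo r t, ENNReal.ofReal (D * r ^ (-γ₁)) *
          ENNReal.ofReal ((t - s) ^ (-a₁)) := by
          refine mul_le_mul_right ?_ _
          refine setLIntegral_mono' measurableSet_Ioo fun s hs => ?_
          have h1 : 0 < t - s := by linarith [hs.2]
          have h2 := hs.1
          rw [← ENNReal.ofReal_mul (by positivity)]
          refine ENNReal.ofReal_le_ofReal ?_
          have h3 : s ^ (-γ₁) ≤ r ^ (-γ₁) :=
            Real.rpow_le_rpow_of_nonpos hr h2.le (by linarith [h.γ₁_nonneg])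
          calc _ ≤ D * ((t - s) ^ (-a₁) * r ^ (-γ₁)) := by gcongr
            _ = _ := by ring
      _ ≤ _ := by
          rw [lintegral_const_mul' _ _ ENNReal.ofReal_ne_top, lintegral_sub_rpow_neg ha hrt,
            ← ENNReal.ofReal_mul (by positivity), ← ENNReal.ofReal_mul hCN]
          refine ENNReal.ofReal_le_ofReal ?_
          have h0 : 0 < t - r := by linarith
          have h1 : 0 ≤ CN * (4 / (1 - γ₁) + 4 / (1 - a₁)) * D * r ^ (-γ₁) * (t - r) ^ (1 - a₁) := by
            positivity
          calc _ = CN / (1 - a₁) * D * r ^ (-γ₁) * (t - r) ^ (1 - a₁) := by ring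
            _ ≤ _ := by linarith

theorem VecPair.heat_continuous (h : VecPair α σ a₁ γ₁ a₂ γ₂ N M) {w : Vec d} (hw : N w ≠ ⊤) {t : ℝ}
    (ht : 0 ≤ t) : Tendsto (fun s => N (heat α s w - heat α t w)) (𝓝[Icc 0 1] t) (𝓝 0) := by
  obtain ⟨C, hC, hb⟩ := h.mulBound_heat
  by_cases ht1 : t ≤ 1
  swap
  · have : 𝓝[Icc (0 : ℝ) 1] t = ⊥ := by
      rw [← notMem_closure_iff_nhdsWithin_eq_bot, isClosed_Icc.closure_eq]
      exact fun h => ht1 h.2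
    rw [this]; exact tendsto_bot
  have hle : ∀ s ∈ Icc (0 : ℝ) 1, N (heat α s w - heat α t w) ≤
      ENNReal.ofReal C * N (heat α |s - t| w - w) := by
    have aux : ∀ x ∈ Icc (0 : ℝ) 1, ∀ y, x ≤ y → y ≤ 1 → N (heat α y w - heat α x w) ≤
        ENNReal.ofReal C * N (heat α (y - x) w - w) := by
      intro x hx y hxy hy
      have e : heat α y w - heat α x w = fun i m => (heatSymbol α x m : ℂ) *
          (heat α (y - x) w - w) i m := by
        have h1 := heat_heat α x (y - x) w
        rw [add_sub_cancel] at h1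
        rw [← h1, ← heat_sub]; rfl
      rw [e]
      refine h.normN.mul _ C hC (hb x hx.1 hx.2) _ ?_
      refine ne_top_of_le_ne_top (ENNReal.add_ne_top.2 ⟨?_, hw⟩) (h.normN.sub _ _)
      exact ne_top_of_le_ne_top (ENNReal.mul_ne_top ENNReal.ofReal_ne_top hw)
        (h.normN.mul _ C hC (hb (y - x) (by linarith) (by linarith [hx.1])) w hw)
    intro s hs
    rcases le_total t s with hts | hst
    · rw [abs_of_nonneg (by linarith)]
      exact aux t ⟨ht, ht1⟩ s hts hs.2
    · rw [abs_of_nonpos (by linarith), neg_sub, h.normN.sub_comm]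
      exact aux s hs t hst ht1
  have h0 : Tendsto (fun r => N (heat α r w - w)) (𝓝[≥] 0) (𝓝 0) := by
    rw [← Ioi_insert, nhdsWithin_insert]
    refine Tendsto.sup ?_ (h.heat_tendsto w hw)
    rw [tendsto_pure_left]
    intro s hs
    have : N (heat α 0 w - w) = 0 := by rw [heat_zero, sub_self, h.normN.zero]
    rw [this]; exact mem_of_mem_nhds hs
  have habs : Tendsto (fun s => |s - t|) (𝓝[Icc 0 1] t) (𝓝[≥] 0) := by
    refine tendsto_nhdsWithin_iff.2 ⟨?_, .of_forall fun s => mem_Ici.2 (abs_nonneg _)⟩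
    have : Tendsto (fun s => |s - t|) (𝓝 t) (𝓝 |t - t|) := (by fun_prop : Continuous fun s => |s - t|).tendsto t
    rw [sub_self, abs_zero] at this
    exact this.mono_left nhdsWithin_le_nhds
  have h1 : Tendsto (fun s => ENNReal.ofReal C * N (heat α |s - t| w - w)) (𝓝[Icc 0 1] t) (𝓝 0) := by
    have := ENNReal.Tendsto.const_mul (h0.comp habs) (Or.inr (ENNReal.ofReal_ne_top (r := C)))
    rwa [mul_zero] at this
  refine tendsto_of_tendsto_of_tendsto_of_le_of_le' tendsto_const_nhds h1 (.of_forall fun _ => zero_le) ?_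
  filter_upwards [self_mem_nhdsWithin] with s hs using hle s hs

theorem VecPair.restart (h : VecPair α σ a₁ γ₁ a₂ γ₂ N M) {T A : ℝ} (hT1 : T ≤ 1)
    (hA : 0 ≤ A) {u₀ : Vec d} {u : ℝ → Vec d} (hm : CoeffMeas T u)
    (hb : ∀ t, 0 < t → t ≤ T → Bdd N M σ t (u t) A)
    (hs : ∀ t, 0 ≤ t → t ≤ T → SolvesAt α u₀ u t) {r t : ℝ} (hr : 0 < r) (hrt : r < t) (htT : t ≤ T) :
    u t = heat α (t - r) (u r) -
      fun i m => ∫ s in Ioo r t, heat α (t - s) (nonlin (u s) (u s)) i m := by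
  have hbae : ∀ᵐ s ∂(volume.restrict (Ioo 0 T)), Bdd N M σ s (u s) A := by
    filter_upwards [ae_restrict_mem measurableSet_Ioo] with s hs using hb s hs.1 hs.2.le
  have h1 := duh_eq_add (F := fun s => nonlin (u s) (u s)) (α := α) hr.le hrt.le
    (h.integrableOn_nonlin hT1 hA hm hbae (hr.trans hrt) htT)
  have h2 := heat_heat α (t - r) r u₀
  rw [sub_add_cancel] at h2
  have h3 : u t = heat α t u₀ - duh α (fun s => nonlin (u s) (u s)) t := hs t (by linarith) htT
  have h4 : u r = heat α r u₀ - duh α (fun s => nonlin (u s) (u s)) r := hs r hr.le (by linarith)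
  rw [h3, h1]
  rw [h4, heat_sub, h2]
  abel

theorem VecPair.continuous_of_solves (h : VecPair α σ a₁ γ₁ a₂ γ₂ N M) {T A : ℝ} (hT1 : T ≤ 1)
    (hA : 0 ≤ A) {u₀ : Vec d} (hu₀ : N u₀ ≠ ⊤) {u : ℝ → Vec d} (hm : CoeffMeas T u)
    (hb : ∀ t, 0 < t → t ≤ T → Bdd N M σ t (u t) A)
    (hs : ∀ t, 0 ≤ t → t ≤ T → SolvesAt α u₀ u t) {t : ℝ} (ht : t ∈ Icc 0 T) :
    Tendsto (fun s => N (u s - u t)) (𝓝[Icc 0 T] t) (𝓝 0) := by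
  obtain ⟨CQ, hCQ, hQ⟩ := h.bilinear
  obtain ⟨CT, hCT, htail⟩ := h.tail_bound
  have hsq : ∀ᵐ s ∂(volume.restrict (Ioo 0 T)), IsSq (u s) := by
    filter_upwards [ae_restrict_mem measurableSet_Ioo] with s hs
    exact (hb s hs.1 hs.2.le).isSq h hs.1
  have hbae : ∀ᵐ s ∂(volume.restrict (Ioo 0 T)), Bdd N M σ s (u s) A := by
    filter_upwards [ae_restrict_mem measurableSet_Ioo] with s hs using hb s hs.1 hs.2.le
  set F : ℝ → Vec d := fun s => nonlin (u s) (u s) with hF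
  obtain ⟨ht1, ht2⟩ := htail F (CQ * A * A) T (by positivity) hT1 (hm.nonlin hsq) fun s h0 h1 =>
    hQ s h0 (h1.trans hT1) _ _ _ _ hA hA (hb s h0 h1) (hb s h0 h1)
  set B := CT * (CQ * A * A) with hB
  have hB0 : 0 ≤ B := by positivity
  have hexp1 : 0 < 1 - γ₁ - a₁ := by linarith [h.lt_one]
  have hexp2 : 0 < 1 - a₁ := by linarith [h.a₁_lt]
  have hmono : 𝓝[Icc 0 T] t ≤ 𝓝[Icc 0 1] t := nhdsWithin_mono _ (Icc_subset_Icc_right hT1)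
  have hmem : ∀ᶠ s in 𝓝[Icc 0 T] t, s ∈ Icc 0 T := self_mem_nhdsWithin
  rcases ht.1.eq_or_lt with rfl | ht0
  · have hu0 : u 0 = u₀ := by
      rw [hs 0 le_rfl ht.2, heat_zero]
      ext i m; simp [duh]
    have h1 : Tendsto (fun s => N (heat α s u₀ - heat α 0 u₀) + ENNReal.ofReal (B * s ^ (1 - γ₁ - a₁)))
        (𝓝[Icc 0 T] 0) (𝓝 (0 + ENNReal.ofReal (B * 0 ^ (1 - γ₁ - a₁)))) := by
      refine ((h.heat_continuous hu₀ le_rfl).mono_left hmono).add (ENNReal.tendsto_ofReal ?_)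
      refine Tendsto.const_mul _ ?_
      exact ((Real.continuousAt_rpow_const 0 _ (Or.inr hexp1.le)).tendsto).mono_left nhdsWithin_le_nhds
    rw [Real.zero_rpow hexp1.ne', mul_zero, ENNReal.ofReal_zero, add_zero] at h1
    refine tendsto_of_tendsto_of_tendsto_of_le_of_le' tendsto_const_nhds h1 (.of_forall fun _ => zero_le) ?_
    filter_upwards [hmem] with s hsm
    rcases hsm.1.eq_or_lt with rfl | hs0
    · simp [h.normN.zero]
    · rw [hu0, hs s hsm.1 hsm.2, heat_zero]
      have e : heat α s u₀ - duh α F s - u₀ = (heat α s u₀ - u₀) - duh α F s := by abel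
      rw [e]
      exact (h.normN.sub _ _).trans (by gcongr; exact ht1 s hs0 hsm.2)
  · have hrestart : ∀ r s, 0 < r → r < s → s ≤ T → u s = heat α (s - r) (u r) -
        fun i m => ∫ x in Ioo r s, heat α (s - x) (F x) i m :=
      fun r s hr hrs hsT => h.restart hT1 hA hm hb hs hr hrs hsT
    have hcont : Tendsto (fun r : ℝ => B * (t / 2) ^ (-γ₁) * (2 * (t - r)) ^ (1 - a₁) * 2) (𝓝[<] t)
        (𝓝 (B * (t / 2) ^ (-γ₁) * (2 * (t - t)) ^ (1 - a₁) * 2)) := by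
      refine Tendsto.mono_left ?_ nhdsWithin_le_nhds
      refine ContinuousAt.tendsto ?_
      refine ContinuousAt.mul (ContinuousAt.mul continuousAt_const ?_) continuousAt_const
      exact ContinuousAt.rpow_const (by fun_prop) (Or.inr hexp2.le)
    rw [sub_self, mul_zero, Real.zero_rpow hexp2.ne', mul_zero, zero_mul] at hcont
    rw [ENNReal.tendsto_nhds_zero]
    intro ε hε
    rcases eq_or_ne ε ⊤ with rfl | hεt
    · exact .of_forall fun _ => le_top
    have hε' : 0 < ε.toReal / 2 := half_pos (ENNReal.toReal_pos hε.ne' hεt)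
    obtain ⟨r, hr1, hr2, hr3⟩ := ((hcont.eventually (gt_mem_nhds hε')).and
      (Ioo_mem_nhdsLT (half_lt_self ht0) : ∀ᶠ r in 𝓝[<] t, r ∈ Ioo (t / 2) t)).exists
    have hr0 : 0 < r := by linarith
    have hw : N (u r) ≠ ⊤ := (hb r hr0 (by linarith [ht.2])).ne_top
    have h1 : ∀ᶠ s in 𝓝[Icc 0 T] t, N (heat α (s - r) (u r) - heat α (t - r) (u r)) ≤
        ENNReal.ofReal (ε.toReal / 2) := by
      have h2 : Tendsto (fun s => s - r) (𝓝[Icc 0 T] t) (𝓝[Icc 0 1] (t - r)) := by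
        refine tendsto_nhdsWithin_iff.2 ⟨?_, ?_⟩
        · exact ((continuous_id.sub continuous_const).tendsto t).mono_left nhdsWithin_le_nhds
        · filter_upwards [hmem, nhdsWithin_le_nhds (lt_mem_nhds hr3)] with s h3 h4
          exact ⟨by linarith, by linarith [h3.2]⟩
      have h5 := (h.heat_continuous hw (by linarith : 0 ≤ t - r)).comp h2
      exact h5.eventually (ge_mem_nhds (by simpa using hε'))
    have h6 : ∀ᶠ s in 𝓝[Icc 0 T] t, s ∈ Ioo r (t + (t - r)) :=
      nhdsWithin_le_nhds (Ioo_mem_nhds hr3 (by linarith))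
    filter_upwards [h1, h6, hmem] with s h1 h6 h7
    have hE : ∀ s, r < s → s ≤ T → s < t + (t - r) →
        N (fun i m => ∫ x in Ioo r s, heat α (s - x) (F x) i m) ≤
          ENNReal.ofReal (B * (t / 2) ^ (-γ₁) * (2 * (t - r)) ^ (1 - a₁)) := by
      intro s hrs hsT hst
      refine (ht2 r s hr0 hrs hsT).trans (ENNReal.ofReal_le_ofReal ?_)
      have h8 : r ^ (-γ₁) ≤ (t / 2) ^ (-γ₁) :=
        Real.rpow_le_rpow_of_nonpos (by linarith) hr2.le (by linarith [h.γ₁_nonneg])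
      have h9 : 0 ≤ s - r := by linarith
      have h10 : s - r ≤ 2 * (t - r) := by linarith
      gcongr
    set Y := B * (t / 2) ^ (-γ₁) * (2 * (t - r)) ^ (1 - a₁) with hY
    have hY0 : 0 ≤ Y := by
      have : 0 ≤ 2 * (t - r) := by linarith
      positivity
    rw [hrestart r s hr0 h6.1 h7.2, hrestart r t hr0 hr3 ht.2]
    set E1 : Vec d := fun i m => ∫ x in Ioo r s, heat α (s - x) (F x) i m
    set E2 : Vec d := fun i m => ∫ x in Ioo r t, heat α (t - x) (F x) i m
    have e : heat α (s - r) (u r) - E1 - (heat α (t - r) (u r) - E2) =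
        (heat α (s - r) (u r) - heat α (t - r) (u r)) - (E1 - E2) := by abel
    rw [e]
    calc _ ≤ ENNReal.ofReal (ε.toReal / 2) + (ENNReal.ofReal Y + ENNReal.ofReal Y) := by
          refine (h.normN.sub _ _).trans (add_le_add h1 ((h.normN.sub _ _).trans (add_le_add ?_ ?_)))
          · exact hE s h6.1 h7.2 h6.2
          · exact hE t hr3 ht.2 (by linarith)
      _ ≤ ε := by
          rw [← ENNReal.ofReal_add hY0 hY0, ← ENNReal.ofReal_add hε'.le (by positivity)]
          refine ENNReal.ofReal_le_of_le_toReal ?_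
          linarith

end FracNS
end

noncomputable section
namespace FracNS
variable {d : ℕ} {α σ a₁ γ₁ a₂ γ₂ : ℝ} {N M : Vec d → ℝ≥0∞}

/-! ### Finite differences and spatial regularity -/

/-- Translation by `η` in the direction of the `j`-th coordinate. -/
def shift (j : Fin d) (η : ℝ) (u : Vec d) : Vec d := fun i m => shiftSymbol j η m * u i m

/-- The finite difference with step `η` in the direction of the `j`-th coordinate. -/
def diff (j : Fin d) (η : ℝ) (u : Vec d) : Vec d := fun i m => (shiftSymbol j η m - 1) * u i m

theorem diff_eq (j : Fin d) (η : ℝ) (u : Vec d) : diff j η u = shift j η u - u := by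
  ext i m; simp [diff, shift, sub_mul]

theorem iterate_diff_apply (j : Fin d) (η : ℝ) (n : ℕ) (u : Vec d) (i : Fin d) (m : Fin d → ℤ) :
    (diff j η)^[n] u i m = (shiftSymbol j η m - 1) ^ n * u i m := by
  induction n generalizing u with
  | zero => simp
  | succ n ih => rw [Function.iterate_succ_apply, ih, diff, pow_succ, mul_assoc]

theorem iterate_diff_add (j : Fin d) (η : ℝ) (n : ℕ) (u v : Vec d) :
    (diff j η)^[n] (u + v) = (diff j η)^[n] u + (diff j η)^[n] v := by
  ext i m; simp [iterate_diff_apply, mul_add]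

theorem iterate_diff_shift (j : Fin d) (η : ℝ) (n : ℕ) (u : Vec d) :
    (diff j η)^[n] (shift j η u) = shift j η ((diff j η)^[n] u) := by
  ext i m; simp only [iterate_diff_apply, shift]; ring

theorem shiftSymbol_add (j : Fin d) (η : ℝ) (m k : Fin d → ℤ) :
    shiftSymbol j η (m + k) = shiftSymbol j η m * shiftSymbol j η k := by
  simp only [shiftSymbol, ← Complex.exp_add]
  congr 1
  simp only [Pi.add_apply]
  push_cast; ring

theorem nonlin_shift (j : Fin d) (η : ℝ) (u v : Vec d) :
    nonlin (shift j η u) (shift j η v) = shift j η (nonlin u v) := by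
  ext i m
  simp only [nonlin, shift, Finset.mul_sum]
  refine Finset.sum_congr rfl fun k _ => Finset.sum_congr rfl fun l _ => ?_
  rw [mul_left_comm]
  congr 1
  simp only [conv, ← tsum_mul_left]
  refine tsum_congr fun n => ?_
  have := shiftSymbol_add j η n (m - n)
  rw [add_sub_cancel] at this
  simp only [shift]
  rw [this]; ring

theorem nonlin_diff (j : Fin d) (η : ℝ) {u v : Vec d} (hu : IsSq u) (hv : IsSq v)
    (hu' : IsSq (diff j η u)) (hv' : IsSq (diff j η v)) :
    diff j η (nonlin u v) = nonlin (diff j η u) (shift j η v) + nonlin u (diff j η v) := by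
  have e : ∀ w : Vec d, shift j η w = w + diff j η w := fun w => by rw [diff_eq]; abel
  have hsv : IsSq (shift j η v) := by rw [e]; exact hv.add hv'
  rw [diff_eq j η (nonlin u v), ← nonlin_shift, e u, nonlin_add_left hu hu' hsv]
  nth_rewrite 1 [e v]
  rw [nonlin_add_right hu hv hv']
  abel

theorem Bdd.shift (hN : VecNorm N) (hM : VecNorm M) {s A : ℝ} {u : Vec d} (h : Bdd N M σ s u A)
    (hs : 0 < s) (j : Fin d) (η : ℝ) : Bdd N M σ s (shift j η u) A := by
  have := h.mul hN hM hs zero_le_one (mulBound_shiftSymbol j η)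
  rwa [one_mul] at this

theorem VecPair.force_diff (h : VecPair α σ a₁ γ₁ a₂ γ₂ N M) (j : Fin d) : ∃ C : ℝ, 0 ≤ C ∧
    ∀ s, 0 < s → s ≤ 1 → ∀ (y η : ℝ), 0 ≤ η → ∀ (n : ℕ) (u v : Vec d) (A B : ℝ), 0 ≤ A → 0 ≤ B →
      (∀ l ≤ n, Bdd N M σ s ((diff j y)^[l] u) (A * η ^ l)) →
      (∀ l ≤ n, Bdd N M σ s ((diff j y)^[l] v) (B * η ^ l)) →
      Force N M α a₁ γ₁ a₂ γ₂ s ((diff j y)^[n] (nonlin u v)) (2 ^ n * (C * A * B) * η ^ n) := by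
  obtain ⟨C, hC, hb⟩ := h.bilinear
  refine ⟨C, hC, fun s h0 h1 y η hη n => ?_⟩
  induction n with
  | zero =>
    intro u v A B hA hB hu hv
    have h2 := hu 0 le_rfl
    have h3 := hv 0 le_rfl
    simp only [Function.iterate_zero, id, pow_zero, mul_one] at h2 h3
    simpa using hb s h0 h1 u v A B hA hB h2 h3
  | succ n ih =>
    intro u v A B hA hB hu hv
    have hsq : ∀ {w : Vec d} {X : ℝ}, Bdd N M σ s w X → IsSq w := fun hw => hw.isSq h h0
    rw [Function.iterate_succ_apply, nonlin_diff j y (u := u) (v := v) (hsq (hu 0 (by omega))) (hsq (hv 0 (by omega)))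
      (hsq (hu 1 (by omega))) (hsq (hv 1 (by omega))), iterate_diff_add]
    have h2 := ih (diff j y u) (FracNS.shift j y v) (A * η) B (by positivity) hB
      (fun l hl => by
        have := hu (l + 1) (by omega)
        rw [Function.iterate_succ_apply, pow_succ] at this
        exact this.mono (le_of_eq (by ring)))
      (fun l hl => by
        rw [iterate_diff_shift]
        exact (hv l (by omega)).shift h.normN h.normM h0 j y)
    have h3 := ih u (diff j y v) A (B * η) hA (by positivity) (fun l hl => hu l (by omega))
      (fun l hl => by
        have := hv (l + 1) (by omega)
        rw [Function.iterate_succ_apply, pow_succ] at this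
        exact this.mono (le_of_eq (by ring)))
    refine (h2.add h.normN h.normM h0.le (by positivity) (by positivity) h3).mono h0.le
      (le_of_eq ?_)
    ring

theorem Bdd.later {s t A : ℝ} {u : Vec d} (h : Bdd N M σ s u A) (hσ : 0 ≤ σ) (hs : 0 < s) (hst : s ≤ t)
    (ht : t ≤ 1) : Bdd N M σ t u (s ^ (-σ) * A) := by
  have h1 : 1 ≤ s ^ (-σ) := Real.one_le_rpow_of_pos_of_le_one_of_nonpos hs (hst.trans ht) (by linarith)
  unfold Bdd
  rw [ENNReal.ofReal_mul (by positivity)]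
  have h2 : 1 ≤ ENNReal.ofReal (s ^ (-σ)) := by simpa using h1
  refine ⟨h.1.trans (le_mul_of_one_le_left zero_le h2), ?_⟩
  have h3 : t ^ σ ≤ s ^ (-σ) * s ^ σ := by
    rw [← Real.rpow_add hs, neg_add_cancel, Real.rpow_zero]
    exact Real.rpow_le_one (by linarith) ht hσ
  calc _ ≤ ENNReal.ofReal (s ^ (-σ) * s ^ σ) * M u := by gcongr
    _ = ENNReal.ofReal (s ^ (-σ)) * (ENNReal.ofReal (s ^ σ) * M u) := by
        rw [ENNReal.ofReal_mul (by positivity), mul_assoc]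
    _ ≤ _ := by gcongr; exact h.2

/-- A finite difference of a Duhamel integral gains a power of the step. -/
theorem VecPair.diff_tail (h : VecPair α σ a₁ γ₁ a₂ γ₂ N M) {ς : ℝ} (h0 : 0 < ς) (h1 : ς ≤ 1)
    (hς₁ : a₁ + ς / (2 * α) < 1) (hς₂ : a₂ + ς / (2 * α) < 1) (j : Fin d) {r : ℝ} (hr : 0 < r) :
    ∃ C : ℝ, 0 ≤ C ∧ ∀ (F : ℝ → Vec d) (D t y : ℝ), 0 ≤ D → r < t → t ≤ 1 →
      (∀ i m, AEStronglyMeasurable (fun s => F s i m) (volume.restrict (Ioo r t))) →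
      (∀ s, r < s → s < t → Force N M α a₁ γ₁ a₂ γ₂ s (F s) D) →
      Bdd N M σ t (fun i m => ∫ s in Ioo r t, diff j y (heat α (t - s) (F s)) i m)
        (C * D * |y| ^ ς) := by
  obtain ⟨CN, hCN, hN⟩ := h.normN.integral
  obtain ⟨CM, hCM, hM⟩ := h.normM.integral
  obtain ⟨χ⟩ := h.cutoff
  obtain ⟨CS, hCS, hS⟩ := mulBound_shift_sub_one_heat (d := d) χ h.α_pos h0 h1 j
  have hα := h.α_pos
  set δ := ς / (2 * α) with hδ
  have hδ0 : 0 < δ := by positivity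
  have key : ∀ (b : Vec d → ℝ≥0∞) (C a γ : ℝ), VecNorm b → 0 ≤ C → 0 ≤ a → 0 ≤ γ → a + δ < 1 →
      (∀ (I : Set ℝ) (f : ℝ → Vec d) (w : ℝ → ℝ≥0∞),
        (∀ i m, AEStronglyMeasurable (fun s => f s i m) (volume.restrict I)) →
        (∀ᵐ s ∂(volume.restrict I), ∀ i, Summable fun m => ‖f s i m‖) → Measurable w →
        (∀ᵐ s ∂(volume.restrict I), b (f s) ≤ w s) →
        b (fun i m => ∫ s in I, f s i m) ≤ ENNReal.ofReal C * ∫⁻ s in I, w s) →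
      ∃ C' : ℝ, 0 ≤ C' ∧ ∀ (F : ℝ → Vec d) (D t y : ℝ), 0 ≤ D → r < t → t ≤ 1 →
      (∀ i m, AEStronglyMeasurable (fun s => F s i m) (volume.restrict (Ioo r t))) →
      (∀ s, r < s → s < t → Force N M α a₁ γ₁ a₂ γ₂ s (F s) D) →
      (∀ s, r < s → s < t → ∀ τ, 0 < τ → τ ≤ 1 → b (heat α τ (F s)) ≤
        ENNReal.ofReal (D * (τ ^ (-a) * s ^ (-γ)))) →
      b (fun i m => ∫ s in Ioo r t, diff j y (heat α (t - s) (F s)) i m) ≤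
        ENNReal.ofReal (C' * D * |y| ^ ς) := by
    intro b C a γ hb hC ha hγ haδ hint
    have h1a : 0 < 1 - (a + δ) := by linarith
    refine ⟨C * (CS * 4 * r ^ (-γ) / (1 - (a + δ))), by positivity,
      fun F D t y hD hrt ht1 hm hF hbF => ?_⟩
    have hle : ∀ s ∈ Ioo r t, b (diff j y (heat α (t - s) (F s))) ≤
        ENNReal.ofReal (CS * 4 * r ^ (-γ) * D * |y| ^ ς) * ENNReal.ofReal ((t - s) ^ (-(a + δ))) := by
      intro s hs
      have hts : 0 < t - s := by linarith [hs.2]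
      have hs0 : 0 < s := hr.trans hs.1
      have e : diff j y (heat α (t - s) (F s)) = fun i m =>
          ((shiftSymbol j y m - 1) * heatSymbol α ((t - s) / 2) m) * heat α ((t - s) / 2) (F s) i m := by
        have h2 := heat_heat α ((t - s) / 2) ((t - s) / 2) (F s)
        rw [add_halves] at h2
        rw [← h2]
        ext i m
        simp only [diff, heat, mul_assoc]
      have h3 := hbF s hs.1 hs.2 ((t - s) / 2) (by linarith) (by linarith)
      rw [e]
      refine (hb.mul _ _ (by positivity) (hS ((t - s) / 2) y (by linarith) (by linarith)) _
        (ne_top_of_le_ne_top ENNReal.ofReal_ne_top h3)).trans ?_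
      refine (mul_le_mul_right h3 _).trans ?_
      rw [← ENNReal.ofReal_mul (by positivity), ← ENNReal.ofReal_mul (by positivity)]
      refine ENNReal.ofReal_le_ofReal ?_
      have h4 : s ^ (-γ) ≤ r ^ (-γ) := Real.rpow_le_rpow_of_nonpos hr hs.1.le (by linarith)
      have h5 : ((t - s) / 2) ^ (-δ) * ((t - s) / 2) ^ (-a) ≤ 4 * (t - s) ^ (-(a + δ)) := by
        rw [← Real.rpow_add (by positivity)]
        have e2 : -δ + -a = -(a + δ) := by ring
        rw [e2, Real.div_rpow hts.le zero_le_two, Real.rpow_neg zero_le_two, div_inv_eq_mul, mul_comm]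
        gcongr
        calc (2 : ℝ) ^ (a + δ) ≤ 2 ^ (1 : ℝ) := Real.rpow_le_rpow_of_exponent_le one_le_two haδ.le
          _ ≤ 4 := by norm_num
      calc _ = CS * |y| ^ ς * D * ((((t - s) / 2) ^ (-δ) * ((t - s) / 2) ^ (-a)) * s ^ (-γ)) := by ring
        _ ≤ CS * |y| ^ ς * D * ((4 * (t - s) ^ (-(a + δ))) * r ^ (-γ)) := by gcongr
        _ = _ := by ring
    refine (hint (Ioo r t) (fun s => diff j y (heat α (t - s) (F s)))
      (fun s => ENNReal.ofReal (CS * 4 * r ^ (-γ) * D * |y| ^ ς) *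
        ENNReal.ofReal ((t - s) ^ (-(a + δ)))) (fun i m => ?_) ?_ (by fun_prop) ?_).trans ?_
    · refine AEStronglyMeasurable.const_mul (AEStronglyMeasurable.mul ?_ (hm i m)) _
      have := (continuous_heatSymbol α m).comp
        (continuous_const.sub continuous_id : Continuous fun s => t - s)
      exact (Complex.continuous_ofReal.comp this).aestronglyMeasurable
    · filter_upwards [ae_restrict_mem measurableSet_Ioo] with s hs i
      have h6 := h.force_summable (hr.trans hs.1) hD (hF s hs.1 hs.2)
        (by linarith [hs.2] : 0 < t - s) (by linarith [hs.1]) i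
      refine Summable.of_nonneg_of_le (fun _ => norm_nonneg _) (fun m => ?_) (h6.mul_left 2)
      rw [diff, norm_mul]
      gcongr
      refine (norm_sub_le _ _).trans ?_
      have h7 := (mulBound_shiftSymbol j y).norm_le zero_le_one m
      rw [norm_one]
      linarith
    · filter_upwards [ae_restrict_mem measurableSet_Ioo] with s hs using hle s hs
    · rw [lintegral_const_mul' _ _ ENNReal.ofReal_ne_top, lintegral_sub_rpow_neg haδ hrt,
        ← ENNReal.ofReal_mul (by positivity), ← ENNReal.ofReal_mul hC]
      refine ENNReal.ofReal_le_ofReal ?_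
      have h8 : (t - r) ^ (1 - (a + δ)) ≤ 1 :=
        Real.rpow_le_one (by linarith) (by linarith) h1a.le
      calc _ = C * (CS * 4 * r ^ (-γ) / (1 - (a + δ))) * D * |y| ^ ς * (t - r) ^ (1 - (a + δ)) := by
            ring
        _ ≤ C * (CS * 4 * r ^ (-γ) / (1 - (a + δ))) * D * |y| ^ ς * 1 := by gcongr
        _ = _ := mul_one _
  obtain ⟨C₁, hC₁, k₁⟩ := key N CN a₁ γ₁ h.normN hCN h.a₁_nonneg h.γ₁_nonneg hς₁ hN
  obtain ⟨C₂, hC₂, k₂⟩ := key M CM a₂ γ₂ h.normM hCM h.a₂_nonneg h.γ₂_nonneg hς₂ hM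
  refine ⟨C₁ + C₂, by positivity, fun F D t y hD hrt ht1 hm hF => ⟨?_, ?_⟩⟩
  · refine (k₁ F D t y hD hrt ht1 hm hF fun s h2 h3 τ h4 h5 => (hF s h2 h3 τ h4 h5).1).trans ?_
    gcongr; linarith
  · refine le_trans ?_ ((k₂ F D t y hD hrt ht1 hm hF
      fun s h2 h3 τ h4 h5 => (hF s h2 h3 τ h4 h5).2).trans ?_)
    · refine mul_le_of_le_one_left zero_le ?_
      rw [ENNReal.ofReal_le_one]
      exact Real.rpow_le_one (by linarith) ht1 h.σ_nonneg
    · gcongr; linarith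

end FracNS
end

noncomputable section
namespace FracNS
variable {d : ℕ} {α σ a₁ γ₁ a₂ γ₂ : ℝ} {N M : Vec d → ℝ≥0∞}

/-- Finite differences of the solution of any order are controlled by powers of the step. -/
theorem VecPair.diff_bdd (h : VecPair α σ a₁ γ₁ a₂ γ₂ N M) {T A : ℝ} (hT1 : T ≤ 1)
    (hA : 0 ≤ A) {u₀ : Vec d} {u : ℝ → Vec d} (hm : CoeffMeas T u)
    (hb : ∀ t, 0 < t → t ≤ T → Bdd N M σ t (u t) A)
    (hs : ∀ t, 0 ≤ t → t ≤ T → SolvesAt α u₀ u t) (j : Fin d) :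
    ∃ ς : ℝ, 0 < ς ∧ ∀ n : ℕ, ∀ ε, 0 < ε → ∃ C : ℝ, 0 ≤ C ∧ ∀ t, ε ≤ t → t ≤ T → ∀ (y : ℝ), ∀ l ≤ n,
      Bdd N M σ t ((diff j y)^[l] (u t)) (C * (|y| ^ ς) ^ l) := by
  have hα := h.α_pos
  have ha1 := h.a₁_lt
  have ha2 := h.a₂_lt
  obtain ⟨ς, h0, h1'⟩ : ∃ ς : ℝ, 0 < ς ∧ ς < min 1 (min ((1 - a₁) * (2 * α)) ((1 - a₂) * (2 * α))) := by
    refine exists_between (lt_min one_pos (lt_min ?_ ?_))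
    · have : 0 < 1 - a₁ := by linarith
      positivity
    · have : 0 < 1 - a₂ := by linarith
      positivity
  have h1 : ς ≤ 1 := (h1'.trans_le (min_le_left _ _)).le
  have hς₁ : a₁ + ς / (2 * α) < 1 := by
    have := h1'.trans_le ((min_le_right _ _).trans (min_le_left _ _))
    rw [← div_lt_iff₀ (by positivity)] at this
    linarith
  have hς₂ : a₂ + ς / (2 * α) < 1 := by
    have := h1'.trans_le ((min_le_right _ _).trans (min_le_right _ _))
    rw [← div_lt_iff₀ (by positivity)] at this
    linarith
  obtain ⟨χ⟩ := h.cutoff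
  obtain ⟨CS, hCS, hS⟩ := mulBound_shift_sub_one_heat (d := d) χ h.α_pos h0 h1 j
  obtain ⟨CF, hCF, hF⟩ := h.force_diff j
  refine ⟨ς, h0, fun n => ?_⟩
  induction n with
  | zero =>
    refine fun ε hε => ⟨A, hA, fun t hεt htT y l hl => ?_⟩
    obtain rfl : l = 0 := by omega
    simpa using hb t (hε.trans_le hεt) htT
  | succ n ih =>
    intro ε hε
    obtain ⟨r, hr, hrε⟩ : ∃ r : ℝ, 0 < r ∧ r < ε := exists_between hε
    obtain ⟨C, hC, hCb⟩ := ih r hr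
    obtain ⟨CT, hCT, hT⟩ := h.diff_tail h0 h1 hς₁ hς₂ j hr
    refine ⟨C + (r ^ (-σ) * (CS * (ε - r) ^ (-(ς / (2 * α))) * C) + CT * (2 ^ n * (CF * C * C))),
      by have : 0 < ε - r := by linarith
         positivity, fun t hεt htT y l hl => ?_⟩
    have hεr : 0 < ε - r := by linarith
    have hrt : r < t := by linarith
    rcases Nat.lt_or_ge l (n + 1) with hln | hln
    · refine (hCb t (by linarith) htT y l (by omega)).mono ?_
      gcongr
      have : 0 ≤ r ^ (-σ) * (CS * (ε - r) ^ (-(ς / (2 * α))) * C) + CT * (2 ^ n * (CF * C * C)) := by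
        positivity
      linarith
    obtain rfl : l = n + 1 := by omega
    set η := |y| ^ ς with hη
    have hη0 : 0 ≤ η := by positivity
    have e : (diff j y)^[n + 1] (u t) =
        (fun i m => ((shiftSymbol j y m - 1) * heatSymbol α (t - r) m) * (diff j y)^[n] (u r) i m) -
        fun i m => ∫ s in Ioo r t, diff j y
          (heat α (t - s) ((diff j y)^[n] (nonlin (u s) (u s)))) i m := by
      ext i m
      rw [iterate_diff_apply]
      nth_rewrite 1 [h.restart hT1 hA hm hb hs hr hrt htT]
      simp only [Pi.sub_apply, heat, iterate_diff_apply, diff]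
      rw [mul_sub, ← integral_const_mul]
      congr 1
      · ring
      · refine integral_congr_ae (.of_forall fun s => ?_)
        simp only
        ring
    have hsq : ∀ᵐ s ∂(volume.restrict (Ioo 0 T)), IsSq (u s) := by
      filter_upwards [ae_restrict_mem measurableSet_Ioo] with s hs
      exact (hb s hs.1 hs.2.le).isSq h hs.1
    have hlin : Bdd N M σ t (fun i m => ((shiftSymbol j y m - 1) * heatSymbol α (t - r) m) *
        (diff j y)^[n] (u r) i m) (r ^ (-σ) * (CS * (ε - r) ^ (-(ς / (2 * α))) * C) * η ^ (n + 1)) := by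
      have h2 := ((hCb r le_rfl (by linarith) y n le_rfl).mul h.normN h.normM hr (by positivity)
        (hS (t - r) y (by linarith) (by linarith))).later h.σ_nonneg hr hrt.le (htT.trans hT1)
      refine h2.mono ?_
      have h3 : (t - r) ^ (-(ς / (2 * α))) ≤ (ε - r) ^ (-(ς / (2 * α))) :=
        Real.rpow_le_rpow_of_nonpos hεr (by linarith) (by rw [neg_nonpos]; positivity)
      calc _ = r ^ (-σ) * (CS * (t - r) ^ (-(ς / (2 * α))) * C) * η ^ (n + 1) := by
            rw [hη, pow_succ]; ring
        _ ≤ _ := by gcongr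
    have hint := hT (fun s => (diff j y)^[n] (nonlin (u s) (u s))) (2 ^ n * (CF * C * C) * η ^ n) t y
      (by positivity) hrt (htT.trans hT1) (fun i m => by
        simp only [iterate_diff_apply]
        exact (((hm.nonlin hsq) i m).mono_measure
          (Measure.restrict_mono (Ioo_subset_Ioo hr.le htT) le_rfl)).const_mul _)
      fun s hrs hst => hF s (by linarith) (by linarith) y η hη0 n (u s) (u s) C C hC hC
        (fun l hl => hCb s hrs.le (by linarith) y l hl) (fun l hl => hCb s hrs.le (by linarith) y l hl)
    rw [e]
    refine (hlin.sub h.normN h.normM (by positivity) (by positivity) hint).mono ?_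
    have h5 : 0 ≤ C * η ^ (n + 1) := by positivity
    calc _ = (r ^ (-σ) * (CS * (ε - r) ^ (-(ς / (2 * α))) * C) + CT * (2 ^ n * (CF * C * C))) *
          η ^ (n + 1) := by rw [← hη, pow_succ]; ring
      _ ≤ _ := by rw [add_mul C]; linarith

theorem exists_norm_freq_le {m : Fin d → ℤ} (hm : m ≠ 0) :
    ∃ j, m j ≠ 0 ∧ ‖freq m‖ ≤ d * |(m j : ℝ)| := by
  obtain ⟨i, hi⟩ := Function.ne_iff.1 hm
  obtain ⟨j, -, hj⟩ := Finset.exists_max_image Finset.univ (fun j => |(m j : ℝ)|) ⟨i, Finset.mem_univ i⟩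
  have h1 : 1 ≤ |(m i : ℝ)| := by exact_mod_cast Int.one_le_abs hi
  refine ⟨j, fun h => ?_, ?_⟩
  · have := hj i (Finset.mem_univ i)
    rw [h] at this
    simp only [Int.cast_zero, abs_zero] at this
    linarith
  · rw [EuclideanSpace.norm_eq]
    refine Real.sqrt_le_iff.2 ⟨by positivity, ?_⟩
    calc ∑ i, ‖freq m i‖ ^ 2 ≤ ∑ _i : Fin d, |(m j : ℝ)| ^ 2 := by
          refine Finset.sum_le_sum fun i _ => ?_
          have : ‖freq m i‖ = |(m i : ℝ)| := rfl
          rw [this]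
          have := hj i (Finset.mem_univ i)
          gcongr
      _ = d * |(m j : ℝ)| ^ 2 := by simp
      _ ≤ d ^ 2 * |(m j : ℝ)| ^ 2 := by
          gcongr
          have : (1 : ℝ) ≤ d := by exact_mod_cast (Fin.pos i)
          nlinarith
      _ = _ := by ring

theorem shiftSymbol_half (j : Fin d) {m : Fin d → ℤ} (hm : m j ≠ 0) :
    shiftSymbol j (1 / (2 * (m j : ℝ))) m = -1 := by
  have : (m j : ℝ) ≠ 0 := by exact_mod_cast hm
  rw [shiftSymbol]
  have e : 1 / (2 * (m j : ℝ)) * m j = 1 / 2 := by field_simp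
  rw [e]
  push_cast
  rw [show 2 * (Real.pi : ℂ) * Complex.I * (1 / 2) = Real.pi * Complex.I by ring, Complex.exp_pi_mul_I]

/-- The Fourier coefficients of the solution decay rapidly, uniformly away from the initial time. -/
theorem VecPair.decay (h : VecPair α σ a₁ γ₁ a₂ γ₂ N M) {T A : ℝ} (hT1 : T ≤ 1)
    (hA : 0 ≤ A) {u₀ : Vec d} {u : ℝ → Vec d} (hm : CoeffMeas T u)
    (hb : ∀ t, 0 < t → t ≤ T → Bdd N M σ t (u t) A)
    (hs : ∀ t, 0 ≤ t → t ≤ T → SolvesAt α u₀ u t) {ε : ℝ} (hε : 0 < ε) (k : ℕ) :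
    ∃ C : ℝ, 0 ≤ C ∧ ∀ t, ε ≤ t → t ≤ T → ∀ i m, ‖u t i m‖ ≤ C * (wt m ^ k)⁻¹ := by
  obtain ⟨CN, K, hCN, hco⟩ := h.normN.coeff_real
  have hj : ∀ j : Fin d, ∃ C : ℝ, 0 ≤ C ∧ ∀ t, ε ≤ t → t ≤ T → ∀ i m, m j ≠ 0 →
      ‖freq m‖ ≤ d * |(m j : ℝ)| → ‖u t i m‖ ≤ C * (wt m ^ k)⁻¹ := by
    intro j
    obtain ⟨ς, hς, hd⟩ := h.diff_bdd hT1 hA hm hb hs j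
    obtain ⟨n, hn⟩ := exists_nat_gt (((K + k : ℕ) : ℝ) / ς)
    rw [div_lt_iff₀ hς] at hn
    obtain ⟨C, hC, hCb⟩ := hd n ε hε
    refine ⟨CN * C * (d : ℝ) ^ (ς * n), by positivity, fun t hεt htT i m hmj hfm => ?_⟩
    have hw := wt_pos m
    have hmj' : 1 ≤ |(m j : ℝ)| := by exact_mod_cast Int.one_le_abs hmj
    have h1 := hco _ _ (by positivity) (hCb t hεt htT (1 / (2 * (m j : ℝ))) n le_rfl).1 i m
    rw [iterate_diff_apply, shiftSymbol_half j hmj, norm_mul, norm_pow] at h1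
    have h2 : ‖(-1 - 1 : ℂ)‖ = 2 := by norm_num
    rw [h2] at h1
    have h3 : ‖u t i m‖ ≤ 2 ^ n * ‖u t i m‖ :=
      le_mul_of_one_le_left (norm_nonneg _) (one_le_pow₀ one_le_two)
    have hd0 : (1 : ℝ) ≤ d := by exact_mod_cast (Fin.pos i)
    have h4 : |1 / (2 * (m j : ℝ))| ≤ d / wt m := by
      rw [abs_div, abs_one, abs_mul, abs_two, div_le_div_iff₀ (by positivity) hw, one_mul]
      unfold wt
      have : (1 : ℝ) ≤ d * |(m j : ℝ)| := by nlinarith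
      nlinarith
    have h5 : (|1 / (2 * (m j : ℝ))| ^ ς) ^ n ≤ (d : ℝ) ^ (ς * n) * (wt m ^ (K + k))⁻¹ := by
      calc _ ≤ ((d / wt m) ^ ς) ^ n := by gcongr
        _ = (d : ℝ) ^ (ς * n) * (wt m ^ (ς * n))⁻¹ := by
            rw [← Real.rpow_natCast, ← Real.rpow_mul (by positivity),
              Real.div_rpow (by positivity) hw.le, div_eq_mul_inv]
        _ ≤ _ := by
            gcongr
            rw [← Real.rpow_natCast]
            exact Real.rpow_le_rpow_of_exponent_le (one_le_wt m) (by linarith)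
    calc _ ≤ CN * wt m ^ K * (C * (|1 / (2 * (m j : ℝ))| ^ ς) ^ n) := h3.trans h1
      _ ≤ CN * wt m ^ K * (C * ((d : ℝ) ^ (ς * n) * (wt m ^ (K + k))⁻¹)) := by gcongr
      _ = _ := by rw [pow_add]; field_simp
  choose C hC hCb using hj
  refine ⟨CN * A + ∑ j, C j, add_nonneg (by positivity) (Finset.sum_nonneg fun j _ => hC j),
    fun t hεt htT i m => ?_⟩
  have hw := wt_pos m
  by_cases hm0 : m = 0
  · have h1 := hco _ _ hA (hb t (hε.trans_le hεt) htT).1 i m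
    have h2 : wt m = 1 := by rw [hm0]; simp [wt, freq_zero]
    rw [h2] at h1 ⊢
    simp only [one_pow, mul_one, inv_one] at h1 ⊢
    have := Finset.sum_nonneg fun j (_ : j ∈ Finset.univ) => hC j
    linarith
  · obtain ⟨j, hj, hfj⟩ := exists_norm_freq_le hm0
    refine (hCb j t hεt htT i m hj hfj).trans ?_
    gcongr
    have := Finset.single_le_sum (f := C) (fun j _ => hC j) (Finset.mem_univ j)
    have : 0 ≤ CN * A := by positivity
    linarith

end FracNS
end

noncomputable section
namespace FracNS
variable {d : ℕ} {T : ℝ}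

/-! ### Families of rapidly decaying Fourier coefficients that are smooth in time -/

/-- Rapid decay of the Fourier coefficients, uniform in time on `[ε, T)`. -/
def RapidDecay (T : ℝ) (c : ℝ → Seq d) : Prop :=
  ∀ ε, 0 < ε → ∀ k : ℕ, ∃ C : ℝ, 0 ≤ C ∧ ∀ t, ε ≤ t → t < T → ∀ m, ‖c t m‖ ≤ C * (wt m ^ k)⁻¹

/-- Families of Fourier coefficients with `n` time derivatives, all rapidly decaying. -/
def TimeSmooth (T : ℝ) : ℕ → (ℝ → Seq d) → Prop
  | 0, c => RapidDecay T c ∧ ∀ m, ContinuousOn (fun t => c t m) (Ioo 0 T)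
  | n + 1, c => RapidDecay T c ∧ ∃ c' : ℝ → Seq d,
      (∀ t ∈ Ioo 0 T, ∀ m, HasDerivAt (fun s => c s m) (c' t m) t) ∧ TimeSmooth T n c'

theorem TimeSmooth.decay {n : ℕ} {c : ℝ → Seq d} (h : TimeSmooth T n c) : RapidDecay T c := by
  cases n with
  | zero => exact h.1
  | succ n => exact h.1

theorem TimeSmooth.continuousOn {n : ℕ} {c : ℝ → Seq d} (h : TimeSmooth T n c) (m : Fin d → ℤ) :
    ContinuousOn (fun t => c t m) (Ioo 0 T) := by
  cases n with
  | zero => exact h.2 m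
  | succ n =>
    obtain ⟨-, c', hc, -⟩ := h
    exact fun t ht => (hc t ht m).continuousAt.continuousWithinAt

theorem TimeSmooth.pred {n : ℕ} {c : ℝ → Seq d} (h : TimeSmooth T (n + 1) c) : TimeSmooth T n c := by
  induction n generalizing c with
  | zero => exact ⟨h.decay, h.continuousOn⟩
  | succ n ih =>
    obtain ⟨h1, c', hc, h2⟩ := h
    exact ⟨h1, c', hc, ih h2⟩

theorem RapidDecay.add {c c' : ℝ → Seq d} (h : RapidDecay T c) (h' : RapidDecay T c') :
    RapidDecay T fun t => c t + c' t := fun ε hε k => by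
  obtain ⟨C, hC, hb⟩ := h ε hε k
  obtain ⟨C', hC', hb'⟩ := h' ε hε k
  refine ⟨C + C', by positivity, fun t h0 h1 m => (norm_add_le _ _).trans ?_⟩
  rw [add_mul]
  exact add_le_add (hb t h0 h1 m) (hb' t h0 h1 m)

theorem TimeSmooth.add {n : ℕ} {c c' : ℝ → Seq d} (h : TimeSmooth T n c) (h' : TimeSmooth T n c') :
    TimeSmooth T n fun t => c t + c' t := by
  induction n generalizing c c' with
  | zero => exact ⟨h.1.add h'.1, fun m => (h.2 m).add (h'.2 m)⟩
  | succ n ih =>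
    obtain ⟨h1, e, he, h2⟩ := h
    obtain ⟨h1', e', he', h2'⟩ := h'
    exact ⟨h1.add h1', fun t => e t + e' t, fun t ht m => (he t ht m).add (he' t ht m), ih h2 h2'⟩

theorem RapidDecay.mul {c : ℝ → Seq d} (h : RapidDecay T c) {p : Seq d} {D : ℝ} {K : ℕ} (hD : 0 ≤ D)
    (hp : ∀ m, ‖p m‖ ≤ D * wt m ^ K) : RapidDecay T fun t m => p m * c t m := fun ε hε k => by
  obtain ⟨C, hC, hb⟩ := h ε hε (K + k)
  refine ⟨D * C, by positivity, fun t h0 h1 m => ?_⟩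
  have hw := wt_pos m
  rw [norm_mul]
  calc _ ≤ D * wt m ^ K * (C * (wt m ^ (K + k))⁻¹) := by
        gcongr
        · exact hp m
        · exact hb t h0 h1 m
    _ = _ := by rw [pow_add]; field_simp

theorem TimeSmooth.mul {n : ℕ} {c : ℝ → Seq d} (h : TimeSmooth T n c) {p : Seq d} {D : ℝ} {K : ℕ}
    (hD : 0 ≤ D) (hp : ∀ m, ‖p m‖ ≤ D * wt m ^ K) : TimeSmooth T n fun t m => p m * c t m := by
  induction n generalizing c with
  | zero => exact ⟨h.1.mul hD hp, fun m => continuousOn_const.mul (h.2 m)⟩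
  | succ n ih =>
    obtain ⟨h1, e, he, h2⟩ := h
    exact ⟨h1.mul hD hp, fun t m => p m * e t m, fun t ht m => (he t ht m).const_mul _, ih h2⟩

theorem timeSmooth_zero (n : ℕ) : TimeSmooth T n fun _ => (0 : Seq d) := by
  have h0 : RapidDecay T fun _ => (0 : Seq d) := fun ε _ k =>
    ⟨0, le_rfl, fun t _ _ m => by simp⟩
  induction n with
  | zero => exact ⟨h0, fun m => continuousOn_const⟩
  | succ n ih => exact ⟨h0, _, fun t _ m => hasDerivAt_const _ _, ih⟩

theorem TimeSmooth.sum {ι : Type*} (s : Finset ι) {n : ℕ} {c : ι → ℝ → Seq d}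
    (h : ∀ i ∈ s, TimeSmooth T n (c i)) : TimeSmooth T n fun t => ∑ i ∈ s, c i t := by
  classical
  induction s using Finset.induction_on with
  | empty => simpa using timeSmooth_zero n
  | insert a s ha ih =>
    simp only [Finset.sum_insert ha]
    exact (h a (by simp)).add (ih fun i hi => h i (by simp [hi]))

theorem wt_le_mul (m k : Fin d → ℤ) : wt m ≤ wt k * wt (m - k) := by
  have h1 : freq m = freq k + freq (m - k) := by
    ext i; simp [freq]
  have h2 : ‖freq m‖ ≤ ‖freq k‖ + ‖freq (m - k)‖ := by rw [h1]; exact norm_add_le _ _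
  have := norm_nonneg (freq k)
  have := norm_nonneg (freq (m - k))
  unfold wt
  nlinarith

/-- Uniform bound for the terms of a convolution. -/
theorem RapidDecay.conv_term {a b : ℝ → Seq d} (ha : RapidDecay T a) (hb : RapidDecay T b) {ε : ℝ}
    (hε : 0 < ε) (K : ℕ) : ∃ C : ℝ, 0 ≤ C ∧ ∀ t, ε ≤ t → t < T → ∀ m k,
      ‖a t k * b t (m - k)‖ ≤ C * (wt m ^ K)⁻¹ * (wt k ^ (2 * d))⁻¹ := by
  obtain ⟨C, hC, hb1⟩ := ha ε hε (K + 2 * d)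
  obtain ⟨C', hC', hb2⟩ := hb ε hε K
  refine ⟨C * C', by positivity, fun t h0 h1 m k => ?_⟩
  have hw := wt_pos m
  have hwk := wt_pos k
  have hwmk := wt_pos (m - k)
  rw [norm_mul]
  calc _ ≤ C * (wt k ^ (K + 2 * d))⁻¹ * (C' * (wt (m - k) ^ K)⁻¹) := by
        gcongr
        · exact hb1 t h0 h1 k
        · exact hb2 t h0 h1 (m - k)
    _ = C * C' * ((wt k * wt (m - k)) ^ K)⁻¹ * (wt k ^ (2 * d))⁻¹ := by
        rw [pow_add, mul_pow]; field_simp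
    _ ≤ _ := by
        gcongr
        exact wt_le_mul m k

theorem RapidDecay.conv {a b : ℝ → Seq d} (ha : RapidDecay T a) (hb : RapidDecay T b) :
    RapidDecay T fun t => conv (a t) (b t) := fun ε hε k => by
  obtain ⟨C, hC, hb⟩ := ha.conv_term hb hε k
  refine ⟨C * ∑' l : Fin d → ℤ, (wt l ^ (2 * d))⁻¹,
    mul_nonneg hC (tsum_nonneg fun l => by have := wt_pos l; positivity), fun t h0 h1 m => ?_⟩
  refine (tsum_of_norm_bounded (((summable_wt d).hasSum).mul_left (C * (wt m ^ k)⁻¹))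
    (hb t h0 h1 m)).trans_eq ?_
  ring

theorem TimeSmooth.conv {n : ℕ} {a b : ℝ → Seq d} (ha : TimeSmooth T n a) (hb : TimeSmooth T n b) :
    TimeSmooth T n fun t => conv (a t) (b t) := by
  induction n generalizing a b with
  | zero =>
    refine ⟨ha.1.conv hb.1, fun m t ht => ?_⟩
    obtain ⟨C, hC, hbd⟩ := ha.1.conv_term hb.1 (half_pos ht.1) 0
    have hs : Ioo (t / 2) T ∈ 𝓝 t := Ioo_mem_nhds (half_lt_self ht.1) ht.2
    have hc : ContinuousOn (fun t => FracNS.conv (a t) (b t) m) (Ioo (t / 2) T) := by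
      refine continuousOn_tsum (fun k => ?_) ((summable_wt d).mul_left (C * (wt m ^ 0)⁻¹))
        fun k s hs => hbd s hs.1.le hs.2 m k
      have hsub : Ioo (t / 2) T ⊆ Ioo 0 T := Ioo_subset_Ioo_left (half_pos ht.1).le
      exact ((ha.2 k).mono hsub).mul ((hb.2 (m - k)).mono hsub)
    exact (hc.continuousAt hs).continuousWithinAt
  | succ n ih =>
    have ha' := ha.pred
    have hb' := hb.pred
    obtain ⟨h1, a', ha1, ha2⟩ := ha
    obtain ⟨h2, b', hb1, hb2⟩ := hb
    refine ⟨h1.conv h2, fun t => FracNS.conv (a' t) (b t) + FracNS.conv (a t) (b' t), fun t ht m => ?_,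
      (ih ha2 hb').add (ih ha' hb2)⟩
    obtain ⟨C, hC, hbd⟩ := ha2.decay.conv_term h2 (half_pos ht.1) 0
    obtain ⟨C', hC', hbd'⟩ := h1.conv_term hb2.decay (half_pos ht.1) 0
    obtain ⟨C₀, hC₀, hbd₀⟩ := h1.conv_term h2 (half_pos ht.1) 0
    have hsm : Summable fun k : Fin d → ℤ => (C + C') * (wt m ^ 0)⁻¹ * (wt k ^ (2 * d))⁻¹ :=
      (summable_wt d).mul_left _
    have htm : t ∈ Ioo (t / 2) T := ⟨half_lt_self ht.1, ht.2⟩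
    have hsub : Ioo (t / 2) T ⊆ Ioo 0 T := Ioo_subset_Ioo_left (half_pos ht.1).le
    have key := hasDerivAt_tsum_of_isPreconnected (g := fun k s => a s k * b s (m - k))
      (g' := fun k s => a' s k * b s (m - k) + a s k * b' s (m - k)) hsm isOpen_Ioo isPreconnected_Ioo
      (fun k s hs => (ha1 s (hsub hs) k).mul (hb1 s (hsub hs) (m - k)))
      (fun k s hs => by
        refine (norm_add_le _ _).trans ?_
        rw [add_mul, add_mul]
        exact add_le_add (hbd s hs.1.le hs.2 m k) (hbd' s hs.1.le hs.2 m k)) htm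
      (Summable.of_norm_bounded ((summable_wt d).mul_left _) fun k => hbd₀ t htm.1.le htm.2 m k) htm
    refine key.congr_deriv ?_
    rw [Summable.tsum_add]
    · rfl
    · exact Summable.of_norm_bounded ((summable_wt d).mul_left _) fun k => hbd t htm.1.le htm.2 m k
    · exact Summable.of_norm_bounded ((summable_wt d).mul_left _) fun k => hbd' t htm.1.le htm.2 m k

theorem norm_lerayDeriv_le (i k j : Fin d) (m : Fin d → ℤ) :
    ‖lerayDeriv i k j (freq m)‖ ≤ 4 * Real.pi * wt m ^ 1 := by
  have hpi := Real.pi_pos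
  have h1 : ∀ l, ‖((freq m l : ℝ) : ℂ)‖ ≤ ‖freq m‖ := fun l => by
    rw [Complex.norm_real]; exact PiLp.norm_apply_le (freq m) l
  have h2 : ‖(if i = k then (1 : ℂ) else 0) - (freq m i : ℂ) * (freq m k : ℂ) / ((‖freq m‖ ^ 2 : ℝ) : ℂ)‖
      ≤ 2 := by
    refine (norm_sub_le _ _).trans ?_
    have h3 : ‖if i = k then (1 : ℂ) else 0‖ ≤ 1 := by split_ifs <;> simp
    have h4 : ‖(freq m i : ℂ) * (freq m k : ℂ) / ((‖freq m‖ ^ 2 : ℝ) : ℂ)‖ ≤ 1 := by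
      rw [norm_div, norm_mul, Complex.norm_real (‖freq m‖ ^ 2), Real.norm_of_nonneg (by positivity)]
      refine div_le_one_of_le₀ ?_ (by positivity)
      rw [sq]
      exact mul_le_mul (h1 i) (h1 k) (norm_nonneg _) (norm_nonneg _)
    linarith
  rw [lerayDeriv, norm_mul, norm_mul]
  have h5 : ‖2 * (Real.pi : ℂ) * Complex.I‖ = 2 * Real.pi := by
    simp [abs_of_pos hpi]
  rw [h5, pow_one]
  calc _ ≤ 2 * Real.pi * wt m * 2 := by
        have hw := wt_pos m
        refine mul_le_mul (mul_le_mul_of_nonneg_left ((h1 j).trans ?_) (by positivity)) h2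
          (norm_nonneg _) (by positivity)
        unfold wt; linarith
    _ = _ := by ring

theorem lapSymbol_le (α : ℝ) : ∃ (D : ℝ) (K : ℕ), 0 ≤ D ∧
    ∀ m : Fin d → ℤ, 0 < α → lapSymbol α (freq m) ≤ D * wt m ^ K := by
  obtain ⟨K, hK⟩ := exists_nat_gt (2 * α)
  refine ⟨(2 * Real.pi) ^ (2 * α), K, by have := Real.pi_pos; positivity, fun m hα => ?_⟩
  have hpi := Real.pi_pos
  have hw := wt_pos m
  rw [lapSymbol, Real.mul_rpow (by positivity) (norm_nonneg _)]
  gcongr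
  calc ‖freq m‖ ^ (2 * α) ≤ wt m ^ (2 * α) := by
        refine Real.rpow_le_rpow (norm_nonneg _) ?_ (by positivity)
        unfold wt; linarith
    _ ≤ wt m ^ (K : ℝ) := Real.rpow_le_rpow_of_exponent_le (one_le_wt m) hK.le
    _ = _ := Real.rpow_natCast _ _

theorem TimeSmooth.nonlin {n : ℕ} {u : ℝ → Vec d} (h : ∀ i, TimeSmooth T n fun t => u t i) (i : Fin d) :
    TimeSmooth T n fun t => nonlin (u t) (u t) i := by
  have h1 := TimeSmooth.sum Finset.univ fun k _ => TimeSmooth.sum Finset.univ fun j _ =>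
    ((h k).conv (h j)).mul (p := fun m => lerayDeriv i k j (freq m)) (by have := Real.pi_pos; positivity)
      (norm_lerayDeriv_le i k j)
  convert! h1 using 2 with t
  ext m
  simp [FracNS.nonlin]

variable {α σ a₁ γ₁ a₂ γ₂ : ℝ} {N M : Vec d → ℝ≥0∞}

theorem VecPair.coeff_continuousOn (h : VecPair α σ a₁ γ₁ a₂ γ₂ N M) {u : ℝ → Vec d}
    (hc : ∀ t ∈ Icc 0 T, Tendsto (fun s => N (u s - u t)) (𝓝[Icc 0 T] t) (𝓝 0)) (i : Fin d)
    (m : Fin d → ℤ) : ContinuousOn (fun t => u t i m) (Icc 0 T) := by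
  obtain ⟨C, K, hC, hco⟩ := h.normN.coeff
  intro t ht
  rw [ContinuousWithinAt, tendsto_iff_edist_tendsto_0]
  have h1 : Tendsto (fun s => ENNReal.ofReal (C * wt m ^ K) * N (u s - u t)) (𝓝[Icc 0 T] t) (𝓝 0) := by
    have := ENNReal.Tendsto.const_mul (hc t ht) (Or.inr (ENNReal.ofReal_ne_top (r := C * wt m ^ K)))
    rwa [mul_zero] at this
  refine tendsto_of_tendsto_of_tendsto_of_le_of_le tendsto_const_nhds h1 (fun _ => zero_le) fun s => ?_
  rw [edist_eq_enorm_sub]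
  exact hco (u s - u t) i m

/-- Solutions of the integral equation are smooth in time. -/
theorem VecPair.timeSmooth (h : VecPair α σ a₁ γ₁ a₂ γ₂ N M) {A : ℝ} (hT1 : T ≤ 1)
    (hA : 0 ≤ A) {u₀ : Vec d} (hu₀ : N u₀ ≠ ⊤) {u : ℝ → Vec d} (hm : CoeffMeas T u)
    (hb : ∀ t, 0 < t → t ≤ T → Bdd N M σ t (u t) A)
    (hs : ∀ t, 0 ≤ t → t ≤ T → SolvesAt α u₀ u t) (n : ℕ) :
    ∀ i, TimeSmooth T n fun t => u t i := by
  have hdecay : ∀ i, RapidDecay T fun t => u t i := fun i ε hε k => by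
    obtain ⟨C, hC, hd⟩ := h.decay hT1 hA hm hb hs hε k
    exact ⟨C, hC, fun t h0 h1 m => hd t h0 h1.le i m⟩
  induction n with
  | zero =>
    refine fun i => ⟨hdecay i, fun m => ?_⟩
    exact (h.coeff_continuousOn (fun t ht => h.continuous_of_solves hT1 hA hu₀ hm hb hs ht) i m).mono
      Ioo_subset_Icc_self
  | succ n ih =>
    intro i
    obtain ⟨D, K, hD, hl⟩ := lapSymbol_le (d := d) α
    have hQ := TimeSmooth.nonlin ih
    refine ⟨hdecay i, fun t => (fun m => (-lapSymbol α (freq m) : ℂ) * u t i m) +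
      fun m => (-1 : ℂ) * nonlin (u t) (u t) i m, fun t ht m => ?_, TimeSmooth.add
      ((ih i).mul (p := fun m => (-lapSymbol α (freq m) : ℂ)) hD (K := K) fun m => ?_)
      ((hQ i).mul (p := fun _ => (-1 : ℂ)) zero_le_one (K := 0) fun m => by simp)⟩
    swap
    · rw [norm_neg, Complex.norm_real, Real.norm_of_nonneg (lapSymbol_nonneg _ _)]
      exact hl m h.α_pos
    set l : ℂ := ((lapSymbol α (freq m) : ℝ) : ℂ) with hl
    set f : ℝ → ℂ := fun r => Complex.exp (r * l) * nonlin (u r) (u r) i m with hf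
    have hheat : ∀ r : ℝ, (heatSymbol α r m : ℂ) = Complex.exp (-(r * l)) := fun r => by
      rw [heatSymbol_eq, hl]; push_cast; ring_nf
    have hbae : ∀ᵐ s ∂(volume.restrict (Ioo 0 T)), Bdd N M σ s (u s) A := by
      filter_upwards [ae_restrict_mem measurableSet_Ioo] with s hs using hb s hs.1 hs.2.le
    have hfe : ∀ s r : ℝ, (heatSymbol α (s - r) m : ℂ) * nonlin (u r) (u r) i m =
        Complex.exp (-(s * l)) * f r := fun s r => by
      rw [hheat, hf, ← mul_assoc, ← Complex.exp_add]
      congr 2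
      push_cast; ring
    have hexp : ∀ s ∈ Ioo 0 T, u s i m =
        Complex.exp (-(s * l)) * (u₀ i m - ∫ r in (0 : ℝ)..s, f r) := by
      intro s hsT
      have h1 : u s i m = heatSymbol α s m * u₀ i m -
          ∫ r in Ioo 0 s, heatSymbol α (s - r) m * nonlin (u r) (u r) i m :=
        congrFun (congrFun (hs s hsT.1.le hsT.2.le) i) m
      rw [h1, hheat]
      simp only [hfe]
      rw [integral_const_mul, intervalIntegral.integral_of_le hsT.1.le, integral_Ioc_eq_integral_Ioo]
      ring
    have hfc : ContinuousOn f (Ioo 0 T) :=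
      (Continuous.continuousOn (by fun_prop)).mul ((hQ i).continuousOn m)
    have hint : IntervalIntegrable f volume 0 t := by
      rw [intervalIntegrable_iff_integrableOn_Ioo_of_le ht.1.le]
      have h2 := h.integrableOn_nonlin hT1 hA hm hbae ht.1 ht.2.le i m
      simp only [hfe] at h2
      have h3 := h2.const_mul (Complex.exp (t * l))
      refine h3.congr (.of_forall fun r => ?_)
      simp only
      rw [← mul_assoc, ← Complex.exp_add, add_neg_cancel, Complex.exp_zero, one_mul]
    have hftc : HasDerivAt (fun s => ∫ r in (0 : ℝ)..s, f r) (f t) t :=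
      intervalIntegral.integral_hasDerivAt_right hint
        (hfc.stronglyMeasurableAtFilter isOpen_Ioo t ht) (hfc.continuousAt (isOpen_Ioo.mem_nhds ht))
    have he : HasDerivAt (fun s : ℝ => Complex.exp (-(s * l))) (Complex.exp (-(t * l)) * -(1 * l)) t :=
      ((Complex.ofRealCLM.hasDerivAt (x := t)).mul_const l).neg.cexp
    have key := he.mul (hftc.const_sub (u₀ i m))
    refine (key.congr_of_eventuallyEq ?_).congr_deriv ?_
    · filter_upwards [isOpen_Ioo.mem_nhds ht] with s hs using hexp s hs
    · have h4 : Complex.exp (-(t * l)) * f t = nonlin (u t) (u t) i m := by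
        rw [hf, ← mul_assoc, ← Complex.exp_add, neg_add_cancel, Complex.exp_zero, one_mul]
      simp only [Pi.add_apply]
      rw [hexp t ht]
      linear_combination -h4

/-! ### Joint smoothness -/

/-- The function given by a Fourier series, lifted to `ℝ^d`. -/
def series (c : Seq d) (x : Fin d → ℝ) : ℂ := ∑' m, c m * UnitAddTorus.mFourier m (toTorus x)

end FracNS
end

noncomputable section
namespace FracNS
variable {d : ℕ} {T : ℝ}

theorem hasFDerivAt_mFourier (m : Fin d → ℤ) (x : Fin d → ℝ) :
    HasFDerivAt (fun x : Fin d → ℝ => UnitAddTorus.mFourier m (toTorus x))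
      (∑ j, (ContinuousLinearMap.proj j : (Fin d → ℝ) →L[ℝ] ℝ).smulRight
        (2 * Real.pi * Complex.I * (m j : ℂ) * UnitAddTorus.mFourier m (toTorus x))) x := by
  simp only [mFourier_toTorus]
  have h1 : HasFDerivAt (fun x : Fin d → ℝ => ∑ i, (m i : ℝ) * x i)
      (∑ i, (m i : ℝ) • (ContinuousLinearMap.proj i : (Fin d → ℝ) →L[ℝ] ℝ)) x := by
    refine HasFDerivAt.fun_sum fun i _ => ?_
    exact (ContinuousLinearMap.proj (R := ℝ) (φ := fun _ : Fin d => ℝ) i).hasFDerivAt.const_mul _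
  have h2 := ((Complex.ofRealCLM.hasFDerivAt.comp x h1).const_mul (2 * Real.pi * Complex.I)).cexp
  refine h2.congr_fderiv ?_
  ext v
  simp only [smul_apply, ContinuousLinearMap.coe_comp, Function.comp_apply,
    sum_apply, ContinuousLinearMap.smulRight_apply, Complex.ofRealCLM_apply,
    smul_eq_mul, ContinuousLinearMap.proj_apply, Complex.real_smul, Complex.ofReal_sum,
    Complex.ofReal_mul, Finset.mul_sum]
  refine Finset.sum_congr rfl fun j _ => ?_
  push_cast
  ring

theorem TimeSmooth.summable {n : ℕ} {c : ℝ → Seq d} (h : TimeSmooth T n c) {t : ℝ} (ht : t ∈ Ioo 0 T) :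
    Summable fun m => ‖c t m‖ := by
  obtain ⟨C, hC, hb⟩ := h.decay t ht.1 (2 * d)
  exact Summable.of_nonneg_of_le (fun _ => norm_nonneg _) (hb t le_rfl ht.2) ((summable_wt d).mul_left C)

theorem hasSum_series {c : Seq d} (h : Summable fun m => ‖c m‖) (x : Fin d → ℝ) :
    HasSum (fun m => c m * UnitAddTorus.mFourier m (toTorus x)) (series c x) := by
  refine Summable.hasSum (Summable.of_norm ?_)
  refine h.congr fun m => ?_
  rw [norm_mul, norm_mFourier_apply, mul_one]

theorem continuous_mFourier_toTorus (m : Fin d → ℤ) :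
    Continuous fun x : Fin d → ℝ => UnitAddTorus.mFourier m (toTorus x) := by
  simp only [mFourier_toTorus]
  fun_prop

/-- Fourier series with coefficients smooth in time are jointly smooth. -/
theorem TimeSmooth.contDiffOn {n : ℕ} {c : ℝ → Seq d} (h : TimeSmooth T n c) :
    ContDiffOn ℝ n (fun z : ℝ × (Fin d → ℝ) => series (c z.1) z.2) (Ioo 0 T ×ˢ univ) := by
  induction n generalizing c with
  | zero =>
    rw [Nat.cast_zero, contDiffOn_zero]
    rintro ⟨t, x⟩ ⟨ht, -⟩
    simp only at ht
    obtain ⟨C, hC, hb⟩ := h.decay (t / 2) (half_pos ht.1) (2 * d)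
    have hs : Ioo (t / 2) T ×ˢ (univ : Set (Fin d → ℝ)) ∈ 𝓝 (t, x) :=
      prod_mem_nhds (Ioo_mem_nhds (half_lt_self ht.1) ht.2) univ_mem
    have hsub : Ioo (t / 2) T ⊆ Ioo 0 T := Ioo_subset_Ioo_left (half_pos ht.1).le
    have hc : ContinuousOn (fun z : ℝ × (Fin d → ℝ) => series (c z.1) z.2) (Ioo (t / 2) T ×ˢ univ) := by
      refine continuousOn_tsum (fun m => ?_) ((summable_wt d).mul_left C) fun m z hz => ?_
      · refine ContinuousOn.mul ?_ ?_
        · exact ((h.continuousOn m).mono hsub).comp continuousOn_fst fun z hz => hz.1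
        · exact ((continuous_mFourier_toTorus m).comp continuous_snd).continuousOn
      · rw [norm_mul, norm_mFourier_apply, mul_one]
        exact hb z.1 hz.1.1.le hz.1.2 m
    exact (hc.continuousAt hs).continuousWithinAt
  | succ n ih =>
    have hp : ∀ j : Fin d, TimeSmooth T (n + 1) fun t m =>
        (2 * Real.pi * Complex.I * (m j : ℂ)) * c t m := fun j => by
      refine h.mul (D := 2 * Real.pi) (K := 1) (by have := Real.pi_pos; positivity) fun m => ?_
      have := abs_le_norm_freq m j
      have e : ‖2 * (Real.pi : ℂ) * Complex.I * (m j : ℂ)‖ = 2 * Real.pi * |(m j : ℝ)| := by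
        simp [abs_of_pos Real.pi_pos]
      rw [e, pow_one]
      have := Real.pi_pos
      unfold wt
      gcongr
      linarith
    have h0 := h
    obtain ⟨h1, c', hc', h2⟩ := h
    let L₀ : ℝ × (Fin d → ℝ) →L[ℝ] ℝ := ContinuousLinearMap.fst ℝ ℝ (Fin d → ℝ)
    let L : Fin d → ℝ × (Fin d → ℝ) →L[ℝ] ℝ := fun j =>
      (ContinuousLinearMap.proj j : (Fin d → ℝ) →L[ℝ] ℝ).comp (ContinuousLinearMap.snd ℝ ℝ (Fin d → ℝ))
    let cj : Fin d → ℝ → Seq d := fun j t m => (2 * Real.pi * Complex.I * (m j : ℂ)) * c t m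
    let f' : (Fin d → ℤ) → ℝ × (Fin d → ℝ) → (ℝ × (Fin d → ℝ) →L[ℝ] ℂ) := fun m z =>
      L₀.smulRight (c' z.1 m * UnitAddTorus.mFourier m (toTorus z.2)) +
        ∑ j, (L j).smulRight (cj j z.1 m * UnitAddTorus.mFourier m (toTorus z.2))
    let F' : ℝ × (Fin d → ℝ) → (ℝ × (Fin d → ℝ) →L[ℝ] ℂ) := fun z =>
      L₀.smulRight (series (c' z.1) z.2) + ∑ j, (L j).smulRight (series (cj j z.1) z.2)
    have hsumF : ∀ z ∈ Ioo 0 T ×ˢ (univ : Set (Fin d → ℝ)), HasSum (fun m => f' m z) (F' z) := by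
      intro z hz
      refine HasSum.add ?_ (hasSum_sum fun j _ => ?_)
      · exact (ContinuousLinearMap.smulRightL ℝ _ ℂ L₀).hasSum (hasSum_series (h2.summable hz.1) z.2)
      · exact (ContinuousLinearMap.smulRightL ℝ _ ℂ (L j)).hasSum
          (hasSum_series ((hp j).summable hz.1) z.2)
    have hder : ∀ z ∈ Ioo 0 T ×ˢ (univ : Set (Fin d → ℝ)),
        HasFDerivAt (fun z : ℝ × (Fin d → ℝ) => series (c z.1) z.2) (F' z) z := by
      rintro ⟨t, x⟩ hz
      have ht : t ∈ Ioo 0 T := hz.1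
      obtain ⟨C, hC, hb⟩ := h2.decay (t / 2) (half_pos ht.1) (2 * d)
      choose D hD hbD using fun j => (hp j).decay (t / 2) (half_pos ht.1) (2 * d)
      have hsub : Ioo (t / 2) T ⊆ Ioo 0 T := Ioo_subset_Ioo_left (half_pos ht.1).le
      have hzt : (t, x) ∈ Ioo (t / 2) T ×ˢ (univ : Set (Fin d → ℝ)) :=
        ⟨⟨half_lt_self ht.1, ht.2⟩, mem_univ _⟩
      have key := hasFDerivAt_tsum_of_isPreconnected
        (f := fun m (z : ℝ × (Fin d → ℝ)) => c z.1 m * UnitAddTorus.mFourier m (toTorus z.2)) (f' := f')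
        (u := fun m => (‖L₀‖ * C + ∑ j, ‖L j‖ * D j) * (wt m ^ (2 * d))⁻¹) (𝕜 := ℝ)
        ((summable_wt d).mul_left _) (isOpen_Ioo.prod isOpen_univ)
        (isPreconnected_Ioo.prod isPreconnected_univ) (fun m z hz => ?_) (fun m z hz => ?_) hzt
        (hasSum_series (h0.summable ht) x).summable hzt
      · rw [(hsumF _ hz).tsum_eq] at key
        exact key
      · have k1 : HasFDerivAt (fun z : ℝ × (Fin d → ℝ) => c z.1 m) (L₀.smulRight (c' z.1 m)) z :=
          HasFDerivAt.comp z (f := Prod.fst) (hc' z.1 (hsub hz.1) m).hasFDerivAt hasFDerivAt_fst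
        have k2 := HasFDerivAt.comp z (f := Prod.snd) (hasFDerivAt_mFourier m z.2)
          (hasFDerivAt_snd (𝕜 := ℝ) (E := ℝ) (F := Fin d → ℝ))
        refine (k1.mul k2).congr_fderiv ?_
        refine ContinuousLinearMap.ext fun v => ?_
        simp [f', L₀, L, cj, Finset.mul_sum]
        rw [add_comm]
        refine congrArg₂ _ ?_ (Finset.sum_congr rfl fun j _ => ?_) <;> ring
      · refine (norm_add_le _ _).trans ?_
        rw [add_mul, Finset.sum_mul]
        refine add_le_add ?_ ((norm_sum_le _ _).trans (Finset.sum_le_sum fun j _ => ?_))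
        · rw [ContinuousLinearMap.norm_smulRight_apply, norm_mul, norm_mFourier_apply, mul_one, mul_assoc]
          gcongr
          exact hb z.1 hz.1.1.le hz.1.2 m
        · rw [ContinuousLinearMap.norm_smulRight_apply, norm_mul, norm_mFourier_apply, mul_one, mul_assoc]
          gcongr
          exact hbD j z.1 hz.1.1.le hz.1.2 m
    have hopen : IsOpen (Ioo 0 T ×ˢ (univ : Set (Fin d → ℝ))) := isOpen_Ioo.prod isOpen_univ
    have hcast : ((n + 1 : ℕ) : WithTop ℕ∞) = n + 1 := by push_cast; rfl
    rw [hcast, contDiffOn_succ_iff_fderiv_of_isOpen hopen]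
    refine ⟨fun z hz => (hder z hz).differentiableAt.differentiableWithinAt, fun hω => ?_, ?_⟩
    · exact absurd hω (by simp)
    · have hF' : ContDiffOn ℝ n F' (Ioo 0 T ×ˢ univ) := by
        refine ContDiffOn.add ?_ (ContDiffOn.sum fun j _ => ?_)
        · exact (ContinuousLinearMap.smulRightL ℝ _ ℂ L₀).contDiff.comp_contDiffOn (ih h2)
        · exact (ContinuousLinearMap.smulRightL ℝ _ ℂ (L j)).contDiff.comp_contDiffOn (ih (hp j).pred)
      exact hF'.congr fun z hz => (hder z hz).fderiv

end FracNS
end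



noncomputable section

namespace FracNS

variable {d : ℕ}

/-! ### Fourier coefficients of test functions -/

theorem isOpenQuotientMap_toTorus : IsOpenQuotientMap (toTorus (d := d)) :=
  IsOpenQuotientMap.piMap fun _ => QuotientAddGroup.isOpenQuotientMap_mk

theorem toTorus_add (x y : Fin d → ℝ) : toTorus (x + y) = toTorus x + toTorus y := by
  funext i; simp [toTorus]

theorem toTorus_intCast (n : Fin d → ℤ) : toTorus (fun i => (n i : ℝ)) = 0 := by
  funext i
  have : ((n i : ℝ) : UnitAddCircle) = (((n i) • (1 : ℝ) : ℝ) : UnitAddCircle) := by simp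
  change ((n i : ℝ) : UnitAddCircle) = 0
  rw [this, AddCircle.coe_zsmul, AddCircle.coe_period, smul_zero]

theorem smooth_contDiff (φ : SmoothFun d) : ContDiff ℝ ∞ fun x : Fin d → ℝ => φ.1 (toTorus x) := φ.2

theorem smooth_continuous (φ : SmoothFun d) : Continuous φ.1 :=
  isOpenQuotientMap_toTorus.isQuotientMap.continuous_iff.2 (smooth_contDiff φ).continuous

/-- All derivatives up to order `k` of the lift of `φ` are bounded by `B`. -/
def DerivBdd (k : ℕ) (φ : Torus d → ℂ) (B : ℝ) : Prop :=
  ∀ j ≤ k, ∀ x, ‖iteratedFDeriv ℝ j (fun x : Fin d → ℝ => φ (toTorus x)) x‖ ≤ B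

theorem DerivBdd.norm_le {k : ℕ} {φ : Torus d → ℂ} {B : ℝ} (h : DerivBdd k φ B) (x : Torus d) :
    ‖φ x‖ ≤ B := by
  obtain ⟨y, rfl⟩ := isOpenQuotientMap_toTorus.surjective x
  simpa using h 0 (Nat.zero_le _) y

theorem hasDerivAt_partialFun (j : Fin d) (φ : SmoothFun d) (x : Torus d) (s : ℝ) :
    HasDerivAt (fun s : ℝ => φ.1 (x + toTorus (Pi.single j s)))
      (partialFun j φ.1 (x + toTorus (Pi.single j s))) s := by
  have h : ∀ x : Torus d, HasDerivAt (fun s : ℝ => φ.1 (x + toTorus (Pi.single j s)))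
      (partialFun j φ.1 x) 0 := by
    intro x
    obtain ⟨y, rfl⟩ := isOpenQuotientMap_toTorus.surjective x
    refine DifferentiableAt.hasDerivAt ?_
    simp only [← toTorus_add]
    refine DifferentiableAt.comp (g := fun x : Fin d → ℝ => φ.1 (toTorus x)) (0 : ℝ)
      (((smooth_contDiff φ).differentiable (by simp)) _) ?_
    have : (fun s : ℝ => y + Pi.single j s) = fun s : ℝ => y + s • Pi.single j (1 : ℝ) := by
      funext s; rw [← Pi.single_smul]; simp
    rw [this]
    fun_prop
  have h1 := HasDerivAt.comp_sub_const (a := s) s (f := fun r : ℝ =>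
    φ.1 (x + toTorus (Pi.single j s) + toTorus (Pi.single j r))) (by rw [sub_self]; exact h _)
  refine h1.congr_of_eventuallyEq (.of_forall fun r => ?_)
  simp only [add_assoc, ← toTorus_add, ← Pi.single_add]
  simp

theorem integral_mFourier_mul_translate (m : Fin d → ℤ) (φ : Torus d → ℂ) (y : Torus d) :
    ∫ x, UnitAddTorus.mFourier m x * φ (x + y) ∂(torusMeasure d) =
      UnitAddTorus.mFourier m (-y) * ∫ x, UnitAddTorus.mFourier m x * φ x ∂(torusMeasure d) := by
  rw [← integral_const_mul, ← integral_add_right_eq_self (fun x => UnitAddTorus.mFourier m (-y) * _) y]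
  refine integral_congr_ae (.of_forall fun x => ?_)
  simp only
  rw [← mul_assoc, ← mFourier_add_apply]
  congr 3
  abel

theorem smooth_integrable (φ : SmoothFun d) (m : Fin d → ℤ) :
    Integrable (fun x => UnitAddTorus.mFourier m x * φ.1 x) (torusMeasure d) :=
  ((UnitAddTorus.mFourier m).continuous.mul (smooth_continuous φ)).integrable_of_hasCompactSupport
    (HasCompactSupport.of_compactSpace _)

theorem integral_mFourier_mul_partial (m : Fin d → ℤ) (j : Fin d) (φ : SmoothFun d) :
    ∫ x, UnitAddTorus.mFourier m x * partialFun j φ.1 x ∂(torusMeasure d) =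
      (-(2 * Real.pi * Complex.I * (m j : ℂ))) *
        ∫ x, UnitAddTorus.mFourier m x * φ.1 x ∂(torusMeasure d) := by
  have hc : Continuous (partialFun j φ.1) := smooth_continuous (partialSmooth j φ)
  obtain ⟨B, hB⟩ := (isCompact_univ.image hc).isBounded.exists_norm_le
  have hB' : ∀ x, ‖partialFun j φ.1 x‖ ≤ B := fun x => hB _ ⟨x, mem_univ _, rfl⟩
  have h1 := (hasDerivAt_integral_of_dominated_loc_of_deriv_le (μ := torusMeasure d) (𝕜 := ℝ)
    (F := fun s x => UnitAddTorus.mFourier m x * φ.1 (x + toTorus (Pi.single j s)))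
    (F' := fun s x => UnitAddTorus.mFourier m x * partialFun j φ.1 (x + toTorus (Pi.single j s)))
    (x₀ := 0) (s := univ) (bound := fun _ => B) univ_mem ?_ ?_ ?_ ?_ (integrable_const _) ?_).2
  · have h2 : HasDerivAt (fun s : ℝ => UnitAddTorus.mFourier m (-toTorus (Pi.single j s)) *
        ∫ x, UnitAddTorus.mFourier m x * φ.1 x ∂(torusMeasure d))
        ((-(2 * Real.pi * Complex.I * (m j : ℂ))) *
        ∫ x, UnitAddTorus.mFourier m x * φ.1 x ∂(torusMeasure d)) 0 := by
      have e : (fun s : ℝ => UnitAddTorus.mFourier m (-toTorus (Pi.single j s))) =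
          fun s : ℝ => Complex.exp (-(2 * Real.pi * Complex.I * (m j : ℂ)) * (s : ℂ)) := by
        funext s
        have : -toTorus (Pi.single j s) = toTorus (Pi.single j (-s)) := by
          rw [Pi.single_neg]; funext i; simp [toTorus]
        rw [this, mFourier_toTorus]
        congr 1
        rw [Finset.sum_eq_single j (fun i _ hi => by simp [hi]) (by simp)]
        simp
        ring
      have h3 : HasDerivAt (fun s : ℝ => Complex.exp (-(2 * Real.pi * Complex.I * (m j : ℂ)) * (s : ℂ)))
          (-(2 * Real.pi * Complex.I * (m j : ℂ))) 0 := by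
        have h4 := (((hasDerivAt_id (0 : ℝ)).ofReal_comp).const_mul
          (-(2 * Real.pi * Complex.I * (m j : ℂ)))).cexp
        simpa using h4
      rw [← e] at h3
      exact h3.mul_const _
    simp only [integral_mFourier_mul_translate] at h1
    have h5 := h1.unique h2
    have h0 : toTorus (Pi.single j (0 : ℝ)) = 0 := by rw [Pi.single_zero]; funext i; simp [toTorus]
    have h6 : UnitAddTorus.mFourier m 0 = 1 := by simp [UnitAddTorus.mFourier]
    rw [← h5, h0, neg_zero, h6, one_mul]
  · refine .of_forall fun s => Continuous.aestronglyMeasurable ?_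
    exact (UnitAddTorus.mFourier m).continuous.mul ((smooth_continuous φ).comp (by fun_prop))
  · refine Continuous.integrable_of_hasCompactSupport ?_ (HasCompactSupport.of_compactSpace _)
    exact (UnitAddTorus.mFourier m).continuous.mul ((smooth_continuous φ).comp (by fun_prop))
  · refine Continuous.aestronglyMeasurable ?_
    exact (UnitAddTorus.mFourier m).continuous.mul (hc.comp (by fun_prop))
  · refine .of_forall fun x s _ => ?_
    rw [norm_mul, norm_mFourier_apply, one_mul]
    exact hB' _
  · exact .of_forall fun x s _ => (hasDerivAt_partialFun j φ x s).const_mul _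

theorem partialFun_toTorus (j : Fin d) (φ : SmoothFun d) (x : Fin d → ℝ) :
    partialFun j φ.1 (toTorus x) =
      fderiv ℝ (fun x : Fin d → ℝ => φ.1 (toTorus x)) x (Pi.single j 1) := by
  have hd := ((smooth_contDiff φ).differentiable (by simp)) x
  rw [← hd.lineDeriv_eq_fderiv]
  unfold partialFun lineDeriv
  congr 1
  funext s
  rw [← toTorus_add, ← Pi.single_smul]
  simp

theorem DerivBdd.partialFun {k : ℕ} {φ : SmoothFun d} {B : ℝ} (h : DerivBdd (k + 1) φ.1 B) (j : Fin d) :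
    DerivBdd k (partialFun j φ.1) B := by
  intro l hl x
  simp only [partialFun_toTorus]
  have h1 : ContDiff ℝ ∞ (fderiv ℝ fun x : Fin d → ℝ => φ.1 (toTorus x)) :=
    (smooth_contDiff φ).fderiv_right (by simp)
  refine (norm_iteratedFDeriv_clm_apply_const (N := ∞) h1.contDiffAt (by exact_mod_cast le_top)).trans ?_
  rw [norm_iteratedFDeriv_fderiv]
  refine le_trans ?_ (h (l + 1) (by omega) x)
  refine mul_le_of_le_one_left (norm_nonneg _) ?_
  rw [pi_norm_le_iff_of_nonneg zero_le_one]
  intro i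
  by_cases hi : i = j
  · subst hi; simp
  · simp [hi]

theorem norm_integral_mFourier_mul_le_of_derivBdd (k : ℕ) (m : Fin d → ℤ) (j : Fin d) :
    ∀ {φ : SmoothFun d} {B : ℝ}, DerivBdd k φ.1 B →
      (2 * Real.pi * |(m j : ℝ)|) ^ k * ‖∫ x, UnitAddTorus.mFourier m x * φ.1 x ∂(torusMeasure d)‖ ≤ B := by
  induction k with
  | zero =>
    intro φ B h
    rw [pow_zero, one_mul]
    refine (norm_integral_le_of_norm_le_const (C := B) (.of_forall fun x => ?_)).trans (by simp)
    rw [norm_mul, norm_mFourier_apply, one_mul]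
    exact h.norm_le x
  | succ k ih =>
    intro φ B h
    have h1 := ih (φ := partialSmooth j φ) (h.partialFun j)
    change _ * ‖∫ x, UnitAddTorus.mFourier m x * partialFun j φ.1 x ∂(torusMeasure d)‖ ≤ B at h1
    rw [integral_mFourier_mul_partial, norm_mul] at h1
    refine le_trans (le_of_eq ?_) h1
    have : ‖-(2 * (Real.pi : ℂ) * Complex.I * (m j : ℂ))‖ = 2 * Real.pi * |(m j : ℝ)| := by
      simp [abs_of_pos Real.pi_pos]
    rw [this]; ring

/-- Fourier coefficients of smooth functions decay rapidly. -/
theorem DerivBdd.norm_integral_le {k : ℕ} {φ : SmoothFun d} {B : ℝ} (h : DerivBdd k φ.1 B)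
    (m : Fin d → ℤ) :
    ‖∫ x, UnitAddTorus.mFourier m x * φ.1 x ∂(torusMeasure d)‖ ≤ ((d : ℝ) ^ k + 1) * B * (wt m ^ k)⁻¹ := by
  have hB : 0 ≤ B := (norm_nonneg _).trans (h.norm_le 0)
  have hw := wt_pos m
  rw [← div_eq_mul_inv, le_div_iff₀ (by positivity)]
  by_cases hm : m = 0
  · subst hm
    have e : wt (0 : Fin d → ℤ) = 1 := by
      unfold wt; rw [freq_zero, norm_zero, add_zero]
    rw [e, one_pow, mul_one]
    have h1 : ‖∫ x, UnitAddTorus.mFourier 0 x * φ.1 x ∂(torusMeasure d)‖ ≤ B := by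
      refine (norm_integral_le_of_norm_le_const (C := B) (.of_forall fun x => ?_)).trans (by simp)
      rw [norm_mul, norm_mFourier_apply, one_mul]
      exact h.norm_le x
    refine h1.trans (le_mul_of_one_le_left hB ?_)
    have : (0 : ℝ) ≤ (d : ℝ) ^ k := by positivity
    linarith
  · obtain ⟨j, hj, hle⟩ := exists_norm_freq_le hm
    have h1 := norm_integral_mFourier_mul_le_of_derivBdd k m j h
    have h2 : wt m ≤ d * (2 * Real.pi * |(m j : ℝ)|) := by
      have h3 := one_le_norm_freq hm
      have h4 := Real.pi_gt_three
      have h5 : 0 ≤ (d : ℝ) * |(m j : ℝ)| := by positivity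
      unfold wt
      nlinarith
    calc ‖∫ x, UnitAddTorus.mFourier m x * φ.1 x ∂(torusMeasure d)‖ * wt m ^ k
        ≤ ‖∫ x, UnitAddTorus.mFourier m x * φ.1 x ∂(torusMeasure d)‖ *
          (d * (2 * Real.pi * |(m j : ℝ)|)) ^ k := by gcongr
      _ = (d : ℝ) ^ k * ((2 * Real.pi * |(m j : ℝ)|) ^ k *
          ‖∫ x, UnitAddTorus.mFourier m x * φ.1 x ∂(torusMeasure d)‖) := by rw [mul_pow]; ring
      _ ≤ (d : ℝ) ^ k * B := by gcongr
      _ ≤ _ := by nlinarith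

/-- Smooth families of functions on the torus have uniformly bounded derivatives. -/
theorem exists_derivBdd {Φ : ℝ → Torus d → ℂ}
    (h : ContDiff ℝ ∞ fun z : ℝ × (Fin d → ℝ) => Φ z.1 (toTorus z.2)) (a b : ℝ) (k : ℕ) :
    ∃ B : ℝ, 0 ≤ B ∧ ∀ t ∈ Icc a b, DerivBdd k (Φ t) B := by
  set F : ℝ × (Fin d → ℝ) → ℂ := fun z => Φ z.1 (toTorus z.2) with hF
  have hK : IsCompact (Icc a b ×ˢ Icc (0 : Fin d → ℝ) 1) := isCompact_Icc.prod isCompact_Icc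
  have h1 : ∀ j : ℕ, ∃ B : ℝ, 0 ≤ B ∧ ∀ t ∈ Icc a b, ∀ x, ‖iteratedFDeriv ℝ j F (t, x)‖ ≤ B := by
    intro j
    obtain ⟨B, hB⟩ := (hK.image (h.continuous_iteratedFDeriv (m := j)
      (by exact_mod_cast le_top))).isBounded.exists_norm_le
    refine ⟨max B 0, le_max_right _ _, fun t ht x => ?_⟩
    set n : Fin d → ℤ := fun i => -⌊x i⌋
    have hper : (fun z : ℝ × (Fin d → ℝ) => F (z + (0, fun i => (n i : ℝ)))) = F := by
      funext z
      simp only [hF, Prod.fst_add, Prod.snd_add, add_zero, toTorus_add, toTorus_intCast]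
    have h2 := iteratedFDeriv_comp_add_right (𝕜 := ℝ) (f := F) j (0, fun i => (n i : ℝ)) (t, x)
    rw [hper] at h2
    rw [h2]
    refine le_max_of_le_left (hB _ ⟨_, ⟨?_, ?_⟩, rfl⟩)
    · simpa using ht
    · rw [mem_Icc, Pi.le_def, Pi.le_def]
      constructor <;> intro i <;> simp only [n, Prod.snd_add, Pi.add_apply, Pi.zero_apply, Pi.one_apply,
        Int.cast_neg]
      · linarith [Int.floor_le (x i)]
      · linarith [Int.lt_floor_add_one (x i)]
  choose B hB0 hB using h1
  refine ⟨∑ j ∈ Finset.range (k + 1), B j, Finset.sum_nonneg fun j _ => hB0 j, fun t ht j hj x => ?_⟩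
  refine le_trans ?_ (Finset.single_le_sum (fun j _ => hB0 j) (Finset.mem_range.2 (Nat.lt_succ_of_le hj)))
  refine le_trans ?_ (hB j t ht x)
  let L : (Fin d → ℝ) →L[ℝ] ℝ × (Fin d → ℝ) := ContinuousLinearMap.inr ℝ ℝ (Fin d → ℝ)
  have e : (fun x : Fin d → ℝ => Φ t (toTorus x)) = (fun z => F ((t, 0) + z)) ∘ L := by
    funext y; simp [hF, L]
  rw [e]
  have hsm : ContDiff ℝ ∞ fun z => F ((t, 0) + z) := h.comp (contDiff_const.add contDiff_id)
  rw [L.iteratedFDeriv_comp_right hsm x (i := j) (by exact_mod_cast le_top)]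
  refine (ContinuousMultilinearMap.norm_compContinuousLinearMap_le _ _).trans ?_
  have hL : ‖L‖ ≤ 1 := ContinuousLinearMap.norm_inr_le_one _ _ _
  rw [iteratedFDeriv_comp_add_left]
  have : ((t, 0) + L x : ℝ × (Fin d → ℝ)) = (t, x) := by simp [L]
  rw [this]
  refine mul_le_of_le_one_right (norm_nonneg _) ?_
  exact Finset.prod_le_one (fun _ _ => norm_nonneg _) fun _ _ => hL

theorem smooth_exists_derivBdd (φ : SmoothFun d) (k : ℕ) : ∃ B : ℝ, 0 ≤ B ∧ DerivBdd k φ.1 B := by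
  obtain ⟨B, hB, h⟩ := FracNS.exists_derivBdd (Φ := fun _ => φ.1) ((smooth_contDiff φ).comp contDiff_snd) 0 0 k
  exact ⟨B, hB, h 0 (by simp)⟩

/-! ### Fourier coefficients of distributions -/

theorem norm_iteratedFDeriv_mFourier_smul_le (m : Fin d → ℤ) :
    ∀ (j : ℕ) {F : Type} [NormedAddCommGroup F] [NormedSpace ℝ F] [NormedSpace ℂ F]
      [IsScalarTower ℝ ℂ F] (v : F) (x : Fin d → ℝ),
      ‖iteratedFDeriv ℝ j (fun x : Fin d → ℝ => UnitAddTorus.mFourier m (toTorus x) • v) x‖ ≤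
        (2 * Real.pi * d * wt m) ^ j * ‖v‖ := by
  intro j
  induction j with
  | zero =>
    intro F _ _ _ _ v x
    rw [norm_iteratedFDeriv_zero, norm_smul, norm_mFourier_apply, pow_zero]
  | succ j ih =>
    intro F _ _ _ _ v x
    rw [← norm_iteratedFDeriv_fderiv]
    let L : (Fin d → ℝ) →L[ℝ] F := ∑ i, (ContinuousLinearMap.proj i : (Fin d → ℝ) →L[ℝ] ℝ).smulRight
        ((2 * Real.pi * Complex.I * (m i : ℂ)) • v)
    have e : fderiv ℝ (fun x : Fin d → ℝ => UnitAddTorus.mFourier m (toTorus x) • v) =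
        fun x => UnitAddTorus.mFourier m (toTorus x) • L := by
      funext x
      refine ((hasFDerivAt_mFourier m x).smul_const v).fderiv.trans ?_
      ext w
      simp only [L, ContinuousLinearMap.smulRight_apply, sum_apply, smul_apply, Finset.sum_smul,
        Finset.smul_sum, ContinuousLinearMap.proj_apply]
      refine Finset.sum_congr rfl fun i _ => ?_
      rw [smul_comm _ (w i), smul_smul, ← smul_assoc]
      congr 1
      simp only [Complex.real_smul]; ring
    rw [e]
    refine (ih L x).trans ?_
    have hL : ‖L‖ ≤ (2 * Real.pi * d * wt m) * ‖v‖ := by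
      refine (norm_sum_le _ _).trans ?_
      have h1 : ∀ i ∈ Finset.univ, ‖(ContinuousLinearMap.proj i : (Fin d → ℝ) →L[ℝ] ℝ).smulRight
        ((2 * Real.pi * Complex.I * (m i : ℂ)) • v)‖ ≤ 2 * Real.pi * wt m * ‖v‖ := by
        intro i _
        rw [ContinuousLinearMap.norm_smulRight_apply, norm_smul]
        have h2 : ‖(ContinuousLinearMap.proj i : (Fin d → ℝ) →L[ℝ] ℝ)‖ ≤ 1 :=
          ContinuousLinearMap.opNorm_le_bound _ zero_le_one fun x => by
            rw [one_mul]; exact norm_le_pi_norm x i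
        have h3 : ‖2 * (Real.pi : ℂ) * Complex.I * (m i : ℂ)‖ ≤ 2 * Real.pi * wt m := by
          have e : ‖2 * (Real.pi : ℂ) * Complex.I * (m i : ℂ)‖ = 2 * Real.pi * |(m i : ℝ)| := by
            simp [abs_of_pos Real.pi_pos]
          rw [e]
          have := Real.pi_pos
          gcongr
          have := abs_le_norm_freq m i
          unfold wt; linarith
        calc _ ≤ 1 * ((2 * Real.pi * wt m) * ‖v‖) := by gcongr
          _ = _ := one_mul _
      refine (Finset.sum_le_card_nsmul _ _ _ h1).trans (le_of_eq ?_)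
      simp; ring
    have := Real.pi_pos
    have := wt_pos m
    calc _ ≤ (2 * Real.pi * d * wt m) ^ j * ((2 * Real.pi * d * wt m) * ‖v‖) := by gcongr
      _ = _ := by ring

theorem derivBdd_mFourier (k : ℕ) (m : Fin d → ℤ) :
    DerivBdd k (fun x => UnitAddTorus.mFourier m x) ((2 * Real.pi * d + 1) ^ k * wt m ^ k) := by
  intro j hj x
  have h := norm_iteratedFDeriv_mFourier_smul_le m j (1 : ℂ) x
  simp only [smul_eq_mul, mul_one, norm_one] at h
  refine h.trans ?_
  rw [← mul_pow]
  have := Real.pi_pos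
  have hw := one_le_wt m
  have h1 : 0 ≤ 2 * Real.pi * d := by positivity
  calc (2 * Real.pi * d * wt m) ^ j ≤ ((2 * Real.pi * d + 1) * wt m) ^ j := by
        gcongr; linarith
    _ ≤ _ := pow_le_pow_right₀ (by nlinarith) hj

/-- Families of Fourier coefficients of polynomial growth. -/
def PolyBdd (c : Seq d) : Prop := ∃ (C : ℝ) (K : ℕ), 0 ≤ C ∧ ∀ m, ‖c m‖ ≤ C * wt m ^ K

theorem wt_neg (m : Fin d → ℤ) : wt (-m) = wt m := by
  unfold wt; rw [freq_neg, norm_neg]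

theorem polyBdd_coeff (f : TorusDist d) : PolyBdd (coeff f) := by
  obtain ⟨k, C, hC, h⟩ := f.2
  refine ⟨C * (2 * Real.pi * d + 1) ^ k, k, by have := Real.pi_pos; positivity, fun m => ?_⟩
  have h1 := h (expFun (-m)) _ (derivBdd_mFourier k (-m))
  rw [wt_neg, ← mul_assoc] at h1
  exact h1

theorem smooth_hasSum (φ : SmoothFun d) (x : Torus d) :
    HasSum (fun m => UnitAddTorus.mFourierCoeff φ.1 m * UnitAddTorus.mFourier m x) (φ.1 x) := by
  obtain ⟨B, hB, h⟩ := smooth_exists_derivBdd φ (2 * d)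
  have hs : Summable fun m => ‖UnitAddTorus.mFourierCoeff φ.1 m‖ := by
    refine Summable.of_nonneg_of_le (fun _ => norm_nonneg _) (fun m => ?_)
      ((summable_wt d).mul_left (((d : ℝ) ^ (2 * d) + 1) * B))
    rw [mFourierCoeff_eq, ← wt_neg m]
    exact h.norm_integral_le (-m)
  obtain ⟨h1, h2⟩ := isFourier_of_summable hs
  have h3 : IsFourier φ.1 (UnitAddTorus.mFourierCoeff φ.1) :=
    ⟨(smooth_continuous φ).integrable_of_hasCompactSupport (HasCompactSupport.of_compactSpace _), fun _ => rfl⟩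
  have h4 := (Continuous.ae_eq_iff_eq (torusMeasure d) (smooth_continuous φ) h2).1 (h3.ae_eq h1)
  have h5 := congrFun h4 x
  rw [h5]
  refine (Summable.of_norm (hs.congr fun m => ?_)).hasSum
  rw [norm_mul, norm_mFourier_apply, mul_one]

theorem contDiff_mFourier (m : Fin d → ℤ) :
    ContDiff ℝ ∞ fun x : Fin d → ℝ => UnitAddTorus.mFourier m (toTorus x) := mFourier_smooth m

/-- A distribution is the sum of its Fourier series. -/
theorem hasSum_pairing (f : TorusDist d) (φ : SmoothFun d) :
    HasSum (fun m => coeff f m * ∫ x, UnitAddTorus.mFourier m x * φ.1 x ∂(torusMeasure d)) (f.1 φ) := by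
  obtain ⟨k, C, hC, hf⟩ := f.2
  obtain ⟨B, hB, hφ⟩ := smooth_exists_derivBdd φ (k + 2 * d)
  set a : Seq d := UnitAddTorus.mFourierCoeff φ.1 with ha
  set D := ((d : ℝ) ^ (k + 2 * d) + 1) * B * (2 * Real.pi * d + 1) ^ k with hD
  have hD0 : 0 ≤ D := by have := Real.pi_pos; positivity
  have hak : ∀ m, ‖a m‖ ≤ ((d : ℝ) ^ (k + 2 * d) + 1) * B * (wt m ^ (k + 2 * d))⁻¹ := fun m => by
    rw [ha, mFourierCoeff_eq, ← wt_neg m]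
    exact hφ.norm_integral_le (-m)
  have hterm : ∀ j ≤ k, ∀ m x, ‖iteratedFDeriv ℝ j (fun x : Fin d → ℝ =>
      a m * UnitAddTorus.mFourier m (toTorus x)) x‖ ≤ D * (wt m ^ (2 * d))⁻¹ := by
    intro j hj m x
    have h1 := derivBdd_mFourier k m j hj x
    have h2 : iteratedFDeriv ℝ j (fun x : Fin d → ℝ => a m * UnitAddTorus.mFourier m (toTorus x)) x =
        a m • iteratedFDeriv ℝ j (fun x : Fin d → ℝ => UnitAddTorus.mFourier m (toTorus x)) x :=
      iteratedFDeriv_const_smul_apply' (a := a m)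
        ((contDiff_mFourier m).contDiffAt.of_le (by exact_mod_cast le_top))
    rw [h2, norm_smul]
    have hw := wt_pos m
    have := Real.pi_pos
    calc _ ≤ (((d : ℝ) ^ (k + 2 * d) + 1) * B * (wt m ^ (k + 2 * d))⁻¹) *
          ((2 * Real.pi * d + 1) ^ k * wt m ^ k) := by gcongr; exact hak m
      _ = _ := by rw [hD, pow_add (wt m)]; field_simp
  have hsum : Summable fun m : Fin d → ℤ => D * (wt m ^ (2 * d))⁻¹ := (summable_wt d).mul_left D
  have hlim : Tendsto (fun s : Finset (Fin d → ℤ) => C * ∑' m : {m // m ∉ s}, D * (wt m.1 ^ (2 * d))⁻¹)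
      atTop (𝓝 0) := by
    have := (tendsto_tsum_compl_atTop_zero (fun m : Fin d → ℤ => D * (wt m ^ (2 * d))⁻¹)).const_mul C
    rwa [mul_zero] at this
  have hbound : ∀ s : Finset (Fin d → ℤ), ‖f.1 φ - ∑ m ∈ s, a m * f.1 (expFun m)‖ ≤
      C * ∑' m : {m // m ∉ s}, D * (wt m.1 ^ (2 * d))⁻¹ := by
    intro s
    have e1 : f.1 φ - ∑ m ∈ s, a m * f.1 (expFun m) = f.1 (φ - ∑ m ∈ s, a m • expFun m) := by
      simp [map_sub, map_sum]
    rw [e1]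
    refine hf _ _ fun j hj x => ?_
    have e2 : (fun x : Fin d → ℝ => (φ - ∑ m ∈ s, a m • expFun m : SmoothFun d).1 (toTorus x)) =
        fun x => ∑' m : {m // m ∉ s}, a m.1 * UnitAddTorus.mFourier m.1 (toTorus x) := by
      funext x
      have h1 := smooth_hasSum φ (toTorus x)
      have h2 := h1.summable.sum_add_tsum_subtype_compl s
      rw [h1.tsum_eq] at h2
      have e3 : (φ - ∑ m ∈ s, a m • expFun m : SmoothFun d).1 (toTorus x) =
        φ.1 (toTorus x) - ∑ m ∈ s, a m * UnitAddTorus.mFourier m (toTorus x) := by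
        simp [expFun, Finset.sum_apply]
      rw [e3, ← h2, add_sub_cancel_left]
    rw [e2]
    have h3 := iteratedFDeriv_tsum_apply (𝕜 := ℝ) (N := (k : ℕ∞))
      (f := fun (m : {m // m ∉ s}) (x : Fin d → ℝ) => a m.1 * UnitAddTorus.mFourier m.1 (toTorus x))
      (v := fun _ m => D * (wt m.1 ^ (2 * d))⁻¹)
      (fun m => contDiff_const.mul ((contDiff_mFourier m.1).of_le (by exact_mod_cast le_top)))
      (fun _ _ => hsum.subtype _) (fun i m x hi => hterm i (by exact_mod_cast hi) m.1 x)
      (k := j) (by exact_mod_cast hj) x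
    rw [h3]
    exact tsum_of_norm_bounded (hsum.subtype _).hasSum fun m => hterm j hj m.1 x
  have hmain : HasSum (fun m => a m * f.1 (expFun m)) (f.1 φ) := by
    change Tendsto _ _ _
    rw [tendsto_iff_norm_sub_tendsto_zero]
    refine squeeze_zero (fun _ => norm_nonneg _) (fun s => ?_) hlim
    rw [norm_sub_rev]; exact hbound s
  rw [← (Equiv.neg (Fin d → ℤ)).hasSum_iff] at hmain
  refine hmain.congr_fun ?_
  intro m
  simp only [Function.comp_apply, Equiv.neg_apply, coeff, ha, mFourierCoeff_eq, neg_neg]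
  rw [mul_comm]

theorem pairing_eq (f : TorusDist d) (φ : SmoothFun d) : f.1 φ = seriesPairing (coeff f) φ.1 :=
  (hasSum_pairing f φ).tsum_eq.symm

theorem ext_coeff {f g : TorusDist d} (h : ∀ m, coeff f m = coeff g m) : f = g := by
  refine Subtype.ext (LinearMap.ext fun φ => ?_)
  have : coeff f = coeff g := funext h
  rw [pairing_eq, pairing_eq, this]

theorem PolyBdd.summable {c : Seq d} (h : PolyBdd c) (φ : SmoothFun d) :
    Summable fun m => ‖c m * ∫ x, UnitAddTorus.mFourier m x * φ.1 x ∂(torusMeasure d)‖ := by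
  obtain ⟨C, K, hC, h⟩ := h
  obtain ⟨B, hB, hφ⟩ := smooth_exists_derivBdd φ (K + 2 * d)
  refine Summable.of_nonneg_of_le (fun _ => norm_nonneg _) (fun m => ?_)
    ((summable_wt_mul K).mul_left (C * (((d : ℝ) ^ (K + 2 * d) + 1) * B)))
  rw [norm_mul]
  have := wt_pos m
  calc _ ≤ (C * wt m ^ K) * (((d : ℝ) ^ (K + 2 * d) + 1) * B * (wt m ^ (K + 2 * d))⁻¹) := by
        gcongr
        · exact h m
        · exact hφ.norm_integral_le m
    _ = _ := by ring

open Classical in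
/-- The distribution with given Fourier coefficients of polynomial growth. -/
def ofSeq (c : Seq d) : TorusDist d :=
  if h : PolyBdd c then
    ⟨{ toFun := fun φ => seriesPairing c φ.1
       map_add' := fun φ ψ => by
        unfold seriesPairing
        rw [← (h.summable φ).of_norm.tsum_add (h.summable ψ).of_norm]
        refine tsum_congr fun m => ?_
        rw [← mul_add, ← integral_add (smooth_integrable φ m) (smooth_integrable ψ m)]
        congr 2
        funext x
        exact mul_add _ _ _
       map_smul' := fun a φ => by
        simp only [seriesPairing, RingHom.id_apply, smul_eq_mul]
        rw [← tsum_mul_left]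
        refine tsum_congr fun m => ?_
        rw [mul_left_comm a, ← integral_const_mul a]
        congr 2
        funext x
        exact mul_left_comm _ _ _ },
      by
        obtain ⟨C, K, hC, hc⟩ := h
        refine ⟨K + 2 * d, C * ((d : ℝ) ^ (K + 2 * d) + 1) * ∑' m : Fin d → ℤ, wt m ^ K * (wt m ^ (K + 2 * d))⁻¹,
          ?_, fun φ B hφ => ?_⟩
        · have : 0 ≤ ∑' m : Fin d → ℤ, wt m ^ K * (wt m ^ (K + 2 * d))⁻¹ :=
            tsum_nonneg fun m => by have := wt_pos m; positivity
          positivity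
        · change ‖seriesPairing c φ.1‖ ≤ _
          have hφ' : DerivBdd (K + 2 * d) φ.1 B := hφ
          rw [mul_right_comm, ← tsum_mul_left]
          refine tsum_of_norm_bounded ((summable_wt_mul K).mul_left _).hasSum fun m => ?_
          rw [norm_mul]
          have := wt_pos m
          calc _ ≤ (C * wt m ^ K) * (((d : ℝ) ^ (K + 2 * d) + 1) * B * (wt m ^ (K + 2 * d))⁻¹) := by
                gcongr
                · exact hc m
                · exact hφ'.norm_integral_le m
            _ = _ := by ring⟩
  else 0

theorem seriesPairing_expFun (c : Seq d) (m : Fin d → ℤ) : seriesPairing c (expFun (-m)).1 = c m := by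
  unfold seriesPairing
  have : ∀ k, c k * ∫ x, UnitAddTorus.mFourier k x * (expFun (-m)).1 x ∂(torusMeasure d) =
      if k = m then c k else 0 := by
    intro k
    have e : ∀ x, UnitAddTorus.mFourier k x * (expFun (-m)).1 x = UnitAddTorus.mFourier (k + -m) x :=
      fun x => UnitAddTorus.mFourier_add.symm
    simp only [e, integral_mFourier, add_neg_eq_zero, mul_ite, mul_one, mul_zero]
  simp only [this, tsum_ite_eq]

theorem coeff_ofSeq {c : Seq d} (h : PolyBdd c) (m : Fin d → ℤ) : coeff (ofSeq c) m = c m := by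
  unfold coeff ofSeq
  rw [dif_pos h]
  exact seriesPairing_expFun c m

end FracNS
end



noncomputable section

namespace FracNS

variable {d : ℕ}

/-! ### Distributions given by functions -/

theorem represents_iff {g : Torus d → ℂ} {f : TorusDist d} : Represents g f ↔ IsFourier g (coeff f) := by
  constructor
  · rintro ⟨h1, h2⟩
    refine ⟨h1, fun m => ?_⟩
    rw [coeff, h2, mFourierCoeff_eq]
    refine integral_congr_ae (.of_forall fun x => mul_comm _ _)
  · rintro ⟨h1, h2⟩
    refine ⟨h1, fun φ => ?_⟩
    obtain ⟨B, hB, h⟩ := smooth_exists_derivBdd φ (2 * d)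
    set a : Seq d := UnitAddTorus.mFourierCoeff φ.1 with ha
    have hs : Summable fun m => ‖a m‖ := by
      refine Summable.of_nonneg_of_le (fun _ => norm_nonneg _) (fun m => ?_)
        ((summable_wt d).mul_left (((d : ℝ) ^ (2 * d) + 1) * B))
      rw [ha, mFourierCoeff_eq, ← wt_neg m]
      exact h.norm_integral_le (-m)
    have hint : ∀ m, Integrable (fun x => a m * (UnitAddTorus.mFourier m x * g x)) (torusMeasure d) :=
      fun m => (integrable_mFourier_mul h1 m).const_mul _
    have h3 := hasSum_integral_of_summable_integral_norm hint (by
      simp only [norm_mul, norm_mFourier_apply, one_mul, integral_const_mul]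
      exact hs.mul_right _)
    have e1 : ∫ x, ∑' m, a m * (UnitAddTorus.mFourier m x * g x) ∂(torusMeasure d) =
        ∫ x, g x * φ.1 x ∂(torusMeasure d) := by
      refine integral_congr_ae (.of_forall fun x => ?_)
      simp only
      rw [← (smooth_hasSum φ x).tsum_eq, ← tsum_mul_left]
      refine tsum_congr fun m => ?_
      rw [ha]; ring
    rw [e1, ← (Equiv.neg (Fin d → ℤ)).hasSum_iff] at h3
    refine (hasSum_pairing f φ).unique (h3.congr_fun fun m => ?_)
    simp only [Function.comp_apply, Equiv.neg_apply, integral_const_mul]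
    rw [← h2 m, mFourierCoeff_eq, ha, mFourierCoeff_eq, neg_neg, mul_comm]

theorem lpNorm_eq (p : ℝ≥0∞) (f : TorusDist d) : lpNorm p f = seqLp p (coeff f) := by
  unfold lpNorm seqLp
  simp only [represents_iff]

theorem finite_norm_freq_le (R : ℝ) : {m : Fin d → ℤ | ‖freq m‖ ≤ R}.Finite := by
  have h := (summable_wt d).tendsto_cofinite_zero
  have h1 : (0 : ℝ) < ((1 + |R|) ^ (2 * d))⁻¹ := by positivity
  have h2 := h.eventually_lt_const h1
  rw [Filter.eventually_cofinite] at h2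
  refine h2.subset fun m hm => ?_
  simp only [mem_ofPred_eq, not_lt] at hm ⊢
  have := wt_pos m
  gcongr
  unfold wt
  linarith [le_abs_self R]

theorem summable_symbol_mul (χ : Cutoff d) (a : ℕ) (c : Seq d) :
    Summable fun m => ‖(χ.symbol a m : ℂ) * c m‖ := by
  refine summable_of_ne_finset_zero (s := (finite_norm_freq_le (2 * 2 ^ a)).toFinset) fun m hm => ?_
  have : χ.symbol a m = 0 := by
    by_contra h
    exact hm (by simpa using χ.norm_freq_le_of_symbol_ne_zero h)
  simp [this]

theorem isFourier_lpBlock (χ : Cutoff d) (a : ℕ) (f : TorusDist d) :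
    IsFourier (lpBlock χ a f) (fun m => χ.symbol a m * coeff f m) ∧ Continuous (lpBlock χ a f) :=
  isFourier_of_summable (summable_symbol_mul χ a (coeff f))

/-- The Besov norm of a family of Fourier coefficients. -/
def seqBesov (χ : Cutoff d) (s : ℝ) (q : ℝ≥0∞) (r : ℝ) (c : Seq d) : ℝ≥0∞ :=
  (∑' a : ℕ, ENNReal.ofReal (((2 : ℝ) ^ a) ^ (s * r)) *
    (seqLp q fun m => χ.symbol a m * c m) ^ r) ^ (1 / r)

theorem besovNorm_eq (χ : Cutoff d) (s : ℝ) (q : ℝ≥0∞) (r : ℝ) (f : TorusDist d) :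
    besovNorm χ s q r f = seqBesov χ s q r (coeff f) := by
  unfold besovNorm seqBesov
  simp only [(isFourier_lpBlock χ _ f).1.seqLp_eq]

/-! ### Real vector fields -/

/-- The Fourier coefficients of a vector field. -/
def coeffs (u : VecDist d) : Vec d := fun i => coeff (u i)

theorem coeffs_sub (u v : VecDist d) : coeffs (u - v) = coeffs u - coeffs v := rfl

theorem IsReal.conjSymm {u : VecDist d} (h : IsReal u) : ConjSymm (coeffs u) := by
  intro i m
  have hreal : ∀ x, (UnitAddTorus.mFourier (-m) x : ℂ) = starRingEnd ℂ (UnitAddTorus.mFourier m x) :=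
    fun x => UnitAddTorus.mFourier_neg
  have h1 := h i (expFun m + expFun (-m)) (fun x => by
    change (UnitAddTorus.mFourier m x + UnitAddTorus.mFourier (-m) x).im = 0
    rw [hreal]; simp)
  have h2 := h i (Complex.I • expFun m - Complex.I • expFun (-m)) (fun x => by
    change (Complex.I * UnitAddTorus.mFourier m x - Complex.I * UnitAddTorus.mFourier (-m) x).im = 0
    rw [hreal]; simp)
  rw [map_add] at h1
  rw [map_sub, map_smul, map_smul] at h2
  change coeff (u i) (-m) = starRingEnd ℂ (coeff (u i) m)
  simp only [coeff, neg_neg]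
  simp at h1 h2
  apply Complex.ext
  · simp; linarith
  · simp; linarith

theorem isReal_of_conjSymm {u : VecDist d} (h : ConjSymm (coeffs u)) : IsReal u := by
  intro i φ hφ
  rw [← Complex.conj_eq_iff_im]
  have h1 := hasSum_pairing (u i) φ
  have h2 := (Complex.hasSum_conj' (f := fun m => coeff (u i) m *
    ∫ x, UnitAddTorus.mFourier m x * φ.1 x ∂(torusMeasure d))).2 h1
  rw [← (Equiv.neg (Fin d → ℤ)).hasSum_iff] at h2
  refine h2.unique (h1.congr_fun fun m => ?_)
  have h3 : coeff (u i) (-m) = starRingEnd ℂ (coeff (u i) m) := h i m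
  simp only [Function.comp_apply, Equiv.neg_apply, map_mul, h3, Complex.conj_conj, ← integral_conj]
  congr 2
  funext x
  rw [Complex.conj_eq_iff_im.2 (hφ x), UnitAddTorus.mFourier_neg, Complex.conj_conj]

/-! ### Paraproducts -/

theorem Cutoff.le_norm_freq_of_symbol_ne_zero (χ : Cutoff d) {a : ℕ} {m : Fin d → ℤ}
    (h : χ.symbol (a + 1) m ≠ 0) : 9 / 20 * 2 ^ (a + 1) ≤ ‖freq m‖ := by
  by_contra! h1
  have h2 : ∀ b, a ≤ b → ‖(2 ^ b : ℝ)⁻¹ • freq m‖ < 9 / 10 := fun b hb => by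
    rw [norm_smul, Real.norm_of_nonneg (by positivity), inv_mul_lt_iff₀ (by positivity)]
    have : (2 : ℝ) ^ a ≤ 2 ^ b := pow_le_pow_right₀ one_le_two hb
    rw [pow_succ] at h1
    linarith
  refine h ?_
  rw [symbol, χ.eq_one' (h2 _ (by omega)), χ.eq_one' (h2 _ le_rfl), sub_self]

theorem Cutoff.exists_tsum_symbol_le (χ : Cutoff d) :
    ∃ C : ℝ≥0∞, C ≠ ⊤ ∧ ∀ m, ∑' a, ‖(χ.symbol a m : ℂ)‖ₑ ≤ C := by
  obtain ⟨B, hB⟩ := χ.hasCompactSupport.exists_bound_of_continuous χ.smooth.continuous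
  have hB0 : 0 ≤ B := (norm_nonneg _).trans (hB 0)
  have h1 : ∀ a m, ‖(χ.symbol a m : ℂ)‖ₑ ≤ ENNReal.ofReal (B + B) := fun a m => by
    rw [← ofReal_norm, Complex.norm_real]
    refine ENNReal.ofReal_le_ofReal ?_
    cases a with
    | zero => exact (hB _).trans (by linarith)
    | succ a => exact (norm_sub_le _ _).trans (add_le_add (hB _) (hB _))
  refine ⟨3 * ENNReal.ofReal (B + B), by finiteness, fun m => ?_⟩
  by_cases h : ∃ a, χ.symbol a m ≠ 0
  · classical
    have h2 := Nat.find_spec h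
    set n := Nat.find h with hn
    have h3 : ∀ a ∉ Finset.Icc n (n + 2), ‖(χ.symbol a m : ℂ)‖ₑ = 0 := by
      intro a ha
      by_contra h0
      have h0' : χ.symbol a m ≠ 0 := fun e => h0 (by simp [e])
      refine ha (Finset.mem_Icc.2 ⟨Nat.find_min' h h0', ?_⟩)
      by_contra! hlt
      obtain ⟨b, rfl⟩ : ∃ b, a = b + 1 := ⟨a - 1, by omega⟩
      have h4 := χ.le_norm_freq_of_symbol_ne_zero h0'
      have h5 := χ.norm_freq_le_of_symbol_ne_zero h2
      have h6 : (2 : ℝ) ^ (n + 3) ≤ 2 ^ (b + 1) := pow_le_pow_right₀ one_le_two (by omega)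
      have h7 : (0 : ℝ) < 2 ^ n := by positivity
      rw [pow_add] at h6
      linarith
    rw [tsum_eq_sum h3]
    refine (Finset.sum_le_card_nsmul _ _ _ fun a _ => h1 a m).trans (le_of_eq ?_)
    rw [Nat.card_Icc, show n + 2 + 1 - n = 3 by omega, nsmul_eq_mul]
    norm_num
  · push Not at h
    simp [h]

theorem rpow_tsum_le {ι : Type*} (f : ι → ℝ≥0∞) {r : ℝ} (hr : 1 ≤ r) :
    (∑' i, f i ^ r) ^ (1 / r) ≤ ∑' i, f i := by
  have hr0 : 0 < r := by linarith
  by_cases hS : ∑' i, f i = ⊤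
  · simp [hS]
  rw [one_div, ENNReal.rpow_inv_le_iff hr0]
  calc ∑' i, f i ^ r ≤ ∑' i, f i * (∑' i, f i) ^ (r - 1) := by
        refine ENNReal.tsum_le_tsum fun i => ?_
        have e : f i ^ r = f i * f i ^ (r - 1) := by
          nth_rewrite 2 [← ENNReal.rpow_one (f i)]
          rw [← ENNReal.rpow_add_of_nonneg _ _ zero_le_one (by linarith)]
          congr 1; ring
        rw [e]
        exact mul_le_mul_right (ENNReal.rpow_le_rpow (ENNReal.le_tsum i) (by linarith)) _
    _ = (∑' i, f i) ^ r := by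
        rw [ENNReal.tsum_mul_right]
        nth_rewrite 1 [← ENNReal.rpow_one (∑' i, f i)]
        rw [← ENNReal.rpow_add_of_nonneg _ _ zero_le_one (by linarith)]
        congr 1; ring

theorem hDotNegNorm_le {g : Torus d → ℂ} {c : Seq d} (h : IsFourier g c) :
    hDotNegNorm 1 g ≤ ∑' m, ‖c m‖ₑ := by
  calc hDotNegNorm 1 g ≤ (∑' m : {m : Fin d → ℤ // m ≠ 0}, ‖c m.1‖ₑ ^ (2 : ℝ)) ^ (1 / 2 : ℝ) := by
        unfold hDotNegNorm
        gcongr with m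
        rw [h.2, ← ofReal_norm, ENNReal.ofReal_rpow_of_nonneg (norm_nonneg _) (by norm_num)]
        refine ENNReal.ofReal_le_ofReal ?_
        have e : ‖c m.1‖ ^ (2 : ℝ) = ‖c m.1‖ ^ 2 := by norm_cast
        rw [e]
        refine mul_le_of_le_one_left (by positivity) ?_
        exact Real.rpow_le_one_of_one_le_of_nonpos (one_le_norm_freq m.2) (by norm_num)
    _ ≤ ∑' m : {m : Fin d → ℤ // m ≠ 0}, ‖c m.1‖ₑ := rpow_tsum_le _ (by norm_num)
    _ ≤ _ := ENNReal.tsum_comp_le_tsum_of_injective Subtype.val_injective _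

theorem tsum_enorm_conv_le (a b : Seq d) :
    ∑' m, ‖conv a b m‖ₑ ≤ (∑' m, ‖a m‖ₑ) * ∑' m, ‖b m‖ₑ := by
  calc ∑' m, ‖conv a b m‖ₑ ≤ ∑' m, ∑' k, ‖a k‖ₑ * ‖b (m - k)‖ₑ := by
        refine ENNReal.tsum_le_tsum fun m => ?_
        refine enorm_tsum_le_tsum_enorm.trans_eq ?_
        simp only [enorm_mul]
    _ = ∑' k, ∑' m, ‖a k‖ₑ * ‖b (m - k)‖ₑ := ENNReal.tsum_comm
    _ = _ := by
        rw [← ENNReal.tsum_mul_right]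
        refine tsum_congr fun k => ?_
        rw [ENNReal.tsum_mul_left]
        congr 1
        exact (Equiv.subRight k).tsum_eq fun m => ‖b m‖ₑ

theorem isFourier_lpBlock_mul (χ : Cutoff d) (a b : ℕ) (f g : TorusDist d) :
    IsFourier (fun x => lpBlock χ a f x * lpBlock χ b g x)
      (conv (fun m => χ.symbol a m * coeff f m) (fun m => χ.symbol b m * coeff g m)) := by
  obtain ⟨h1, h2⟩ := isFourier_lpBlock χ a f
  obtain ⟨h3, h4⟩ := isFourier_lpBlock χ b g
  have hm : ∀ {F : Torus d → ℂ}, Continuous F → MemLp F 2 (torusMeasure d) := fun hF =>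
    hF.memLp_of_hasCompactSupport (HasCompactSupport.of_compactSpace _)
  exact isFourier_mul h1 h3 (hm h2) (hm h4)

theorem tensorWellDefined_of_summable (χ : Cutoff d) {u : VecDist d}
    (h : ∀ i, Summable fun m => ‖coeff (u i) m‖) : TensorWellDefined χ 1 u := by
  obtain ⟨C, hC, hsym⟩ := χ.exists_tsum_symbol_le
  intro i j
  have hS : ∀ i, ∑' a, ∑' m, ‖(χ.symbol a m : ℂ) * coeff (u i) m‖ₑ < ⊤ := fun i => by
    rw [ENNReal.tsum_comm]
    simp only [enorm_mul, ENNReal.tsum_mul_right]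
    refine lt_of_le_of_lt (ENNReal.tsum_le_tsum fun m => mul_le_mul_left (hsym m) _) ?_
    rw [ENNReal.tsum_mul_left]
    refine ENNReal.mul_lt_top hC.lt_top ?_
    have := (h i).tsum_ofReal_lt_top
    simpa only [ofReal_norm] using this
  refine lt_of_le_of_lt ?_ (ENNReal.mul_lt_top (hS i) (hS j))
  rw [ENNReal.tsum_prod (f := fun a b => hDotNegNorm 1 fun x => lpBlock χ a (u i) x * lpBlock χ b (u j) x),
    ← ENNReal.tsum_mul_right]
  refine ENNReal.tsum_le_tsum fun a => ?_
  rw [← ENNReal.tsum_mul_left]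
  refine ENNReal.tsum_le_tsum fun b => ?_
  exact (hDotNegNorm_le (isFourier_lpBlock_mul χ a b (u i) (u j))).trans (tsum_enorm_conv_le _ _)

theorem tsum_conv_symbol (χ : Cutoff d) {x y : Seq d} (hx : Summable fun m => ‖x m‖ ^ 2)
    (hy : Summable fun m => ‖y m‖ ^ 2) (m : Fin d → ℤ) :
    ∑' ab : ℕ × ℕ, conv (fun m => χ.symbol ab.1 m * x m) (fun m => χ.symbol ab.2 m * y m) m =
      conv x y m := by
  obtain ⟨C, hC, hsym⟩ := χ.exists_tsum_symbol_le
  have hsum : ∀ k, Summable fun a => ‖(χ.symbol a k : ℂ)‖ := fun k => by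
    have := ENNReal.summable_toReal (ne_top_of_le_ne_top hC (hsym k))
    simpa using this
  have hle : ∀ k, ∑' a, ‖(χ.symbol a k : ℂ)‖ ≤ C.toReal := fun k => by
    have := ENNReal.toReal_mono hC (hsym k)
    rw [ENNReal.tsum_toReal_eq (fun _ => enorm_ne_top)] at this
    simpa using this
  have hxy := summable_conv hx hy m
  let F : (Fin d → ℤ) → ℕ × ℕ → ℂ := fun k ab =>
    ((χ.symbol ab.1 k : ℂ) * x k) * ((χ.symbol ab.2 (m - k) : ℂ) * y (m - k))
  have hF : ∀ k ab, F k ab = (x k * y (m - k)) *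
      ((χ.symbol ab.1 k : ℂ) * (χ.symbol ab.2 (m - k) : ℂ)) := fun k ab => by simp only [F]; ring
  have hprod : ∀ k, Summable fun ab : ℕ × ℕ => ‖(χ.symbol ab.1 k : ℂ) * (χ.symbol ab.2 (m - k) : ℂ)‖ := by
    intro k
    have := (hsum k).mul_of_nonneg (hsum (m - k)) (fun _ => norm_nonneg _) (fun _ => norm_nonneg _)
    simpa only [norm_mul] using this
  have hFs : Summable (Function.uncurry F) := by
    refine Summable.of_norm ((summable_prod_of_nonneg fun _ => norm_nonneg _).2 ⟨fun k => ?_, ?_⟩)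
    · simp only [Function.uncurry_apply_pair, hF, norm_mul (x k * y (m - k))]
      exact (hprod k).mul_left _
    · refine Summable.of_nonneg_of_le (fun k => tsum_nonneg fun _ => norm_nonneg _) (fun k => ?_)
        (hxy.mul_right (C.toReal * C.toReal))
      simp only [Function.uncurry_apply_pair, hF, norm_mul (x k * y (m - k)), tsum_mul_left]
      refine mul_le_mul_of_nonneg_left ?_ (norm_nonneg _)
      have h1 := Summable.tsum_mul_tsum (hsum k) (hsum (m - k)) (by simpa only [norm_mul] using hprod k)
      simp only [norm_mul]
      rw [← h1]
      exact mul_le_mul (hle k) (hle (m - k)) (tsum_nonneg fun _ => norm_nonneg _) ENNReal.toReal_nonneg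
  have h1 : ∀ k, HasSum (fun ab : ℕ × ℕ => F k ab) (x k * y (m - k)) := fun k => by
    have h2 := ((χ.hasSum_symbol k).mul (χ.hasSum_symbol (m - k)) (hprod k).of_norm).mul_left
      (x k * y (m - k))
    rw [mul_one, mul_one] at h2
    exact h2.congr_fun fun ab => hF k ab
  calc ∑' ab : ℕ × ℕ, conv (fun m => χ.symbol ab.1 m * x m) (fun m => χ.symbol ab.2 m * y m) m
      = ∑' ab : ℕ × ℕ, ∑' k, F k ab := rfl
    _ = ∑' k, ∑' ab : ℕ × ℕ, F k ab := hFs.tsum_comm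
    _ = ∑' k, x k * y (m - k) := tsum_congr fun k => (h1 k).tsum_eq

theorem tensorCoeff_eq (χ : Cutoff d) {u : VecDist d} (h : IsSq (coeffs u)) (i j : Fin d)
    {m : Fin d → ℤ} (hm : m ≠ 0) : tensorCoeff χ u i j m = conv (coeffs u i) (coeffs u j) m := by
  unfold tensorCoeff
  rw [if_neg hm, ← tsum_conv_symbol χ (h i) (h j)]
  exact tsum_congr fun ab => (isFourier_lpBlock_mul χ ab.1 ab.2 (u i) (u j)).2 m

theorem duhamelPairing_eq (χ : Cutoff d) (α τ : ℝ) {w : VecDist d} (h : IsSq (coeffs w)) (i : Fin d)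
    (φ : Torus d → ℂ) : duhamelPairing χ α τ w i φ =
      seriesPairing (heat α τ (nonlin (coeffs w) (coeffs w)) i) φ := by
  unfold duhamelPairing
  congr 1
  funext m
  unfold heat nonlin lerayCoeff divCoeff
  congr 1
  refine Finset.sum_congr rfl fun k _ => ?_
  rw [Finset.mul_sum]
  refine Finset.sum_congr rfl fun j _ => ?_
  by_cases hm : m = 0
  · subst hm
    simp [lerayDeriv, freq_zero]
  · rw [tensorCoeff_eq χ h k j hm, lerayDeriv]
    simp only [freq]
    push_cast
    ring

end FracNS
end



noncomputable section

namespace FracNS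

variable {d : ℕ}

/-! ### Pairings with space-time test functions -/

theorem integrable_tsum_mul {X : Type*} [MeasurableSpace X] {μ : Measure X} {f g : X → Seq d}
    (hf : ∀ m, AEStronglyMeasurable (fun x => f x m) μ) (hg : ∀ m, AEStronglyMeasurable (fun x => g x m) μ)
    {w : X → ℝ} (hw : Integrable w μ)
    (hb : ∀ᵐ x ∂μ, ∀ m, ‖f x m * g x m‖ ≤ w x * (wt m ^ (2 * d))⁻¹) :
    Integrable (fun x => ∑' m, f x m * g x m) μ ∧
      HasSum (fun m => ∫ x, f x m * g x m ∂μ) (∫ x, ∑' m, f x m * g x m ∂μ) := by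
  have hmeas : ∀ m, AEStronglyMeasurable (fun x => f x m * g x m) μ := fun m => (hf m).mul (hg m)
  have hs : ∀ x, Summable fun m : Fin d → ℤ => w x * (wt m ^ (2 * d))⁻¹ := fun x =>
    (summable_wt d).mul_left _
  have hint : Integrable (fun x => ∑' m : Fin d → ℤ, w x * (wt m ^ (2 * d))⁻¹) μ := by
    simp only [tsum_mul_left]
    exact hw.mul_const _
  refine ⟨hint.mono' ?_ ?_, hasSum_integral_of_dominated_convergence (fun m x => w x * (wt m ^ (2 * d))⁻¹)
    hmeas ?_ (.of_forall hs) hint ?_⟩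
  · refine aestronglyMeasurable_of_tendsto_ae (atTop : Filter (Finset (Fin d → ℤ)))
      (f := fun s x => ∑ m ∈ s, f x m * g x m) (fun s => ?_) ?_
    · exact Finset.aestronglyMeasurable_fun_sum s fun m _ => hmeas m
    · filter_upwards [hb] with x hx
      exact (Summable.of_norm_bounded (hs x) hx).hasSum
  · filter_upwards [hb] with x hx
    exact tsum_of_norm_bounded (hs x).hasSum hx
  · exact fun m => hb.mono fun x hx => hx m
  · filter_upwards [hb] with x hx
    exact (Summable.of_norm_bounded (hs x) hx).hasSum

/-- The Fourier coefficients of the slices of a test function. -/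
def testCoeff {T : ℝ} (Φ : SpaceTimeTest d T) (t : ℝ) : Seq d := fun m =>
  ∫ x, UnitAddTorus.mFourier m x * Φ.toFun t x ∂(torusMeasure d)

theorem seriesPairing_slice {T : ℝ} (Φ : SpaceTimeTest d T) (c : Seq d) (t : ℝ) :
    seriesPairing c (Φ.slice t).1 = ∑' m, c m * testCoeff Φ t m := rfl

theorem continuous_spaceTimeTest {T : ℝ} (Φ : SpaceTimeTest d T) :
    Continuous fun z : ℝ × Torus d => Φ.toFun z.1 z.2 := by
  have h := (IsOpenQuotientMap.id (X := ℝ)).prodMap (isOpenQuotientMap_toTorus (d := d))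
  exact h.isQuotientMap.continuous_iff.2 Φ.smooth.continuous

theorem continuous_testCoeff {T : ℝ} (Φ : SpaceTimeTest d T) (m : Fin d → ℤ) :
    Continuous fun t => testCoeff Φ t m := by
  have h := continuous_parametric_integral_of_continuous (μ := torusMeasure d)
    (f := fun (t : ℝ) (x : Torus d) => UnitAddTorus.mFourier m x * Φ.toFun t x)
    (((UnitAddTorus.mFourier m).continuous.comp continuous_snd).mul (continuous_spaceTimeTest Φ))
    (isCompact_univ (X := Torus d))
  simp only [Measure.restrict_univ] at h
  exact h

theorem exists_testCoeff_le {T : ℝ} (Φ : SpaceTimeTest d T) (k : ℕ) :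
    ∃ D : ℝ, 0 ≤ D ∧ ∀ t ∈ Icc 0 T, ∀ m, ‖testCoeff Φ t m‖ ≤ D * (wt m ^ k)⁻¹ := by
  obtain ⟨B, hB, h⟩ := exists_derivBdd Φ.smooth 0 T k
  exact ⟨((d : ℝ) ^ k + 1) * B, by positivity, fun t ht m =>
    DerivBdd.norm_integral_le (φ := Φ.slice t) (h t ht) m⟩

theorem mul_testCoeff_le {c D W : ℝ} {K : ℕ} {x y : ℂ} {m : Fin d → ℤ}
    (hx : ‖x‖ ≤ c * wt m ^ K * W) (hy : ‖y‖ ≤ D * (wt m ^ (K + 2 * d))⁻¹) :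
    ‖x * y‖ ≤ c * D * W * (wt m ^ (2 * d))⁻¹ := by
  have := wt_pos m
  rw [norm_mul]
  calc ‖x‖ * ‖y‖ ≤ (c * wt m ^ K * W) * (D * (wt m ^ (K + 2 * d))⁻¹) :=
        mul_le_mul hx hy (norm_nonneg _) ((norm_nonneg _).trans hx)
    _ = _ := by rw [pow_add]; field_simp

/-- The region of integration of the Duhamel term. -/
def triangle (T : ℝ) : Set (ℝ × ℝ) := {z | 0 < z.2 ∧ z.2 < z.1 ∧ z.1 < T}

theorem measurableSet_triangle (T : ℝ) : MeasurableSet (triangle T) :=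
  (measurableSet_lt measurable_const measurable_snd).inter
    ((measurableSet_lt measurable_snd measurable_fst).inter
      (measurableSet_lt measurable_fst measurable_const))

theorem triangle_subset (T : ℝ) : triangle T ⊆ Ioo 0 T ×ˢ Ioo 0 T := fun _ hz =>
  ⟨⟨hz.1.trans hz.2.1, hz.2.2⟩, ⟨hz.1, hz.2.1.trans hz.2.2⟩⟩

theorem integrableOn_triangle_kernel {a γ T : ℝ} (ha : 0 ≤ a) (hγ : 0 ≤ γ) (h : a + γ < 1) (hT1 : T ≤ 1) :
    IntegrableOn (fun z : ℝ × ℝ => (z.1 - z.2) ^ (-a) * z.2 ^ (-γ)) (triangle T) := by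
  have hmeas : Measurable fun z : ℝ × ℝ => (z.1 - z.2) ^ (-a) * z.2 ^ (-γ) := by fun_prop
  refine ⟨hmeas.aestronglyMeasurable, ?_⟩
  set C := 4 / (1 - γ) + 4 / (1 - a) with hC
  have hC0 : 0 ≤ C := by
    have h1 : 0 < 1 - γ := by linarith
    have h2 : 0 < 1 - a := by linarith
    positivity
  have e : ∫⁻ z in triangle T, ‖(z.1 - z.2) ^ (-a) * z.2 ^ (-γ)‖ₑ =
      ∫⁻ z in triangle T, ENNReal.ofReal ((z.1 - z.2) ^ (-a) * z.2 ^ (-γ)) := by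
    refine setLIntegral_congr_fun (measurableSet_triangle T) fun z hz => ?_
    have h1 : 0 ≤ z.1 - z.2 := by linarith [hz.2.1]
    have h2 := hz.1.le
    exact Real.enorm_of_nonneg (by positivity)
  rw [HasFiniteIntegral, e, ← lintegral_indicator (measurableSet_triangle T), Measure.volume_eq_prod,
    lintegral_prod _ (hmeas.ennreal_ofReal.indicator (measurableSet_triangle T)).aemeasurable]
  have hle : ∀ t, ∫⁻ s, (triangle T).indicator
      (fun z => ENNReal.ofReal ((z.1 - z.2) ^ (-a) * z.2 ^ (-γ))) (t, s) ≤
      (Ioo 0 T).indicator (fun _ => ENNReal.ofReal C) t := by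
    intro t
    by_cases ht : t ∈ Ioo 0 T
    · rw [indicator_of_mem ht]
      have e2 : ∀ s, (triangle T).indicator
          (fun z => ENNReal.ofReal ((z.1 - z.2) ^ (-a) * z.2 ^ (-γ))) (t, s) =
          (Ioo 0 t).indicator (fun s => ENNReal.ofReal ((t - s) ^ (-a) * s ^ (-γ))) s := fun s => by
        by_cases hs : s ∈ Ioo 0 t
        · rw [indicator_of_mem hs, indicator_of_mem (show (t, s) ∈ triangle T from ⟨hs.1, hs.2, ht.2⟩)]
        · rw [indicator_of_notMem hs, indicator_of_notMem (fun h => hs ⟨h.1, h.2.1⟩)]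
      simp only [e2]
      rw [lintegral_indicator measurableSet_Ioo]
      refine (kernel_le ha (by linarith) hγ (by linarith) ht.1).trans (ENNReal.ofReal_le_ofReal ?_)
      refine mul_le_of_le_one_right hC0 ?_
      exact Real.rpow_le_one ht.1.le (ht.2.le.trans hT1) (by linarith)
    · rw [indicator_of_notMem ht, nonpos_iff_eq_zero]
      have e2 : ∀ s, (triangle T).indicator
          (fun z => ENNReal.ofReal ((z.1 - z.2) ^ (-a) * z.2 ^ (-γ))) (t, s) = 0 := fun s =>
        indicator_of_notMem (fun h => ht ⟨h.1.trans h.2.1, h.2.2⟩) _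
      simp [e2]
  refine lt_of_le_of_lt (lintegral_mono hle) ?_
  rw [lintegral_indicator measurableSet_Ioo, setLIntegral_const]
  exact ENNReal.mul_lt_top ENNReal.ofReal_lt_top (by simp)

variable {α σ a₁ γ₁ a₂ γ₂ : ℝ} {N M : Vec d → ℝ≥0∞}

theorem VecPair.nonlin_coeff (h : VecPair α σ a₁ γ₁ a₂ γ₂ N M) {A : ℝ} (hA : 0 ≤ A) :
    ∃ (C : ℝ) (K : ℕ), 0 ≤ C ∧ ∀ (s : ℝ) (u : Vec d), 0 < s → s ≤ 1 → Bdd N M σ s u A →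
      ∀ τ, 0 < τ → τ ≤ 1 → ∀ i m,
        ‖heat α τ (nonlin u u) i m‖ ≤ C * wt m ^ K * (τ ^ (-a₁) * s ^ (-γ₁)) := by
  obtain ⟨C, hC, hbil⟩ := h.bilinear
  obtain ⟨C', K, hC', hf⟩ := h.force_coeff
  refine ⟨C' * (C * A * A), K, by positivity, fun s u hs hs1 hu τ hτ hτ1 i m => ?_⟩
  refine (hf s _ (C * A * A) hs (by positivity) (hbil s hs hs1 u u A A hA hA hu hu) τ hτ hτ1 i m).trans
    (le_of_eq ?_)
  ring

theorem VecPair.integrable_duhamel (h : VecPair α σ a₁ γ₁ a₂ γ₂ N M) (χ : Cutoff d) {T A : ℝ} (hT1 : T ≤ 1)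
    (hA : 0 ≤ A) {u : ℝ → Vec d} (hm : CoeffMeas T u)
    (hb : ∀ t, 0 < t → t ≤ T → Bdd N M σ t (u t) A) {U : ℝ → VecDist d}
    (hU : ∀ t, 0 < t → t ≤ T → coeffs (U t) = u t) (Φ : SpaceTimeTest d T) (i : Fin d) :
    IntegrableOn (fun z : ℝ × ℝ => duhamelPairing χ α (z.1 - z.2) (U z.2) i (Φ.slice z.1).1)
      (triangle T) := by
  obtain ⟨C, K, hC, hnl⟩ := h.nonlin_coeff hA
  obtain ⟨D, hD, hΦ⟩ := exists_testCoeff_le Φ (K + 2 * d)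
  have hsq : ∀ s, 0 < s → s ≤ T → IsSq (u s) := fun s hs hsT => (hb s hs hsT).isSq h hs
  have hnm := hm.nonlin (by
    filter_upwards [ae_restrict_mem measurableSet_Ioo] with s hs using hsq s hs.1 hs.2.le)
  have hker := (integrableOn_triangle_kernel h.a₁_nonneg h.γ₁_nonneg h.lt_one hT1).const_mul (C * D)
  have key := (integrable_tsum_mul (μ := volume.restrict (triangle T))
    (f := fun z : ℝ × ℝ => heat α (z.1 - z.2) (nonlin (u z.2) (u z.2)) i)
    (g := fun z => testCoeff Φ z.1) (fun m => ?_) (fun m => ?_) hker ?_).1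
  · refine Integrable.congr key ?_
    filter_upwards [ae_restrict_mem (measurableSet_triangle T)] with z hz
    have h0 := hU z.2 hz.1 (hz.2.1.trans hz.2.2).le
    rw [duhamelPairing_eq χ α _ (by rw [h0]; exact hsq _ hz.1 (hz.2.1.trans hz.2.2).le), h0,
      seriesPairing_slice]
  · refine AEStronglyMeasurable.mul (f := fun z : ℝ × ℝ => (heatSymbol α (z.1 - z.2) m : ℂ)) ?_ ?_
    · exact (Complex.continuous_ofReal.comp ((continuous_heatSymbol α m).comp
        (continuous_fst.sub continuous_snd))).aestronglyMeasurable
    · have h1 : AEStronglyMeasurable (fun z : ℝ × ℝ => nonlin (u z.2) (u z.2) i m)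
          ((volume.restrict (Ioo 0 T)).prod (volume.restrict (Ioo 0 T))) := (hnm i m).comp_snd
      rw [Measure.prod_restrict, ← Measure.volume_eq_prod] at h1
      exact h1.mono_set (triangle_subset T)
  · exact ((continuous_testCoeff Φ m).comp continuous_fst).aestronglyMeasurable
  · filter_upwards [ae_restrict_mem (measurableSet_triangle T)] with z hz m
    exact mul_testCoeff_le (hnl z.2 (u z.2) hz.1 (by linarith [hz.2.1, hz.2.2])
      (hb _ hz.1 (hz.2.1.trans hz.2.2).le) (z.1 - z.2) (by linarith [hz.2.1])
      (by linarith [hz.1, hz.2.2]) i m) (hΦ z.1 ⟨(hz.1.trans hz.2.1).le, hz.2.2.le⟩ m)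

/-- The Duhamel term paired with a test function. -/
theorem VecPair.integral_duhamel (h : VecPair α σ a₁ γ₁ a₂ γ₂ N M) (χ : Cutoff d) {T A : ℝ} (hT1 : T ≤ 1)
    (hA : 0 ≤ A) {u : ℝ → Vec d} (hm : CoeffMeas T u)
    (hb : ∀ᵐ t ∂(volume.restrict (Ioo 0 T)), Bdd N M σ t (u t) A) {U : ℝ → VecDist d}
    (hU : ∀ t, 0 < t → t ≤ T → coeffs (U t) = u t) (Φ : SpaceTimeTest d T) (i : Fin d) {t : ℝ}
    (ht : t ∈ Ioo 0 T) :
    HasSum (fun m => duh α (fun s => nonlin (u s) (u s)) t i m * testCoeff Φ t m)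
      (∫ s in Ioo 0 t, duhamelPairing χ α (t - s) (U s) i (Φ.slice t).1) := by
  obtain ⟨C, K, hC, hnl⟩ := h.nonlin_coeff hA
  obtain ⟨D, hD, hΦ⟩ := exists_testCoeff_le Φ (K + 2 * d)
  have hb' : ∀ᵐ s ∂(volume.restrict (Ioo 0 t)), Bdd N M σ s (u s) A :=
    ae_restrict_of_ae_restrict_of_subset (Ioo_subset_Ioo_right ht.2.le) hb
  have hnm := hm.nonlin (by
    filter_upwards [hb, ae_restrict_mem measurableSet_Ioo] with s hs hs' using hs.isSq h hs'.1)
  have hker := (integrableOn_kernel h.a₁_nonneg h.a₁_lt h.γ₁_nonneg h.γ₁_lt ht.1).const_mul (C * D)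
  have key := (integrable_tsum_mul (μ := volume.restrict (Ioo 0 t))
    (f := fun s : ℝ => heat α (t - s) (nonlin (u s) (u s)) i)
    (g := fun _ => testCoeff Φ t) (fun m => ?_) (fun m => aestronglyMeasurable_const) hker ?_).2
  · have e : ∫ s in Ioo 0 t, duhamelPairing χ α (t - s) (U s) i (Φ.slice t).1 =
        ∫ s in Ioo 0 t, ∑' m, heat α (t - s) (nonlin (u s) (u s)) i m * testCoeff Φ t m := by
      refine integral_congr_ae ?_
      filter_upwards [hb', ae_restrict_mem measurableSet_Ioo] with s hs hs'
      have h0 := hU s hs'.1 (hs'.2.trans ht.2).le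
      rw [duhamelPairing_eq χ α _ (by rw [h0]; exact hs.isSq h hs'.1), h0, seriesPairing_slice]
    rw [e]
    refine key.congr_fun fun m => ?_
    exact (integral_mul_const _ _).symm
  · refine AEStronglyMeasurable.mul (f := fun s : ℝ => (heatSymbol α (t - s) m : ℂ)) ?_ ?_
    · exact (Complex.continuous_ofReal.comp ((continuous_heatSymbol α m).comp
        (continuous_const.sub continuous_id))).aestronglyMeasurable
    · exact (hnm i m).mono_set (Ioo_subset_Ioo_right ht.2.le)
  · filter_upwards [hb', ae_restrict_mem measurableSet_Ioo] with s hs hs' m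
    exact mul_testCoeff_le (hnl s (u s) hs'.1 (by linarith [hs'.2, ht.2]) hs (t - s) (by linarith [hs'.2])
      (by linarith [hs'.1, ht.2]) i m) (hΦ t (Ioo_subset_Icc_self ht) m)

theorem VecNorm.polyBdd {b : Vec d → ℝ≥0∞} (hb : VecNorm b) {u : Vec d} (hu : b u ≠ ⊤) (i : Fin d) :
    PolyBdd (u i) := by
  obtain ⟨C, K, hC, hc⟩ := hb.coeff_real
  refine ⟨C * (b u).toReal, K, by positivity, fun m => ?_⟩
  refine (hc u (b u).toReal (by positivity) (by rw [ENNReal.ofReal_toReal hu]) i m).trans (le_of_eq ?_)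
  ring

theorem norm_heat_le {τ : ℝ} (hτ : 0 ≤ τ) (u : Vec d) (i : Fin d) (m : Fin d → ℤ) :
    ‖heat α τ u i m‖ ≤ ‖u i m‖ := by
  have h0 := heatSymbol_pos α τ m
  have h1 := heatSymbol_le_one (α := α) hτ m
  unfold heat
  rw [norm_mul, Complex.norm_real, Real.norm_of_nonneg h0.le]
  exact mul_le_of_le_one_left (norm_nonneg _) h1

theorem VecPair.isMildSolution (h : VecPair α σ a₁ γ₁ a₂ γ₂ N M) (χ : Cutoff d) {T A : ℝ} (hT1 : T ≤ 1)
    (hA : 0 ≤ A) {u₀ : VecDist d} {u : ℝ → Vec d} (hm : CoeffMeas T u)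
    (hb : ∀ t, 0 < t → t ≤ T → Bdd N M σ t (u t) A)
    (hs : ∀ t, 0 ≤ t → t ≤ T → SolvesAt α (coeffs u₀) u t) {U : ℝ → VecDist d}
    (hU : ∀ t, 0 ≤ t → t ≤ T → coeffs (U t) = u t) (hreal : ∀ t, 0 ≤ t → t ≤ T → ConjSymm (u t)) :
    IsMildSolution χ α T u₀ U := by
  have hU' : ∀ t, 0 < t → t ≤ T → coeffs (U t) = u t := fun t ht => hU t ht.le
  have hU_i : ∀ t ∈ Ioo 0 T, ∀ i, coeff (U t i) = u t i := fun t ht i =>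
    congrFun (hU' t ht.1 ht.2.le) i
  have hsum : ∀ t ∈ Ioo 0 T, ∀ i, Summable fun m => ‖u t i m‖ := fun t ht i => by
    obtain ⟨C, hC, hd⟩ := h.decay hT1 hA hm hb hs ht.1 (2 * d)
    exact Summable.of_nonneg_of_le (fun _ => norm_nonneg _) (fun m => hd t le_rfl ht.2.le i m)
      ((summable_wt d).mul_left C)
  have hpair : ∀ (Φ : SpaceTimeTest d T) (i : Fin d) (t), t ∈ Ioo 0 T →
      (U t i).1 (Φ.slice t) = ∑' m, u t i m * testCoeff Φ t m := fun Φ i t ht => by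
    rw [pairing_eq, hU_i t ht, seriesPairing_slice]
  have hint_u : ∀ (Φ : SpaceTimeTest d T) (i : Fin d),
      IntegrableOn (fun t => (U t i).1 (Φ.slice t)) (Ioo 0 T) := fun Φ i => by
    obtain ⟨C, K, hC, hc⟩ := h.normN.coeff_real
    obtain ⟨D, hD, hΦ⟩ := exists_testCoeff_le Φ (K + 2 * d)
    have key := (integrable_tsum_mul (μ := volume.restrict (Ioo 0 T)) (f := fun t => u t i)
      (g := fun t => testCoeff Φ t) (w := fun _ => C * D * A) (fun m => hm i m)
      (fun m => (continuous_testCoeff Φ m).aestronglyMeasurable) (integrable_const _) ?_).1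
    · refine Integrable.congr key ?_
      filter_upwards [ae_restrict_mem measurableSet_Ioo] with t ht
      exact (hpair Φ i t ht).symm
    · filter_upwards [ae_restrict_mem measurableSet_Ioo] with t ht m
      exact mul_testCoeff_le (hc _ A hA (hb t ht.1 ht.2.le).1 i m) (hΦ t (Ioo_subset_Icc_self ht) m)
  refine ⟨fun t ht => isReal_of_conjSymm ?_, ⟨1, one_pos, ?_⟩, hint_u,
    fun Φ i => h.integrable_duhamel χ hT1 hA hm hb hU' Φ i, fun Φ i => ?_⟩
  · rw [hU t ht.1 ht.2.le]; exact hreal t ht.1 ht.2.le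
  · filter_upwards [ae_restrict_mem measurableSet_Ioo] with t ht
    refine tensorWellDefined_of_summable χ fun i => ?_
    rw [hU_i t ht i]
    exact hsum t ht i
  obtain ⟨C, K, hC, hp⟩ := polyBdd_coeff (u₀ i)
  obtain ⟨D, hD, hΦ⟩ := exists_testCoeff_le Φ (K + 2 * d)
  have hheat_le : ∀ t ∈ Ioo 0 T, ∀ m, ‖heat α t (coeffs u₀) i m * testCoeff Φ t m‖ ≤
      C * D * 1 * (wt m ^ (2 * d))⁻¹ := fun t ht m =>
    mul_testCoeff_le (((norm_heat_le ht.1.le _ i m).trans (hp m)).trans_eq (mul_one _).symm)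
      (hΦ t (Ioo_subset_Icc_self ht) m)
  have hint_heat : IntegrableOn (fun t => heatPairing α t u₀ i (Φ.slice t).1) (Ioo 0 T) := by
    refine (integrable_tsum_mul (μ := volume.restrict (Ioo 0 T)) (f := fun t => heat α t (coeffs u₀) i)
      (g := fun t => testCoeff Φ t) (w := fun _ => C * D * 1) (fun m => coeffMeas_heat α T _ i m)
      (fun m => (continuous_testCoeff Φ m).aestronglyMeasurable) (integrable_const _) ?_).1
    filter_upwards [ae_restrict_mem measurableSet_Ioo] with t ht m using hheat_le t ht m
  have hb' : ∀ᵐ t ∂(volume.restrict (Ioo 0 T)), Bdd N M σ t (u t) A := by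
    filter_upwards [ae_restrict_mem measurableSet_Ioo] with t ht using hb t ht.1 ht.2.le
  have hpt : ∀ t ∈ Ioo 0 T, (U t i).1 (Φ.slice t) = heatPairing α t u₀ i (Φ.slice t).1 -
      ∫ s in Ioo 0 t, duhamelPairing χ α (t - s) (U s) i (Φ.slice t).1 := fun t ht => by
    have h1 := h.integral_duhamel χ hT1 hA hm hb' hU' Φ i ht
    have h2 : HasSum (fun m => heat α t (coeffs u₀) i m * testCoeff Φ t m)
        (heatPairing α t u₀ i (Φ.slice t).1) :=
      (Summable.of_norm_bounded ((summable_wt d).mul_left _) (hheat_le t ht)).hasSum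
    rw [hpair Φ i t ht, ← (h2.sub h1).tsum_eq]
    refine tsum_congr fun m => ?_
    rw [hs t ht.1.le ht.2.le, ← sub_mul]
    rfl
  have hint_duh : IntegrableOn (fun t => ∫ s in Ioo 0 t,
      duhamelPairing χ α (t - s) (U s) i (Φ.slice t).1) (Ioo 0 T) := by
    refine (hint_heat.sub (hint_u Φ i)).congr ?_
    filter_upwards [ae_restrict_mem measurableSet_Ioo] with t ht
    rw [Pi.sub_apply, hpt t ht, sub_sub_cancel]
  rw [← integral_sub hint_heat hint_duh]
  exact setIntegral_congr_fun measurableSet_Ioo hpt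

end FracNS
end



noncomputable section

namespace FracNS

variable {d : ℕ} {α σ a₁ γ₁ a₂ γ₂ T : ℝ} {N M : Vec d → ℝ≥0∞}

/-! ### Uniqueness -/

/-- The test function `η(t) e^{-2πi m·x}`. -/
def productTest (m : Fin d → ℤ) {η : ℝ → ℝ} (hη : ContDiff ℝ ∞ η) (hc : HasCompactSupport η)
    (hs : tsupport η ⊆ Ioo 0 T) : SpaceTimeTest d T where
  toFun t x := (η t : ℂ) * UnitAddTorus.mFourier (-m) x
  smooth := (Complex.ofRealCLM.contDiff.comp (hη.comp contDiff_fst)).mul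
    ((contDiff_mFourier (-m)).comp contDiff_snd)
  compact_support := by
    rcases (tsupport η).eq_empty_or_nonempty with h | h
    · refine ⟨1, T - 1, one_pos, by linarith, fun t _ x => ?_⟩
      rw [tsupport_eq_empty_iff] at h
      simp [h]
    · obtain ⟨a, ha⟩ := hc.isCompact.exists_isLeast h
      obtain ⟨b, hb⟩ := hc.isCompact.exists_isGreatest h
      refine ⟨a, b, (hs ha.1).1, (hs hb.1).2, fun t ht x => ?_⟩
      have : η t = 0 := by
        by_contra h0
        have h1 := subset_tsupport η h0
        exact ht ⟨ha.2 h1, hb.2 h1⟩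
      simp [this]

theorem seriesPairing_smul (c : Seq d) (a : ℂ) (φ : Torus d → ℂ) :
    seriesPairing c (fun x => a * φ x) = a * seriesPairing c φ := by
  unfold seriesPairing
  rw [← tsum_mul_left]
  refine tsum_congr fun m => ?_
  simp only [mul_left_comm _ a, integral_const_mul]

theorem seriesPairing_productTest (m : Fin d → ℤ) {η : ℝ → ℝ} (hη : ContDiff ℝ ∞ η)
    (hc : HasCompactSupport η) (hs : tsupport η ⊆ Ioo 0 T) (c : Seq d) (t : ℝ) :
    seriesPairing c ((productTest m hη hc hs).slice t).1 = η t * c m :=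
  (seriesPairing_smul c (η t) _).trans (congrArg _ (seriesPairing_expFun c m))

/-- A mild solution solves the integral equation almost everywhere. -/
theorem VecPair.solvesAt_of_isMildSolution (h : VecPair α σ a₁ γ₁ a₂ γ₂ N M) {χ : Cutoff d} {A : ℝ}
    (hT1 : T ≤ 1) (hA : 0 ≤ A) {u₀ : VecDist d} {U : ℝ → VecDist d}
    (hU : IsMildSolution χ α T u₀ U) (hm : CoeffMeas T fun t => coeffs (U t))
    (hb : ∀ᵐ t ∂(volume.restrict (Ioo 0 T)), Bdd N M σ t (coeffs (U t)) A) :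
    ∀ᵐ t ∂(volume.restrict (Ioo 0 T)), SolvesAt α (coeffs u₀) (fun t => coeffs (U t)) t := by
  set u : ℝ → Vec d := fun t => coeffs (U t) with hu
  have hnm := hm.nonlin (by
    filter_upwards [hb, ae_restrict_mem measurableSet_Ioo] with s hs hs' using hs.isSq h hs'.1)
  obtain ⟨C, K, hC, hc⟩ := h.normN.coeff_real
  obtain ⟨CB, hCB, hbil⟩ := h.bilinear
  obtain ⟨l, hl, hduh⟩ := h.duh_bdd one_pos
  have key : ∀ i m, ∀ᵐ t ∂(volume.restrict (Ioo 0 T)),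
      u t i m = heat α t (coeffs u₀) i m - duh α (fun s => nonlin (u s) (u s)) t i m := by
    intro i m
    have hu_int : IntegrableOn (fun t => u t i m) (Ioo 0 T) := by
      refine Integrable.mono' (g := fun _ => C * wt m ^ K * A) (integrable_const _) (hm i m) ?_
      filter_upwards [hb] with t ht using hc _ A hA ht.1 i m
    have hheat_int : IntegrableOn (fun t => heat α t (coeffs u₀) i m) (Ioo 0 T) := by
      refine Integrable.mono' (g := fun _ => ‖coeffs u₀ i m‖) (integrable_const _)
        (coeffMeas_heat α T _ i m) ?_
      filter_upwards [ae_restrict_mem measurableSet_Ioo] with t ht using norm_heat_le ht.1.le _ i m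
    have hF : ∀ᵐ s ∂(volume.restrict (Ioo 0 T)), Force N M α a₁ γ₁ a₂ γ₂ s (nonlin (u s) (u s))
        (CB * A * A * Real.exp (l * s)) := by
      filter_upwards [hb, ae_restrict_mem measurableSet_Ioo] with s hs hs'
      refine (hbil s hs'.1 (hs'.2.le.trans hT1) _ _ A A hA hA hs hs).mono hs'.1.le ?_
      refine le_mul_of_one_le_right (by positivity) (Real.one_le_exp (mul_nonneg hl hs'.1.le))
    have hduh_int : IntegrableOn (fun t => duh α (fun s => nonlin (u s) (u s)) t i m) (Ioo 0 T) := by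
      refine Integrable.mono' (g := fun _ => C * wt m ^ K * (1 * (CB * A * A) * Real.exp (l * T)))
        (integrable_const _) (hnm.duh i m) ?_
      filter_upwards [ae_restrict_mem measurableSet_Ioo] with t ht
      have h1 := hduh _ (CB * A * A) T (by positivity) hT1 hnm hF t ht.1 ht.2.le
      refine (hc _ _ (by positivity) h1.1 i m).trans ?_
      have := wt_pos m
      gcongr
      exact ht.2.le
    have hzero := isOpen_Ioo.ae_eq_zero_of_integral_contDiff_smul_eq_zero (μ := volume) (U := Ioo 0 T)
      (f := fun t => u t i m - (heat α t (coeffs u₀) i m - duh α (fun s => nonlin (u s) (u s)) t i m))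
      (hu_int.sub (hheat_int.sub hduh_int)).locallyIntegrableOn (fun η hη hηc hηs => ?_)
    · rw [← ae_restrict_iff' measurableSet_Ioo] at hzero
      filter_upwards [hzero] with t ht using sub_eq_zero.1 ht
    · set Φ := productTest m hη hηc hηs
      have heq := hU.equation Φ i
      obtain ⟨B, hB⟩ := hηc.exists_bound_of_continuous hη.continuous
      have hmul : ∀ {f : ℝ → ℂ}, IntegrableOn f (Ioo 0 T) →
          IntegrableOn (fun t => (η t : ℂ) * f t) (Ioo 0 T) := fun hf =>
        hf.bdd_mul (c := B) (Complex.continuous_ofReal.comp hη.continuous).aestronglyMeasurable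
          (.of_forall fun t => by rw [Complex.norm_real]; exact hB t)
      have e1 : ∫ t in Ioo 0 T, (U t i).1 (Φ.slice t) = ∫ t in Ioo 0 T, (η t : ℂ) * u t i m := by
        refine integral_congr_ae (.of_forall fun t => ?_)
        simp only
        rw [pairing_eq, seriesPairing_productTest]
        rfl
      have e2 : ∫ t in Ioo 0 T, heatPairing α t u₀ i (Φ.slice t).1 =
          ∫ t in Ioo 0 T, (η t : ℂ) * heat α t (coeffs u₀) i m := by
        refine integral_congr_ae (.of_forall fun t => ?_)
        simp only [heatPairing]
        rw [seriesPairing_productTest]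
        rfl
      have e3 : ∫ t in Ioo 0 T, ∫ s in Ioo 0 t, duhamelPairing χ α (t - s) (U s) i (Φ.slice t).1 =
          ∫ t in Ioo 0 T, (η t : ℂ) * duh α (fun s => nonlin (u s) (u s)) t i m := by
        refine setIntegral_congr_fun measurableSet_Ioo fun t ht => ?_
        have hb' : ∀ᵐ s ∂(volume.restrict (Ioo 0 t)), Bdd N M σ s (u s) A :=
          ae_restrict_of_ae_restrict_of_subset (Ioo_subset_Ioo_right ht.2.le) hb
        simp only [duh]
        rw [← integral_const_mul]
        refine integral_congr_ae ?_
        filter_upwards [hb', ae_restrict_mem measurableSet_Ioo] with s hs hs'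
        rw [duhamelPairing_eq χ α _ (hs.isSq h hs'.1), seriesPairing_productTest]
        rfl
      rw [e1, e2, e3] at heq
      have hsupp : ∀ t ∉ Ioo 0 T, η t • (u t i m - (heat α t (coeffs u₀) i m -
          duh α (fun s => nonlin (u s) (u s)) t i m)) = 0 := fun t ht => by
        rw [image_eq_zero_of_notMem_tsupport fun h => ht (hηs h), zero_smul]
      rw [← setIntegral_eq_integral_of_forall_compl_eq_zero hsupp]
      simp only [Complex.real_smul, mul_sub]
      have e4 := integral_sub (hmul hheat_int) (hmul hduh_int)
      have e5 := integral_sub (hmul hu_int) ((hmul hheat_int).sub (hmul hduh_int))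
      simp only [Pi.sub_apply] at e5
      rw [e5, e4, heq, sub_self]
  have key' := (ae_all_iff.2 fun i => ae_all_iff.2 fun m => key i m)
  filter_upwards [key'] with t ht
  funext i m
  exact ht i m

theorem duh_at_zero (F : ℝ → Vec d) : duh α F 0 = 0 := by
  ext i m; simp [duh]

theorem exists_bound_of_continuous (hN : VecNorm N) {u : ℝ → Vec d} (hfin : ∀ t ∈ Icc 0 T, N (u t) < ⊤)
    (hc : ∀ t ∈ Icc 0 T, Tendsto (fun s => N (u s - u t)) (𝓝[Icc 0 T] t) (𝓝 0)) :
    ∃ A : ℝ, 0 ≤ A ∧ ∀ t ∈ Icc 0 T, N (u t) ≤ ENNReal.ofReal A := by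
  have h := isCompact_Icc.induction_on (s := Icc 0 T)
    (p := fun S => ∃ B : ℝ≥0∞, B ≠ ⊤ ∧ ∀ t ∈ S ∩ Icc 0 T, N (u t) ≤ B) ⟨0, by simp, by simp⟩
    (fun S S' hS ⟨B, hB, h⟩ => ⟨B, hB, fun t ht => h t ⟨hS ht.1, ht.2⟩⟩)
    (fun S S' ⟨B, hB, h⟩ ⟨B', hB', h'⟩ => ⟨B + B', by finiteness, fun t ht => by
      rcases ht.1 with h1 | h1
      · exact (h t ⟨h1, ht.2⟩).trans le_self_add
      · exact (h' t ⟨h1, ht.2⟩).trans le_add_self⟩)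
    (fun t ht => by
      have h1 := (hc t ht).eventually_lt_const zero_lt_one
      refine ⟨_, h1, 1 + N (u t), ENNReal.add_ne_top.2 ⟨ENNReal.one_ne_top, (hfin t ht).ne⟩,
        fun s hs => ?_⟩
      have e : u s = (u s - u t) + u t := by simp
      rw [e]
      refine (hN.add _ _).trans ?_
      gcongr
      have h2 : N (u s - u t) < 1 := hs.1
      exact h2.le)
  obtain ⟨B, hB, h⟩ := h
  exact ⟨B.toReal, ENNReal.toReal_nonneg, fun t ht => by
    rw [ENNReal.ofReal_toReal hB]; exact h t ⟨ht, ht⟩⟩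

theorem VecPair.eqOn_of_ae_eq (h : VecPair α σ a₁ γ₁ a₂ γ₂ N M) (hT : 0 < T) {u v : ℝ → Vec d}
    (hu : ∀ t ∈ Icc 0 T, Tendsto (fun s => N (u s - u t)) (𝓝[Icc 0 T] t) (𝓝 0))
    (hv : ∀ t ∈ Icc 0 T, Tendsto (fun s => N (v s - v t)) (𝓝[Icc 0 T] t) (𝓝 0))
    (he : ∀ᵐ t ∂(volume.restrict (Ioo 0 T)), u t = v t) {t : ℝ} (ht : t ∈ Icc 0 T) : u t = v t := by
  funext i m
  have he' : (fun t => u t i m) =ᵐ[volume.restrict (Icc 0 T)] fun t => v t i m := by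
    rw [← restrict_Ioo_eq_restrict_Icc]
    filter_upwards [he] with t ht
    rw [ht]
  exact Measure.eqOn_Icc_of_ae_eq volume hT.ne he' (h.coeff_continuousOn hu i m)
    (h.coeff_continuousOn hv i m) ht

theorem CoeffMeas.of_continuous (h : VecPair α σ a₁ γ₁ a₂ γ₂ N M) {u : ℝ → Vec d}
    (hc : ∀ t ∈ Icc 0 T, Tendsto (fun s => N (u s - u t)) (𝓝[Icc 0 T] t) (𝓝 0)) : CoeffMeas T u :=
  fun i m => ((h.coeff_continuousOn hc i m).mono Ioo_subset_Icc_self).aestronglyMeasurable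
    measurableSet_Ioo

/-- The distribution-valued function with given Fourier coefficients. -/
def ofVec (u : Vec d) : VecDist d := fun i => ofSeq (u i)

theorem VecNorm.coeffs_ofVec (hN : VecNorm N) {u : Vec d} (hu : N u ≠ ⊤) : coeffs (ofVec u) = u := by
  funext i m
  exact coeff_ofSeq (hN.polyBdd hu i) m

theorem VecPair.smoothOn (h : VecPair α σ a₁ γ₁ a₂ γ₂ N M) {A : ℝ} (hT1 : T ≤ 1)
    (hA : 0 ≤ A) {u₀ : Vec d} (hu₀ : N u₀ ≠ ⊤) {u : ℝ → Vec d} (hm : CoeffMeas T u)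
    (hb : ∀ t, 0 < t → t ≤ T → Bdd N M σ t (u t) A)
    (hs : ∀ t, 0 ≤ t → t ≤ T → SolvesAt α u₀ u t) {U : ℝ → VecDist d}
    (hU : ∀ t, 0 ≤ t → t ≤ T → coeffs (U t) = u t) (hreal : ∀ t, 0 ≤ t → t ≤ T → ConjSymm (u t)) :
    SmoothOn T U := by
  have hsm := h.timeSmooth hT1 hA hu₀ hm hb hs
  refine ⟨fun i t x => (∑' m, u t i m * UnitAddTorus.mFourier m x).re, fun i => ⟨?_, fun t ht => ?_⟩⟩
  · refine contDiffOn_infty.2 fun n => ?_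
    exact Complex.reCLM.contDiff.comp_contDiffOn (hsm n i).contDiffOn
  · rw [represents_iff]
    have hsum : Summable fun m => ‖u t i m‖ := (hsm 0 i).summable ht
    have e : (fun x => (((∑' m, u t i m * UnitAddTorus.mFourier m x).re : ℝ) : ℂ)) =
        fun x => ∑' m, u t i m * UnitAddTorus.mFourier m x := by
      funext x
      rw [← Complex.conj_eq_iff_re, Complex.conj_tsum]
      rw [← (Equiv.neg (Fin d → ℤ)).tsum_eq]
      refine tsum_congr fun m => ?_
      simp only [Equiv.neg_apply, map_mul, UnitAddTorus.mFourier_neg, Complex.conj_conj,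
        hreal t ht.1.le ht.2.le i m]
    rw [e]
    have h1 := congrFun (hU t ht.1.le ht.2.le) i
    change coeff (U t i) = u t i at h1
    rw [h1]
    exact (isFourier_of_summable hsum).1

/-- A pair of norms with suitable smoothing estimates gives local well-posedness. -/
theorem VecPair.locallyWellPosed (h : VecPair α σ a₁ γ₁ a₂ γ₂ N M) (χ : Cutoff d) :
    LocallyWellPosed χ α (fun u => N (coeffs u)) (fun u => M (coeffs u)) σ := by
  intro u₀ hu₀
  have hN0 : N (coeffs u₀) ≠ ⊤ := hu₀.2.2.ne
  set R : ℝ := (N (coeffs u₀)).toReal + 1 with hR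
  have hR0 : 0 ≤ R := by positivity
  obtain ⟨T, A, hT, hT1, hA, hsol⟩ := h.exists_solution hR0
  have hball : ∀ v₀ : VecDist d, N (coeffs (v₀ - u₀)) < ENNReal.ofReal 1 →
      N (coeffs v₀) ≤ ENNReal.ofReal R := fun v₀ hv => by
    have e : coeffs v₀ = coeffs u₀ + coeffs (v₀ - u₀) := by rw [coeffs_sub]; simp
    rw [e, hR, ENNReal.ofReal_add ENNReal.toReal_nonneg zero_le_one, ENNReal.ofReal_toReal hN0]
    exact (h.normN.add _ _).trans (by gcongr)
  choose! u hum hub hus hureal using hsol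
  have hN_fin : ∀ v₀, N v₀ ≤ ENNReal.ofReal R → ∀ t, 0 ≤ t → t ≤ T → N (u v₀ t) ≠ ⊤ := by
    intro v₀ hv t ht htT
    rcases ht.eq_or_lt with rfl | ht
    · rw [hus v₀ hv 0 le_rfl htT, heat_zero, duh_at_zero, sub_zero]
      exact ne_top_of_le_ne_top ENNReal.ofReal_ne_top hv
    · exact (hub v₀ hv t ht htT).ne_top
  have hcoeffs : ∀ v₀, N v₀ ≤ ENNReal.ofReal R → ∀ t, 0 ≤ t → t ≤ T →
      coeffs (ofVec (u v₀ t)) = u v₀ t := fun v₀ hv t ht htT =>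
    h.normN.coeffs_ofVec (hN_fin v₀ hv t ht htT)
  have hcont : ∀ v₀, N v₀ ≤ ENNReal.ofReal R → ∀ t ∈ Icc 0 T,
      Tendsto (fun s => N (u v₀ s - u v₀ t)) (𝓝[Icc 0 T] t) (𝓝 0) := fun v₀ hv t ht =>
    h.continuous_of_solves hT1 hA (ne_top_of_le_ne_top ENNReal.ofReal_ne_top hv) (hum v₀ hv)
      (hub v₀ hv) (hus v₀ hv) ht
  have hae : ∀ {p : ℝ → Prop}, (∀ t, 0 < t → t ≤ T → p t) →
      ∀ᵐ t ∂(volume.restrict (Ioo 0 T)), p t := fun hp => by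
    filter_upwards [ae_restrict_mem measurableSet_Ioo] with t ht using hp t ht.1 ht.2.le
  refine ⟨T, hT, 1, one_pos, fun v₀ t => ofVec (u (coeffs v₀) t), fun v₀ hv₀ hv => ?_,
    fun v₀ hv₀ hv ε hε => ?_⟩
  · have hvR := hball v₀ hv
    have hreal : ∀ t, 0 ≤ t → t ≤ T → ConjSymm (u (coeffs v₀) t) := fun t _ _ =>
      hureal _ hvR hv₀.1.conjSymm t
    refine ⟨⟨?_, ?_, ?_⟩, fun v hvsol t ht => ?_, ?_⟩
    · exact h.isMildSolution χ hT1 hA (hum _ hvR) (hub _ hvR) (hus _ hvR) (hcoeffs _ hvR) hreal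
    · intro t ht
      refine ⟨?_, ?_⟩
      · simp only
        rw [hcoeffs _ hvR t ht.1 ht.2]
        exact (hN_fin _ hvR t ht.1 ht.2).lt_top
      · refine (hcont _ hvR t ht).congr' ?_
        filter_upwards [self_mem_nhdsWithin] with s hs
        rw [coeffs_sub, hcoeffs _ hvR t ht.1 ht.2, hcoeffs _ hvR s hs.1 hs.2]
    · refine ⟨A, hae fun t ht htT => ?_⟩
      simp only
      rw [hcoeffs _ hvR t ht.le htT]
      exact (hub _ hvR t ht htT).2
    · obtain ⟨hmild, hvc, C, hvM⟩ := hvsol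
      have hvcont : ∀ t ∈ Icc 0 T, Tendsto (fun s => N (coeffs (v s) - coeffs (v t)))
          (𝓝[Icc 0 T] t) (𝓝 0) := fun t ht => (hvc t ht).2
      obtain ⟨A', hA', hvN⟩ := exists_bound_of_continuous h.normN (u := fun t => coeffs (v t))
        (fun t ht => (hvc t ht).1) hvcont
      set A'' := max A (max A' C) with hA''
      have hA''0 : 0 ≤ A'' := hA.trans (le_max_left _ _)
      have hvm : CoeffMeas T fun t => coeffs (v t) := CoeffMeas.of_continuous h hvcont
      have hvb : ∀ᵐ t ∂(volume.restrict (Ioo 0 T)), Bdd N M σ t (coeffs (v t)) A'' := by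
        filter_upwards [hvM, ae_restrict_mem measurableSet_Ioo] with t h1 ht
        refine ⟨(hvN t (Ioo_subset_Icc_self ht)).trans (ENNReal.ofReal_le_ofReal ?_),
          h1.trans (ENNReal.ofReal_le_ofReal ?_)⟩
        · exact (le_max_left _ _).trans (le_max_right _ _)
        · exact (le_max_right _ _).trans (le_max_right _ _)
      have hvs := h.solvesAt_of_isMildSolution hT1 hA''0 hmild hvm hvb
      obtain ⟨L, hL, hstab⟩ := h.stability hA''0
      have hEq : ∀ᵐ t ∂(volume.restrict (Ioo 0 T)), coeffs (v t) = u (coeffs v₀) t := by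
        filter_upwards [hvs, ae_restrict_mem measurableSet_Ioo] with t h1 ht
        have h2 := hstab T 0 (coeffs v₀) (coeffs v₀) (fun t => coeffs (v t)) (u (coeffs v₀)) hT1 le_rfl
          hvm (hum _ hvR) hvb (hae fun t ht htT => (hub _ hvR t ht htT).mono (le_max_left _ _)) hvs
          (hae fun t ht htT => hus _ hvR t ht.le htT) (by rw [sub_self, h.normN.zero]; simp) t ht.1
          ht.2.le h1 (hus _ hvR t ht.1.le ht.2.le)
        rw [mul_zero, ENNReal.ofReal_zero, nonpos_iff_eq_zero] at h2
        exact sub_eq_zero.1 (h.normN.eq_zero h2)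
      have h3 := h.eqOn_of_ae_eq hT hvcont (hcont _ hvR) hEq ht
      rw [← hcoeffs _ hvR t ht.1 ht.2] at h3
      funext i
      exact ext_coeff fun m => congrFun (congrFun h3 i) m
    · exact h.smoothOn hT1 hA (ne_top_of_le_ne_top ENNReal.ofReal_ne_top hvR) (hum _ hvR) (hub _ hvR)
        (hus _ hvR) (hcoeffs _ hvR) hreal
  · obtain ⟨L, hL, hstab⟩ := h.stability hA
    refine ⟨ε / (L + 1), by positivity, fun w₀ hw₀ hw hwv t ht => ?_⟩
    have hvR := hball v₀ hv
    have hwR := hball w₀ hw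
    have hd : ε / (L + 1) ≤ ε := div_le_self hε.le (by linarith)
    simp only
    rw [coeffs_sub, hcoeffs _ hvR t ht.1 ht.2, hcoeffs _ hwR t ht.1 ht.2]
    rcases ht.1.eq_or_lt with rfl | ht0
    · rw [hus _ hvR 0 le_rfl ht.2, hus _ hwR 0 le_rfl ht.2, heat_zero, heat_zero, duh_at_zero, duh_at_zero,
        sub_zero, sub_zero, ← coeffs_sub]
      exact hwv.le.trans (ENNReal.ofReal_le_ofReal hd)
    · refine (hstab T (ε / (L + 1)) _ _ _ _ hT1 (by positivity) (hum _ hwR) (hum _ hvR)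
        (hae (hub _ hwR)) (hae (hub _ hvR)) (hae fun t ht => hus _ hwR t ht.le)
        (hae fun t ht => hus _ hvR t ht.le) hwv.le t ht0 ht.2 (hus _ hwR t ht.1 ht.2)
        (hus _ hvR t ht.1 ht.2)).trans (ENNReal.ofReal_le_ofReal ?_)
      rw [mul_div_assoc', div_le_iff₀ (by linarith)]
      nlinarith

end FracNS
end



noncomputable section

namespace FracNS

variable {d : ℕ} {α : ℝ}

/-! ### Lebesgue spaces -/

theorem seqNorm_seqLp {q : ℝ≥0∞} (hq : 1 ≤ q) : SeqNorm (seqLp (d := d) q) where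
  add := seqLp_add hq
  smul := seqLp_smul q
  coeff := ⟨1, 0, zero_le_one, fun u m => by simpa using enorm_le_seqLp hq u m⟩
  complete := fun _ _ _ hB hu hl => seqLp_complete hq hB hu hl
  integral := fun _ _ _ hm hs hw hle => seqLp_integral hq hm hs hw hle
  mul := fun _ _ _ hc u hu => hc q hq u hu

theorem tendsto_heat_sub_one_of_finite (α : ℝ) (q : ℝ≥0∞) {c : Seq d} {s : Finset (Fin d → ℤ)}
    (hc : ∀ m ∉ s, c m = 0) :
    Tendsto (fun t => seqLp q (fun m => ((heatSymbol α t m : ℂ) - 1) * c m)) (𝓝[>] 0) (𝓝 0) := by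
  have h1 : Tendsto (fun t => ∑ m ∈ s, ‖((heatSymbol α t m : ℂ) - 1) * c m‖ₑ) (𝓝[>] 0) (𝓝 0) := by
    have h2 : Continuous fun t => ∑ m ∈ s, ‖((heatSymbol α t m : ℂ) - 1) * c m‖ₑ := by
      refine continuous_finsetSum _ fun m _ => Continuous.enorm ?_
      exact ((Complex.continuous_ofReal.comp (continuous_heatSymbol α m)).sub continuous_const).mul
        continuous_const
    have h3 := (h2.tendsto 0).mono_left (nhdsWithin_le_nhds (s := Ioi 0))
    simpa [heatSymbol_zero] using h3
  refine tendsto_of_tendsto_of_tendsto_of_le_of_le tendsto_const_nhds h1 (fun _ => zero_le) fun t => ?_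
  refine (seqLp_le_tsum q _).trans (le_of_eq ?_)
  exact tsum_eq_sum fun m hm => by simp [hc m hm]

theorem exists_mulBound_heat_sub_one (χ : Cutoff d) (hα : 0 < α) : ∃ C : ℝ, 0 ≤ C ∧
    ∀ t : ℝ, 0 ≤ t → t ≤ 1 → MulBound (fun m : Fin d → ℤ => (heatSymbol α t m : ℂ) - 1) C := by
  obtain ⟨C, hC, h⟩ := mulBound_heatSymbol χ hα
  refine ⟨C + 1, by positivity, fun t h0 h1 => ?_⟩
  have h2 := (mulBound_one (d := d)).const_mul (-1)
  have h3 := (h t h0 h1).add h2 hC (by simp)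
  simp only [norm_neg, norm_one, mul_one, ← sub_eq_add_neg] at h3
  exact h3

theorem IsFourier.congr {g g' : Torus d → ℂ} {c : Seq d} (h : IsFourier g c)
    (he : g =ᵐ[torusMeasure d] g') : IsFourier g' c :=
  ⟨h.1.congr he, fun m => by rw [← mFourierCoeff_congr_ae he]; exact h.2 m⟩

theorem exists_finite_approx {p : ℝ≥0∞} (hp : 1 ≤ p) (hpt : p ≠ ⊤) {u : Seq d} (hu : seqLp p u ≠ ⊤)
    {ε : ℝ≥0∞} (hε : ε ≠ 0) :
    ∃ (c : Seq d) (s : Finset (Fin d → ℤ)), (∀ m ∉ s, c m = 0) ∧ seqLp p (u - c) < ε := by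
  have : Fact (1 ≤ p) := ⟨hp⟩
  obtain ⟨g, hg⟩ := exists_isFourier hu
  have hgm := hg.memLp hu
  let L : (Fin d → ℤ) → Lp ℂ p (torusMeasure d) := UnitAddTorus.mFourierLp p
  have hspan : ∀ h ∈ Submodule.span ℂ (range L),
      ∃ (c : Seq d) (s : Finset (Fin d → ℤ)), (∀ m ∉ s, c m = 0) ∧ IsFourier (h : Torus d → ℂ) c := by
    classical
    intro h hh
    induction hh using Submodule.span_induction with
    | mem x hx =>
      obtain ⟨k, rfl⟩ := hx
      refine ⟨Pi.single k 1, {k}, fun m hm => Pi.single_eq_of_ne (by simpa using hm) _, ?_⟩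
      exact (isFourier_mFourier k).congr (UnitAddTorus.coeFn_mFourierLp p k).symm
    | zero =>
      exact ⟨0, ∅, fun _ _ => rfl, isFourier_zero.congr (Lp.coeFn_zero ℂ p (torusMeasure d)).symm⟩
    | add x y _ _ hx hy =>
      obtain ⟨c, s, hc, hx⟩ := hx
      obtain ⟨c', s', hc', hy⟩ := hy
      refine ⟨c + c', s ∪ s', fun m hm => ?_, ?_⟩
      · rw [Finset.mem_union, not_or] at hm
        simp [hc m hm.1, hc' m hm.2]
      · exact (hx.add hy).congr (Lp.coeFn_add x y).symm
    | smul a x _ hx =>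
      obtain ⟨c, s, hc, hx⟩ := hx
      exact ⟨a • c, s, fun m hm => by simp [hc m hm], (hx.smul a).congr (Lp.coeFn_smul a x).symm⟩
  have htop : (Submodule.span ℂ (range L)).topologicalClosure = ⊤ :=
    UnitAddTorus.span_mFourierLp_closure_eq_top hpt
  have hmem : hgm.toLp g ∈ closure (Submodule.span ℂ (range L) : Set (Lp ℂ p (torusMeasure d))) := by
    rw [← Submodule.topologicalClosure_coe, htop]; trivial
  obtain ⟨h, hh, hd⟩ := EMetric.mem_closure_iff.1 hmem ε (pos_iff_ne_zero.2 hε)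
  obtain ⟨c, s, hc, hF⟩ := hspan h hh
  refine ⟨c, s, hc, ?_⟩
  rw [(hg.sub hF).seqLp_eq]
  rw [Lp.edist_def] at hd
  refine lt_of_le_of_lt (le_of_eq (eLpNorm_congr_ae ?_)) hd
  filter_upwards [hgm.coeFn_toLp] with x hx
  simp only [Pi.sub_apply]
  rw [hx]

theorem tendsto_heat_seqLp (χ : Cutoff d) (hα : 0 < α) {p : ℝ≥0∞} (hp : 1 ≤ p) (hpt : p ≠ ⊤) {u : Seq d}
    (hu : seqLp p u ≠ ⊤) :
    Tendsto (fun t => seqLp p (fun m => ((heatSymbol α t m : ℂ) - 1) * u m)) (𝓝[>] 0) (𝓝 0) := by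
  obtain ⟨C, hC, hb⟩ := exists_mulBound_heat_sub_one χ hα
  rw [ENNReal.tendsto_nhds_zero]
  intro ε hε
  by_cases hεt : ε = ⊤
  · simp [hεt]
  have hK : ENNReal.ofReal C + 1 ≠ 0 := by simp
  have hKt : ENNReal.ofReal C + 1 ≠ ⊤ := by finiteness
  obtain ⟨c, s, hc, hlt⟩ := exists_finite_approx hp hpt hu
    (ε := ε / 2 / (ENNReal.ofReal C + 1))
    (ENNReal.div_ne_zero.2 ⟨(ENNReal.half_pos hε.ne').ne', hKt⟩)
  have h1 := (tendsto_heat_sub_one_of_finite α p hc).eventually_lt_const (ENNReal.half_pos hε.ne')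
  filter_upwards [h1, Ioo_mem_nhdsGT (zero_lt_one (α := ℝ))] with t ht ht1
  have e : (fun m => ((heatSymbol α t m : ℂ) - 1) * u m) =
      (fun m => ((heatSymbol α t m : ℂ) - 1) * (u - c) m) + fun m => ((heatSymbol α t m : ℂ) - 1) * c m := by
    funext m
    simp only [Pi.sub_apply, Pi.add_apply]; ring
  rw [e, ← ENNReal.add_halves ε]
  refine (seqLp_add hp _ _).trans (add_le_add ?_ ht.le)
  refine (hb t ht1.1.le ht1.2.le p hp _ hlt.ne_top).trans ?_
  calc ENNReal.ofReal C * seqLp p (u - c) ≤ (ENNReal.ofReal C + 1) * (ε / 2 / (ENNReal.ofReal C + 1)) := by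
        gcongr
        exact le_self_add
    _ ≤ ε / 2 := ENNReal.mul_div_le

theorem toReal_inv_inv_ofReal {y : ℝ} (hy : 0 ≤ y) : ((ENNReal.ofReal y)⁻¹⁻¹).toReal = y := by
  rw [inv_inv, ENNReal.toReal_ofReal hy]

/-- The smoothed nonlinearity in Lebesgue spaces. -/
theorem exists_bilinear_seqLp (χ : Cutoff d) (hα : 0 < α) {y w : ℝ} (hy1 : 2 * y ≤ 1) (hw : 0 ≤ w)
    (hwy : w ≤ 2 * y) : ∃ C : ℝ, 0 ≤ C ∧ ∀ τ, 0 < τ → τ ≤ 1 → ∀ f g : Seq d,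
      seqLp 2 f ≠ ⊤ → seqLp 2 g ≠ ⊤ → ∀ A B : ℝ, 0 ≤ A → seqLp (ENNReal.ofReal y)⁻¹ f ≤ ENNReal.ofReal A →
      seqLp (ENNReal.ofReal y)⁻¹ g ≤ ENNReal.ofReal B → ∀ i k j : Fin d,
      seqLp (ENNReal.ofReal w)⁻¹ (fun m => lerayDeriv i k j (freq m) * heatSymbol α τ m * conv f g m) ≤
        ENNReal.ofReal (C * τ ^ (-((1 + d * (2 * y - w)) / (2 * α))) * (A * B)) := by
  have hy : 0 ≤ y := by linarith
  have h1 : ∀ i k j : Fin d, _ := fun i k j =>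
    mulLE_heat χ hα (A := lerayDeriv i k j) (fun ξ hξ => contDiffAt_lerayDeriv i k j hξ)
    (k := 1) (lerayDeriv_smul i k j) (p := (ENNReal.ofReal (2 * y))⁻¹) (q := (ENNReal.ofReal w)⁻¹)
    (ENNReal.one_le_inv.2 (ENNReal.ofReal_le_one.2 hy1))
    (ENNReal.inv_le_inv.2 (ENNReal.ofReal_le_ofReal hwy)) (by
      rw [toReal_inv_inv_ofReal (by linarith), toReal_inv_inv_ofReal hw]
      have : (0 : ℝ) ≤ d * (2 * y - w) := mul_nonneg d.cast_nonneg (by linarith)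
      linarith)
  simp only [toReal_inv_inv_ofReal hw, toReal_inv_inv_ofReal (show 0 ≤ 2 * y by linarith)] at h1
  choose C hC h using h1
  refine ⟨∑ i, ∑ k, ∑ j, C i k j, Finset.sum_nonneg fun i _ => Finset.sum_nonneg fun k _ =>
    Finset.sum_nonneg fun j _ => hC i k j, fun τ h0 h1 f g hf hg A B hA hfA hgB i k j => ?_⟩
  have : ENNReal.HolderTriple (ENNReal.ofReal y)⁻¹ (ENNReal.ofReal y)⁻¹ (ENNReal.ofReal (2 * y))⁻¹ :=
    ⟨by rw [inv_inv, inv_inv, ← ENNReal.ofReal_add hy hy, two_mul]⟩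
  have hconv : seqLp (ENNReal.ofReal (2 * y))⁻¹ (conv f g) ≤ ENNReal.ofReal (A * B) := by
    rw [ENNReal.ofReal_mul hA]
    exact (seqLp_conv_le hf hg).trans (mul_le_mul' hfA hgB)
  refine (h i k j τ h0 h1 (conv f g) (ne_top_of_le_ne_top ENNReal.ofReal_ne_top hconv)).trans ?_
  have hle : C i k j ≤ ∑ i, ∑ k, ∑ j, C i k j :=
    calc C i k j ≤ ∑ j, C i k j := Finset.single_le_sum (fun j _ => hC i k j) (Finset.mem_univ j)
      _ ≤ ∑ k, ∑ j, C i k j := Finset.single_le_sum (f := fun k => ∑ j, C i k j)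
          (fun k _ => Finset.sum_nonneg fun j _ => hC i k j) (Finset.mem_univ k)
      _ ≤ _ := Finset.single_le_sum (f := fun i => ∑ k, ∑ j, C i k j)
          (fun i _ => Finset.sum_nonneg fun k _ => Finset.sum_nonneg fun j _ => hC i k j) (Finset.mem_univ i)
  have := hC i k j
  rw [ENNReal.ofReal_mul (q := A * B) (mul_nonneg (this.trans hle) (by positivity))]
  exact mul_le_mul' (ENNReal.ofReal_le_ofReal (mul_le_mul_of_nonneg_right hle (by positivity))) hconv

/-- Interpolation between the two norms of the solution class. -/
theorem seqLp_le_of_weighted {x y z e s A : ℝ} (hz : 0 ≤ z) (hzy : z ≤ y) (hyx : y ≤ x) (hs : 0 < s)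
    (hA : 0 ≤ A) {f : Seq d} (hN : seqLp (ENNReal.ofReal x)⁻¹ f ≤ ENNReal.ofReal A)
    (hM : ENNReal.ofReal (s ^ (e * (x - z))) * seqLp (ENNReal.ofReal z)⁻¹ f ≤ ENNReal.ofReal A) :
    seqLp (ENNReal.ofReal y)⁻¹ f ≤ ENNReal.ofReal (s ^ (-(e * (x - y))) * A) := by
  obtain ⟨l, h0, h1, hl⟩ : ∃ l : ℝ, 0 ≤ l ∧ l ≤ 1 ∧ x - y = l * (x - z) := by
    rcases (hzy.trans hyx).eq_or_lt with h | h
    · exact ⟨0, le_rfl, zero_le_one, by linarith⟩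
    · have h2 : 0 < x - z := by linarith
      exact ⟨(x - y) / (x - z), div_nonneg (by linarith) h2.le, (div_le_one h2).2 (by linarith),
        by field_simp⟩
  have hM' : seqLp (ENNReal.ofReal z)⁻¹ f ≤ ENNReal.ofReal (s ^ (-(e * (x - z))) * A) := by
    rw [ENNReal.ofReal_mul (by positivity), Real.rpow_neg hs.le, ENNReal.ofReal_inv_of_pos (by positivity),
      mul_comm, ← div_eq_mul_inv, ENNReal.le_div_iff_mul_le (by left; simp; positivity) (by left; simp),
      mul_comm]
    exact hM
  refine (seqLp_interpolation (p := (ENNReal.ofReal x)⁻¹) (r := (ENNReal.ofReal z)⁻¹)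
    (ne_top_of_le_ne_top ENNReal.ofReal_ne_top hN) h0 h1 ?_).trans ?_
  · rw [inv_inv, inv_inv, inv_inv, ← ENNReal.ofReal_mul (by linarith), ← ENNReal.ofReal_mul hz,
      ← ENNReal.ofReal_add (mul_nonneg (by linarith) (by linarith)) (mul_nonneg hz h0)]
    congr 1
    linarith
  · have e1 : s ^ (-(e * (x - y))) * A = A ^ (1 - l) * (s ^ (-(e * (x - z))) * A) ^ l := by
      rw [Real.mul_rpow (by positivity) hA, ← Real.rpow_mul hs.le, mul_left_comm]
      congr 1
      · congr 1; rw [hl]; ring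
      · rcases hA.eq_or_lt with rfl | hA
        · rcases h0.eq_or_lt with rfl | h0
          · simp
          · rw [Real.zero_rpow h0.ne', mul_zero]
        · rw [← Real.rpow_add hA]; simp
    rw [e1, ENNReal.ofReal_mul (by positivity), ← ENNReal.ofReal_rpow_of_nonneg hA (by linarith),
      ← ENNReal.ofReal_rpow_of_nonneg (by positivity) h0]
    gcongr

/-- The pair of Lebesgue norms satisfies the smoothing estimates. -/
theorem exists_seqPair_seqLp (χ : Cutoff d) (hd : 0 < d) (hα : 1 / 2 < α) {x z : ℝ} (hx : 0 < x)
    (hx1 : x < 1) (hdx : d * x < 2 * α - 1) (hz : 0 ≤ z) (hzx : z ≤ x) (hzx' : z ≤ 1 - x) :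
    ∃ a₁ γ₁ a₂ γ₂ : ℝ, SeqPair α (d / (2 * α) * (x - z)) a₁ γ₁ a₂ γ₂
      (seqLp (d := d) (ENNReal.ofReal x)⁻¹) (seqLp (d := d) (ENNReal.ofReal z)⁻¹) := by
  have hα0 : 0 < α := by linarith
  have hd0 : (0 : ℝ) < d := by exact_mod_cast hd
  have hz2 : z ≤ 1 / 2 := by linarith
  set e : ℝ := d / (2 * α) with he
  have he0 : 0 < e := by positivity
  have hp1 : 1 ≤ (ENNReal.ofReal x)⁻¹ := ENNReal.one_le_inv.2 (ENNReal.ofReal_le_one.2 hx1.le)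
  have hq1 : 1 ≤ (ENNReal.ofReal z)⁻¹ := ENNReal.one_le_inv.2 (ENNReal.ofReal_le_one.2 (by linarith))
  have hq2 : 2 ≤ (ENNReal.ofReal z)⁻¹ := by
    rw [ENNReal.le_inv_iff_le_inv, ← ENNReal.ofReal_ofNat 2, ← ENNReal.ofReal_inv_of_pos two_pos]
    exact ENNReal.ofReal_le_ofReal (by linarith)
  obtain ⟨y₁, hzy₁, hy₁x, hy₁2, hy₁⟩ : ∃ y, z ≤ y ∧ y ≤ x ∧ 2 * y ≤ 1 ∧ x ≤ 2 * y := by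
    refine ⟨min x (1 / 2), le_min hzx hz2, min_le_left _ _, ?_, ?_⟩
    · linarith [min_le_right x (1 / 2 : ℝ)]
    · rcases min_choice x (1 / 2 : ℝ) with h | h <;> rw [h] <;> linarith
  obtain ⟨y₂, hzy₂, hy₂x, hy₂2, hy₂U, hy₂L⟩ : ∃ y, z ≤ y ∧ y ≤ x ∧ 2 * y ≤ 1 ∧
      d * (2 * y - z) < 2 * α - 1 ∧ d * (x - y) < α := by
    set U := z / 2 + (2 * α - 1) / (2 * d) with hU
    set L := max z (x - α / d) with hL
    have hdiv : x < (2 * α - 1) / d := by rw [lt_div_iff₀ hd0]; linarith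
    have e1 : (2 * α - 1) / (2 * d) = (2 * α - 1) / d / 2 := by field_simp
    have e2 : α / d = (2 * α - 1) / d / 2 + 1 / (2 * d) := by field_simp; ring
    have h3 : 0 < 1 / (2 * (d : ℝ)) := by positivity
    have hLU : L < U := by
      rw [hU, hL, e1, e2, max_lt_iff]; constructor <;> linarith
    have hLx : L ≤ x := max_le hzx (by linarith)
    have hL2 : L ≤ 1 / 2 := max_le hz2 (by linarith)
    refine ⟨min (min x (1 / 2)) ((U + L) / 2), ?_, ?_, ?_, ?_, ?_⟩
    · exact (le_max_left _ _).trans (le_min (le_min hLx hL2) (by linarith))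
    · exact (min_le_left _ _).trans (min_le_left _ _)
    · linarith [(min_le_left (min x (1 / 2)) ((U + L) / 2)).trans (min_le_right _ _)]
    · have h4 : min (min x (1 / 2)) ((U + L) / 2) < U := lt_of_le_of_lt (min_le_right _ _) (by linarith)
      have h5 : d * (2 * (min (min x (1 / 2)) ((U + L) / 2)) - z) < d * (2 * U - z) := by gcongr
      refine h5.trans_eq ?_
      rw [hU]; field_simp; ring
    · have h4 : L < (U + L) / 2 := by linarith
      have h5 : x - α / d ≤ L := le_max_right _ _
      have h6 : x - α / d < min (min x (1 / 2)) ((U + L) / 2) := by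
        refine lt_min (lt_min ?_ ?_) (by linarith)
        · have : 0 < α / d := by positivity
          linarith
        · linarith
      have h7 : x - min (min x (1 / 2)) ((U + L) / 2) < α / d := by linarith
      calc _ < d * (α / d) := by gcongr
        _ = α := by field_simp
  have hσ : 0 ≤ e * (x - z) := mul_nonneg he0.le (by linarith)
  have hsq : ∀ s A : ℝ, 0 < s → ∀ f : Seq d, ENNReal.ofReal (s ^ (e * (x - z))) *
      seqLp (ENNReal.ofReal z)⁻¹ f ≤ ENNReal.ofReal A → seqLp 2 f ≠ ⊤ := fun s A hs f hf h => by
    have h1 : seqLp (ENNReal.ofReal z)⁻¹ f = ⊤ := top_le_iff.1 (h ▸ seqLp_mono hq2 f)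
    rw [h1, ENNReal.mul_top (by simp; positivity)] at hf
    exact absurd (top_le_iff.1 hf) ENNReal.ofReal_ne_top
  obtain ⟨C₁, hC₁, hb₁⟩ := exists_bilinear_seqLp (d := d) χ hα0 hy₁2 hx.le hy₁
  obtain ⟨C₂, hC₂, hb₂⟩ := exists_bilinear_seqLp (d := d) χ hα0 hy₂2 hz (by linarith : z ≤ 2 * y₂)
  have hexp : ∀ {y w : ℝ}, (1 + d * (2 * y - w)) / (2 * α) + 2 * (e * (x - y)) =
      (1 + d * (2 * x - w)) / (2 * α) := fun {y w} => by rw [he]; field_simp; ring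
  have hgain : ∀ {y : ℝ}, y ≤ x → 0 ≤ 2 * (e * (x - y)) := fun hy =>
    mul_nonneg two_pos.le (mul_nonneg he0.le (by linarith))
  refine ⟨(1 + d * (2 * y₁ - x)) / (2 * α), 2 * (e * (x - y₁)), (1 + d * (2 * y₂ - z)) / (2 * α),
    2 * (e * (x - y₂)), ?_⟩
  have hpos : ∀ {y w : ℝ}, w ≤ 2 * y → 0 ≤ (1 + d * (2 * y - w)) / (2 * α) := fun hy => by
    have := mul_nonneg hd0.le (sub_nonneg.2 hy)
    positivity
  refine
    { α_pos := hα0, σ_nonneg := hσ, a₁_nonneg := hpos hy₁, γ₁_nonneg := hgain hy₁x,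
      lt_one := ?_, a₂_nonneg := hpos (by linarith), a₂_lt := ?_, γ₂_nonneg := hgain hy₂x, γ₂_lt := ?_,
      lt_add := ?_, normN := seqNorm_seqLp hp1, normM := seqNorm_seqLp hq1,
      heat_tendsto := fun u hu => tendsto_heat_seqLp χ hα0 hp1 (by simpa using hx) hu,
      heat_M := ?_, sq := fun u hu => summable_sq_of_seqLp (ne_top_of_le_ne_top hu (seqLp_mono hq2 u)),
      bilinear := ⟨C₁ + C₂, by positivity, fun s τ hs hs1 hτ hτ1 f g A B hA hB hfN hfM hgN hgM i k j => ?_⟩ }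
  · rw [hexp, div_lt_one (by positivity)]; linarith
  · rw [div_lt_one (by positivity)]; linarith
  · rw [he]
    have : 2 * (d / (2 * α) * (x - y₂)) = d * (x - y₂) / α := by field_simp
    rw [this, div_lt_one hα0]
    exact hy₂L
  · rw [hexp, ← sub_pos, he]
    have : 1 + d / (2 * α) * (x - z) - (1 + d * (2 * x - z)) / (2 * α) = (2 * α - 1 - d * x) / (2 * α) := by
      field_simp; ring
    rw [this]
    exact div_pos (by linarith) (by positivity)
  · rcases hzx.eq_or_lt with rfl | hlt
    · obtain ⟨C, hC, h⟩ := mulBound_heatSymbol χ hα0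
      refine ⟨C, hC, fun t h0 h1 u hu => ?_⟩
      rw [sub_self, mul_zero, Real.rpow_zero, ENNReal.ofReal_one, one_mul]
      exact h t h0.le h1 _ hp1 u hu
    · obtain ⟨C, hC, h⟩ := mulLE_heat χ hα0 (A := fun _ => 1) (fun _ _ => contDiffAt_const) (k := 0)
        (fun N hN ξ => by simp) hp1 (ENNReal.inv_le_inv.2 (ENNReal.ofReal_le_ofReal hzx)) (by
          rw [toReal_inv_inv_ofReal hx.le, toReal_inv_inv_ofReal hz, zero_add]
          exact mul_pos hd0 (by linarith))
      rw [toReal_inv_inv_ofReal hx.le, toReal_inv_inv_ofReal hz] at h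
      refine ⟨C, hC, fun t h0 h1 u hu => ?_⟩
      have h2 := h t h0 h1 u hu
      simp only [one_mul] at h2
      refine (mul_le_mul_right h2 _).trans (le_of_eq ?_)
      rw [← mul_assoc, ← ENNReal.ofReal_mul (by positivity), mul_left_comm, ← Real.rpow_add h0]
      have : e * (x - z) + -((0 + d * (x - z)) / (2 * α)) = 0 := by rw [he]; field_simp; ring
      rw [this, Real.rpow_zero, mul_one]
  · have hf2 := hsq s A hs f hfM
    have hg2 := hsq s B hs g hgM
    have key : ∀ {C y w : ℝ}, 0 ≤ C → C ≤ C₁ + C₂ →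
        C * τ ^ (-((1 + d * (2 * y - w)) / (2 * α))) *
          ((s ^ (-(e * (x - y))) * A) * (s ^ (-(e * (x - y))) * B)) ≤ (C₁ + C₂) * A * B *
          (τ ^ (-((1 + d * (2 * y - w)) / (2 * α))) * s ^ (-(2 * (e * (x - y))))) := by
      intro C y w _ hC'
      have : s ^ (-(2 * (e * (x - y)))) = s ^ (-(e * (x - y))) * s ^ (-(e * (x - y))) := by
        rw [← Real.rpow_add hs]; congr 1; ring
      rw [this]
      calc _ = C * (A * B * (τ ^ (-((1 + d * (2 * y - w)) / (2 * α))) *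
            (s ^ (-(e * (x - y))) * s ^ (-(e * (x - y)))))) := by ring
        _ ≤ (C₁ + C₂) * (A * B * (τ ^ (-((1 + d * (2 * y - w)) / (2 * α))) *
            (s ^ (-(e * (x - y))) * s ^ (-(e * (x - y)))))) := by gcongr
        _ = _ := by ring
    constructor
    · refine (hb₁ τ hτ hτ1 f g hf2 hg2 _ _ (by positivity)
        (seqLp_le_of_weighted (e := e) hz hzy₁ hy₁x hs hA hfN hfM)
        (seqLp_le_of_weighted (e := e) hz hzy₁ hy₁x hs hB hgN hgM) i k j).trans
        (ENNReal.ofReal_le_ofReal (key hC₁ (by linarith)))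
    · refine (hb₂ τ hτ hτ1 f g hf2 hg2 _ _ (by positivity)
        (seqLp_le_of_weighted (e := e) hz hzy₂ hy₂x hs hA hfN hfM)
        (seqLp_le_of_weighted (e := e) hz hzy₂ hy₂x hs hB hgN hgM) i k j).trans
        (ENNReal.ofReal_le_ofReal (key hC₂ (by linarith)))

theorem locallyWellPosed_lp (hd : 0 < d) (χ : Cutoff d) (hα : 1 / 2 < α) {p : ℝ}
    (hp : max (d / (2 * α - 1)) 1 < p) {ρ : ℝ≥0∞} (hpρ : ENNReal.ofReal p ≤ ρ)
    (hpρ' : ENNReal.ofReal (p / (p - 1)) ≤ ρ) :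
    LocallyWellPosed χ α (vecLpNorm (ENNReal.ofReal p)) (vecLpNorm ρ)
      (d / (2 * α) * (1 / p - (ρ⁻¹).toReal)) := by
  have hp1 : 1 < p := lt_of_le_of_lt (le_max_right _ _) hp
  have hp0 : 0 < p := by linarith
  have hdp : d / (2 * α - 1) < p := lt_of_le_of_lt (le_max_left _ _) hp
  have hinv : ∀ {y : ℝ}, 0 < y → ENNReal.ofReal y ≤ ρ → (ρ⁻¹).toReal ≤ 1 / y := fun {y} hy h => by
    have h1 : ρ⁻¹ ≤ ENNReal.ofReal (1 / y) := by
      rw [one_div, ENNReal.ofReal_inv_of_pos hy]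
      exact ENNReal.inv_le_inv.2 h
    exact ENNReal.toReal_le_of_le_ofReal (by positivity) h1
  have hρ0 : ρ⁻¹ ≠ ⊤ := ENNReal.inv_ne_top.2 (lt_of_lt_of_le (by simpa using hp0) hpρ).ne'
  have h2 : (ρ⁻¹).toReal ≤ 1 - 1 / p := by
    have h3 := hinv (y := p / (p - 1)) (div_pos hp0 (by linarith)) hpρ'
    have h4 : 1 / (p / (p - 1)) = 1 - 1 / p := by field_simp
    linarith
  obtain ⟨a₁, γ₁, a₂, γ₂, h⟩ := exists_seqPair_seqLp (d := d) χ hd hα (x := 1 / p) (z := (ρ⁻¹).toReal)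
    (by positivity) (by rw [div_lt_one hp0]; exact hp1) (by
      rw [div_lt_iff₀ (by linarith)] at hdp
      rw [mul_one_div, div_lt_iff₀ hp0]; linarith) ENNReal.toReal_nonneg (hinv hp0 hpρ) h2
  have h3 := (h.vecPair χ).locallyWellPosed χ
  rw [ENNReal.ofReal_toReal hρ0, inv_inv, one_div, ENNReal.ofReal_inv_of_pos hp0, inv_inv, ← one_div] at h3
  have e : ∀ q : ℝ≥0∞, (fun u : VecDist d => vecNorm (seqLp q) (coeffs u)) = vecLpNorm q := fun q => by
    funext u
    simp only [vecLpNorm, lpNorm_eq]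
    rfl
  rw [e, e] at h3
  exact h3

end FracNS
end



noncomputable section

namespace FracNS

variable {d : ℕ} {α : ℝ}

/-! ### Besov spaces -/

/-- The Littlewood–Paley blocks of a family of Fourier coefficients. -/
def block (χ : Cutoff d) (a : ℕ) (c : Seq d) : Seq d := fun m => χ.symbol a m * c m

/-- The dyadic weight `2^{as}`. -/
def dyadic (s : ℝ) (a : ℕ) : ℝ≥0∞ := ENNReal.ofReal (((2 : ℝ) ^ a) ^ s)

/-- The `ℓ^r` norm. -/
def ellNorm (r : ℝ) (X : ℕ → ℝ≥0∞) : ℝ≥0∞ := (∑' a, X a ^ r) ^ (1 / r)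

theorem dyadic_add (s t : ℝ) (a : ℕ) : dyadic (s + t) a = dyadic s a * dyadic t a := by
  rw [dyadic, Real.rpow_add (by positivity), ENNReal.ofReal_mul (by positivity), dyadic, dyadic]

theorem dyadic_mono {s t : ℝ} (h : s ≤ t) (a : ℕ) : dyadic s a ≤ dyadic t a :=
  ENNReal.ofReal_le_ofReal (Real.rpow_le_rpow_of_exponent_le (one_le_pow₀ one_le_two) h)

theorem le_dyadic_mul {s : ℝ} {a : ℕ} {x y : ℝ≥0∞} (h : dyadic s a * x ≤ y) : x ≤ dyadic (-s) a * y := by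
  have e : dyadic (-s) a * dyadic s a = 1 := by
    rw [← dyadic_add, neg_add_cancel, dyadic, Real.rpow_zero, ENNReal.ofReal_one]
  calc x = dyadic (-s) a * (dyadic s a * x) := by rw [← mul_assoc, e, one_mul]
    _ ≤ _ := mul_le_mul_right h _

section ellNorm

variable {r : ℝ} {X Y : ℕ → ℝ≥0∞}

theorem ellNorm_mono (hr : 1 ≤ r) (h : ∀ a, X a ≤ Y a) : ellNorm r X ≤ ellNorm r Y := by
  unfold ellNorm
  gcongr with a
  exact h a

theorem ellNorm_eq_lintegral (r : ℝ) (X : ℕ → ℝ≥0∞) :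
    ellNorm r X = (∫⁻ a, X a ^ r ∂Measure.count) ^ (1 / r) := by
  rw [ellNorm, lintegral_count]

theorem ellNorm_add (hr : 1 ≤ r) (X Y : ℕ → ℝ≥0∞) :
    ellNorm r (fun a => X a + Y a) ≤ ellNorm r X + ellNorm r Y := by
  simp only [ellNorm_eq_lintegral]
  exact ENNReal.lintegral_Lp_add_le (Measurable.of_discrete).aemeasurable
    (Measurable.of_discrete).aemeasurable hr

theorem ellNorm_const_mul (hr : 1 ≤ r) (C : ℝ≥0∞) (X : ℕ → ℝ≥0∞) :
    ellNorm r (fun a => C * X a) = C * ellNorm r X := by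
  have hr0 : 0 < r := by linarith
  unfold ellNorm
  simp only [ENNReal.mul_rpow_of_nonneg _ _ hr0.le]
  rw [ENNReal.tsum_mul_left, ENNReal.mul_rpow_of_nonneg _ _ (by positivity), ← ENNReal.rpow_mul,
    mul_one_div_cancel hr0.ne', ENNReal.rpow_one]

theorem le_ellNorm (hr : 1 ≤ r) (X : ℕ → ℝ≥0∞) (a : ℕ) : X a ≤ ellNorm r X := by
  rw [ellNorm, one_div, ENNReal.le_rpow_inv_iff (by linarith)]
  exact ENNReal.le_tsum a

theorem ellNorm_le_of_tendsto (hr : 1 ≤ r) {Z : ℕ → ℕ → ℝ≥0∞} {B : ℝ≥0∞}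
    (h : ∀ a, Tendsto (fun k => Z k a) atTop (𝓝 (X a))) (hB : ∀ᶠ k in atTop, ellNorm r (Z k) ≤ B) :
    ellNorm r X ≤ B := by
  have hr0 : 0 < r := by linarith
  rw [ellNorm, one_div, ENNReal.rpow_inv_le_iff hr0, ENNReal.tsum_eq_iSup_sum]
  refine iSup_le fun s => le_of_tendsto (tendsto_finsetSum s fun a _ =>
    (ENNReal.continuous_rpow_const.tendsto _).comp (h a)) ?_
  filter_upwards [hB] with k hk
  rw [ellNorm, one_div, ENNReal.rpow_inv_le_iff hr0] at hk
  exact (ENNReal.sum_le_tsum s).trans hk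

end ellNorm

section Blocks

variable (χ : Cutoff d) (q : ℝ≥0∞)

theorem block_ne_top (a : ℕ) (c : Seq d) : seqLp q (block χ a c) ≠ ⊤ := by
  refine ne_top_of_le_ne_top ?_ (seqLp_le_tsum q _)
  simpa only [block, ofReal_norm] using (summable_symbol_mul χ a c).tsum_ofReal_lt_top.ne

theorem block_add (a : ℕ) (c c' : Seq d) : block χ a (c + c') = block χ a c + block χ a c' := by
  funext m
  simp [block, mul_add]

theorem block_mul (a : ℕ) (b c : Seq d) :
    block χ a (fun m => b m * c m) = fun m => b m * block χ a c m := by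
  funext m
  simp only [block]; ring

theorem block_eq_zero {a : ℕ} {m : Fin d → ℤ} (c : Seq d)
    (hm : m ∉ (finite_norm_freq_le (d := d) (2 * 2 ^ a)).toFinset) : block χ a c m = 0 := by
  have : χ.symbol a m = 0 := by
    by_contra h
    exact hm (by simpa using χ.norm_freq_le_of_symbol_ne_zero h)
  simp [block, this]

theorem fat_mul_block (a : ℕ) (c : Seq d) :
    (fun m => (blockSymbol χ.fatAnnulus a m : ℂ) * block χ a c m) = block χ a c := by
  funext m
  rw [block, ← mul_assoc, ← Complex.ofReal_mul, χ.fat_mul_symbol]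

theorem hasSum_block (c : Seq d) (m : Fin d → ℤ) : HasSum (fun a => block χ a c m) (c m) := by
  simpa [block] using (χ.hasSum_symbol m).mul_right (c m)

theorem continuous_seqLp_block {q : ℝ≥0∞} (hq : 1 ≤ q) (a : ℕ) :
    Continuous fun c : Seq d => seqLp q (block χ a c) := by
  set s := (finite_norm_freq_le (d := d) (2 * 2 ^ a)).toFinset with hs
  have hle : ∀ c c' : Seq d, seqLp q (block χ a c) ≤
      seqLp q (block χ a c') + ∑ m ∈ s, ‖(χ.symbol a m : ℂ) * (c m - c' m)‖ₑ := fun c c' => by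
    have e : block χ a c = block χ a c' + block χ a (c - c') := by rw [← block_add]; congr 1; abel
    rw [e]
    refine (seqLp_add hq _ _).trans (add_le_add le_rfl ((seqLp_le_tsum q _).trans (le_of_eq ?_)))
    exact tsum_eq_sum fun m hm => by rw [block_eq_zero χ _ hm, enorm_zero]
  rw [continuous_iff_continuousAt]
  intro c
  refine (ENNReal.tendsto_nhds (block_ne_top χ q a c)).2 fun ε hε => ?_
  have h0 : Tendsto (fun c' : Seq d => ∑ m ∈ s, ‖(χ.symbol a m : ℂ) * (c' m - c m)‖ₑ) (𝓝 c) (𝓝 0) := by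
    have : Continuous fun c' : Seq d => ∑ m ∈ s, ‖(χ.symbol a m : ℂ) * (c' m - c m)‖ₑ :=
      continuous_finsetSum _ fun m _ => Continuous.enorm (by fun_prop)
    simpa using this.tendsto c
  filter_upwards [h0.eventually_le_const hε] with c' hc'
  refine ⟨tsub_le_iff_right.2 ((hle c c').trans (add_le_add le_rfl ?_)),
    (hle c' c).trans (add_le_add le_rfl hc')⟩
  refine le_trans (le_of_eq (Finset.sum_congr rfl fun m _ => ?_)) hc'
  rw [enorm_mul, enorm_mul, enorm_sub_rev]

theorem seqBesov_eq {r : ℝ} (hr : 1 ≤ r) (s : ℝ) (c : Seq d) :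
    seqBesov χ s q r c = ellNorm r fun a => dyadic s a * seqLp q (block χ a c) := by
  have hr0 : 0 ≤ r := by linarith
  unfold seqBesov ellNorm
  congr 1
  refine tsum_congr fun a => ?_
  rw [ENNReal.mul_rpow_of_nonneg _ _ hr0, dyadic, ENNReal.ofReal_rpow_of_nonneg (by positivity) hr0,
    ← Real.rpow_mul (by positivity)]
  rfl

variable {χ q} {r : ℝ}

theorem seqBesov_mono {s t : ℝ} (hr : 1 ≤ r) (h : s ≤ t) (c : Seq d) :
    seqBesov χ s q r c ≤ seqBesov χ t q r c := by
  rw [seqBesov_eq χ q hr, seqBesov_eq χ q hr]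
  exact ellNorm_mono hr fun a => mul_le_mul_left (dyadic_mono h a) _

theorem seqLp_block_le {s : ℝ} (hr : 1 ≤ r) (c : Seq d) (a : ℕ) :
    seqLp q (block χ a c) ≤ dyadic (-s) a * seqBesov χ s q r c := by
  refine le_dyadic_mul ?_
  rw [seqBesov_eq χ q hr]
  exact le_ellNorm hr (fun a => dyadic s a * seqLp q (block χ a c)) a

theorem enorm_le_seqBesov (hq : 1 ≤ q) (hr : 1 ≤ r) (s : ℝ) (u : Seq d) (m : Fin d → ℤ) :
    ‖u m‖ₑ ≤ ENNReal.ofReal (2 * 3 ^ (⌈|s|⌉₊ + 1) * wt m ^ (⌈|s|⌉₊ + 1)) * seqBesov χ s q r u := by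
  set k := ⌈|s|⌉₊ with hk
  have hw := wt_pos m
  have h1 : ∀ a, ‖block χ a u m‖ₑ ≤
      ENNReal.ofReal ((3 * wt m) ^ (k + 1)) * seqBesov χ s q r u * 2⁻¹ ^ a := fun a => by
    by_cases h0 : χ.symbol a m = 0
    · simp [block, h0]
    refine (enorm_le_seqLp hq _ _).trans ((seqLp_block_le (s := s) hr u a).trans ?_)
    rw [mul_right_comm]
    refine mul_le_mul_left ?_ _
    have h2 : (2 : ℝ) ^ a ≤ 3 * wt m := by
      cases a with
      | zero => linarith [one_le_wt m]
      | succ a =>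
        have := χ.le_norm_freq_of_symbol_ne_zero h0
        unfold wt
        linarith [norm_nonneg (freq m)]
    have h3 : (2⁻¹ : ℝ≥0∞) ^ a = ENNReal.ofReal ((2 ^ a : ℝ)⁻¹) := by
      rw [ENNReal.ofReal_inv_of_pos (by positivity), ENNReal.ofReal_pow two_pos.le, ENNReal.inv_pow]
      simp
    rw [h3, ← ENNReal.ofReal_mul (by positivity), dyadic]
    refine ENNReal.ofReal_le_ofReal ?_
    calc ((2 : ℝ) ^ a) ^ (-s) ≤ (2 ^ a) ^ (k : ℝ) := by
          refine Real.rpow_le_rpow_of_exponent_le (one_le_pow₀ one_le_two) ?_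
          exact (neg_le_abs s).trans (Nat.le_ceil _)
      _ = (2 ^ a) ^ (k + 1) * (2 ^ a)⁻¹ := by
          rw [Real.rpow_natCast, pow_succ (2 ^ a : ℝ) k, mul_inv_cancel_right₀ (by positivity)]
      _ ≤ _ := by gcongr
  calc ‖u m‖ₑ = ‖∑' a, block χ a u m‖ₑ := by rw [(hasSum_block χ u m).tsum_eq]
    _ ≤ ∑' a, ‖block χ a u m‖ₑ := enorm_tsum_le_tsum_enorm
    _ ≤ ∑' a : ℕ, ENNReal.ofReal ((3 * wt m) ^ (k + 1)) * seqBesov χ s q r u * 2⁻¹ ^ a :=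
        ENNReal.tsum_le_tsum h1
    _ = _ := by
        rw [ENNReal.tsum_mul_left, ENNReal.tsum_geometric, ENNReal.one_sub_inv_two, inv_inv,
          mul_right_comm, mul_assoc 2, ← mul_pow, mul_comm (2 : ℝ), ENNReal.ofReal_mul (by positivity)]
        simp

theorem seqNorm_seqBesov (χ : Cutoff d) (hq : 1 ≤ q) (hr : 1 ≤ r) (s : ℝ) :
    SeqNorm (seqBesov χ s q r) where
  add u v := by
    simp only [seqBesov_eq χ q hr]
    refine (ellNorm_mono hr fun a => ?_).trans (ellNorm_add hr _ _)
    rw [← mul_add, block_add]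
    exact mul_le_mul_right (seqLp_add hq _ _) _
  smul z u := by
    simp only [seqBesov_eq χ q hr]
    rw [← ellNorm_const_mul hr]
    refine ellNorm_mono hr fun a => ?_
    rw [mul_left_comm]
    refine mul_le_mul_right ((le_of_eq ?_).trans (seqLp_smul q z _)) _
    congr 1
    exact block_mul χ a (fun _ => z) u
  coeff := ⟨_, _, by positivity, enorm_le_seqBesov hq hr s⟩
  complete u l B _ hu hl n := by
    simp only [seqBesov_eq χ q hr] at hu ⊢
    refine ellNorm_le_of_tendsto hr
      (Z := fun k a => dyadic s a * seqLp q (block χ a (u n - u k))) (fun a => ?_)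
      (eventually_atTop.2 ⟨n, fun k hk => hu n k hk⟩)
    refine ENNReal.Tendsto.const_mul (((continuous_seqLp_block χ hq a).tendsto _).comp ?_)
      (Or.inr ENNReal.ofReal_ne_top)
    exact tendsto_const_nhds.sub (tendsto_pi_nhds.2 hl)
  integral I f w hm _ hw hle := by
    have hmeas : ∀ a, AEMeasurable (fun t => seqLp q (block χ a (f t))) (volume.restrict I) := fun a =>
      (continuous_seqLp_block χ hq a).measurable.comp_aemeasurable
        (aemeasurable_pi_lambda _ fun m => (hm m).aemeasurable)
    have hae : ∀ᵐ t ∂(volume.restrict I), ∀ a, seqLp q (block χ a (f t)) = (hmeas a).mk _ t :=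
      ae_all_iff.2 fun a => (hmeas a).ae_eq_mk
    have h1 := lintegral_minkowski (ν := volume.restrict I) (μ := Measure.count) hr
      (h := fun t a => dyadic s a * (hmeas a).mk _ t)
      (measurable_from_prod_countable_left fun a =>
        (hmeas a).measurable_mk.const_mul (dyadic s a)).aemeasurable hw (by
      filter_upwards [hle, hae] with t ht ht'
      rw [seqBesov_eq χ q hr, ellNorm_eq_lintegral] at ht
      simpa only [← ht'] using ht)
    refine le_trans ?_ h1
    rw [seqBesov_eq χ q hr, ← ellNorm_eq_lintegral]
    refine ellNorm_mono hr fun a => ?_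
    rw [lintegral_const_mul _ (hmeas a).measurable_mk]
    refine mul_le_mul_right ?_ _
    have e : block χ a (fun m => ∫ t in I, f t m) = fun m => ∫ t in I, block χ a (f t) m := by
      funext m
      simp only [block, integral_const_mul]
    rw [e]
    refine seqLp_integral hq (fun m => (hm m).const_mul _)
      (.of_forall fun t => summable_symbol_mul χ a (f t)) (hmeas a).measurable_mk ?_
    filter_upwards [hae] with t ht
    exact (ht a).le
  mul c C _ hc u _ := by
    simp only [seqBesov_eq χ q hr]
    rw [← ellNorm_const_mul hr]
    refine ellNorm_mono hr fun a => ?_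
    rw [mul_left_comm, block_mul]
    exact mul_le_mul_right (hc q hq _ (block_ne_top χ q a u)) _

theorem tendsto_heat_seqBesov (χ : Cutoff d) (hα : 0 < α) (hq : 1 ≤ q) (hr : 1 ≤ r) {s : ℝ} {u : Seq d}
    (hu : seqBesov χ s q r u ≠ ⊤) :
    Tendsto (fun t => seqBesov χ s q r (fun m => ((heatSymbol α t m : ℂ) - 1) * u m)) (𝓝[>] 0)
      (𝓝 0) := by
  have hr0 : 0 < r := by linarith
  obtain ⟨C, hC, h⟩ := exists_mulBound_heat_sub_one χ hα
  simp only [seqBesov_eq χ q hr, ellNorm_eq_lintegral, block_mul] at hu ⊢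
  have h0 : Tendsto (fun t => ∫⁻ a, (dyadic s a * seqLp q (fun m => ((heatSymbol α t m : ℂ) - 1) *
      block χ a u m)) ^ r ∂Measure.count) (𝓝[>] 0) (𝓝 (∫⁻ _ : ℕ, 0 ∂Measure.count)) := by
    refine tendsto_lintegral_filter_of_dominated_convergence
      (fun a => (ENNReal.ofReal C * (dyadic s a * seqLp q (block χ a u))) ^ r)
      (.of_forall fun t => Measurable.of_discrete) ?_ ?_ (.of_forall fun a => ?_)
    · filter_upwards [Ioo_mem_nhdsGT (zero_lt_one (α := ℝ))] with t ht
      refine .of_forall fun a => ?_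
      rw [mul_left_comm]
      gcongr
      exact h t ht.1.le ht.2.le q hq _ (block_ne_top χ q a u)
    · simp only [ENNReal.mul_rpow_of_nonneg (ENNReal.ofReal C) _ hr0.le]
      rw [lintegral_const_mul _ Measurable.of_discrete]
      refine ENNReal.mul_ne_top (by finiteness) fun htop => hu ?_
      rw [htop, ENNReal.top_rpow_of_pos (by positivity)]
    · have h1 := tendsto_heat_sub_one_of_finite α q fun m hm => block_eq_zero χ (a := a) u hm
      have h2 := (ENNReal.Tendsto.const_mul h1 (Or.inr (ENNReal.ofReal_ne_top
        (r := ((2 : ℝ) ^ a) ^ s))))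
      rw [mul_zero] at h2
      have h3 := (ENNReal.continuous_rpow_const (y := r)).tendsto 0 |>.comp h2
      rwa [ENNReal.zero_rpow_of_pos hr0] at h3
  rw [lintegral_zero] at h0
  have h4 := (ENNReal.continuous_rpow_const (y := 1 / r)).tendsto 0 |>.comp h0
  rwa [ENNReal.zero_rpow_of_pos (by positivity)] at h4

end Blocks

end FracNS
end



noncomputable section

namespace FracNS

variable {d : ℕ} {α : ℝ} {q : ℝ≥0∞} {r : ℝ}

theorem exists_mulBound_fat (χ : Cutoff d) : ∃ C : ℝ, 0 ≤ C ∧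
    ∀ a : ℕ, MulBound (fun m => (blockSymbol χ.fatAnnulus a m : ℂ)) C := by
  obtain ⟨C, hC, h⟩ := χ.isAnnularBump_fatAnnulus.mulBound_block one_pos (A := fun _ => 1)
    (fun _ _ => contDiffAt_const) (k := 0) (by simp) 1
  refine ⟨C, hC, fun a => ?_⟩
  simpa [heatSymbol_zero] using h a 0 le_rfl zero_le_one

theorem tsum_ofReal_dyadic_le {C x z D s : ℝ} (hC : 0 ≤ C)
    (h : Summable (fun a : ℕ => ((2 : ℝ) ^ a) ^ x * (1 + (s * 2 ^ a) ^ z)⁻¹) ∧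
      ∑' a : ℕ, ((2 : ℝ) ^ a) ^ x * (1 + (s * 2 ^ a) ^ z)⁻¹ ≤ D * s ^ (-x)) (hs : 0 < s) :
    ∑' a : ℕ, ENNReal.ofReal (C * (((2 : ℝ) ^ a) ^ x * (1 + (s * 2 ^ a) ^ z)⁻¹)) ≤
      ENNReal.ofReal (C * (D * s ^ (-x))) := by
  rw [← ENNReal.ofReal_tsum_of_nonneg (fun a => by positivity) (h.1.mul_left C), tsum_mul_left]
  exact ENNReal.ofReal_le_ofReal (mul_le_mul_of_nonneg_left h.2 hC)

/-- The blocks of a function with bounds at time `s` for both norms of the solution class. -/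
theorem seqLp_block_le_of_weighted {χ : Cutoff d} (hα : 0 < α) (hr : 1 ≤ r) {θ β s A : ℝ} (hs : 0 < s)
    (hA : 0 ≤ A) {f : Seq d} (hN : seqBesov χ (-θ) q r f ≤ ENNReal.ofReal A)
    (hM : ENNReal.ofReal (s ^ (β / α)) * seqBesov χ (-θ + 2 * β) q r f ≤ ENNReal.ofReal A) (a : ℕ) :
    seqLp q (block χ a f) ≤
      ENNReal.ofReal (2 * A * (((2 : ℝ) ^ a) ^ θ * (1 + (s ^ (1 / (2 * α)) * 2 ^ a) ^ (2 * β))⁻¹)) := by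
  set X := seqLp q (block χ a f) with hX
  have hXt : X ≠ ⊤ := block_ne_top χ q a f
  have h1 : X ≤ dyadic θ a * ENNReal.ofReal A := by
    have := seqLp_block_le (q := q) (χ := χ) (s := -θ) hr f a
    rw [neg_neg] at this
    exact this.trans (mul_le_mul_right hN _)
  have h2 : ENNReal.ofReal (s ^ (β / α)) * X ≤ dyadic (θ - 2 * β) a * ENNReal.ofReal A := by
    have := seqLp_block_le (q := q) (χ := χ) (s := -θ + 2 * β) hr f a
    rw [show -(-θ + 2 * β) = θ - 2 * β by ring] at this
    refine (mul_le_mul_right this _).trans ?_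
    rw [mul_left_comm]
    exact mul_le_mul_right hM _
  rw [← ENNReal.ofReal_toReal hXt, dyadic, ← ENNReal.ofReal_mul (by positivity)] at h1 h2
  rw [← ENNReal.ofReal_mul (by positivity)] at h2
  rw [ENNReal.ofReal_le_ofReal_iff (by positivity)] at h1 h2
  rw [← ENNReal.ofReal_toReal hXt]
  refine ENNReal.ofReal_le_ofReal ?_
  set Y := X.toReal
  have hN0 : (0 : ℝ) < (2 ^ a) ^ (2 * β) := by positivity
  have e : (s ^ (1 / (2 * α)) * 2 ^ a) ^ (2 * β) = s ^ (β / α) * (2 ^ a) ^ (2 * β) := by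
    rw [Real.mul_rpow (by positivity) (by positivity), ← Real.rpow_mul hs.le]
    congr 2
    field_simp
  rw [e, ← mul_assoc, ← div_eq_mul_inv, le_div_iff₀ (by positivity)]
  have h3 : s ^ (β / α) * Y * (2 ^ a) ^ (2 * β) ≤ (2 ^ a) ^ θ * A := by
    refine (mul_le_mul_of_nonneg_right h2 hN0.le).trans_eq ?_
    rw [mul_right_comm, ← Real.rpow_add (by positivity), sub_add_cancel]
  linarith

theorem exists_seqLp_le_of_besov (χ : Cutoff d) (hα : 0 < α) (hq : 1 ≤ q) (hr : 1 ≤ r) {θ β : ℝ}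
    (hθ : 0 < θ) {p : ℝ≥0∞} (hqp : q ≤ p) (hx : θ + d * ((q⁻¹).toReal - (p⁻¹).toReal) < 2 * β) :
    ∃ C : ℝ, 0 ≤ C ∧ ∀ (s A : ℝ) (f : Seq d), 0 < s → 0 ≤ A → seqBesov χ (-θ) q r f ≤ ENNReal.ofReal A →
      ENNReal.ofReal (s ^ (β / α)) * seqBesov χ (-θ + 2 * β) q r f ≤ ENNReal.ofReal A →
      seqLp p f ≤ ENNReal.ofReal
        (C * A * s ^ (-((θ + d * ((q⁻¹).toReal - (p⁻¹).toReal)) / (2 * α)))) := by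
  set e : ℝ := d * ((q⁻¹).toReal - (p⁻¹).toReal) with he
  have he0 : 0 ≤ e := mul_nonneg d.cast_nonneg (sub_nonneg.2 (ENNReal.toReal_mono
    (ENNReal.inv_ne_top.2 (zero_lt_one.trans_le hq).ne') (ENNReal.inv_le_inv.2 hqp)))
  obtain ⟨C, hC, hfat⟩ := exists_mulBound_fat χ
  obtain ⟨D, hD, hsum⟩ := exists_dyadic_sum_le (x := θ + e) (by linarith) hx
  refine ⟨2 * C * 6 ^ e * 2 * D, by positivity, fun s A f hs hA hN hM => ?_⟩
  refine (seqLp_tsum (hq.trans hqp) (hasSum_block χ f)).trans ?_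
  have hb : ∀ a, seqLp p (block χ a f) ≤ ENNReal.ofReal (2 * C * 6 ^ e * 2 * A *
      (((2 : ℝ) ^ a) ^ (θ + e) * (1 + (s ^ (1 / (2 * α)) * 2 ^ a) ^ (2 * β))⁻¹)) := fun a => by
    have h1 := (hfat a).bernstein hC (R := 2 * 2 ^ a)
      (by linarith [one_le_pow₀ (one_le_two (α := ℝ)) (n := a)]) (fun m hm =>
        χ.norm_freq_le_of_fat_ne_zero (by exact_mod_cast hm)) hq hqp _ (block_ne_top χ q a f)
    rw [fat_mul_block, ← he] at h1
    refine (h1.trans (mul_le_mul_right (seqLp_block_le_of_weighted hα hr hs hA hN hM a) _)).trans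
      (le_of_eq ?_)
    rw [← ENNReal.ofReal_mul (by positivity), ← mul_assoc 3,
      Real.mul_rpow (by norm_num) (by positivity), Real.rpow_add (by positivity)]
    congr 1
    norm_num
    ring
  refine (ENNReal.tsum_le_tsum hb).trans ((tsum_ofReal_dyadic_le (by positivity)
    (hsum (s ^ (1 / (2 * α))) (by positivity)) (by positivity)).trans (le_of_eq ?_))
  rw [← Real.rpow_mul hs.le]
  congr 1
  rw [show 1 / (2 * α) * -(θ + e) = -((θ + e) / (2 * α)) by ring]
  ring

theorem exists_lerayDeriv_heat_besov (χ : Cutoff d) (hα : 0 < α) (hq : 1 ≤ q) (hr : 1 ≤ r) {s : ℝ}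
    (hs : -1 < s) : ∃ C : ℝ, 0 ≤ C ∧ ∀ (i k j : Fin d) (τ : ℝ) (g : Seq d), 0 < τ → τ ≤ 1 →
      seqLp q g ≠ ⊤ → seqBesov χ s q r (fun m => lerayDeriv i k j (freq m) * heatSymbol α τ m * g m) ≤
        ENNReal.ofReal (C * τ ^ (-((1 + s) / (2 * α)))) * seqLp q g := by
  obtain ⟨K, hK⟩ := exists_nat_mul_gt hα (1 + s)
  obtain ⟨D, hD, hsum⟩ := exists_dyadic_sum_le (x := 1 + s) (by linarith) hK
  have hb := fun i k j : Fin d => χ.isAnnularBump_annulus.mulBound_block hα (A := lerayDeriv i k j)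
    (fun ξ hξ => contDiffAt_lerayDeriv i k j hξ) (k := 1) (lerayDeriv_smul i k j) K
  choose C hC h using hb
  obtain ⟨C', hC'⟩ := Finite.exists_le fun x : Fin d × Fin d × Fin d => C x.1 x.2.1 x.2.2
  refine ⟨max C' 0 * D, by positivity, fun i k j τ g hτ hτ1 hg => ?_⟩
  have hle : C i k j ≤ max C' 0 := (hC' (i, k, j)).trans (le_max_left _ _)
  have hblk : ∀ a, dyadic s a *
      seqLp q (block χ a fun m => lerayDeriv i k j (freq m) * heatSymbol α τ m * g m) ≤
      ENNReal.ofReal (max C' 0 * (((2 : ℝ) ^ a) ^ (1 + s) *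
        (1 + (τ ^ (1 / (2 * α)) * 2 ^ a) ^ (2 * α * K))⁻¹)) * seqLp q g := fun a => by
    have h1 := h i k j a τ hτ.le hτ1 q hq g hg
    have e : (block χ a fun m => lerayDeriv i k j (freq m) * heatSymbol α τ m * g m) =
        fun m => blockSymbol χ.annulus a m * (lerayDeriv i k j (freq m) * heatSymbol α τ m) * g m := by
      funext m
      rw [block, χ.symbol_eq]; ring
    rw [e]
    refine (mul_le_mul_right h1 _).trans ?_
    rw [← mul_assoc, dyadic, ← ENNReal.ofReal_mul (by positivity)]
    refine mul_le_mul_left (ENNReal.ofReal_le_ofReal ?_) _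
    have e2 : (τ ^ (1 / (2 * α)) * 2 ^ a) ^ (2 * α * K) = (τ * ((2 : ℝ) ^ a) ^ (2 * α)) ^ K := by
      rw [Real.rpow_mul (by positivity), Real.rpow_natCast, Real.mul_rpow (by positivity) (by positivity),
        ← Real.rpow_mul hτ.le, one_div_mul_cancel (by positivity), Real.rpow_one]
    rw [e2, Real.rpow_add (by positivity)]
    calc _ = C i k j * (((2 : ℝ) ^ a) ^ (1 : ℝ) * (2 ^ a) ^ s * (1 + (τ * (2 ^ a) ^ (2 * α)) ^ K)⁻¹) := by
          ring
      _ ≤ _ := by gcongr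
  rw [seqBesov_eq χ q hr]
  refine (rpow_tsum_le _ hr).trans ((ENNReal.tsum_le_tsum hblk).trans ?_)
  rw [ENNReal.tsum_mul_right]
  refine mul_le_mul_left ((tsum_ofReal_dyadic_le (by positivity)
    (hsum (τ ^ (1 / (2 * α))) (by positivity)) (by positivity)).trans (le_of_eq ?_)) _
  rw [← Real.rpow_mul hτ.le, show 1 / (2 * α) * -(1 + s) = -((1 + s) / (2 * α)) by ring, mul_assoc]

theorem exists_heat_besov (χ : Cutoff d) (hα : 0 < α) (hq : 1 ≤ q) (hr : 1 ≤ r) {β : ℝ} (hβ : 0 ≤ β)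
    (hβα : β ≤ α) (s : ℝ) : ∃ C : ℝ, 0 ≤ C ∧ ∀ (t : ℝ) (u : Seq d), 0 < t → t ≤ 1 →
      ENNReal.ofReal (t ^ (β / α)) * seqBesov χ (s + 2 * β) q r (fun m => heatSymbol α t m * u m) ≤
        ENNReal.ofReal C * seqBesov χ s q r u := by
  obtain ⟨C, hC, h⟩ := χ.isAnnularBump_fatAnnulus.mulBound_block hα (A := fun _ => 1)
    (fun _ _ => contDiffAt_const) (k := 0) (by simp) 1
  refine ⟨C, hC, fun t u ht ht1 => ?_⟩
  simp only [seqBesov_eq χ q hr]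
  rw [← ellNorm_const_mul hr, ← ellNorm_const_mul hr]
  refine ellNorm_mono hr fun a => ?_
  have h1 := h a t ht.le ht1 q hq (block χ a u) (block_ne_top χ q a u)
  have e : (block χ a fun m => heatSymbol α t m * u m) = fun m =>
      (blockSymbol χ.fatAnnulus a m : ℂ) * (1 * heatSymbol α t m) * block χ a u m := by
    rw [block_mul]
    conv_lhs => rw [← fat_mul_block]
    funext m; ring
  rw [← e] at h1
  rw [dyadic_add, mul_assoc (dyadic s a), mul_left_comm, mul_left_comm (ENNReal.ofReal C), ← mul_assoc]
  rw [mul_assoc]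
  refine mul_le_mul_right ((mul_le_mul_right (mul_le_mul_right h1 _) _).trans ?_) _
  rw [← mul_assoc, ← mul_assoc, dyadic, ← ENNReal.ofReal_mul (by positivity),
    ← ENNReal.ofReal_mul (by positivity)]
  refine mul_le_mul_left (ENNReal.ofReal_le_ofReal ?_) _
  set y := t * ((2 : ℝ) ^ a) ^ (2 * α) with hy
  have hy0 : 0 < y := by positivity
  have e2 : t ^ (β / α) * ((2 : ℝ) ^ a) ^ (2 * β) = y ^ (β / α) := by
    rw [hy, Real.mul_rpow ht.le (by positivity), ← Real.rpow_mul (by positivity)]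
    congr 2
    field_simp
  have h2 : y ^ (β / α) ≤ 1 + y := by
    rcases le_or_gt y 1 with h | h
    · linarith [Real.rpow_le_one hy0.le h (div_nonneg hβ hα.le)]
    · have := Real.rpow_le_rpow_of_exponent_le h.le ((div_le_one hα).2 hβα)
      rw [Real.rpow_one] at this
      linarith
  rw [e2, Real.rpow_zero, one_mul, pow_one]
  calc y ^ (β / α) * (C * (1 + y)⁻¹) ≤ (1 + y) * (C * (1 + y)⁻¹) := by gcongr
    _ = C := by field_simp

/-- The pair of Besov norms satisfies the smoothing estimates. -/
theorem exists_seqPair_seqBesov (χ : Cutoff d) (hq : 1 ≤ q) (hr : 1 ≤ r) {θ β : ℝ} (hθ : 0 < θ)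
    (hθ' : θ < (2 * α - 1 - d * (q⁻¹).toReal) / 2) (hβ : θ + d * (q⁻¹).toReal / 2 < β)
    (hβ' : β < (2 * α - 1) / 2) :
    ∃ a₁ γ₁ a₂ γ₂ : ℝ, SeqPair α (β / α) a₁ γ₁ a₂ γ₂
      (seqBesov χ (-θ) q r) (seqBesov χ (-θ + 2 * β) q r) := by
  set e : ℝ := d * (q⁻¹).toReal with he
  have he0 : 0 ≤ e := by positivity
  have hα : 0 < α := by linarith
  obtain ⟨C₁, hC₁, h₁⟩ := exists_seqLp_le_of_besov (q := q) (r := r) (θ := θ) (β := β) χ hα hq hr hθ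
    le_rfl (by simp only [sub_self, mul_zero]; linarith)
  obtain ⟨C₂, hC₂, h₂⟩ := exists_seqLp_le_of_besov (q := q) (r := r) (θ := θ) (β := β) χ hα hq hr hθ
    (le_top (a := q)) (by simp only [ENNReal.inv_top, ENNReal.toReal_zero, sub_zero]; linarith)
  simp only [sub_self, mul_zero, add_zero] at h₁
  simp only [ENNReal.inv_top, ENNReal.toReal_zero, sub_zero, ← he] at h₂
  obtain ⟨s₁, hs₁, hs₁', hs₁''⟩ : ∃ s₁ : ℝ, -1 < s₁ ∧ -θ ≤ s₁ ∧ 1 + s₁ + (2 * θ + e) < 2 * α := by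
    refine ⟨-min θ (1 / 2), ?_, ?_, ?_⟩
    · linarith [min_le_right θ (1 / 2 : ℝ)]
    · linarith [min_le_left θ (1 / 2 : ℝ)]
    · rcases min_choice θ (1 / 2 : ℝ) with h | h <;> rw [h] <;> linarith
  obtain ⟨C₃, hC₃, h₃⟩ := exists_lerayDeriv_heat_besov (q := q) (r := r) χ hα hq hr hs₁
  obtain ⟨C₄, hC₄, h₄⟩ := exists_lerayDeriv_heat_besov (q := q) (r := r) (s := -θ + 2 * β) χ hα hq hr
    (by linarith)
  obtain ⟨C₅, hC₅, h₅⟩ := exists_heat_besov (q := q) (r := r) (β := β) χ hα hq hr (by linarith)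
    (by linarith) (-θ)
  have hconv : ∀ (s A B : ℝ) (f g : Seq d), 0 < s → 0 ≤ A → 0 ≤ B →
      seqBesov χ (-θ) q r f ≤ ENNReal.ofReal A →
      ENNReal.ofReal (s ^ (β / α)) * seqBesov χ (-θ + 2 * β) q r f ≤ ENNReal.ofReal A →
      seqBesov χ (-θ) q r g ≤ ENNReal.ofReal B →
      ENNReal.ofReal (s ^ (β / α)) * seqBesov χ (-θ + 2 * β) q r g ≤ ENNReal.ofReal B →
      seqLp q (conv f g) ≤ ENNReal.ofReal (C₁ * C₂ * A * B * s ^ (-((2 * θ + e) / (2 * α)))) := by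
    intro s A B f g hs hA hB hfN hfM hgN hgM
    have hf := h₂ s A f hs hA hfN hfM
    have hg := h₂ s B g hs hB hgN hgM
    have htop : ∀ {u : Seq d} {x : ℝ}, seqLp ⊤ u ≤ ENNReal.ofReal x → seqLp 2 u ≠ ⊤ := fun h =>
      ne_top_of_le_ne_top ENNReal.ofReal_ne_top ((seqLp_mono le_top _).trans h)
    refine ((seqLp_conv_le (p := ⊤) (q := q) (htop hf) (htop hg)).trans
      (mul_le_mul' hf (h₁ s B g hs hB hgN hgM))).trans (le_of_eq ?_)
    rw [← ENNReal.ofReal_mul (by positivity)]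
    congr 1
    have : s ^ (-((2 * θ + e) / (2 * α))) = s ^ (-((θ + e) / (2 * α))) * s ^ (-(θ / (2 * α))) := by
      rw [← Real.rpow_add hs]; congr 1; ring
    rw [this]; ring
  refine ⟨(1 + s₁) / (2 * α), (2 * θ + e) / (2 * α), (1 + (-θ + 2 * β)) / (2 * α),
    (2 * θ + e) / (2 * α), ?_⟩
  refine
    { α_pos := hα, σ_nonneg := div_nonneg (by linarith) hα.le,
      a₁_nonneg := div_nonneg (by linarith) (by linarith),
      γ₁_nonneg := by positivity, lt_one := ?_, a₂_nonneg := div_nonneg (by linarith) (by linarith),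
      a₂_lt := ?_, γ₂_nonneg := by positivity, γ₂_lt := ?_, lt_add := ?_,
      normN := seqNorm_seqBesov χ hq hr _, normM := seqNorm_seqBesov χ hq hr _,
      heat_tendsto := fun u hu => tendsto_heat_seqBesov χ hα hq hr hu,
      heat_M := ⟨C₅, hC₅, fun t h0 h1 u _ => h₅ t u h0 h1⟩, sq := fun u hu => ?_,
      bilinear := ⟨C₁ * C₂ * (C₃ + C₄), by positivity,
        fun s τ hs hs1 hτ hτ1 f g A B hA hB hfN hfM hgN hgM i k j => ?_⟩ }
  · rw [← add_div, div_lt_one (by positivity)]; exact hs₁''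
  · rw [div_lt_one (by positivity)]; linarith
  · rw [div_lt_one (by positivity)]; linarith
  · rw [← add_div, div_lt_iff₀ (by positivity)]
    have : (1 + β / α) * (2 * α) = 2 * α + 2 * β := by field_simp
    rw [this]; linarith
  · have h := h₂ 1 (seqBesov χ (-θ + 2 * β) q r u).toReal u one_pos ENNReal.toReal_nonneg
    rw [ENNReal.ofReal_toReal hu, Real.one_rpow, ENNReal.ofReal_one, one_mul] at h
    exact summable_sq_of_seqLp (ne_top_of_le_ne_top ENNReal.ofReal_ne_top ((seqLp_mono le_top u).trans
      (h (seqBesov_mono hr (by linarith) u) le_rfl)))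
  · have hc := hconv s A B f g hs hA hB hfN hfM hgN hgM
    have hct := ne_top_of_le_ne_top ENNReal.ofReal_ne_top hc
    have key : ∀ {C x : ℝ}, 0 ≤ C → C ≤ C₃ + C₄ →
        ENNReal.ofReal (C * τ ^ (-x)) * seqLp q (conv f g) ≤
          ENNReal.ofReal (C₁ * C₂ * (C₃ + C₄) * A * B *
            (τ ^ (-x) * s ^ (-((2 * θ + e) / (2 * α))))) := fun {C x} h0 hle => by
      refine (mul_le_mul_right hc _).trans ?_
      rw [← ENNReal.ofReal_mul (by positivity)]
      refine ENNReal.ofReal_le_ofReal ?_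
      calc _ = C₁ * C₂ * C * A * B * (τ ^ (-x) * s ^ (-((2 * θ + e) / (2 * α)))) := by ring
        _ ≤ _ := by gcongr
    exact ⟨(seqBesov_mono hr hs₁' _).trans ((h₃ i k j τ _ hτ hτ1 hct).trans (key hC₃ (by linarith))),
      (h₄ i k j τ _ hτ hτ1 hct).trans (key hC₄ (by linarith))⟩

theorem locallyWellPosed_besov (χ : Cutoff d) (hq : 1 ≤ q) (hr : 1 ≤ r) {θ β : ℝ} (hθ : 0 < θ)
    (hθ' : θ < (2 * α - 1 - d * (q⁻¹).toReal) / 2) (hβ : θ + d * (q⁻¹).toReal / 2 < β)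
    (hβ' : β < (2 * α - 1) / 2) :
    LocallyWellPosed χ α (vecBesovNorm χ (-θ) q r) (vecBesovNorm χ (-θ + 2 * β) q r) (β / α) := by
  obtain ⟨a₁, γ₁, a₂, γ₂, h⟩ := exists_seqPair_seqBesov χ hq hr hθ hθ' hβ hβ'
  have h1 := (h.vecPair χ).locallyWellPosed χ
  have e : ∀ s : ℝ, (fun u : VecDist d => vecNorm (seqBesov χ s q r) (coeffs u)) =
      vecBesovNorm χ s q r := fun s => by
    funext u
    simp only [vecBesovNorm, besovNorm_eq]
    rfl
  rwa [e, e] at h1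

end FracNS
end

theorem proposition2p1 {d : ℕ} (hd : 2 ≤ d) (χ : FracNS.Cutoff d) {α : ℝ} (hα : 1 / 2 < α) :
    (∀ p : ℝ, max (d / (2 * α - 1)) 1 < p →
      ∀ ρ : ℝ≥0∞, ENNReal.ofReal p ≤ ρ → ENNReal.ofReal (p / (p - 1)) ≤ ρ →
        FracNS.LocallyWellPosed χ α (FracNS.vecLpNorm (ENNReal.ofReal p)) (FracNS.vecLpNorm ρ)
          (d / (2 * α) * (1 / p - (ρ⁻¹).toReal))) ∧
    (∀ (q : ℝ≥0∞) (θ r : ℝ), ENNReal.ofReal (max (d / (2 * α - 1)) 1) < q →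
      0 < θ → θ < (2 * α - 1 - d * (q⁻¹).toReal) / 2 → 1 ≤ r →
      ∀ β : ℝ, θ + d * (q⁻¹).toReal / 2 < β → β < (2 * α - 1) / 2 →
        FracNS.LocallyWellPosed χ α (FracNS.vecBesovNorm χ (-θ) q r)
          (FracNS.vecBesovNorm χ (-θ + 2 * β) q r) (β / α)) :=
  ⟨fun _ hp _ h₁ h₂ => FracNS.locallyWellPosed_lp (by omega) χ hα hp h₁ h₂,
    fun _ _ _ hq hθ hθ' hr _ h₁ h₂ => FracNS.locallyWellPosed_besov χ
      (le_trans (by rw [← ENNReal.ofReal_one]; exact ENNReal.ofReal_le_ofReal (le_max_right _ _)) hq.le)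
      hr hθ hθ' h₁ h₂⟩
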